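/- **Conventions.** Let $\bigwedge_\infty=\bigwedge_\infty^0\oplus\bigwedge_\infty^1$ be the complex Grassmann algebra on countably many generators $\zeta_1,\zeta_2,\dots$ (finite linear combinations of the monomials $\zeta_{(k)}=\zeta_{k_1}\cdots\zeta_{k_s}$, $k_1<\dots<k_s$) with its even and odd parts; every $a\in\bigwedge_\infty$ is the sum $a=a_B+a_S$ of its body $a_B\in\mathbb C$ and its nilpotent soul. The body of a point $(z,\theta^+,\theta^-)\in\bigwedge_\infty^0\oplus(\bigwedge_\infty^1)^2$ is $z_B$, and the DeWitt open sets are the preimages of the open sets of $\mathbb C$ under the body map. A function $H$ on a DeWitt open set $U$ is superanalytic if $H=f_1+\theta^+f_++\theta^-f_-+\theta^+\theta^-f_{+-}$ where each $f_{(l)}=\sum_{(k)}f_{(l),(k)}\zeta_{(k)}$ (a finite sum at every point), with $f_{(l),(k)}$ analytic on the body $U_B$ of $U$ and extended by $f(z)=\sum_{m\ge0}\frac{z_S^m}{m!}f^{(m)}(z_B)$. Put $D^\pm=\frac{\partial}{\partial\theta^\pm}+\theta^\mp\frac{\partial}{\partial z}$. A superanalytic map $(z,\theta^+,\theta^-)\mapsto(\tilde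 z,\tilde\theta^+,\tilde\theta^-)$ ($\tilde z$ even, $\tilde\theta^\pm$ odd) is *$N=2$ superconformal* if $D^\pm\tilde\theta^\mp=0$, $D^\pm\tilde z=\tilde\theta^\mp D^\pm\tilde\theta^\pm$, and neither $D^+\tilde\theta^+$ nor $D^-\tilde\theta^-$ is identically zero (no such requirement for an empty domain). **The moduli space.** The $N=2$ super-Riemann sphere $S^2\hat{\mathbb C}$ is obtained from two copies of $\bigwedge_\infty^0\oplus(\bigwedge_\infty^1)^2$, with coordinate maps $\sigma$ (south) and $\nu$ (north), glued by $\sigma\circ\nu^{-1}=I$, $I(w,\rho^+,\rho^-)=(1/w,\,i\rho^+/w,\,i\rho^- /w)$. An *$N=2$ super-Riemann sphere with $1+n$ tubes* consists of points $p_0,\dots,p_n$ of $S^2\hat{\mathbb C}$ with pairwise distinct bodies and, for each $j$, a local superconformal coordinate $(U_j,\Omega_j)$ with $\Omega_j(p_j)=0$, i.e. a homeomorphism $\Omega_j$ of an open set $U_j\ni p_j$ onto a DeWitt open set, superconformal in both directions with respect to $\sigma$ and $\nu$. Two of them, $(p_j;U_j,\Omega_j)$ and $(q_j;V_j,\Xi_j)$,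 are *superconformally equivalent* if there is a bijection $F$ of $S^2\hat{\mathbb C}$, superconformal together with its inverse, with $F(p_j)=q_j$ and $\Omega_j=\Xi_j\circ F$ near $p_j$ for all $j$. The *moduli space* is the set of equivalence classes (this is an equivalence relation). **The data.** On $\bigwedge_\infty[[x]][\varphi^+,\varphi^-]$ let, for $j\ge1$, $$L_j=-\Bigl(x^{j+1}\tfrac{\partial}{\partial x}+\tfrac{j+1}{2}x^j\bigl(\varphi^+\tfrac{\partial}{\partial\varphi^+}+\varphi^-\tfrac{\partial}{\partial\varphi^-}\bigr)\Bigr),\qquad J_j=-x^j\Bigl(\varphi^+\tfrac{\partial}{\partial\varphi^+}-\varphi^-\tfrac{\partial}{\partial\varphi^-}\Bigr),$$ $$G^\pm_{j-\frac12}=-\Bigl(x^j\bigl(\tfrac{\partial}{\partial\varphi^\pm}-\varphi^\mp\tfrac{\partial}{\partial x}\bigr)\pm jx^{j-1}\varphi^+\varphi^-\tfrac{\partial}{\partial\varphi^\pm}\Bigr).$$ For sequences $B=(A^+,A^-,M^+,M^-)$ with $A^\pm_j\in\bigwedge_\infty^0$ and $M^\pm_{j-\frac12}\in\bigwedge_\infty^1$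 ($j\ge1$), put $$\tilde E(B)=(\tilde x,\tilde\varphi^+,\tilde\varphi^-)=\exp\Bigl(-\sum_{j\ge1}\bigl(A^+_jL_j+A^-_jJ_j+M^+_{j-\frac12}G^+_{j-\frac12}+M^-_{j-\frac12}G^-_{j-\frac12}\bigr)\Bigr)\cdot(x,\varphi^+,\varphi^-),$$ and $\hat E(a,b,B)=(a^2\tilde x,\,ab\,\tilde\varphi^+,\,ab^{-1}\tilde\varphi^-)$ for $a,b\in(\bigwedge_\infty^0)^\times$; the latter depends only on $B$ and on the class of $(a,b)$ modulo $\langle\pm1\rangle$, where $-1$ sends $(a,b)$ to $(-a,-b)$. Let $\mathcal H$ be the set of all $B$ such that $\tilde E(B)$ converges absolutely, to values in $\bigwedge_\infty$, in some DeWitt neighbourhood of $0$. For $n\ge1$ let $S^2M^{n-1}$ be the set of $(n-1)$-tuples of points $(z_j,\theta_j^+,\theta_j^-)\in(\bigwedge_\infty^0)^\times\times(\bigwedge_\infty^1)^2$ with $(z_j)_B\ne(z_k)_B$ for $j\ne k$, and let $$S^2K(n)=S^2M^{n-1}\times\mathcal H\times\Bigl(\bigl((\textstyle\bigwedge_\infty^0)^\times\bigr)^2/\langle\pm1\rangle\times\mathcal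 H\Bigr)^n,$$ $$S^2K(0)=\bigl\{(A^+,A^-,M^+,M^-)\in\mathcal H : A^+_1=M^+_{\frac12}=M^-_{\frac12}=0\bigr\}.$$ **Theorem.** 1. Let $n\ge1$. For every element $\bigl((z_j,\theta_j^\pm)_{j=1}^{n-1};\,B^{(0)};\,([a^{(k)},b^{(k)}],B^{(k)})_{k=1}^n\bigr)$ of $S^2K(n)$ there is an $N=2$ super-Riemann sphere with $1+n$ tubes such that $p_0=\nu^{-1}(0)$, $p_k=\sigma^{-1}(z_k,\theta_k^+,\theta_k^-)$ for $1\le k\le n$, where $(z_n,\theta_n^+,\theta_n^-)=0$, and $$\Omega_0\circ\sigma^{-1}(w,\rho^+,\rho^-)=\tilde E(B^{(0)})\Bigl(\frac1w,\frac{i\rho^+}{w},\frac{i\rho^-}{w}\Bigr)\quad\text{near infinity},$$ $$\Omega_k\circ\sigma^{-1}(w,\rho^+,\rho^-)=\hat E(a^{(k)},b^{(k)},B^{(k)})\bigl(w-z_k-\rho^+\theta_k^--\rho^-\theta_k^+,\ \rho^+-\theta_k^+,\ \rho^--\theta_k^-\bigr)\quad\text{near }p_k .$$ All such spheres are superconformally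 equivalent, and sending the element to their common class is a bijection from $S^2K(n)$ onto the moduli space of $N=2$ super-Riemann spheres with $1+n$ tubes. 2. For every $B\in S^2K(0)$ there is an $N=2$ super-Riemann sphere with one tube such that $p_0=\nu^{-1}(0)$ and $\Omega_0\circ\sigma^{-1}(w,\rho^+,\rho^-)=\tilde E(B)(1/w,i\rho^+/w,i\rho^- /w)$ near infinity. All such spheres are superconformally equivalent, and sending $B$ to their common class is a bijection from $S^2K(0)$ onto the moduli space of $N=2$ super-Riemann spheres with one tube. -/

import Mathlib

noncomputable section

namespace N2Sphere

/-! ### The infinite complex Grassmann algebra -/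

/-- The Grassmann algebra `⋀_∞` over `ℂ` on countably many generators `ζ_0, ζ_1, …`; its elements
are finite linear combinations of monomials. -/
abbrev Grassmann : Type := ExteriorAlgebra ℂ (ℕ →₀ ℂ)

/-- The basis of monomials `ζ_{k_1} ⋯ ζ_{k_s}`, `k_1 < ⋯ < k_s`, indexed by finite sets. -/
def zeta : Module.Basis (Finset ℕ) ℂ Grassmann :=
  (Finsupp.basisSingleOne : Module.Basis ℕ ℂ (ℕ →₀ ℂ)).ExteriorAlgebra

/-- The even part `⋀_∞^0`. -/
abbrev GEven : Subalgebra ℂ Grassmann := CliffordAlgebra.even (0 : QuadraticForm ℂ (ℕ →₀ ℂ))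

/-- The odd part `⋀_∞^1`. -/
abbrev GOdd : Submodule ℂ Grassmann := CliffordAlgebra.evenOdd (0 : QuadraticForm ℂ (ℕ →₀ ℂ)) 1

/-- The body `a_B ∈ ℂ` of `a ∈ ⋀_∞`. -/
def gbody (a : Grassmann) : ℂ := ExteriorAlgebra.algebraMapInv a

/-- The soul `a_S = a - a_B` (a nilpotent element). -/
def gsoul (a : Grassmann) : Grassmann := a - algebraMap ℂ Grassmann (gbody a)

/-- A point `(z, θ⁺, θ⁻)` of `⋀_∞^0 ⊕ (⋀_∞^1)^2`. -/
@[ext]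
structure SPoint where
  z : Grassmann
  tp : Grassmann
  tm : Grassmann
  z_even : z ∈ GEven
  tp_odd : tp ∈ GOdd
  tm_odd : tm ∈ GOdd

/-- The body of a point of `⋀_∞^0 ⊕ (⋀_∞^1)^2`. -/
def SPoint.body (p : SPoint) : ℂ := gbody p.z

/-- The point `0 = (0, 0, 0)`. -/
def SPoint.origin : SPoint :=
  ⟨0, 0, 0, zero_mem _, zero_mem _, zero_mem _⟩

/-- The DeWitt topology: the open sets are the preimages of open subsets of `ℂ` under the
projection onto the body. -/
instance : TopologicalSpace SPoint := TopologicalSpace.induced SPoint.body inferInstance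

/-! ### Expressions in two odd variables -/

/-- The four monomials `1, θ⁺, θ⁻, θ⁺θ⁻` in two odd variables. -/
inductive Sector
  | one
  | p
  | m
  | pm

/-- Parity of the monomial (as a number of odd variables). -/
def Sector.card : Sector → ℕ
  | .one => 0
  | .p => 1
  | .m => 1
  | .pm => 2

section OddOps

variable {X : Type} [AddCommGroup X]

/- A family `u : Sector → X` stands for `u_1 + θ⁺ u_p + θ⁻ u_m + θ⁺θ⁻ u_pm`, with the odd variables
written to the left of the coefficients. -/

/-- The left derivative `∂/∂θ⁺`. -/
def dThetaP (u : Sector → X) : Sector → X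
  | .one => u .p
  | .p => 0
  | .m => u .pm
  | .pm => 0

/-- The left derivative `∂/∂θ⁻`. -/
def dThetaM (u : Sector → X) : Sector → X
  | .one => u .m
  | .p => -u .pm
  | .m => 0
  | .pm => 0

/-- Left multiplication by `θ⁺`. -/
def thetaP (u : Sector → X) : Sector → X
  | .one => 0
  | .p => u .one
  | .m => 0
  | .pm => u .m

/-- Left multiplication by `θ⁻`. -/
def thetaM (u : Sector → X) : Sector → X
  | .one => 0
  | .p => 0
  | .m => u .one
  | .pm => -u .p

end OddOps

/-- The value `v_1 + θ⁺ v_p + θ⁻ v_m + θ⁺θ⁻ v_pm`. -/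
def assemble (tp tm : Grassmann) (v : Sector → Grassmann) : Grassmann :=
  v .one + tp * v .p + tm * v .m + tp * tm * v .pm

/-! ### Superanalytic and superconformal functions -/

/-- The coefficient functions `f_{(l),(k)} : ℂ → ℂ` of a `(1,2)`-superfunction
`H(z, θ⁺, θ⁻) = ∑_{(l)} θ_{(l)} ∑_{(k)} f_{(l),(k)}(z) ζ_{(k)}`. -/
abbrev SuperFn : Type := Sector → Finset ℕ → ℂ → ℂ

/-- The extension of a function of `z_B ∈ ℂ` to `z ∈ ⋀_∞^0`:
`f(z) = ∑_l (z_S ^ l / l!) f^{(l)}(z_B)`, a finite sum as `z_S` is nilpotent. -/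
def extend (f : ℂ → ℂ) (z : Grassmann) : Grassmann :=
  ∑ᶠ l : ℕ, (((l.factorial : ℂ))⁻¹ * iteratedDeriv l f (gbody z)) • gsoul z ^ l

/-- The value `∑_{(l)} θ_{(l)} ∑_{(k)} f_{(l),(k)}(z) ζ_{(k)}` at a point. -/
def SuperFn.eval (F : SuperFn) (p : SPoint) : Grassmann :=
  assemble p.tp p.tm fun s => ∑ᶠ k : Finset ℕ, extend (F s k) p.z * zeta k

/-- The coefficient functions are analytic on `V ⊆ ℂ`, and `∑_{(k)} f_{(l),(k)} ζ_{(k)}` is an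
element of `⋀_∞`, that is, a finite sum, at every point of `V`. -/
def SuperFn.AnalyticOn (F : SuperFn) (V : Set ℂ) : Prop :=
  (∀ s k, AnalyticOnNhd ℂ (F s k) V) ∧ ∀ s, ∀ w ∈ V, {k | F s k w ≠ 0}.Finite

/-- `F` is even. -/
def SuperFn.EvenOn (F : SuperFn) (V : Set ℂ) : Prop :=
  ∀ s k, Odd (s.card + k.card) → ∀ w ∈ V, F s k w = 0

/-- `F` is odd. -/
def SuperFn.OddOn (F : SuperFn) (V : Set ℂ) : Prop :=
  ∀ s k, Even (s.card + k.card) → ∀ w ∈ V, F s k w = 0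

/-- `∂/∂z`. -/
def SuperFn.dz (F : SuperFn) : SuperFn := fun s k => deriv (F s k)

/-- `D⁺ = ∂/∂θ⁺ + θ⁻ ∂/∂z`. -/
def SuperFn.DP (F : SuperFn) : SuperFn := dThetaP F + thetaM F.dz

/-- `D⁻ = ∂/∂θ⁻ + θ⁺ ∂/∂z`. -/
def SuperFn.DM (F : SuperFn) : SuperFn := dThetaM F + thetaP F.dz

/-- `H = (z̃, θ̃⁺, θ̃⁻)` is an `N = 2` superconformal function on the DeWitt open set `U`: it is
superanalytic with `z̃` even and `θ̃^±` odd, it satisfies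
`D⁺θ̃⁻ = D⁻θ̃⁺ = D⁺z̃ - θ̃⁻ D⁺θ̃⁺ = D⁻z̃ - θ̃⁺ D⁻θ̃⁻ = 0`, and `D⁺θ̃⁺`, `D⁻θ̃⁻` do not vanish identically
(when `U` is non-empty). -/
def IsSuperconformalOn (H : SPoint → SPoint) (U : Set SPoint) : Prop :=
  IsOpen U ∧ ∃ Z P M : SuperFn,
    (Z.AnalyticOn (SPoint.body '' U) ∧ P.AnalyticOn (SPoint.body '' U) ∧
      M.AnalyticOn (SPoint.body '' U)) ∧
    (Z.EvenOn (SPoint.body '' U) ∧ P.OddOn (SPoint.body '' U) ∧ M.OddOn (SPoint.body '' U)) ∧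
    (∀ x ∈ U, (H x).z = Z.eval x ∧ (H x).tp = P.eval x ∧ (H x).tm = M.eval x) ∧
    (∀ x ∈ U, M.DP.eval x = 0 ∧ P.DM.eval x = 0 ∧
      Z.DP.eval x - (H x).tm * P.DP.eval x = 0 ∧
      Z.DM.eval x - (H x).tp * M.DM.eval x = 0) ∧
    (U.Nonempty → (∃ x ∈ U, P.DP.eval x ≠ 0) ∧ ∃ x ∈ U, M.DM.eval x ≠ 0)

/-! ### The `N = 2` super-Riemann sphere -/

/-- `p = I(q)`, where `I(w, ρ⁺, ρ⁻) = (1/w, i ρ⁺/w, i ρ⁻/w)` for `q = (w, ρ⁺, ρ⁻)` with `w`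
invertible. -/
def IsInversion (q p : SPoint) : Prop :=
  q.z * p.z = 1 ∧ p.z * q.z = 1 ∧
    p.tp = Complex.I • (q.tp * p.z) ∧ p.tm = Complex.I • (q.tm * p.z)

/-- The gluing of a southern copy (`inl`) and a northern copy (`inr`) of `⋀_∞^0 ⊕ (⋀_∞^1)^2`
along `I`. -/
def glue : SPoint ⊕ SPoint → SPoint ⊕ SPoint → Prop
  | .inl p, .inl p' => p = p'
  | .inr q, .inr q' => q = q'
  | .inl p, .inr q => IsInversion q p
  | .inr q, .inl p => IsInversion q p

theorem IsInversion.unique_right {q p p' : SPoint} (h : IsInversion q p) (h' : IsInversion q p') :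
    p = p' := by
  obtain ⟨_, h2, h3, h4⟩ := h
  obtain ⟨k1, _, k3, k4⟩ := h'
  have hz : p.z = p'.z := by
    calc p.z = p.z * (q.z * p'.z) := by rw [k1, mul_one]
      _ = p'.z := by rw [← mul_assoc, h2, one_mul]
  apply SPoint.ext hz
  · rw [h3, k3, hz]
  · rw [h4, k4, hz]

theorem IsInversion.unique_left {q q' p : SPoint} (h : IsInversion q p) (h' : IsInversion q' p) :
    q = q' := by
  obtain ⟨h1, h2, h3, h4⟩ := h
  obtain ⟨k1, k2, k3, k4⟩ := h'
  have hz : q.z = q'.z := by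
    calc q.z = q.z * (p.z * q'.z) := by rw [k2, mul_one]
      _ = q'.z := by rw [← mul_assoc, h1, one_mul]
  have cancel : ∀ a b : Grassmann, Complex.I • (a * p.z) = Complex.I • (b * p.z) → a = b := by
    intro a b hab
    have hab' : a * p.z = b * p.z := smul_right_injective Grassmann Complex.I_ne_zero hab
    calc a = a * p.z * q.z := by rw [mul_assoc, h2, mul_one]
      _ = b := by rw [hab', mul_assoc, h2, mul_one]
  apply SPoint.ext hz
  · exact cancel _ _ (h3.symm.trans k3)
  · exact cancel _ _ (h4.symm.trans k4)

theorem glue_equivalence : Equivalence glue where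
  refl x := by cases x <;> rfl
  symm {x y} h := by
    cases x <;> cases y <;> first | exact Eq.symm h | exact h
  trans {x y w} h h' := by
    rcases x with a | a <;> rcases y with b | b <;> rcases w with c | c
    · exact Eq.trans h h'
    · have h : a = b := h
      subst h; exact h'
    · exact IsInversion.unique_right (show IsInversion b a from h) h'
    · have h' : b = c := h'
      subst h'; exact h
    · have h' : b = c := h'
      subst h'; exact h
    · exact IsInversion.unique_left (show IsInversion a b from h) h'
    · have h : a = b := h
      subst h; exact h'
    · exact Eq.trans h h'

instance glueSetoid : Setoid (SPoint ⊕ SPoint) := ⟨glue, glue_equivalence⟩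

/-- The `N = 2` super-Riemann sphere, with the (quotient) DeWitt topology. -/
abbrev Sphere : Type := Quotient glueSetoid

/-- The two coordinate charts. -/
inductive Pole
  | south
  | north

/-- The inverses `σ⁻¹, ν⁻¹ : ⋀_∞^0 ⊕ (⋀_∞^1)^2 → S²Ĉ` of the southern and the northern coordinate
map; their ranges are the coordinate neighbourhoods. -/
def pt : Pole → SPoint → Sphere
  | .south, p => Quotient.mk _ (.inl p)
  | .north, q => Quotient.mk _ (.inr q)

/-- The point lies in the domain of the given coordinate chart. -/
def Pole.nbhd (c : Pole) : Set Sphere := Set.range (pt c)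

/-- Two points have the same body: they lie in a common chart and their coordinates there have the
same body. -/
def SameBody (x y : Sphere) : Prop :=
  ∃ (c : Pole) (a b : SPoint), x = pt c a ∧ y = pt c b ∧ a.body = b.body

/-- Local `N = 2` superconformal coordinates `(U, Ω)` on the sphere: a homeomorphism of an open set
onto a DeWitt open set whose transition functions with the two standard charts are, in both
directions, `N = 2` superconformal. -/
def IsSuperconformalChart (Om : OpenPartialHomeomorph Sphere SPoint) : Prop :=
  ∀ c : Pole,
    IsSuperconformalOn (fun x => Om (pt c x)) (pt c ⁻¹' Om.source) ∧
    ∃ H : SPoint → SPoint,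
      IsSuperconformalOn H {y | y ∈ Om.target ∧ Om.symm y ∈ c.nbhd} ∧
      ∀ y, y ∈ Om.target → Om.symm y ∈ c.nbhd → pt c (H y) = Om.symm y

/-- An `N = 2` superconformal map from the sphere to itself: it is `N = 2` superconformal in the
standard charts. -/
def IsSuperconformalMap (F : Sphere → Sphere) : Prop :=
  ∀ c d : Pole, ∃ H : SPoint → SPoint,
    IsSuperconformalOn H {x | F (pt c x) ∈ d.nbhd} ∧
    ∀ x, F (pt c x) ∈ d.nbhd → pt d (H x) = F (pt c x)

/-- An `N = 2` super-Riemann sphere with `1 + n` tubes. The puncture with index `0` is the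
negatively oriented one, the others are positively oriented. -/
structure TubedSphere (n : ℕ) where
  puncture : Fin (n + 1) → Sphere
  distinct : ∀ j k, j ≠ k → ¬ SameBody (puncture j) (puncture k)
  coord : Fin (n + 1) → OpenPartialHomeomorph Sphere SPoint
  coord_superconformal : ∀ j, IsSuperconformalChart (coord j)
  mem_source : ∀ j, puncture j ∈ (coord j).source
  vanishing : ∀ j, coord j (puncture j) = SPoint.origin

/-- `N = 2` superconformal equivalence of `N = 2` super-Riemann spheres with `1 + n` tubes. -/
def SuperconformallyEquivalent {n : ℕ} (S T : TubedSphere n) : Prop :=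
  ∃ F : Sphere ≃ Sphere, IsSuperconformalMap F ∧ IsSuperconformalMap F.symm ∧
    ∀ j, F (S.puncture j) = T.puncture j ∧
      ∃ W : Set Sphere, IsOpen W ∧ S.puncture j ∈ W ∧ W ⊆ (S.coord j).source ∧
        ∀ x ∈ W, F x ∈ (T.coord j).source ∧ S.coord j x = T.coord j (F x)

/-- The moduli space of `N = 2` super-Riemann spheres with `1 + n` tubes. -/
def Moduli (n : ℕ) : Type := Quot (SuperconformallyEquivalent (n := n))

/-! ### Infinitesimal superconformal transformations and their exponentials -/

/-- Formal series `u ∈ ⋀_∞[[x]][φ⁺, φ⁻]`; `u s n` is the coefficient of `φ_s x ^ n`, written to the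
right of the odd variables. -/
abbrev SSeries : Type := Sector → ℕ → Grassmann

/-- `∂/∂x`. -/
def dx (u : SSeries) : SSeries := fun s n => ((n : ℂ) + 1) • u s (n + 1)

/-- Multiplication by `x ^ k`. -/
def xpow (k : ℕ) (u : SSeries) : SSeries := fun s n => if k ≤ n then u s (n - k) else 0

/-- Left multiplication by an even constant. -/
def evenMul (a : Grassmann) (u : SSeries) : SSeries := fun s n => a * u s n

/-- Left multiplication by an odd constant, which anticommutes with `φ^±`. -/
def oddMul (a : Grassmann) (u : SSeries) : SSeries := fun s n => ((-1 : ℂ) ^ s.card) • (a * u s n)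

/-- `L_j = -(x^{j+1} ∂_x + ((j+1)/2) x^j (φ⁺ ∂_{φ⁺} + φ⁻ ∂_{φ⁻}))`. -/
def opL (j : ℕ) (u : SSeries) : SSeries :=
  -(xpow (j + 1) (dx u) +
    (((j : ℂ) + 1) / 2) • xpow j (thetaP (dThetaP u) + thetaM (dThetaM u)))

/-- `J_j = -x^j (φ⁺ ∂_{φ⁺} - φ⁻ ∂_{φ⁻})`. -/
def opJ (j : ℕ) (u : SSeries) : SSeries :=
  -xpow j (thetaP (dThetaP u) - thetaM (dThetaM u))

/-- `G⁺_{j-1/2} = -(x^j (∂_{φ⁺} - φ⁻ ∂_x) + j x^{j-1} φ⁺φ⁻ ∂_{φ⁺})`, for `j ≥ 1`. -/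
def opGP (j : ℕ) (u : SSeries) : SSeries :=
  -(xpow j (dThetaP u - thetaM (dx u)) +
    (j : ℂ) • xpow (j - 1) (thetaP (thetaM (dThetaP u))))

/-- `G⁻_{j-1/2} = -(x^j (∂_{φ⁻} - φ⁺ ∂_x) - j x^{j-1} φ⁺φ⁻ ∂_{φ⁻})`, for `j ≥ 1`. -/
def opGM (j : ℕ) (u : SSeries) : SSeries :=
  -(xpow j (dThetaM u - thetaP (dx u)) -
    (j : ℂ) • xpow (j - 1) (thetaP (thetaM (dThetaM u))))

/-- An element `(A⁺, A⁻, M⁺, M⁻)` of `(⋀_∞^∞)^2`. The sequences are indexed from `0`: the entries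
with index `i` are `A^±_{i+1}` and `M^±_{i+1/2}`. -/
structure InfData where
  AP : ℕ → GEven
  AM : ℕ → GEven
  MP : ℕ → GOdd
  MM : ℕ → GOdd

/-- `𝒯 = -∑_{j ≥ 1} (A⁺_j L_j + A⁻_j J_j + M⁺_{j-1/2} G⁺_{j-1/2} + M⁻_{j-1/2} G⁻_{j-1/2})`.
Only the terms with `j ≤ n + 1` contribute to the coefficients of `x ^ n`. -/
def InfData.field (B : InfData) (u : SSeries) : SSeries := fun s n =>
  -∑ i ∈ Finset.range (n + 1),
    (evenMul (B.AP i) (opL (i + 1) u) + evenMul (B.AM i) (opJ (i + 1) u) +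
      oddMul (B.MP i) (opGP (i + 1) u) + oddMul (B.MM i) (opGM (i + 1) u)) s n

/-- `exp(𝒯) · u`. With `x` of weight `1` and `φ^±` of weight `1/2` the operator `𝒯` raises weights by
at least `1/2`, so that only `𝒯 ^ k` with `k ≤ 2 n + 2` contributes to the coefficients of `x ^ n`. -/
def InfData.exp (B : InfData) (u : SSeries) : SSeries := fun s n =>
  ∑ k ∈ Finset.range (2 * n + 3), ((k.factorial : ℂ))⁻¹ • (B.field^[k] u) s n

/-- The series `x`. -/
def serX : SSeries
  | .one, n => if n = 1 then 1 else 0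
  | _, _ => 0

/-- The series `φ⁺`. -/
def serP : SSeries
  | .p, n => if n = 0 then 1 else 0
  | _, _ => 0

/-- The series `φ⁻`. -/
def serM : SSeries
  | .m, n => if n = 0 then 1 else 0
  | _, _ => 0

/-- A triple `(x̃, φ̃⁺, φ̃⁻)` of formal series. -/
structure FormalMap where
  z : SSeries
  tp : SSeries
  tm : SSeries

/-- `Ẽ(A⁺, A⁻, M⁺, M⁻) = exp(𝒯) · (x, φ⁺, φ⁻)`. -/
def Etilde (B : InfData) : FormalMap := ⟨B.exp serX, B.exp serP, B.exp serM⟩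

/-- `Ê(a, b, A⁺, A⁻, M⁺, M⁻) = exp(𝒯) · a^{-2L_0} · b^{-J_0} · (x, φ⁺, φ⁻) =
(a² x̃, a b φ̃⁺, a b⁻¹ φ̃⁻)`, where `(x̃, φ̃⁺, φ̃⁻) = Ẽ(A⁺, A⁻, M⁺, M⁻)`. -/
def Ehat (a b : GEvenˣ) (B : InfData) : FormalMap :=
  ⟨evenMul ((a * a : GEvenˣ) : GEven) (Etilde B).z,
    evenMul ((a * b : GEvenˣ) : GEven) (Etilde B).tp,
    evenMul ((a * b⁻¹ : GEvenˣ) : GEven) (Etilde B).tm⟩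

/-- The series `∑ a_n` in `⋀_∞` converges absolutely, in every coefficient of a monomial in the
generators, to the element `v` of `⋀_∞`. -/
def HasGSum (a : ℕ → Grassmann) (v : Grassmann) : Prop :=
  ∀ k : Finset ℕ, HasSum (fun n => zeta.repr (a n) k) (zeta.repr v k)

/-- The formal series `u` converges absolutely at `(x, φ⁺, φ⁻) = (z, tp, tm)`, with the value `v`. -/
def SSeries.HasValue (u : SSeries) (z tp tm v : Grassmann) : Prop :=
  ∃ f : Sector → Grassmann, (∀ s, HasGSum (fun n => u s n * z ^ n) (f s)) ∧ v = assemble tp tm f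

/-- The formal map converges absolutely at `(z, tp, tm)`, with the value `y`. -/
def FormalMap.HasValue (E : FormalMap) (z tp tm : Grassmann) (y : SPoint) : Prop :=
  E.z.HasValue z tp tm y.z ∧ E.tp.HasValue z tp tm y.tp ∧ E.tm.HasValue z tp tm y.tm

/-- `𝓗`: the data for which `Ẽ` converges absolutely in some DeWitt neighbourhood of `0`. -/
def calH : Set InfData :=
  {B | ∃ r : ℝ, 0 < r ∧ ∀ x : SPoint, ‖x.body‖ < r → ∃ y, (Etilde B).HasValue x.z x.tp x.tm y}

/-! ### The data describing the moduli space -/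

/-- `S²M^m`: the `m`-tuples of points of `(⋀_∞^0)^× × (⋀_∞^1)^2` with distinct bodies. -/
def S2M (m : ℕ) : Set (Fin m → SPoint) :=
  {q | (∀ j, IsUnit (q j).z) ∧ ∀ j k, j ≠ k → (q j).body ≠ (q k).body}

/-- `((⋀_∞^0)^×)^2 / ⟨±1⟩`. -/
abbrev Scale : Type := (GEvenˣ × GEvenˣ) ⧸ Subgroup.zpowers (-1 : GEvenˣ × GEvenˣ)

/-- `S²K(n) = S²M^{n-1} × 𝓗 × (((⋀_∞^0)^×)^2 / ⟨±1⟩ × 𝓗)^n`, for `n ≥ 1`. -/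
abbrev S2K (n : ℕ) : Type := S2M (n - 1) × calH × (Fin n → Scale × calH)

/-- `S²K(0) = {(A⁺, A⁻, M⁺, M⁻) ∈ 𝓗 | A⁺_1 = M⁺_{1/2} = M⁻_{1/2} = 0}`. -/
def S2K0 : Set InfData := {B | B ∈ calH ∧ B.AP 0 = 0 ∧ B.MP 0 = 0 ∧ B.MM 0 = 0}

/-- The positions of the positively oriented punctures: the first `n - 1` are given and the last one
is at `0`. -/
def position {n : ℕ} (q : Fin (n - 1) → SPoint) (k : Fin n) : SPoint :=
  if h : k.val < n - 1 then q ⟨k.val, h⟩ else SPoint.origin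

/-- The negatively oriented puncture of `S` is at infinity, and its local coordinate is, as a
function of the southern coordinate `(w, ρ⁺, ρ⁻)` in a neighbourhood of infinity, equal to
`Ẽ(B)(1/w, i ρ⁺/w, i ρ⁻/w)`. -/
def CoordAtInfinity {n : ℕ} (S : TubedSphere n) (B : InfData) : Prop :=
  S.puncture 0 = pt .north SPoint.origin ∧
  ∃ r : ℝ, 0 < r ∧ ∀ x : SPoint, r < ‖x.body‖ →
    pt .south x ∈ (S.coord 0).source ∧
    (Etilde B).HasValue (Ring.inverse x.z) (Complex.I • (x.tp * Ring.inverse x.z))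
      (Complex.I • (x.tm * Ring.inverse x.z)) (S.coord 0 (pt .south x))

/-- The puncture of `S` with index `j` is at the point `q = (z, θ⁺, θ⁻)` in the southern coordinate
`(w, ρ⁺, ρ⁻)`, and its local coordinate is, near the puncture, equal to
`Ê(a, b, B)(w - z - ρ⁺ θ⁻ - ρ⁻ θ⁺, ρ⁺ - θ⁺, ρ⁻ - θ⁻)`. -/
def CoordAt {n : ℕ} (S : TubedSphere n) (j : Fin (n + 1)) (q : SPoint) (a b : GEvenˣ)
    (B : InfData) : Prop :=
  S.puncture j = pt .south q ∧
  ∃ r : ℝ, 0 < r ∧ ∀ x : SPoint, ‖x.body - q.body‖ < r →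
    pt .south x ∈ (S.coord j).source ∧
    (Ehat a b B).HasValue (x.z - q.z - x.tp * q.tm - x.tm * q.tp) (x.tp - q.tp) (x.tm - q.tm)
      (S.coord j (pt .south x))

/-- `S` is a canonical `N = 2` supersphere with `1 + n` tubes given by the data `Q ∈ S²K(n)`. -/
def Represents {n : ℕ} (Q : S2K n) (S : TubedSphere n) : Prop :=
  CoordAtInfinity S Q.2.1 ∧
  ∀ k : Fin n, ∃ a b : GEvenˣ, (QuotientGroup.mk (a, b) : Scale) = (Q.2.2 k).1 ∧
    CoordAt S k.succ (position Q.1.1 k) a b (Q.2.2 k).2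

end N2Sphere

end

noncomputable section
namespace N2Sphere
open Filter Topology

open CliffordAlgebra (involute)

/-! ### The Grassmann algebra: parity, body and soul -/

/-! The moduli problem has a local half and a global half. Locally, a superconformal coordinate that
vanishes at a puncture becomes, in a standard parametrization of the sphere at that puncture, a germ
of a superconformal map fixing the origin. Such germs correspond bijectively to convergent data `(a,
b, B)` modulo a common sign of `a` and `b`. Globally, automorphisms of the sphere move the punctures
to standard positions, and the automorphisms that are left over are eliminated by the normalizations
built into the parameter space.

Two devices keep the calculus with souls elementary. There are infinitely many generators, so for
each `x` some odd `η` has the property that `η x = 0` forces `x = 0` (`odd_cancel`); coefficients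
can therefore be read off from first-order expansions in auxiliary odd parameters. Moreover every
even element arises from a complex number by successively adding even elements of square zero
(`even_sq_induction`), so the only Taylor formula ever needed is `f(z + t) = f(z) + f'(z) t` with
`t² = 0`. In these terms `F(z + ηθ⁻, θ⁺ + η, θ⁻) = F + η D⁺F`, and the superconformal equations say
that `H` carries the shift by `η` to the shift by `η c` with `c = D⁺θ̃⁺`, and likewise for `D⁻`
(`RelP`, `RelM`). Compositions and inverses of superconformal maps are then formal.

Local half. A formal series is determined by its values at the points with body zero
(`ev_injective`), so identities between series are checked on values. The field `T` is an even
derivation that commutes with `D⁺` up to multiplication by `D⁺(Tφ⁺)` (`dPs_field`); a product rule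
for exponentials turns this into the superconformal equations for `exp(T)` (`exp_conformal`).
Conversely, a formal superconformal map is determined by the coefficients of `1` and `φ^±` in `φ̃^±`
(`FormalMap.Conf.ext`). Weight by weight these determine the data and can be prescribed, because a
change of the data in a given weight changes the exponential, to leading order, by the corresponding
field (`exp_sub`, `Etilde_injective`, `exists_data`). Convergence of the series is equivalent to
superanalyticity of the germ (`exists_superFn_of_hasValue`, `SuperFn.hasValue_ser`). An inverse
function theorem, proved by adjoining one generator at a time (`HasInv.of_low`), makes these germs
into charts.

Global half. Supertranslations, scalings and the interchange of the two charts are automorphisms,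
and they move the first puncture to infinity. An automorphism that fixes infinity is a scaling
followed by a supertranslation (`AutConf.eq_affine`): its components have at most simple poles at
infinity once zero is also fixed, so Liouville's theorem makes them affine. Leading coefficients one
at infinity exclude the scaling (`scale_eq_one`). For `n ≥ 1` the last puncture at zero excludes the
translation. For `n = 0` a translation by `q` changes `M^±_{1/2}` by `i` times the odd coordinates
of `q` and, when these vanish, `A⁺_1` by the even coordinate (`first_order_odd`,
`first_order_even`); requiring these three entries to be zero excludes the translation and can
always be achieved by one. -/

/-- The parity automorphism of `⋀_∞`. -/
abbrev parity : Grassmann →ₐ[ℂ] Grassmann := CliffordAlgebra.involute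

theorem mem_even_iff' {x : Grassmann} :
    x ∈ GEven ↔ x ∈ CliffordAlgebra.evenOdd (0 : QuadraticForm ℂ (ℕ →₀ ℂ)) 0 := by
  rw [← CliffordAlgebra.even_toSubmodule]; rfl

theorem parity_even {x : Grassmann} (h : x ∈ GEven) : parity x = x :=
  CliffordAlgebra.involute_eq_of_mem_even (mem_even_iff'.1 h)

theorem parity_odd {x : Grassmann} (h : x ∈ GOdd) : parity x = -x :=
  CliffordAlgebra.involute_eq_of_mem_odd h

theorem exists_even_add_odd (x : Grassmann) : ∃ a ∈ GEven, ∃ b ∈ GOdd, a + b = x := by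
  have h := (CliffordAlgebra.evenOdd_isCompl (0 : QuadraticForm ℂ (ℕ →₀ ℂ))).sup_eq_top
  have hx : x ∈ CliffordAlgebra.evenOdd (0 : QuadraticForm ℂ (ℕ →₀ ℂ)) 0 ⊔
    CliffordAlgebra.evenOdd (0 : QuadraticForm ℂ (ℕ →₀ ℂ)) 1 := by rw [h]; trivial
  obtain ⟨a, ha, b, hb, hab⟩ := Submodule.mem_sup.1 hx
  exact ⟨a, mem_even_iff'.2 ha, b, hb, hab⟩

theorem mem_even_iff {x : Grassmann} : x ∈ GEven ↔ parity x = x := by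
  refine ⟨parity_even, fun h => ?_⟩
  obtain ⟨a, ha, b, hb, rfl⟩ := exists_even_add_odd x
  rw [map_add, parity_even ha, parity_odd hb] at h
  have : b = 0 := by
    have h2 : (2 : ℂ) • b = 0 := by
      rw [two_smul, show b + b = (a + b) - (a + -b) by abel, h, sub_self]
    simpa using h2
  simpa [this] using ha

theorem mem_odd_iff {x : Grassmann} : x ∈ GOdd ↔ parity x = -x := by
  refine ⟨parity_odd, fun h => ?_⟩
  obtain ⟨a, ha, b, hb, rfl⟩ := exists_even_add_odd x
  rw [map_add, parity_even ha, parity_odd hb] at h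
  have : a = 0 := by
    have h2 : (2 : ℂ) • a = 0 := by
      rw [two_smul, show a + a = (a + -b) + (a + b) by abel, h]; abel
    simpa using h2
  simpa [this] using hb

/-- The even part of an element. -/
def evenPart : Grassmann →ₗ[ℂ] Grassmann := (2⁻¹ : ℂ) • (LinearMap.id + parity.toLinearMap)

theorem evenPart_apply (x : Grassmann) : evenPart x = (2⁻¹ : ℂ) • (x + parity x) := rfl

theorem parity_parity (x : Grassmann) : parity (parity x) = x :=
  CliffordAlgebra.involute_involute x

theorem evenPart_mem (x : Grassmann) : evenPart x ∈ GEven := by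
  rw [mem_even_iff, evenPart_apply, map_smul, map_add, parity_parity, add_comm]

theorem evenPart_of_even {x : Grassmann} (h : x ∈ GEven) : evenPart x = x := by
  rw [evenPart_apply, parity_even h, ← two_smul ℂ, smul_smul]; norm_num

theorem evenPart_of_odd {x : Grassmann} (h : x ∈ GOdd) : evenPart x = 0 := by
  rw [evenPart_apply, parity_odd h]; simp

theorem sub_evenPart_mem (x : Grassmann) : x - evenPart x ∈ GOdd := by
  rw [mem_odd_iff, map_sub, parity_even (evenPart_mem x), evenPart_apply]
  module

theorem even_mul_even {x y : Grassmann} (hx : x ∈ GEven) (hy : y ∈ GEven) : x * y ∈ GEven :=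
  mul_mem hx hy

theorem even_mul_odd {x y : Grassmann} (hx : x ∈ GEven) (hy : y ∈ GOdd) : x * y ∈ GOdd := by
  rw [mem_odd_iff, map_mul, parity_even hx, parity_odd hy, mul_neg]

theorem odd_mul_even {x y : Grassmann} (hx : x ∈ GOdd) (hy : y ∈ GEven) : x * y ∈ GOdd := by
  rw [mem_odd_iff, map_mul, parity_odd hx, parity_even hy, neg_mul]

theorem odd_mul_odd {x y : Grassmann} (hx : x ∈ GOdd) (hy : y ∈ GOdd) : x * y ∈ GEven := by
  rw [mem_even_iff, map_mul, parity_odd hx, parity_odd hy, neg_mul_neg]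

/-! ### Graded commutativity -/

theorem ι_mul_ι_comm (v w : ℕ →₀ ℂ) (x : Grassmann) :
    ExteriorAlgebra.ι ℂ v * ExteriorAlgebra.ι ℂ w * x =
      x * (ExteriorAlgebra.ι ℂ v * ExteriorAlgebra.ι ℂ w) := by
  have anti : ∀ a b : ℕ →₀ ℂ, ExteriorAlgebra.ι ℂ a * ExteriorAlgebra.ι ℂ b =
      -(ExteriorAlgebra.ι ℂ b * ExteriorAlgebra.ι ℂ a) := fun a b =>
    eq_neg_of_add_eq_zero_left (ExteriorAlgebra.ι_add_mul_swap a b)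
  induction x using ExteriorAlgebra.induction with
  | algebraMap r => exact (Algebra.commutes r _).symm
  | ι u => rw [mul_assoc, anti w u, mul_neg, ← mul_assoc, anti v u, neg_mul, neg_neg, mul_assoc]
  | mul a b ha hb => rw [← mul_assoc, ha, mul_assoc, hb, mul_assoc]
  | add a b ha hb => rw [mul_add, ha, hb, add_mul]

theorem even_comm {a : Grassmann} (ha : a ∈ GEven) (x : Grassmann) : a * x = x * a := by
  rw [mem_even_iff'] at ha
  induction a, ha using CliffordAlgebra.even_induction with
  | algebraMap r => exact Algebra.commutes r x
  | add a b _ _ ha hb => rw [add_mul, ha, hb, mul_add]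
  | ι_mul_ι_mul v w a _ ha =>
    have := ι_mul_ι_comm v w x
    rw [mul_assoc, ha, ← mul_assoc]
    erw [this]
    rw [mul_assoc]

/-- Stated for arbitrary `x`, so that odd factors can be moved without first splitting `x` into its
even and odd parts. -/
theorem odd_mul_comm {a : Grassmann} (ha : a ∈ GOdd) (x : Grassmann) : a * x = parity x * a := by
  induction a, ha using CliffordAlgebra.odd_induction with
  | ι v =>
    induction x using ExteriorAlgebra.induction with
    | algebraMap r => rw [AlgHom.commutes]; exact (Algebra.commutes r _).symm
    | ι u =>
      erw [CliffordAlgebra.involute_ι]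
      rw [neg_mul]
      exact eq_neg_of_add_eq_zero_left (ExteriorAlgebra.ι_add_mul_swap v u)
    | mul a b ha hb => rw [map_mul, ← mul_assoc, ha, mul_assoc, hb, mul_assoc]
    | add a b ha hb => rw [map_add, mul_add, ha, hb, add_mul]
  | add a b _ _ ha hb => rw [add_mul, ha, hb, mul_add]
  | ι_mul_ι_mul v w a _ ha =>
    rw [mul_assoc, ha, ← mul_assoc]
    erw [ι_mul_ι_comm v w (parity x)]
    rw [mul_assoc]

theorem odd_anticomm {a b : Grassmann} (ha : a ∈ GOdd) (hb : b ∈ GOdd) : a * b = -(b * a) := by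
  rw [odd_mul_comm ha, parity_odd hb, neg_mul]

theorem odd_mul_self {a : Grassmann} (ha : a ∈ GOdd) : a * a = 0 := by
  have h := odd_anticomm ha ha
  have h2 : (2 : ℂ) • (a * a) = 0 := by rw [two_smul]; nth_rw 1 [h]; simp
  simpa using h2

/-- `a x a = 0` for `a` odd. -/
theorem odd_mul_mul_self {a : Grassmann} (ha : a ∈ GOdd) (x : Grassmann) : a * (x * a) = 0 := by
  rw [← mul_assoc, odd_mul_comm ha, mul_assoc, odd_mul_self ha, mul_zero]

/-! ### The body homomorphism and the nilpotency of even souls -/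

@[simp] theorem gbody_zero : gbody 0 = 0 := map_zero _
@[simp] theorem gbody_one : gbody 1 = 1 := map_one _
@[simp] theorem gbody_add (x y : Grassmann) : gbody (x + y) = gbody x + gbody y := map_add _ _ _
@[simp] theorem gbody_sub (x y : Grassmann) : gbody (x - y) = gbody x - gbody y := map_sub _ _ _
@[simp] theorem gbody_neg (x : Grassmann) : gbody (-x) = -gbody x := map_neg _ _
@[simp] theorem gbody_mul (x y : Grassmann) : gbody (x * y) = gbody x * gbody y := map_mul _ _ _
@[simp] theorem gbody_smul (c : ℂ) (x : Grassmann) : gbody (c • x) = c * gbody x := map_smul _ _ _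
@[simp] theorem gbody_algebraMap (c : ℂ) : gbody (algebraMap ℂ Grassmann c) = c :=
  ExteriorAlgebra.algebraMap_leftInverse _ c

/-- The body as a linear functional. -/
def gbodyL : Grassmann →ₗ[ℂ] ℂ := ExteriorAlgebra.algebraMapInv.toLinearMap

theorem gbodyL_apply (x : Grassmann) : gbodyL x = gbody x := rfl

theorem gbody_ι (v : ℕ →₀ ℂ) : gbody (ExteriorAlgebra.ι ℂ v) = 0 := by
  simp [gbody, ExteriorAlgebra.algebraMapInv]

theorem gbody_odd {x : Grassmann} (hx : x ∈ GOdd) : gbody x = 0 := by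
  induction x, hx using CliffordAlgebra.odd_induction with
  | ι v => exact gbody_ι v
  | add a b _ _ ha hb => rw [gbody_add, ha, hb, add_zero]
  | ι_mul_ι_mul v w a _ ha => rw [gbody_mul, ha, mul_zero]

theorem body_add_soul (x : Grassmann) : algebraMap ℂ Grassmann (gbody x) + gsoul x = x := by
  simp [gsoul]

theorem algebraMap_even (c : ℂ) : algebraMap ℂ Grassmann c ∈ GEven := GEven.algebraMap_mem c

theorem gsoul_even {x : Grassmann} (hx : x ∈ GEven) : gsoul x ∈ GEven :=
  sub_mem hx (algebraMap_even _)

/-- Even elements are sums of scalars and of products `p q a` with `p` odd. Such a product squares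
to zero because `p` occurs twice, and sums of commuting nilpotents are nilpotent. -/
theorem even_soul_nilpotent {x : Grassmann} (hx : x ∈ GEven) : IsNilpotent (gsoul x) := by
  rw [mem_even_iff'] at hx
  induction x, hx using CliffordAlgebra.even_induction with
  | algebraMap r =>
    have : gsoul (algebraMap ℂ Grassmann r) = 0 := by simp [gsoul]
    erw [this]; exact IsNilpotent.zero
  | add a b ha' hb' ha hb =>
    have : gsoul (a + b) = gsoul a + gsoul b := by simp [gsoul]; abel
    rw [this]
    exact Commute.isNilpotent_add (even_comm (gsoul_even (mem_even_iff'.2 ha')) _) ha hb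
  | ι_mul_ι_mul v w a ha' ha =>
    have h0 : gbody (CliffordAlgebra.ι (0 : QuadraticForm ℂ (ℕ →₀ ℂ)) v *
      CliffordAlgebra.ι (0 : QuadraticForm ℂ (ℕ →₀ ℂ)) w * a) = 0 := by
      have := gbody_ι v
      simp only [gbody_mul]
      erw [this]; simp
    rw [gsoul, h0, map_zero, sub_zero]
    refine ⟨2, ?_⟩
    have h1 := CliffordAlgebra.ι_mem_evenOdd_one (0 : QuadraticForm ℂ (ℕ →₀ ℂ)) v
    generalize CliffordAlgebra.ι (0 : QuadraticForm ℂ (ℕ →₀ ℂ)) v = p at h1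
    generalize CliffordAlgebra.ι (0 : QuadraticForm ℂ (ℕ →₀ ℂ)) w = q
    have := odd_mul_mul_self h1 (q * a)
    calc (p * q * a) ^ 2 = (p * ((q * a) * p)) * (q * a) := by rw [pow_two]; simp only [mul_assoc]
      _ = 0 := by rw [this, zero_mul]

/-! ### Contraction with a dual generator and cancellation of odd factors -/

/-- The generators. -/
def gen (N : ℕ) : Grassmann := ExteriorAlgebra.ι ℂ (Finsupp.single N 1)

theorem gen_odd (N : ℕ) : gen N ∈ GOdd := CliffordAlgebra.ι_mem_evenOdd_one _ _

/-- Contraction with the `N`-th dual generator. -/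
def contr (N : ℕ) : Grassmann →ₗ[ℂ] Grassmann :=
  CliffordAlgebra.contractLeft (Q := (0 : QuadraticForm ℂ (ℕ →₀ ℂ))) (Finsupp.lapply N)

theorem contr_ι_mul (N : ℕ) (v : ℕ →₀ ℂ) (x : Grassmann) :
    contr N (ExteriorAlgebra.ι ℂ v * x) = v N • x - ExteriorAlgebra.ι ℂ v * contr N x :=
  CliffordAlgebra.contractLeft_ι_mul (Q := (0 : QuadraticForm ℂ (ℕ →₀ ℂ))) _ _ _

theorem contr_gen_mul (N : ℕ) (x : Grassmann) : contr N (gen N * x) = x - gen N * contr N x := by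
  rw [gen, contr_ι_mul]; simp

theorem contr_algebraMap (N : ℕ) (c : ℂ) : contr N (algebraMap ℂ Grassmann c) = 0 :=
  CliffordAlgebra.contractLeft_algebraMap (Q := (0 : QuadraticForm ℂ (ℕ →₀ ℂ))) _ _

theorem contr_mul (N : ℕ) (x y : Grassmann) :
    contr N (x * y) = contr N x * y + parity x * contr N y := by
  induction x using CliffordAlgebra.left_induction generalizing y with
  | algebraMap r =>
    have h : contr N (algebraMap ℂ Grassmann r) = 0 := contr_algebraMap N r
    erw [h]
    rw [AlgHom.commutes, zero_mul, zero_add]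
    erw [← Algebra.smul_def, ← Algebra.smul_def, map_smul]
  | add a b ha hb => rw [add_mul, map_add, ha, hb, map_add, map_add]; noncomm_ring
  | ι_mul x v hx =>
    have h1 := contr_ι_mul N v (x * y)
    have h2 := contr_ι_mul N v x
    rw [mul_assoc]
    erw [h1, h2]
    rw [hx, map_mul, CliffordAlgebra.involute_ι, sub_mul, smul_mul_assoc]
    erw [mul_add]
    rw [neg_mul, neg_mul, ← mul_assoc, ← mul_assoc]
    abel_nf

/-- An element involves only finitely many generators, and contraction with any other generator
kills it. -/
theorem exists_contr_eq_zero (x : Grassmann) : ∃ N₀, ∀ N ≥ N₀, contr N x = 0 := by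
  induction x using CliffordAlgebra.left_induction with
  | algebraMap r => exact ⟨0, fun N _ => contr_algebraMap N r⟩
  | add a b ha hb =>
    obtain ⟨n, hn⟩ := ha
    obtain ⟨m, hm⟩ := hb
    refine ⟨max n m, fun N hN => ?_⟩
    rw [map_add, hn N (le_trans (le_max_left _ _) hN), hm N (le_trans (le_max_right _ _) hN),
      add_zero]
  | ι_mul x v hx =>
    obtain ⟨n, hn⟩ := hx
    refine ⟨max n (v.support.sup id + 1), fun N hN => ?_⟩
    have h1 := contr_ι_mul N v x
    have h2 : v N = 0 := by
      by_contra h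
      have : N ≤ v.support.sup id := Finset.le_sup (f := id) (Finsupp.mem_support_iff.2 h)
      have := le_trans (le_max_right _ _) hN
      omega
    rw [h2, hn N (le_trans (le_max_left _ _) hN), zero_smul, mul_zero, sub_zero] at h1
    exact h1

theorem exists_gen_mul_injective (x : Grassmann) : ∃ N₀, ∀ N ≥ N₀, gen N * x = 0 → x = 0 := by
  obtain ⟨n, hn⟩ := exists_contr_eq_zero x
  refine ⟨n, fun N hN h => ?_⟩
  have := contr_gen_mul N x
  rw [h, hn N hN, map_zero, mul_zero, sub_zero] at this
  exact this.symm

/-- The infinite supply of generators is essential: over finitely many generators the top monomial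
is annihilated by every odd element. This is what allows derivatives to be read off from expansions
in an odd parameter. -/
theorem odd_cancel {x : Grassmann} (h : ∀ η ∈ GOdd, η * x = 0) : x = 0 := by
  obtain ⟨n, hn⟩ := exists_gen_mul_injective x
  exact hn n le_rfl (h _ (gen_odd n))

theorem odd_cancel' {x y : Grassmann} (h : ∀ η ∈ GOdd, η * x = η * y) : x = y := by
  rw [← sub_eq_zero]
  exact odd_cancel fun η hη => by rw [mul_sub, h η hη, sub_self]

/-! ### The basis of monomials -/

/-- Which vectors occur is irrelevant for the uses below: the length of the product gives the parity
of the monomial, and its first factor shows that body and square vanish. -/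
theorem zeta_eq_prod (k : Finset ℕ) : ∃ l : List (ℕ →₀ ℂ), l.length = k.card ∧
    zeta k = (l.map (ExteriorAlgebra.ι ℂ)).prod := by
  have h := ExteriorAlgebra.basis_apply_ofCard
    (Finsupp.basisSingleOne : Module.Basis ℕ ℂ (ℕ →₀ ℂ)) (s := k) rfl
  refine ⟨List.ofFn (Finsupp.basisSingleOne ∘
    Set.powersetCard.ofFinEmbEquiv.symm (Set.powersetCard.ofCard (s := k) rfl)), by simp,
    h.trans ((ExteriorAlgebra.ιMulti_apply _).trans ?_)⟩
  rw [List.map_ofFn]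
  rfl

theorem parity_zeta (k : Finset ℕ) : parity (zeta k) = (-1 : ℂ) ^ k.card • zeta k := by
  obtain ⟨l, hl, h⟩ := zeta_eq_prod k
  rw [h, ← hl]
  exact CliffordAlgebra.involute_prod_map_ι l

theorem zeta_even {k : Finset ℕ} (h : Even k.card) : zeta k ∈ GEven := by
  rw [mem_even_iff, parity_zeta, h.neg_one_pow, one_smul]

theorem zeta_odd {k : Finset ℕ} (h : Odd k.card) : zeta k ∈ GOdd := by
  rw [mem_odd_iff, parity_zeta, h.neg_one_pow, neg_one_smul]

theorem zeta_empty : zeta ∅ = 1 := by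
  obtain ⟨l, hl, h⟩ := zeta_eq_prod ∅
  have : l = [] := List.length_eq_zero_iff.1 (by simpa using hl)
  rw [h, this]; simp

theorem gbody_zeta {k : Finset ℕ} (hk : k ≠ ∅) : gbody (zeta k) = 0 := by
  obtain ⟨l, hl, h⟩ := zeta_eq_prod k
  match l, hl, h with
  | [], hl, _ => exact absurd (Finset.card_eq_zero.1 hl.symm) hk
  | v :: l, _, h => rw [h, List.map_cons, List.prod_cons, gbody_mul, gbody_ι, zero_mul]

theorem gbody_eq_repr (x : Grassmann) : gbody x = zeta.repr x ∅ := by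
  have : gbodyL = (Finsupp.lapply ∅ : (Finset ℕ →₀ ℂ) →ₗ[ℂ] ℂ) ∘ₗ zeta.repr.toLinearMap := by
    apply zeta.ext
    intro k
    simp only [gbodyL_apply, LinearMap.comp_apply, LinearEquiv.coe_coe, Module.Basis.repr_self]
    by_cases hk : k = ∅
    · simp [hk, zeta_empty]
    · simp [gbody_zeta hk, hk]
  exact congrArg (fun f : Grassmann →ₗ[ℂ] ℂ => f x) this

/-- Coefficient of `ζ_k`. -/
def coef (k : Finset ℕ) : Grassmann →ₗ[ℂ] ℂ :=
  (Finsupp.lapply k : (Finset ℕ →₀ ℂ) →ₗ[ℂ] ℂ) ∘ₗ zeta.repr.toLinearMap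

theorem coef_apply (k : Finset ℕ) (x : Grassmann) : coef k x = zeta.repr x k := rfl

theorem coef_zeta (k l : Finset ℕ) : coef k (zeta l) = if l = k then 1 else 0 := by
  rw [coef_apply, Module.Basis.repr_self, Finsupp.single_apply]

theorem coef_ext {x y : Grassmann} (h : ∀ k, coef k x = coef k y) : x = y :=
  zeta.repr.injective (Finsupp.ext h)

theorem sum_coef (x : Grassmann) {K : Finset (Finset ℕ)} (hK : ∀ k ∉ K, coef k x = 0) :
    ∑ k ∈ K, coef k x • zeta k = x := by
  apply coef_ext
  intro j
  simp only [map_sum, map_smul, coef_zeta, smul_eq_mul, mul_ite, mul_one, mul_zero]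
  rw [Finset.sum_ite_eq']
  split_ifs with h
  · rfl
  · exact (hK j h).symm

theorem coef_support (x : Grassmann) : ∀ k ∉ (zeta.repr x).support, coef k x = 0 := fun _ hk => by
  simpa [coef_apply] using hk

theorem coef_parity (k : Finset ℕ) (x : Grassmann) :
    coef k (parity x) = (-1 : ℂ) ^ k.card * coef k x := by
  have : coef k ∘ₗ parity.toLinearMap = (-1 : ℂ) ^ k.card • coef k := by
    apply zeta.ext
    intro l
    simp only [LinearMap.comp_apply, AlgHom.toLinearMap_apply, parity_zeta, map_smul, coef_zeta,
      LinearMap.smul_apply]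
    split_ifs with h
    · rw [h]
    · simp
  exact congrArg (fun f : Grassmann →ₗ[ℂ] ℂ => f x) this

theorem coef_of_even {k : Finset ℕ} {x : Grassmann} (hx : x ∈ GEven) (hk : Odd k.card) :
    coef k x = 0 := by
  have := coef_parity k x
  rw [parity_even hx, hk.neg_one_pow] at this
  linear_combination (1 / 2) * this

theorem coef_of_odd {k : Finset ℕ} {x : Grassmann} (hx : x ∈ GOdd) (hk : Even k.card) :
    coef k x = 0 := by
  have := coef_parity k x
  rw [parity_odd hx, hk.neg_one_pow, map_neg] at this
  linear_combination (-1 / 2) * this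

/-! ### Extension of functions of the body -/

/-- Every even element is obtained from a scalar by adding even elements of square zero. -/
theorem even_sq_induction' {P : Grassmann → Prop} (scalar : ∀ c : ℂ, P (algebraMap ℂ Grassmann c))
    (add : ∀ z t, z ∈ GEven → t ∈ GEven → t * t = 0 → gbody t = 0 → P z → P (z + t))
    {z : Grassmann} (hz : z ∈ GEven) : P z := by
  -- The base point `z` stays arbitrary, so that the summands of a soul can be added one after the
  -- other.
  have key : ∀ a, a ∈ GEven → ∀ z, z ∈ GEven → P z → P (z + gsoul a) := by
    intro a ha
    rw [mem_even_iff'] at ha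
    induction a, ha using CliffordAlgebra.even_induction with
    | algebraMap r =>
      intro z _ h
      have : gsoul (algebraMap ℂ Grassmann r) = 0 := by simp [gsoul]
      erw [this]; rwa [add_zero]
    | add a b ha' hb' ha hb =>
      intro z hz h
      have : gsoul (a + b) = gsoul a + gsoul b := by simp [gsoul]; abel
      rw [this, ← add_assoc]
      exact hb _ (add_mem hz (gsoul_even (mem_even_iff'.2 ha'))) (ha _ hz h)
    | ι_mul_ι_mul v w a ha' ha =>
      intro z hz h
      have h1 := CliffordAlgebra.ι_mem_evenOdd_one (0 : QuadraticForm ℂ (ℕ →₀ ℂ)) v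
      have h2 := CliffordAlgebra.ι_mem_evenOdd_one (0 : QuadraticForm ℂ (ℕ →₀ ℂ)) w
      generalize CliffordAlgebra.ι (0 : QuadraticForm ℂ (ℕ →₀ ℂ)) v = p at h1
      generalize CliffordAlgebra.ι (0 : QuadraticForm ℂ (ℕ →₀ ℂ)) w = q at h2
      have h0 : gbody (p * q * a) = 0 := by rw [gbody_mul, gbody_mul, gbody_odd h1]; simp
      have h3 : gsoul (p * q * a) = p * q * a := by rw [gsoul, h0, map_zero, sub_zero]
      erw [h3]
      refine add z _ hz (even_mul_even (odd_mul_odd h1 h2) (mem_even_iff'.2 ha')) ?_ h0 h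
      have := odd_mul_mul_self h1 (q * a)
      calc (p * q * a) * (p * q * a) = (p * ((q * a) * p)) * (q * a) := by simp only [mul_assoc]
        _ = 0 := by rw [this, zero_mul]
  rw [← body_add_soul z]
  exact key z hz _ (algebraMap_even _) (scalar _)

-- The same principle for predicates that mention the proof of evenness, in the shape the
-- `induction` tactic expects.
@[elab_as_elim]
theorem even_sq_induction {P : ∀ z, z ∈ GEven → Prop}
    (scalar : ∀ c : ℂ, P (algebraMap ℂ Grassmann c) (algebraMap_even c))
    (add : ∀ z t, ∀ (hz : z ∈ GEven) (ht : t ∈ GEven), t * t = 0 → gbody t = 0 → P z hz →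
      P (z + t) (add_mem hz ht)) (z : Grassmann) (hz : z ∈ GEven) : P z hz := by
  have : ∃ h : z ∈ GEven, P z h :=
    even_sq_induction' (P := fun z => ∃ h : z ∈ GEven, P z h)
      (fun c => ⟨_, scalar c⟩) (fun z t _ ht h hb ⟨hz, hP⟩ => ⟨_, add z t hz ht h hb hP⟩) hz
  exact this.2

theorem gbody_of_sq {t : Grassmann} (h : t * t = 0) : gbody t = 0 := by
  have := congrArg gbody h
  rw [gbody_mul, gbody_zero] at this
  exact mul_self_eq_zero.1 this

theorem gsoul_add_of_body {z t : Grassmann} (ht : gbody t = 0) : gsoul (z + t) = gsoul z + t := by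
  simp [gsoul, ht]; abel

/-- The Taylor coefficients of `f` at `b`. -/
def tay (f : ℂ → ℂ) (b : ℂ) (l : ℕ) : ℂ := ((l.factorial : ℂ))⁻¹ * iteratedDeriv l f b

theorem tay_zero (f : ℂ → ℂ) (b : ℂ) : tay f b 0 = f b := by simp [tay]

theorem tay_deriv (f : ℂ → ℂ) (b : ℂ) (l : ℕ) :
    tay (deriv f) b l = ((l : ℂ) + 1) * tay f b (l + 1) := by
  rw [tay, tay, iteratedDeriv_succ', Nat.factorial_succ]
  have h1 : ((l : ℂ) + 1) ≠ 0 := by exact_mod_cast Nat.succ_ne_zero l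
  have h2 : ((l.factorial : ℂ)) ≠ 0 := by exact_mod_cast Nat.factorial_ne_zero l
  push_cast
  field_simp

theorem tay_congr {f g : ℂ → ℂ} {b : ℂ} (h : f =ᶠ[𝓝 b] g) (l : ℕ) : tay f b l = tay g b l := by
  rw [tay, tay, h.iteratedDeriv_eq]

theorem extend_eq_sum (f : ℂ → ℂ) {z : Grassmann} {M : ℕ} (h : gsoul z ^ M = 0) :
    extend f z = ∑ l ∈ Finset.range M, tay f (gbody z) l • gsoul z ^ l := by
  refine finsum_eq_sum_of_support_subset _ fun l hl => ?_
  rw [Finset.coe_range, Set.mem_Iio]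
  by_contra hlt
  refine hl ?_
  simp [pow_eq_zero_of_le (not_lt.1 hlt) h]

theorem extend_algebraMap (f : ℂ → ℂ) (c : ℂ) :
    extend f (algebraMap ℂ Grassmann c) = algebraMap ℂ Grassmann (f c) := by
  have : gsoul (algebraMap ℂ Grassmann c) ^ 1 = 0 := by simp [gsoul]
  rw [extend_eq_sum f this]
  simp [tay_zero, Algebra.algebraMap_eq_smul_one]

theorem add_pow_of_sq {s t : Grassmann} (hs : s ∈ GEven) (ht : t * t = 0) (l : ℕ) :
    (s + t) ^ (l + 1) = s ^ (l + 1) + ((l : ℂ) + 1) • (s ^ l * t) := by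
  induction l with
  | zero => simp
  | succ l ih =>
    rw [pow_succ, ih, add_mul, mul_add, mul_add, smul_mul_assoc, smul_mul_assoc, mul_assoc _ t s,
      ← even_comm hs t, mul_assoc _ t t, ht, mul_zero, smul_zero, add_zero, ← mul_assoc,
      ← pow_succ, ← pow_succ, add_assoc]
    congr 1
    push_cast
    module

/-- The binomial expansion of each power stops after the linear term, and shifting the index turns
the Taylor coefficients of `f` into those of `f'`. Together with square-zero induction this replaces
all manipulation of Taylor series. -/
theorem extend_add_sq (f : ℂ → ℂ) {z t : Grassmann} (hz : z ∈ GEven) (ht' : t ∈ GEven)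
    (ht : t * t = 0) : extend f (z + t) = extend f z + extend (deriv f) z * t := by
  obtain ⟨M, hM⟩ := even_soul_nilpotent hz
  obtain ⟨K, hK⟩ := even_soul_nilpotent (add_mem hz ht')
  have hb := gbody_of_sq ht
  -- A common range that annihilates the powers of both souls; the sum for the derivative is shorter
  -- by one term.
  have h1 : gsoul z ^ (M + K + 1) = 0 := pow_eq_zero_of_le (by omega) hM
  have h1' : gsoul z ^ (M + K) = 0 := pow_eq_zero_of_le (by omega) hM
  have h2 : gsoul (z + t) ^ (M + K + 1) = 0 := pow_eq_zero_of_le (by omega) hK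
  rw [extend_eq_sum f h1, extend_eq_sum f h2, extend_eq_sum _ h1', gsoul_add_of_body hb,
    gbody_add, hb, add_zero, Finset.sum_range_succ', Finset.sum_range_succ', Finset.sum_mul,
    add_right_comm, ← Finset.sum_add_distrib, pow_zero, pow_zero]
  congr 1
  refine Finset.sum_congr rfl fun l _ => ?_
  rw [add_pow_of_sq (gsoul_even hz) ht, smul_add, smul_smul, smul_mul_assoc, tay_deriv, mul_comm]

theorem extend_even (f : ℂ → ℂ) {z : Grassmann} (hz : z ∈ GEven) : extend f z ∈ GEven := by
  obtain ⟨M, hM⟩ := even_soul_nilpotent hz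
  rw [extend_eq_sum f hM]
  exact Subalgebra.sum_mem _ fun l _ => Subalgebra.smul_mem _ (pow_mem (gsoul_even hz) l) _

theorem extend_congr {f g : ℂ → ℂ} {z : Grassmann} (h : f =ᶠ[𝓝 (gbody z)] g) :
    extend f z = extend g z := by
  unfold extend
  simp only [h.iteratedDeriv_eq]

theorem gbody_extend (f : ℂ → ℂ) {z : Grassmann} (hz : z ∈ GEven) :
    gbody (extend f z) = f (gbody z) := by
  induction z, hz using even_sq_induction with
  | scalar c => rw [extend_algebraMap, gbody_algebraMap, gbody_algebraMap]
  | add z t hz ht h hb ih => rw [extend_add_sq f hz ht h, gbody_add, gbody_mul, hb, ih]; simp [hb]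

theorem extend_const (c : ℂ) {z : Grassmann} (hz : z ∈ GEven) :
    extend (fun _ => c) z = algebraMap ℂ Grassmann c := by
  have h0 : extend (fun _ => (0 : ℂ)) z = 0 := by
    obtain ⟨M, hM⟩ := even_soul_nilpotent hz
    rw [extend_eq_sum _ hM]
    refine Finset.sum_eq_zero fun l _ => ?_
    rw [tay, iteratedDeriv_const]; simp
  clear h0
  induction z, hz using even_sq_induction with
  | scalar a => rw [extend_algebraMap]
  | add z t hz ht h hb ih =>
    have h0 : extend (deriv fun _ : ℂ => c) z = 0 := by
      obtain ⟨M, hM⟩ := even_soul_nilpotent hz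
      rw [extend_eq_sum _ hM]
      refine Finset.sum_eq_zero fun l _ => ?_
      rw [deriv_const', tay, iteratedDeriv_const]; simp
    rw [extend_add_sq _ hz ht h, ih, h0, zero_mul, add_zero]

theorem extend_id {z : Grassmann} (hz : z ∈ GEven) : extend (fun w => w) z = z := by
  induction z, hz using even_sq_induction with
  | scalar a => rw [extend_algebraMap]
  | add z t hz ht h hb ih =>
    rw [extend_add_sq _ hz ht h, ih, deriv_id'', extend_const _ hz, map_one, one_mul]

/-- The functions vary in the induction because its step passes to derivatives; analyticity makes
the rule for the derivatives hold in a neighbourhood of the body, as `extend_congr` requires.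
Products and compositions below follow the same pattern. -/
theorem extend_add {f g : ℂ → ℂ} {z : Grassmann} (hz : z ∈ GEven) (hf : AnalyticAt ℂ f (gbody z))
    (hg : AnalyticAt ℂ g (gbody z)) : extend (f + g) z = extend f z + extend g z := by
  induction z, hz using even_sq_induction generalizing f g with
  | scalar a => simp only [extend_algebraMap, Pi.add_apply, map_add]
  | add z t hz ht h hb ih =>
    simp only [gbody_add, hb, add_zero] at hf hg
    have hd : deriv (f + g) =ᶠ[𝓝 (gbody z)] deriv f + deriv g := by
      filter_upwards [hf.eventually_analyticAt, hg.eventually_analyticAt] with w h1 h2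
      exact deriv_add h1.differentiableAt h2.differentiableAt
    rw [extend_add_sq _ hz ht h, extend_add_sq _ hz ht h, extend_add_sq _ hz ht h, ih hf hg,
      extend_congr hd, ih hf.deriv hg.deriv, add_mul]
    abel

theorem extend_smul (c : ℂ) (f : ℂ → ℂ) {z : Grassmann} (hz : z ∈ GEven) :
    extend (c • f) z = c • extend f z := by
  obtain ⟨M, hM⟩ := even_soul_nilpotent hz
  rw [extend_eq_sum _ hM, extend_eq_sum _ hM, Finset.smul_sum]
  refine Finset.sum_congr rfl fun l _ => ?_
  rw [tay, tay, iteratedDeriv_const_smul_field, smul_smul]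
  congr 1
  simp only [smul_eq_mul]; ring

theorem extend_mul {f g : ℂ → ℂ} {z : Grassmann} (hz : z ∈ GEven) (hf : AnalyticAt ℂ f (gbody z))
    (hg : AnalyticAt ℂ g (gbody z)) : extend (f * g) z = extend f z * extend g z := by
  induction z, hz using even_sq_induction generalizing f g with
  | scalar a => simp only [extend_algebraMap, Pi.mul_apply, map_mul]
  | add z t hz ht h hb ih =>
    simp only [gbody_add, hb, add_zero] at hf hg
    have hd : deriv (f * g) =ᶠ[𝓝 (gbody z)] deriv f * g + f * deriv g := by
      filter_upwards [hf.eventually_analyticAt, hg.eventually_analyticAt] with w h1 h2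
      exact deriv_mul h1.differentiableAt h2.differentiableAt
    rw [extend_add_sq _ hz ht h, extend_add_sq _ hz ht h, extend_add_sq _ hz ht h, ih hf hg,
      extend_congr hd, extend_add hz (hf.deriv.mul hg) (hf.mul hg.deriv), ih hf.deriv hg,
      ih hf hg.deriv]
    simp only [add_mul, mul_add]
    rw [mul_assoc _ t (_ * t), ← mul_assoc t _ t, even_comm ht, mul_assoc _ t t, h,
      mul_assoc _ t (extend g z), even_comm ht (extend g z)]
    simp only [mul_assoc, mul_zero, add_zero]
    abel

theorem extend_comp {f g : ℂ → ℂ} {z : Grassmann} (hz : z ∈ GEven) (hf : AnalyticAt ℂ f (gbody z))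
    (hg : AnalyticAt ℂ g (f (gbody z))) :
    extend (fun w => g (f w)) z = extend g (extend f z) := by
  induction z, hz using even_sq_induction generalizing f g with
  | scalar a => simp only [extend_algebraMap]
  | add z t hz ht h hb ih =>
    simp only [gbody_add, hb, add_zero] at hf hg
    have hd : deriv (fun w => g (f w)) =ᶠ[𝓝 (gbody z)] (fun w => deriv g (f w)) * deriv f := by
      filter_upwards [hf.eventually_analyticAt,
        hf.continuousAt.eventually hg.eventually_analyticAt] with w h1 h2
      exact deriv_comp (h₂ := g) (h := f) w h2.differentiableAt h1.differentiableAt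
    have e1 : extend (deriv f) z * t ∈ GEven := even_mul_even (extend_even _ hz) ht
    have e2 : extend (deriv f) z * t * (extend (deriv f) z * t) = 0 := by
      rw [mul_assoc, ← mul_assoc t, even_comm ht, mul_assoc _ t t, h]; simp
    rw [extend_add_sq _ hz ht h, extend_add_sq _ hz ht h, extend_add_sq _ (extend_even _ hz) e1 e2,
      ih hf hg, extend_congr hd, extend_mul (f := fun w => deriv g (f w)) hz (hg.deriv.comp hf) hf.deriv, ih hf hg.deriv,
      mul_assoc]

/-! ### Inverses and square roots of even elements -/

/-- An even element with non-zero body is invertible, with even inverse. -/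
theorem exists_inverse {z : Grassmann} (hz : z ∈ GEven) (hb : gbody z ≠ 0) :
    extend (fun w => w⁻¹) z * z = 1 ∧ z * extend (fun w => w⁻¹) z = 1 := by
  have h : extend (fun w => w⁻¹) z * z = 1 := by
    nth_rw 2 [← extend_id hz]
    rw [← extend_mul hz (analyticAt_inv hb) (g := fun w => w) analyticAt_id]
    have : ((fun w : ℂ => w⁻¹) * fun w => w) =ᶠ[𝓝 (gbody z)] fun _ => 1 := by
      filter_upwards [isOpen_ne.mem_nhds hb] with w hw
      exact inv_mul_cancel₀ hw
    rw [extend_congr this, extend_const _ hz, map_one]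
  exact ⟨h, by rw [← even_comm (extend_even _ hz)]; exact h⟩

theorem exists_sqrt {z : Grassmann} (hz : z ∈ GEven) (hb : gbody z ≠ 0) :
    ∃ a ∈ GEven, a * a = z := by
  set b := gbody z with hbdef
  -- The logarithm is taken of `w / b`, which is close to `1`, so the branch cut is avoided for
  -- every `b ≠ 0`.
  let f : ℂ → ℂ := fun w => Complex.exp ((Complex.log b + Complex.log (w / b)) / 2)
  have hf : AnalyticAt ℂ f b := by
    have h1 : AnalyticAt ℂ (fun w => Complex.log (w / b)) b := by
      refine AnalyticAt.clog (by fun_prop) ?_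
      rw [div_self hb]; exact Complex.one_mem_slitPlane
    have h2 : AnalyticAt ℂ (fun w => (Complex.log b + Complex.log (w / b)) / 2) b :=
      (analyticAt_const.add h1).div_const
    exact h2.cexp
  refine ⟨extend f z, extend_even _ hz, ?_⟩
  rw [← extend_mul hz hf hf]
  have : (f * f) =ᶠ[𝓝 (gbody z)] fun w => w := by
    filter_upwards [isOpen_ne.mem_nhds hb] with w hw
    have : f w * f w = Complex.exp (Complex.log b) * Complex.exp (Complex.log (w / b)) := by
      rw [← Complex.exp_add, ← Complex.exp_add]; ring_nf
    rw [Pi.mul_apply, this, Complex.exp_log hb, Complex.exp_log (div_ne_zero hw hb)]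
    field_simp
  rw [extend_congr this, extend_id hz]

theorem isUnit_of_body {z : Grassmann} (hz : z ∈ GEven) (hb : gbody z ≠ 0) : IsUnit z :=
  ⟨⟨z, extend (fun w => w⁻¹) z, (exists_inverse hz hb).2, (exists_inverse hz hb).1⟩, rfl⟩

theorem body_ne_zero_of_isUnit {z : Grassmann} (h : IsUnit z) : gbody z ≠ 0 :=
  (h.map (ExteriorAlgebra.algebraMapInv : Grassmann →ₐ[ℂ] ℂ)).ne_zero

theorem inverse_eq_extend {z : Grassmann} (hz : z ∈ GEven) (hb : gbody z ≠ 0) :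
    Ring.inverse z = extend (fun w => w⁻¹) z := by
  have : z = ((⟨z, extend (fun w => w⁻¹) z, (exists_inverse hz hb).2,
    (exists_inverse hz hb).1⟩ : Grassmannˣ) : Grassmann) := rfl
  conv_lhs => rw [this]
  rw [Ring.inverse_unit]; rfl

/-! ### Superanalytic germs -/

/-- The filter of DeWitt neighbourhoods of the points with body `w`. -/
def bn (w : ℂ) : Filter SPoint := comap SPoint.body (𝓝 w)

theorem nhds_eq_bn (p : SPoint) : 𝓝 p = bn p.body := nhds_induced _ _

theorem eventually_bn {w : ℂ} {Q : SPoint → Prop} :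
    (∀ᶠ p in bn w, Q p) ↔ ∀ᶠ w' in 𝓝 w, ∀ p : SPoint, p.body = w' → Q p := eventually_comap

theorem eventually_bn_body {w : ℂ} {Q : ℂ → Prop} (h : ∀ᶠ w' in 𝓝 w, Q w') :
    ∀ᶠ p in bn w, Q p.body := tendsto_comap.eventually h

/-- DeWitt neighbourhoods contain whole fibres of the body map, so a property that holds near a body
holds at every point over it. -/
theorem of_eventually_bn {w : ℂ} {Q : SPoint → Prop} (h : ∀ᶠ p in bn w, Q p) {p : SPoint}
    (hp : p.body = w) : Q p := (eventually_bn.1 h).self_of_nhds p hp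

theorem eventually_eventually_bn {w : ℂ} {Q : SPoint → Prop} (h : ∀ᶠ p in bn w, Q p) :
    ∀ᶠ w' in 𝓝 w, ∀ᶠ p in bn w', Q p := by
  filter_upwards [(eventually_bn.1 h).eventually_nhds] with w' hw'
  exact eventually_bn.2 hw'

/-- The point with given scalar body, and zero soul and odd coordinates. -/
def SPoint.ofBody (w : ℂ) : SPoint :=
  ⟨algebraMap ℂ Grassmann w, 0, 0, algebraMap_even w, zero_mem _, zero_mem _⟩

theorem SPoint.body_ofBody (w : ℂ) : (SPoint.ofBody w).body = w := gbody_algebraMap w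

/-! ### Shifts of points -/

/-- The shift `(z, θ⁺, θ⁻) ↦ (z + ηθ⁻, θ⁺ + η, θ⁻)`. -/
def SPoint.shP (p : SPoint) (η : GOdd) : SPoint :=
  ⟨p.z + η * p.tm, p.tp + η, p.tm, add_mem p.z_even (odd_mul_odd η.2 p.tm_odd),
    add_mem p.tp_odd η.2, p.tm_odd⟩

/-- The shift `(z, θ⁺, θ⁻) ↦ (z + ηθ⁺, θ⁺, θ⁻ + η)`. -/
def SPoint.shM (p : SPoint) (η : GOdd) : SPoint :=
  ⟨p.z + η * p.tp, p.tp, p.tm + η, add_mem p.z_even (odd_mul_odd η.2 p.tp_odd),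
    p.tp_odd, add_mem p.tm_odd η.2⟩

/-- The shift `(z, θ⁺, θ⁻) ↦ (z + t, θ⁺, θ⁻)`. -/
def SPoint.shZ (p : SPoint) (t : GEven) : SPoint :=
  ⟨p.z + t, p.tp, p.tm, add_mem p.z_even t.2, p.tp_odd, p.tm_odd⟩

theorem SPoint.body_shP (p : SPoint) (η : GOdd) : (p.shP η).body = p.body := by
  simp [SPoint.body, SPoint.shP, gbody_odd η.2]

theorem SPoint.body_shM (p : SPoint) (η : GOdd) : (p.shM η).body = p.body := by
  simp [SPoint.body, SPoint.shM, gbody_odd η.2]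

theorem SPoint.body_shZ (p : SPoint) {t : GEven} (ht : gbody t = 0) :
    (p.shZ t).body = p.body := by
  simp [SPoint.body, SPoint.shZ, ht]

theorem odd_sq_mul {a : Grassmann} (ha : a ∈ GOdd) (b : Grassmann) : a * b * (a * b) = 0 := by
  rw [← mul_assoc, mul_assoc a b a, odd_mul_mul_self ha, zero_mul]

/-- Setting odd variables to zero isolates the first three coefficients; once they vanish, two
successive odd cancellations remove the last one. -/
theorem assemble_eq_zero {v : Sector → Grassmann}
    (h : ∀ η ∈ GOdd, ∀ η' ∈ GOdd, assemble η η' v = 0) : v = 0 := by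
  have h1 : v .one = 0 := by simpa [assemble] using h 0 (zero_mem _) 0 (zero_mem _)
  have h2 : v .p = 0 := odd_cancel fun η hη => by
    simpa [assemble, h1] using h η hη 0 (zero_mem _)
  have h3 : v .m = 0 := odd_cancel fun η hη => by
    simpa [assemble, h1] using h 0 (zero_mem _) η hη
  have h4 : v .pm = 0 := odd_cancel fun η hη => odd_cancel fun η' hη' => by
    simpa [assemble, h1, h2, h3, mul_assoc] using h η' hη' η hη
  funext s
  cases s <;> assumption

theorem assemble_add (a b : Grassmann) (v w : Sector → Grassmann) :
    assemble a b (v + w) = assemble a b v + assemble a b w := by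
  simp only [assemble, Pi.add_apply, mul_add]; abel

theorem assemble_smul (a b : Grassmann) (c : ℂ) (v : Sector → Grassmann) :
    assemble a b (c • v) = c • assemble a b v := by
  simp only [assemble, Pi.smul_apply, mul_smul_comm, smul_add]

/-- The coefficient functions are analytic at `w`, and all but finitely many vanish near `w`. -/
def SuperFn.AnAt (F : SuperFn) (w : ℂ) : Prop :=
  (∀ s k, AnalyticAt ℂ (F s k) w) ∧
    ∃ K : Finset (Finset ℕ), ∀ᶠ w' in 𝓝 w, ∀ s, ∀ k ∉ K, F s k w' = 0

theorem SuperFn.AnAt.eventually {F : SuperFn} {w : ℂ} (h : F.AnAt w) : ∀ᶠ w' in 𝓝 w, F.AnAt w' := by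
  obtain ⟨h1, K, hK⟩ := h
  have h2 : ∀ᶠ w' in 𝓝 w, ∀ k ∈ K, ∀ s, AnalyticAt ℂ (F s k) w' := by
    rw [Finset.eventually_all]
    intro k _
    filter_upwards [(h1 .one k).eventually_analyticAt, (h1 .p k).eventually_analyticAt,
      (h1 .m k).eventually_analyticAt, (h1 .pm k).eventually_analyticAt] with w' a b c d s
    cases s <;> assumption
  filter_upwards [h2, hK.eventually_nhds] with w' a b
  refine ⟨fun s k => ?_, K, b⟩
  by_cases hk : k ∈ K
  · exact a k hk s
  · have : F s k =ᶠ[𝓝 w'] fun _ => 0 := by filter_upwards [b] with w'' h using h s k hk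
    exact analyticAt_const.congr this.symm

theorem extend_of_eventually_zero {f : ℂ → ℂ} {z : Grassmann} (hz : z ∈ GEven)
    (h : ∀ᶠ w in 𝓝 (gbody z), f w = 0) : extend f z = 0 := by
  rw [extend_congr (g := fun _ => 0) h, extend_const _ hz, map_zero]

/-- The coefficient of `θ_s` in the value. -/
def SuperFn.sec (F : SuperFn) (s : Sector) (z : Grassmann) : Grassmann :=
  ∑ᶠ k : Finset ℕ, extend (F s k) z * zeta k

theorem SuperFn.eval_eq (F : SuperFn) (p : SPoint) :
    F.eval p = assemble p.tp p.tm fun s => F.sec s p.z := rfl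

theorem SuperFn.sec_eq_sum {F : SuperFn} {K : Finset (Finset ℕ)} {z : Grassmann} (hz : z ∈ GEven)
    (h : ∀ᶠ w in 𝓝 (gbody z), ∀ s, ∀ k ∉ K, F s k w = 0) (s : Sector) :
    F.sec s z = ∑ k ∈ K, extend (F s k) z * zeta k := by
  refine finsum_eq_sum_of_support_subset _ fun k hk => ?_
  by_contra hkK
  refine hk ?_
  show extend (F s k) z * zeta k = 0
  rw [extend_of_eventually_zero hz (by filter_upwards [h] with w hw using hw s k hkK), zero_mul]

theorem SuperFn.sec_add {F G : SuperFn} {z : Grassmann} (hz : z ∈ GEven) (hF : F.AnAt (gbody z))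
    (hG : G.AnAt (gbody z)) (s : Sector) : (F + G).sec s z = F.sec s z + G.sec s z := by
  obtain ⟨h1, K, hK⟩ := hF
  obtain ⟨h2, L, hL⟩ := hG
  rw [SuperFn.sec_eq_sum (F := F) (K := K ∪ L) hz (by
      filter_upwards [hK] with w hw s k hk using hw s k fun h => hk (Finset.mem_union_left _ h)),
    SuperFn.sec_eq_sum (F := G) (K := K ∪ L) hz (by
      filter_upwards [hL] with w hw s k hk using hw s k fun h => hk (Finset.mem_union_right _ h)),
    SuperFn.sec_eq_sum (F := F + G) (K := K ∪ L) hz (by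
      filter_upwards [hK, hL] with w hw hw' s k hk
      simp [hw s k fun h => hk (Finset.mem_union_left _ h),
        hw' s k fun h => hk (Finset.mem_union_right _ h)]), ← Finset.sum_add_distrib]
  refine Finset.sum_congr rfl fun k _ => ?_
  rw [← add_mul, ← extend_add hz (h1 s k) (h2 s k)]; rfl

theorem SuperFn.sec_smul {F : SuperFn} {z : Grassmann} (hz : z ∈ GEven) (hF : F.AnAt (gbody z))
    (c : ℂ) (s : Sector) : (c • F).sec s z = c • F.sec s z := by
  obtain ⟨h1, K, hK⟩ := hF
  rw [SuperFn.sec_eq_sum hz hK, SuperFn.sec_eq_sum (K := K) hz (by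
      filter_upwards [hK] with w hw s k hk
      simp [hw s k hk]), Finset.smul_sum]
  refine Finset.sum_congr rfl fun k _ => ?_
  rw [← smul_mul_assoc, ← extend_smul c _ hz]; rfl

theorem SuperFn.AnAt.add {F G : SuperFn} {w : ℂ} (hF : F.AnAt w) (hG : G.AnAt w) :
    (F + G).AnAt w := by
  obtain ⟨h1, K, hK⟩ := hF
  obtain ⟨h2, L, hL⟩ := hG
  refine ⟨fun s k => (h1 s k).add (h2 s k), K ∪ L, ?_⟩
  filter_upwards [hK, hL] with w hw hw' s k hk
  simp [hw s k fun h => hk (Finset.mem_union_left _ h),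
        hw' s k fun h => hk (Finset.mem_union_right _ h)]

theorem SuperFn.AnAt.smul {F : SuperFn} {w : ℂ} (hF : F.AnAt w) (c : ℂ) : (c • F).AnAt w := by
  obtain ⟨h1, K, hK⟩ := hF
  refine ⟨fun s k => (analyticAt_const (v := c)).smul (h1 s k), K, ?_⟩
  filter_upwards [hK] with w hw s k hk
  simp [hw s k hk]

theorem SuperFn.AnAt.zero (w : ℂ) : (0 : SuperFn).AnAt w :=
  ⟨fun _ _ => analyticAt_const, ∅, Eventually.of_forall fun _ _ _ _ => rfl⟩

theorem SuperFn.AnAt.dz {F : SuperFn} {w : ℂ} (hF : F.AnAt w) : F.dz.AnAt w := by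
  obtain ⟨h1, K, hK⟩ := hF
  refine ⟨fun s k => (h1 s k).deriv, K, ?_⟩
  filter_upwards [hK.eventually_nhds] with w hw s k hk
  have : F s k =ᶠ[𝓝 w] fun _ => 0 := by filter_upwards [hw] with w' h using h s k hk
  rw [SuperFn.dz, this.deriv_eq, deriv_const]

theorem SuperFn.AnAt.ops {F : SuperFn} {w : ℂ} (hF : F.AnAt w) :
    SuperFn.AnAt (dThetaP F) w ∧ SuperFn.AnAt (dThetaM F) w ∧
    SuperFn.AnAt (thetaP F) w ∧ SuperFn.AnAt (thetaM F) w := by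
  obtain ⟨h1, K, hK⟩ := hF
  refine ⟨⟨?_, K, ?_⟩, ⟨?_, K, ?_⟩, ⟨?_, K, ?_⟩, ⟨?_, K, ?_⟩⟩
  all_goals first
    | (intro s k
       cases s <;> first | exact h1 _ k | exact analyticAt_const | exact (h1 _ k).neg)
    | (filter_upwards [hK] with w hw s k hk
       cases s <;> first | exact hw _ k hk | rfl | (show -_ = (0 : ℂ); rw [neg_eq_zero]; exact hw _ k hk))

theorem SuperFn.AnAt.DP {F : SuperFn} {w : ℂ} (hF : F.AnAt w) : F.DP.AnAt w :=
  hF.ops.1.add hF.dz.ops.2.2.2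

theorem SuperFn.AnAt.DM {F : SuperFn} {w : ℂ} (hF : F.AnAt w) : F.DM.AnAt w :=
  hF.ops.2.1.add hF.dz.ops.2.2.1

theorem SuperFn.sec_shift {F : SuperFn} {z t : Grassmann} (hz : z ∈ GEven) (hF : F.AnAt (gbody z))
    (ht : t ∈ GEven) (h : t * t = 0) (s : Sector) :
    F.sec s (z + t) = F.sec s z + t * F.dz.sec s z := by
  obtain ⟨K, hK⟩ := hF.2
  have hK' : ∀ᶠ w in 𝓝 (gbody z), ∀ s, ∀ k ∉ K, F.dz s k w = 0 := by
    filter_upwards [hK.eventually_nhds] with w hw s k hk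
    have : F s k =ᶠ[𝓝 w] fun _ => 0 := by filter_upwards [hw] with w' h using h s k hk
    rw [SuperFn.dz, this.deriv_eq, deriv_const]
  rw [SuperFn.sec_eq_sum hz hK, SuperFn.sec_eq_sum hz hK',
    SuperFn.sec_eq_sum (K := K) (add_mem hz ht) (by rw [gbody_add, gbody_of_sq h, add_zero]; exact hK),
    Finset.mul_sum, ← Finset.sum_add_distrib]
  refine Finset.sum_congr rfl fun k _ => ?_
  rw [extend_add_sq _ hz ht h, add_mul, ← even_comm ht, mul_assoc]; rfl

theorem SuperFn.sec_neg {F : SuperFn} {z : Grassmann} (hz : z ∈ GEven) (hF : F.AnAt (gbody z))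
    (s : Sector) : (-F).sec s z = -F.sec s z := by
  have := SuperFn.sec_smul hz hF (-1) s
  rwa [neg_one_smul, neg_one_smul] at this

theorem SuperFn.sec_zero {z : Grassmann} (hz : z ∈ GEven) (s : Sector) :
    (0 : SuperFn).sec s z = 0 := by
  have := SuperFn.sec_smul hz (SuperFn.AnAt.zero _) 0 s
  rwa [zero_smul, zero_smul] at this

/-- `F(z + ηθ⁻, θ⁺ + η, θ⁻) = F + η D⁺F`. -/
theorem SuperFn.eval_shP {F : SuperFn} {p : SPoint} (hF : F.AnAt p.body) (η : GOdd) :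
    F.eval (p.shP η) = F.eval p + η * F.DP.eval p := by
  have hz := p.z_even
  have hF' : F.AnAt (gbody p.z) := hF
  have e := fun s => SuperFn.sec_shift hz hF' (odd_mul_odd η.2 p.tm_odd) (odd_sq_mul η.2 _) s
  have d := fun s => SuperFn.sec_add hz hF'.ops.1 hF'.dz.ops.2.2.2 s
  have d1 : F.DP.sec .one p.z = F.sec .p p.z :=
    (d .one).trans ((congrArg (_ + ·) (SuperFn.sec_zero hz .one)).trans (add_zero _))
  have d2 : F.DP.sec .p p.z = 0 :=
    (d .p).trans ((congrArg₂ (· + ·) (SuperFn.sec_zero hz .p) (SuperFn.sec_zero hz .p)).trans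
      (add_zero _))
  have d3 : F.DP.sec .m p.z = F.sec .pm p.z + F.dz.sec .one p.z := d .m
  have d4 : F.DP.sec .pm p.z = -F.dz.sec .p p.z :=
    (d .pm).trans ((congrArg₂ (· + ·) (SuperFn.sec_zero hz .p) (SuperFn.sec_neg hz hF'.dz .p)).trans
      (zero_add _))
  rw [SuperFn.eval_eq, SuperFn.eval_eq, SuperFn.eval_eq]
  simp only [assemble, SPoint.shP, e, d1, d2, d3, d4]
  -- These relations bring `η` to the right of `θ⁺` and `θ⁻` in every product and delete products
  -- with a repeated odd factor; afterwards the two sides differ only by the order of summation.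
  have a1 : (η : Grassmann) * p.tp = -(p.tp * η) := odd_anticomm η.2 p.tp_odd
  have a2 : (η : Grassmann) * p.tm = -(p.tm * η) := odd_anticomm η.2 p.tm_odd
  have a3 := odd_mul_self p.tm_odd
  have a4 := odd_mul_self η.2
  have a5 := odd_anticomm p.tm_odd p.tp_odd
  have z1 : ∀ x, p.tm * (p.tm * x) = 0 := fun x => by rw [← mul_assoc, a3, zero_mul]
  have z2 : ∀ x, (η : Grassmann) * (η * x) = 0 := fun x => by rw [← mul_assoc, a4, zero_mul]
  have z3 : ∀ x, (η : Grassmann) * (p.tm * x) = -(p.tm * (η * x)) := fun x => by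
    rw [← mul_assoc, a2, neg_mul, mul_assoc]
  have z4 : ∀ x, (η : Grassmann) * (p.tp * x) = -(p.tp * (η * x)) := fun x => by
    rw [← mul_assoc, a1, neg_mul, mul_assoc]
  simp only [mul_add, add_mul, mul_assoc, z3, z4, z1, z2, mul_neg, neg_zero, mul_zero, add_zero, neg_neg]
  abel

/-- `F(z + ηθ⁺, θ⁺, θ⁻ + η) = F + η D⁻F`. -/
theorem SuperFn.eval_shM {F : SuperFn} {p : SPoint} (hF : F.AnAt p.body) (η : GOdd) :
    F.eval (p.shM η) = F.eval p + η * F.DM.eval p := by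
  have hz := p.z_even
  have hF' : F.AnAt (gbody p.z) := hF
  have e := fun s => SuperFn.sec_shift hz hF' (odd_mul_odd η.2 p.tp_odd) (odd_sq_mul η.2 _) s
  have d := fun s => SuperFn.sec_add hz hF'.ops.2.1 hF'.dz.ops.2.2.1 s
  have d1 : F.DM.sec .one p.z = F.sec .m p.z :=
    (d .one).trans ((congrArg (_ + ·) (SuperFn.sec_zero hz .one)).trans (add_zero _))
  have d2 : F.DM.sec .m p.z = 0 :=
    (d .m).trans ((congrArg₂ (· + ·) (SuperFn.sec_zero hz .p) (SuperFn.sec_zero hz .p)).trans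
      (add_zero _))
  have d3 : F.DM.sec .p p.z = -F.sec .pm p.z + F.dz.sec .one p.z :=
    (d .p).trans (congrArg (· + _) (SuperFn.sec_neg hz hF' .pm))
  have d4 : F.DM.sec .pm p.z = F.dz.sec .m p.z :=
    (d .pm).trans ((congrArg (· + _) (SuperFn.sec_zero hz .p)).trans (zero_add _))
  rw [SuperFn.eval_eq, SuperFn.eval_eq, SuperFn.eval_eq]
  simp only [assemble, SPoint.shM, e, d1, d2, d3, d4]
  have a1 : (η : Grassmann) * p.tp = -(p.tp * η) := odd_anticomm η.2 p.tp_odd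
  have a2 : (η : Grassmann) * p.tm = -(p.tm * η) := odd_anticomm η.2 p.tm_odd
  have a3 := odd_mul_self p.tp_odd
  have a4 := odd_mul_self η.2
  have z1 : ∀ x, p.tp * (p.tp * x) = 0 := fun x => by rw [← mul_assoc, a3, zero_mul]
  have z2 : ∀ x, (η : Grassmann) * (η * x) = 0 := fun x => by rw [← mul_assoc, a4, zero_mul]
  have z3 : ∀ x, (η : Grassmann) * (p.tm * x) = -(p.tm * (η * x)) := fun x => by
    rw [← mul_assoc, a2, neg_mul, mul_assoc]
  have z4 : ∀ x, (η : Grassmann) * (p.tp * x) = -(p.tp * (η * x)) := fun x => by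
    rw [← mul_assoc, a1, neg_mul, mul_assoc]
  have z5 : ∀ x, p.tm * (p.tp * x) = -(p.tp * (p.tm * x)) := fun x => by
    rw [← mul_assoc, odd_anticomm p.tm_odd p.tp_odd, neg_mul, mul_assoc]
  simp only [mul_add, add_mul, mul_assoc, z3, z4, z5, z1, z2, mul_neg, neg_zero, mul_zero, add_zero, neg_neg]
  abel

theorem SuperFn.eval_shZ {F : SuperFn} {p : SPoint} (hF : F.AnAt p.body) (t : GEven)
    (ht : (t : Grassmann) * t = 0) : F.eval (p.shZ t) = F.eval p + t * F.dz.eval p := by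
  rw [SuperFn.eval_eq, SuperFn.eval_eq, SuperFn.eval_eq]
  simp only [assemble, SPoint.shZ, fun s => SuperFn.sec_shift p.z_even hF t.2 ht s, mul_add,
    ← mul_assoc, ← even_comm t.2 p.tp, ← even_comm t.2 p.tm, ← even_comm t.2 (p.tp * p.tm)]
  abel

/-- A superanalytic germ that vanishes at all points with body `w` is zero near `w`. -/
theorem SuperFn.eventually_zero_of_vanish {F : SuperFn} {w : ℂ} (hF : F.AnAt w)
    (h : ∀ p : SPoint, p.body = w → F.eval p = 0) :
    ∀ᶠ w' in 𝓝 w, ∀ s k, F s k w' = 0 := by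
  -- Shifts of `z` by even elements of square zero stay in the fibre over `w`, so vanishing on the
  -- fibre passes to the `z`-derivative. Hence all Taylor coefficients at `w` vanish.
  have step : ∀ G : SuperFn, G.AnAt w → (∀ p : SPoint, p.body = w → G.eval p = 0) →
      (∀ s k, G s k w = 0) ∧ ∀ p : SPoint, p.body = w → G.dz.eval p = 0 := by
    intro G hG hv
    constructor
    · have hz : gbody (algebraMap ℂ Grassmann w) = w := gbody_algebraMap w
      have hsec : (fun s => G.sec s (algebraMap ℂ Grassmann w)) = 0 := by
        refine assemble_eq_zero fun η hη η' hη' => ?_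
        exact hv ⟨algebraMap ℂ Grassmann w, η, η', algebraMap_even w, hη, hη'⟩ hz
      intro s k
      obtain ⟨K, hK⟩ := hG.2
      have h1 := congrFun hsec s
      change G.sec s (algebraMap ℂ Grassmann w) = 0 at h1
      rw [SuperFn.sec_eq_sum (algebraMap_even w) (by rw [hz]; exact hK)] at h1
      by_cases hk : k ∈ K
      · have h2 := congrArg (coef k) h1
        simp only [extend_algebraMap, map_sum, ← Algebra.smul_def, map_smul, coef_zeta,
          map_zero, smul_eq_mul, mul_ite, mul_one, mul_zero,
          Finset.sum_ite_eq', hk, if_true] at h2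
        exact h2
      · exact hK.self_of_nhds s k hk
    · intro p hp
      refine odd_cancel fun η hη => odd_cancel fun η' hη' => ?_
      have ht : (η' * η) * (η' * η) = 0 := odd_sq_mul hη' _
      have := SuperFn.eval_shZ (F := G) (p := p) (by rw [hp]; exact hG)
        ⟨η' * η, odd_mul_odd hη' hη⟩ ht
      rw [hv p hp, hv _ (by rw [SPoint.body_shZ _ (gbody_of_sq ht), hp]), zero_add, mul_assoc] at this
      exact this.symm
  have all : ∀ n : ℕ, ∀ G : SuperFn, G.AnAt w → (∀ p : SPoint, p.body = w → G.eval p = 0) →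
      ∀ s k, iteratedDeriv n (G s k) w = 0 := by
    intro n
    induction n with
    | zero => intro G hG hv s k; rw [iteratedDeriv_zero]; exact (step G hG hv).1 s k
    | succ n ih =>
      intro G hG hv s k
      rw [iteratedDeriv_succ']
      exact ih G.dz hG.dz (step G hG hv).2 s k
  have each : ∀ s k, ∀ᶠ w' in 𝓝 w, F s k w' = 0 := by
    intro s k
    have hp := (hF.1 s k).hasFPowerSeriesAt
    have : FormalMultilinearSeries.ofScalars ℂ
        (fun n => iteratedDeriv n (F s k) w / (n.factorial : ℂ)) = 0 := by
      ext n
      simp [FormalMultilinearSeries.ofScalars, all n F hF h s k]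
    rw [this] at hp
    exact hp.eventually_eq_zero
  obtain ⟨K, hK⟩ := hF.2
  have h2 : ∀ᶠ w' in 𝓝 w, ∀ k ∈ K, ∀ s, F s k w' = 0 := by
    rw [Finset.eventually_all]
    intro k _
    filter_upwards [each .one k, each .p k, each .m k, each .pm k] with w' a b c d s
    cases s <;> assumption
  filter_upwards [h2, hK] with w' a b s k
  by_cases hk : k ∈ K
  · exact a k hk s
  · exact b s k hk

/-! ### Superanalytic functions near a body -/

/-- `Φ` is superanalytic near the points with body `w`. -/
def SAn (w : ℂ) (Φ : SPoint → Grassmann) : Prop :=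
  ∃ F : SuperFn, F.AnAt w ∧ ∀ᶠ p in bn w, Φ p = F.eval p

/-- The monomial `θ_s`. -/
def SPoint.mon (p : SPoint) : Sector → Grassmann
  | .one => 1
  | .p => p.tp
  | .m => p.tm
  | .pm => p.tp * p.tm

theorem assemble_eq_mon (p : SPoint) (v : Sector → Grassmann) :
    assemble p.tp p.tm v =
      p.mon .one * v .one + p.mon .p * v .p + p.mon .m * v .m + p.mon .pm * v .pm := by
  simp [assemble, SPoint.mon]

theorem SuperFn.eval_add {F G : SuperFn} {p : SPoint} (hF : F.AnAt p.body) (hG : G.AnAt p.body) :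
    (F + G).eval p = F.eval p + G.eval p := by
  simp only [SuperFn.eval_eq, fun s => SuperFn.sec_add p.z_even hF hG s]
  exact assemble_add _ _ (fun s => F.sec s p.z) (fun s => G.sec s p.z)

theorem SuperFn.eval_smul {F : SuperFn} {p : SPoint} (hF : F.AnAt p.body) (c : ℂ) :
    (c • F).eval p = c • F.eval p := by
  simp only [SuperFn.eval_eq, fun s => SuperFn.sec_smul p.z_even hF c s]
  exact assemble_smul _ _ c (fun s => F.sec s p.z)

theorem SAn.congr {w : ℂ} {Φ Ψ : SPoint → Grassmann} (h : SAn w Φ) (e : ∀ᶠ p in bn w, Ψ p = Φ p) :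
    SAn w Ψ := by
  obtain ⟨F, hF, h⟩ := h
  exact ⟨F, hF, by filter_upwards [h, e] with p a b using b.trans a⟩

theorem SAn.eventually {w : ℂ} {Φ : SPoint → Grassmann} (h : SAn w Φ) :
    ∀ᶠ w' in 𝓝 w, SAn w' Φ := by
  obtain ⟨F, hF, h⟩ := h
  filter_upwards [hF.eventually, eventually_eventually_bn h] with w' a b using ⟨F, a, b⟩

theorem SAn.add {w : ℂ} {Φ Ψ : SPoint → Grassmann} (h : SAn w Φ) (h' : SAn w Ψ) :
    SAn w (fun p => Φ p + Ψ p) := by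
  obtain ⟨F, hF, h⟩ := h
  obtain ⟨G, hG, h'⟩ := h'
  refine ⟨F + G, hF.add hG, ?_⟩
  filter_upwards [h, h', eventually_bn_body hF.eventually, eventually_bn_body hG.eventually]
    with p a b c d
  rw [a, b, SuperFn.eval_add c d]

theorem SAn.smul {w : ℂ} {Φ : SPoint → Grassmann} (h : SAn w Φ) (c : ℂ) :
    SAn w (fun p => c • Φ p) := by
  obtain ⟨F, hF, h⟩ := h
  refine ⟨c • F, hF.smul c, ?_⟩
  filter_upwards [h, eventually_bn_body hF.eventually] with p a b
  rw [a, SuperFn.eval_smul b]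

theorem SAn.zero (w : ℂ) : SAn w (fun _ => 0) := by
  have h := SuperFn.AnAt.zero w
  refine ⟨0, h, ?_⟩
  filter_upwards [eventually_bn_body h.eventually] with p hp
  have := SuperFn.eval_smul hp 0
  rw [zero_smul, zero_smul] at this
  exact this.symm

-- Terms of this shape generate all superanalytic germs under sums, so closure properties need only
-- be verified on them.
open Classical in
theorem SAn.basic {w : ℂ} (s : Sector) {f : ℂ → ℂ} (hf : AnalyticAt ℂ f w) (c : Grassmann) :
    SAn w (fun p => p.mon s * (extend f p.z * c)) := by
  set F : SuperFn := fun s' k => if s' = s then coef k c • f else 0 with hFdef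
  have hK : ∀ w', ∀ s', ∀ k ∉ (zeta.repr c).support, F s' k w' = 0 := by
    intro w' s' k hk
    simp only [hFdef]
    split_ifs
    · simp [coef_support c k hk]
    · rfl
  refine ⟨F, ⟨fun s' k => ?_, (zeta.repr c).support, Eventually.of_forall hK⟩,
    Eventually.of_forall fun p => ?_⟩
  · simp only [hFdef]
    split_ifs
    · exact (analyticAt_const (v := coef k c)).smul hf
    · exact analyticAt_const
  · have key : ∀ s', F.sec s' p.z = if s' = s then extend f p.z * c else 0 := by
      intro s'
      rw [SuperFn.sec_eq_sum p.z_even (Eventually.of_forall hK)]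
      simp only [hFdef]
      split_ifs with h
      · conv_rhs => rw [← sum_coef c (coef_support c), Finset.mul_sum]
        refine Finset.sum_congr rfl fun k _ => ?_
        rw [extend_smul _ _ p.z_even, smul_mul_assoc, mul_smul_comm]
      · refine Finset.sum_eq_zero fun k _ => ?_
        rw [extend_of_eventually_zero (f := 0) p.z_even (Eventually.of_forall fun _ => rfl), zero_mul]
    rw [SuperFn.eval_eq, assemble_eq_mon, key, key, key, key]
    cases s <;> simp

/-- Near `w` only finitely many coefficient functions are non-zero, so a germ is a finite sum of
basic terms, collected sector by sector. -/
theorem SAn.induction' {w : ℂ} {P : (SPoint → Grassmann) → Prop}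
    (congr : ∀ Φ Ψ, SAn w Φ → P Φ → (∀ᶠ p in bn w, Ψ p = Φ p) → P Ψ)
    (zero : P fun _ => 0)
    (add : ∀ Φ Ψ, SAn w Φ → SAn w Ψ → P Φ → P Ψ → P fun p => Φ p + Ψ p)
    (basic : ∀ (s : Sector) (f : ℂ → ℂ) (k : Finset ℕ), AnalyticAt ℂ f w →
      P fun p => p.mon s * (extend f p.z * zeta k))
    (Φ : SPoint → Grassmann) (h : SAn w Φ) : P Φ := by
  obtain ⟨F, hF, h⟩ := h
  obtain ⟨K, hK⟩ := hF.2
  have hsum : ∀ (s : Sector) (L : Finset (Finset ℕ)),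
      SAn w (fun p => ∑ k ∈ L, p.mon s * (extend (F s k) p.z * zeta k)) ∧
      P (fun p => ∑ k ∈ L, p.mon s * (extend (F s k) p.z * zeta k)) := by
    intro s L
    induction L using Finset.induction with
    | empty => simp only [Finset.sum_empty]; exact ⟨SAn.zero w, zero⟩
    | insert a L ha ih =>
      simp only [Finset.sum_insert ha]
      exact ⟨(SAn.basic s (hF.1 s a) _).add ih.1,
        add _ _ (SAn.basic s (hF.1 s a) _) ih.1 (basic s _ a (hF.1 s a)) ih.2⟩
  have h1 := hsum .one K
  have h2 := hsum .p K
  have h3 := hsum .m K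
  have h4 := hsum .pm K
  refine congr _ Φ (((h1.1.add h2.1).add h3.1).add h4.1) (add _ _ ((h1.1.add h2.1).add h3.1) h4.1
    (add _ _ (h1.1.add h2.1) h3.1 (add _ _ h1.1 h2.1 h1.2 h2.2) h3.2) h4.2) ?_
  filter_upwards [h, eventually_bn_body hK.eventually_nhds] with p hp hp'
  rw [hp, SuperFn.eval_eq, assemble_eq_mon]
  simp only [fun s => SuperFn.sec_eq_sum p.z_even hp' s, Finset.mul_sum]

@[elab_as_elim]
theorem SAn.induction {w : ℂ} {P : ∀ Φ, SAn w Φ → Prop}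
    (congr : ∀ Φ Ψ (h : SAn w Φ), P Φ h → ∀ e : ∀ᶠ p in bn w, Ψ p = Φ p, P Ψ (h.congr e))
    (zero : P (fun _ => 0) (SAn.zero w))
    (add : ∀ Φ Ψ (h : SAn w Φ) (h' : SAn w Ψ), P Φ h → P Ψ h' →
      P (fun p => Φ p + Ψ p) (h.add h'))
    (basic : ∀ (s : Sector) (f : ℂ → ℂ) (k : Finset ℕ) (hf : AnalyticAt ℂ f w),
      P (fun p => p.mon s * (extend f p.z * zeta k)) (SAn.basic s hf _))
    (Φ : SPoint → Grassmann) (h : SAn w Φ) : P Φ h := by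
  have : ∃ h, P Φ h := SAn.induction' (P := fun Φ => ∃ h, P Φ h)
    (fun Φ Ψ _ ⟨h, hP⟩ e => ⟨_, congr Φ Ψ h hP e⟩) ⟨_, zero⟩
    (fun Φ Ψ _ _ ⟨h, hP⟩ ⟨h', hP'⟩ => ⟨_, add Φ Ψ h h' hP hP'⟩)
    (fun s f k hf => ⟨_, basic s f k hf⟩) Φ h
  exact this.2

theorem SAn.const_mul {w : ℂ} {Φ : SPoint → Grassmann} (h : SAn w Φ) (c : Grassmann) :
    SAn w (fun p => c * Φ p) := by
  induction Φ, h using SAn.induction with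
  | congr Φ Ψ _ h e =>
    exact SAn.congr h (by filter_upwards [e] with p hp; rw [hp])
  | zero => simpa using SAn.zero w
  | add Φ Ψ _ _ h h' => simpa only [mul_add] using h.add h'
  | basic s f k hf =>
    have key : ∀ p : SPoint, c * (p.mon s * (extend f p.z * zeta k)) = p.mon s * (extend f p.z *
        ((match s with | .one => c | .p => parity c | .m => parity c | .pm => c) * zeta k)) := by
      intro p
      have he := extend_even f p.z_even
      cases s
      · simp only [SPoint.mon, one_mul]
        rw [← mul_assoc, ← even_comm he, mul_assoc]
      · simp only [SPoint.mon]
        rw [← mul_assoc, ← parity_parity c, ← odd_mul_comm p.tp_odd, parity_parity, mul_assoc,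
          ← mul_assoc (parity c), ← even_comm he, mul_assoc]
      · simp only [SPoint.mon]
        rw [← mul_assoc, ← parity_parity c, ← odd_mul_comm p.tm_odd, parity_parity, mul_assoc,
          ← mul_assoc (parity c), ← even_comm he, mul_assoc]
      · simp only [SPoint.mon]
        rw [← mul_assoc c, ← even_comm (odd_mul_odd p.tp_odd p.tm_odd), mul_assoc (p.tp * p.tm),
          ← mul_assoc c, ← even_comm he, mul_assoc (extend f p.z)]
    simp only [key]
    exact SAn.basic s hf _

theorem SAn.neg {w : ℂ} {Φ : SPoint → Grassmann} (h : SAn w Φ) : SAn w (fun p => -Φ p) := by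
  simpa using h.smul (-1)

theorem SAn.tp_mul {w : ℂ} {Φ : SPoint → Grassmann} (h : SAn w Φ) :
    SAn w (fun p => p.tp * Φ p) := by
  induction Φ, h using SAn.induction with
  | congr Φ Ψ _ h e =>
    exact SAn.congr h (by filter_upwards [e] with p hp; rw [hp])
  | zero => simpa using SAn.zero w
  | add Φ Ψ _ _ h h' => simpa only [mul_add] using h.add h'
  | basic s f k hf =>
    cases s
    · simpa [SPoint.mon] using SAn.basic .p hf (zeta k)
    · refine (SAn.zero w).congr (Eventually.of_forall fun p => ?_)
      simp only [SPoint.mon]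
      rw [← mul_assoc, odd_mul_self p.tp_odd, zero_mul]
    · simpa [SPoint.mon, mul_assoc] using SAn.basic .pm hf (zeta k)
    · refine (SAn.zero w).congr (Eventually.of_forall fun p => ?_)
      simp only [SPoint.mon]
      rw [← mul_assoc, ← mul_assoc p.tp p.tp, odd_mul_self p.tp_odd, zero_mul, zero_mul]

theorem SAn.tm_mul {w : ℂ} {Φ : SPoint → Grassmann} (h : SAn w Φ) :
    SAn w (fun p => p.tm * Φ p) := by
  induction Φ, h using SAn.induction with
  | congr Φ Ψ _ h e =>
    exact SAn.congr h (by filter_upwards [e] with p hp; rw [hp])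
  | zero => simpa using SAn.zero w
  | add Φ Ψ _ _ h h' => simpa only [mul_add] using h.add h'
  | basic s f k hf =>
    cases s
    · simpa [SPoint.mon] using SAn.basic .m hf (zeta k)
    · refine (SAn.basic .pm hf (zeta k)).neg.congr (Eventually.of_forall fun p => ?_)
      simp only [SPoint.mon]
      rw [← mul_assoc, odd_anticomm p.tm_odd p.tp_odd, neg_mul]
    · refine (SAn.zero w).congr (Eventually.of_forall fun p => ?_)
      simp only [SPoint.mon]
      rw [← mul_assoc, odd_mul_self p.tm_odd, zero_mul]
    · refine (SAn.zero w).congr (Eventually.of_forall fun p => ?_)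
      simp only [SPoint.mon]
      rw [← mul_assoc, odd_mul_mul_self p.tm_odd, zero_mul]

theorem SAn.extend_mul {w : ℂ} {Φ : SPoint → Grassmann} (h : SAn w Φ) {g : ℂ → ℂ}
    (hg : AnalyticAt ℂ g w) : SAn w (fun p => extend g p.z * Φ p) := by
  induction Φ, h using SAn.induction with
  | congr Φ Ψ _ h e =>
    exact SAn.congr h (by filter_upwards [e] with p hp; rw [hp])
  | zero => simpa using SAn.zero w
  | add Φ Ψ _ _ h h' => simpa only [mul_add] using h.add h'
  | basic s f k hf =>
    refine (SAn.basic s (hg.mul hf) (zeta k)).congr ?_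
    filter_upwards [eventually_bn_body hf.eventually_analyticAt,
      eventually_bn_body hg.eventually_analyticAt] with p a b
    rw [N2Sphere.extend_mul p.z_even b a, ← mul_assoc, even_comm (extend_even g p.z_even), mul_assoc,
      ← mul_assoc (extend g p.z)]

theorem SAn.mul {w : ℂ} {Φ Ψ : SPoint → Grassmann} (h : SAn w Φ) (h' : SAn w Ψ) :
    SAn w (fun p => Φ p * Ψ p) := by
  induction Φ, h using SAn.induction with
  | congr Φ Φ' _ h e =>
    exact SAn.congr h (by filter_upwards [e] with p hp; rw [hp])
  | zero => simpa using SAn.zero w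
  | add Φ Φ' _ _ h h' => simpa only [add_mul] using h.add h'
  | basic s f k hf =>
    have h1 := (h'.const_mul (zeta k)).extend_mul hf
    cases s
    · simpa [SPoint.mon, mul_assoc] using h1
    · simpa [SPoint.mon, mul_assoc] using h1.tp_mul
    · simpa [SPoint.mon, mul_assoc] using h1.tm_mul
    · simpa [SPoint.mon, mul_assoc] using h1.tm_mul.tp_mul

theorem SAn.sub {w : ℂ} {Φ Ψ : SPoint → Grassmann} (h : SAn w Φ) (h' : SAn w Ψ) :
    SAn w (fun p => Φ p - Ψ p) := by
  simpa only [sub_eq_add_neg] using h.add h'.neg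

theorem SAn.extend_z {w : ℂ} {f : ℂ → ℂ} (hf : AnalyticAt ℂ f w) :
    SAn w (fun p => extend f p.z) := by
  simpa [SPoint.mon] using SAn.basic .one hf 1

theorem SAn.const (w : ℂ) (c : Grassmann) : SAn w (fun _ => c) := by
  refine (SAn.basic .one (f := fun _ => 1) analyticAt_const c).congr
    (Eventually.of_forall fun p => ?_)
  simp [SPoint.mon, extend_const _ p.z_even]

theorem SAn.z (w : ℂ) : SAn w (fun p => p.z) :=
  (SAn.extend_z (f := fun w => w) analyticAt_id).congr
    (Eventually.of_forall fun p => (extend_id p.z_even).symm)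

theorem SAn.tp (w : ℂ) : SAn w (fun p => p.tp) := by simpa using (SAn.const w 1).tp_mul

theorem SAn.tm (w : ℂ) : SAn w (fun p => p.tm) := by simpa using (SAn.const w 1).tm_mul

theorem zeta_sq {k : Finset ℕ} (hk : k ≠ ∅) : zeta k * zeta k = 0 := by
  obtain ⟨l, hl, h⟩ := zeta_eq_prod k
  match l, hl, h with
  | [], hl, _ => exact absurd (Finset.card_eq_zero.1 hl.symm) hk
  | v :: l, _, h =>
    rw [h, List.map_cons, List.prod_cons]
    exact odd_sq_mul (CliffordAlgebra.ι_mem_evenOdd_one _ v) _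

/-- The even part of a superanalytic function is the sum of an extension of a function of the body
and of finitely many even functions of square zero. -/
theorem SAn.even_decomp {w : ℂ} {Φ : SPoint → Grassmann} (h : SAn w Φ) :
    ∃ f : ℂ → ℂ, AnalyticAt ℂ f w ∧ ∃ l : List (SPoint → Grassmann),
      (∀ t ∈ l, SAn w t ∧ ∀ p, t p ∈ GEven ∧ t p * t p = 0) ∧
      ∀ᶠ p in bn w, evenPart (Φ p) = extend f p.z + (l.map fun t => t p).sum := by
  induction Φ, h using SAn.induction with
  | congr Φ Φ' _ h e =>
    obtain ⟨f, hf, l, hl, h⟩ := h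
    exact ⟨f, hf, l, hl, by filter_upwards [h, e] with p a b; rw [b, a]⟩
  | zero =>
    refine ⟨fun _ => 0, analyticAt_const, [], by simp, Eventually.of_forall fun p => ?_⟩
    simp [extend_const _ p.z_even]
  | add Φ Ψ _ _ h h' =>
    obtain ⟨f, hf, l, hl, h⟩ := h
    obtain ⟨f', hf', l', hl', h'⟩ := h'
    refine ⟨f + f', hf.add hf', l ++ l', ?_, ?_⟩
    · intro t ht
      rcases List.mem_append.1 ht with ht | ht
      · exact hl t ht
      · exact hl' t ht
    · filter_upwards [h, h', eventually_bn_body hf.eventually_analyticAt,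
        eventually_bn_body hf'.eventually_analyticAt] with p a b c d
      rw [map_add, a, b, N2Sphere.extend_add p.z_even c d]
      simp only [List.map_append, List.sum_append]
      abel
  | basic s f k hf =>
    have hz : ∀ p : SPoint, extend (fun _ => (0 : ℂ)) p.z = 0 := fun p => by
      rw [extend_const _ p.z_even, map_zero]
    have hodd : ∀ t : SPoint → Grassmann, (∀ p, t p ∈ GOdd) →
        ∃ f : ℂ → ℂ, AnalyticAt ℂ f w ∧ ∃ l : List (SPoint → Grassmann),
        (∀ t ∈ l, SAn w t ∧ ∀ p, t p ∈ GEven ∧ t p * t p = 0) ∧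
        ∀ᶠ p in bn w, evenPart (t p) = extend f p.z + (l.map fun t => t p).sum := fun t ht =>
      ⟨fun _ => 0, analyticAt_const, [], by simp, Eventually.of_forall fun p => by
        rw [evenPart_of_odd (ht p), hz]; simp⟩
    have heven : ∀ t : SPoint → Grassmann, SAn w t → (∀ p, t p ∈ GEven ∧ t p * t p = 0) →
        ∃ f : ℂ → ℂ, AnalyticAt ℂ f w ∧ ∃ l : List (SPoint → Grassmann),
        (∀ t ∈ l, SAn w t ∧ ∀ p, t p ∈ GEven ∧ t p * t p = 0) ∧
        ∀ᶠ p in bn w, evenPart (t p) = extend f p.z + (l.map fun t => t p).sum := fun t hS ht =>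
      ⟨fun _ => 0, analyticAt_const, [t], by simpa using ⟨hS, ht⟩, Eventually.of_forall fun p => by
        rw [evenPart_of_even (ht p).1, hz]; simp⟩
    have hS := SAn.basic s hf (zeta k)
    have he := fun p : SPoint => extend_even f p.z_even
    -- The only even basic term whose square can be non-zero is the one without generators and odd
    -- variables; it supplies `f`. Other even terms contain an odd factor twice in their square or
    -- the square of a non-trivial monomial, and odd terms have no even part.
    rcases Nat.even_or_odd k.card with hk | hk
    · have hk' := fun p => even_mul_even (he p) (zeta_even hk)
      cases s
      · by_cases hk0 : k = ∅
        · refine ⟨f, hf, [], by simp, Eventually.of_forall fun p => ?_⟩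
          subst hk0
          simp only [SPoint.mon, one_mul, zeta_empty, mul_one, evenPart_of_even (he p)]
          simp
        · refine heven _ hS fun p => ?_
          simp only [SPoint.mon, one_mul]
          refine ⟨hk' p, ?_⟩
          rw [mul_assoc, ← mul_assoc (zeta k), even_comm (zeta_even hk), mul_assoc (extend f p.z) (zeta k),
            zeta_sq hk0, mul_zero, mul_zero]
      · exact hodd _ fun p => odd_mul_even p.tp_odd (hk' p)
      · exact hodd _ fun p => odd_mul_even p.tm_odd (hk' p)
      · refine heven _ hS fun p => ⟨even_mul_even (odd_mul_odd p.tp_odd p.tm_odd) (hk' p), ?_⟩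
        have := odd_sq_mul p.tp_odd (p.tm * (extend f p.z * zeta k))
        simpa only [SPoint.mon, mul_assoc] using this
    · have hk' := fun p => even_mul_odd (he p) (zeta_odd hk)
      cases s
      · exact hodd _ fun p => by simpa [SPoint.mon] using hk' p
      · exact heven _ hS fun p => ⟨odd_mul_odd p.tp_odd (hk' p), odd_sq_mul p.tp_odd _⟩
      · exact heven _ hS fun p => ⟨odd_mul_odd p.tm_odd (hk' p), odd_sq_mul p.tm_odd _⟩
      · exact hodd _ fun p => even_mul_odd (odd_mul_odd p.tp_odd p.tm_odd) (hk' p)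

theorem gbody_evenPart (x : Grassmann) : gbody (evenPart x) = gbody x := by
  have h := gbody_odd (sub_evenPart_mem x)
  rw [gbody_sub, sub_eq_zero] at h
  exact h.symm

theorem even_list_sum {l : List (SPoint → Grassmann)} {w : ℂ}
    (hl : ∀ t ∈ l, SAn w t ∧ ∀ p, t p ∈ GEven ∧ t p * t p = 0) (p : SPoint) :
    (l.map fun t => t p).sum ∈ GEven ∧ gbody (l.map fun t => t p).sum = 0 := by
  induction l with
  | nil => simp
  | cons t l ih =>
    have h1 := ih fun t ht => hl t (List.mem_cons_of_mem _ ht)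
    have h2 := (hl t List.mem_cons_self).2 p
    simp only [List.map_cons, List.sum_cons, gbody_add, h1.2, gbody_of_sq h2.2, add_zero, and_true]
    exact add_mem h2.1 h1.1

/-- The body of a superanalytic function is an analytic function of the body. -/
theorem SAn.body {w : ℂ} {Φ : SPoint → Grassmann} (h : SAn w Φ) :
    ∃ f : ℂ → ℂ, AnalyticAt ℂ f w ∧ ∀ᶠ p in bn w, gbody (Φ p) = f p.body := by
  obtain ⟨f, hf, l, hl, h⟩ := h.even_decomp
  refine ⟨f, hf, ?_⟩
  filter_upwards [h] with p hp
  rw [← gbody_evenPart, hp, gbody_add, (even_list_sum hl p).2, add_zero, gbody_extend _ p.z_even]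
  rfl

/-- The extension of an analytic function composed with an even superanalytic function. -/
theorem SAn.extend_comp {w : ℂ} {Φ : SPoint → Grassmann} (h : SAn w Φ)
    (he : ∀ᶠ p in bn w, Φ p ∈ GEven) {b : ℂ} (hb : ∀ p : SPoint, p.body = w → gbody (Φ p) = b)
    {g : ℂ → ℂ} (hg : AnalyticAt ℂ g b) : SAn w (fun p => extend g (Φ p)) := by
  obtain ⟨f, hf, l, hl, h⟩ := h.even_decomp
  have hfb : f w = b := by
    have h1 := of_eventually_bn h (SPoint.body_ofBody w)
    have h2 := congrArg gbody h1
    rw [gbody_evenPart, hb _ (SPoint.body_ofBody w), gbody_add, (even_list_sum hl _).2, add_zero,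
      gbody_extend _ (SPoint.z_even _)] at h2
    rw [h2]; congr 1; exact (SPoint.body_ofBody w).symm
  suffices H : SAn w fun p => extend g (extend f p.z + (l.map fun t => t p).sum) by
    refine H.congr ?_
    filter_upwards [h, he] with p a b
    rw [← a, evenPart_of_even b]
  clear h he
  -- The square-zero summands are added one at a time by `g(z + t) = g(z) + g'(z) t`, starting from
  -- the ordinary composition of `g` with `f`.
  induction l generalizing g with
  | nil =>
    refine (SAn.extend_z (f := fun w => g (f w)) (hg.comp_of_eq hf hfb)).congr ?_
    have hg' : ∀ᶠ w' in 𝓝 w, AnalyticAt ℂ g (f w') :=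
      hf.continuousAt.eventually (by rw [hfb]; exact hg.eventually_analyticAt)
    filter_upwards [eventually_bn_body hf.eventually_analyticAt, eventually_bn_body hg'] with p a c
    simp only [List.map_nil, List.sum_nil, add_zero]
    exact (N2Sphere.extend_comp p.z_even a c).symm
  | cons t l ih =>
    have hl' := fun t ht => hl t (List.mem_cons_of_mem _ ht)
    have ht := hl t List.mem_cons_self
    refine ((ih hg hl').add ((ih hg.deriv hl').mul ht.1)).congr (Eventually.of_forall fun p => ?_)
    rw [← extend_add_sq g (add_mem (extend_even f p.z_even) (even_list_sum hl' p).1) (ht.2 p).1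
      (ht.2 p).2]
    simp only [List.map_cons, List.sum_cons]
    congr 1
    abel

/-! ### Superanalytic maps -/

/-- The components of `H` are superanalytic near the points with body `w`. -/
def SAnMap (w : ℂ) (H : SPoint → SPoint) : Prop :=
  SAn w (fun p => (H p).z) ∧ SAn w (fun p => (H p).tp) ∧ SAn w (fun p => (H p).tm)

theorem SAnMap.body {w : ℂ} {H : SPoint → SPoint} (h : SAnMap w H) :
    ∃ f : ℂ → ℂ, AnalyticAt ℂ f w ∧ ∀ᶠ p in bn w, (H p).body = f p.body := h.1.body

theorem SAnMap.tendsto {w w' : ℂ} {H : SPoint → SPoint} (h : SAnMap w H) {p : SPoint}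
    (hp : p.body = w) (hp' : (H p).body = w') : Tendsto H (bn w) (bn w') := by
  obtain ⟨f, hf, h⟩ := h.body
  have : f w = w' := by rw [← hp', of_eventually_bn h hp, hp]
  refine tendsto_comap_iff.2 (Tendsto.congr' (f₁ := fun p => f p.body) ?_ ?_)
  · filter_upwards [h] with p hp using hp.symm
  · rw [← this]
    exact hf.continuousAt.tendsto.comp tendsto_comap

theorem SAnMap.body_eq {w : ℂ} {H : SPoint → SPoint} (h : SAnMap w H) {p q : SPoint}
    (hp : p.body = w) (hq : q.body = w) : (H p).body = (H q).body := by
  obtain ⟨f, hf, h⟩ := h.body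
  rw [of_eventually_bn h hp, of_eventually_bn h hq, hp, hq]

theorem SAn.comp {w w' : ℂ} {Φ : SPoint → Grassmann} {H : SPoint → SPoint} (h : SAn w' Φ)
    (hH : SAnMap w H) {p : SPoint} (hp : p.body = w) (hp' : (H p).body = w') :
    SAn w (fun p => Φ (H p)) := by
  induction Φ, h using SAn.induction with
  | congr Φ Φ' _ h e => exact h.congr ((hH.tendsto hp hp').eventually e)
  | zero => exact SAn.zero w
  | add Φ Φ' _ _ h h' => exact h.add h'
  | basic s f k hf =>
    have h1 : SAn w fun p => extend f (H p).z * zeta k :=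
      (SAn.extend_comp hH.1 (Eventually.of_forall fun p => (H p).z_even)
        (fun q hq => (hH.body_eq hq hp).trans hp') hf).mul (SAn.const w _)
    cases s
    · simpa [SPoint.mon] using h1
    · exact hH.2.1.mul h1
    · exact hH.2.2.mul h1
    · exact (hH.2.1.mul hH.2.2).mul h1

theorem SAnMap.comp {w w' : ℂ} {G H : SPoint → SPoint} (hG : SAnMap w' G)
    (hH : SAnMap w H) {p : SPoint} (hp : p.body = w) (hp' : (H p).body = w') :
    SAnMap w (fun p => G (H p)) :=
  ⟨hG.1.comp hH hp hp', hG.2.1.comp hH hp hp', hG.2.2.comp hH hp hp'⟩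

theorem SAnMap.congr {w : ℂ} {G H : SPoint → SPoint} (hH : SAnMap w H)
    (e : ∀ᶠ p in bn w, G p = H p) : SAnMap w G :=
  ⟨hH.1.congr (by filter_upwards [e] with p h; rw [h]),
    hH.2.1.congr (by filter_upwards [e] with p h; rw [h]),
    hH.2.2.congr (by filter_upwards [e] with p h; rw [h])⟩

theorem SAnMap.eventually {w : ℂ} {H : SPoint → SPoint} (hH : SAnMap w H) :
    ∀ᶠ w' in 𝓝 w, SAnMap w' H := by
  filter_upwards [hH.1.eventually, hH.2.1.eventually, hH.2.2.eventually] with w' a b c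
    using ⟨a, b, c⟩

/-- A superanalytic function that vanishes at the points with body `w` vanishes near them. -/
theorem SAn.eventually_zero {w : ℂ} {Φ : SPoint → Grassmann} (h : SAn w Φ)
    (h0 : ∀ p : SPoint, p.body = w → Φ p = 0) : ∀ᶠ p in bn w, Φ p = 0 := by
  obtain ⟨F, hF, h⟩ := h
  have h1 := SuperFn.eventually_zero_of_vanish hF fun p hp => by rw [← of_eventually_bn h hp, h0 p hp]
  filter_upwards [h, eventually_bn_body h1.eventually_nhds] with p hp hp'
  rw [hp, SuperFn.eval_eq]
  have : ∀ s, F.sec s p.z = 0 := fun s => by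
    rw [SuperFn.sec_eq_sum (K := ∅) p.z_even (by filter_upwards [hp'] with w h s k _ using h s k)]
    simp
  simp [this, assemble]

theorem eventually_bn_shP {w : ℂ} {Q : SPoint → Prop} (h : ∀ᶠ p in bn w, Q p) :
    ∀ᶠ p in bn w, ∀ η, Q (p.shP η) := by
  rw [eventually_bn] at h ⊢
  filter_upwards [h] with w' hw p hp η using hw _ (by rw [p.body_shP, hp])

theorem eventually_bn_shM {w : ℂ} {Q : SPoint → Prop} (h : ∀ᶠ p in bn w, Q p) :
    ∀ᶠ p in bn w, ∀ η, Q (p.shM η) := by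
  rw [eventually_bn] at h ⊢
  filter_upwards [h] with w' hw p hp η using hw _ (by rw [p.body_shM, hp])

theorem SAn.exists_DP {w : ℂ} {Φ : SPoint → Grassmann} (h : SAn w Φ) :
    ∃ Φ', SAn w Φ' ∧ ∀ᶠ p in bn w, ∀ η : GOdd, Φ (p.shP η) = Φ p + η * Φ' p := by
  obtain ⟨F, hF, h⟩ := h
  refine ⟨F.DP.eval, ⟨F.DP, hF.DP, Eventually.of_forall fun _ => rfl⟩, ?_⟩
  filter_upwards [h, eventually_bn_shP h, eventually_bn_body hF.eventually] with p a b c η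
  rw [a, b, SuperFn.eval_shP c]

theorem SAn.exists_DM {w : ℂ} {Φ : SPoint → Grassmann} (h : SAn w Φ) :
    ∃ Φ', SAn w Φ' ∧ ∀ᶠ p in bn w, ∀ η : GOdd, Φ (p.shM η) = Φ p + η * Φ' p := by
  obtain ⟨F, hF, h⟩ := h
  refine ⟨F.DM.eval, ⟨F.DM, hF.DM, Eventually.of_forall fun _ => rfl⟩, ?_⟩
  filter_upwards [h, eventually_bn_shM h, eventually_bn_body hF.eventually] with p a b c η
  rw [a, b, SuperFn.eval_shM c]

/-! ### Superconformal maps, intrinsically -/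

/-- The product of an odd and an even element. -/
def oddSMul (η : GOdd) (c : GEven) : GOdd := ⟨η * c, odd_mul_even η.2 c.2⟩

@[simp] theorem coe_oddSMul (η : GOdd) (c : GEven) : (oddSMul η c : Grassmann) = η * c := rfl

/-- `H` intertwines the shifts along `D⁺` at `p`, with the factor `c`. -/
def RelP (H : SPoint → SPoint) (p : SPoint) (c : GEven) : Prop :=
  ∀ η : GOdd, H (p.shP η) = (H p).shP (oddSMul η c)

/-- `H` intertwines the shifts along `D⁻` at `p`, with the factor `c`. -/
def RelM (H : SPoint → SPoint) (p : SPoint) (c : GEven) : Prop :=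
  ∀ η : GOdd, H (p.shM η) = (H p).shM (oddSMul η c)

/-- Superanalytic and superconformal near the points with body `w`, with possibly degenerate
derivative. -/
def WConfAt (w : ℂ) (H : SPoint → SPoint) : Prop :=
  SAnMap w H ∧ ∀ᶠ p in bn w, (∃ c, RelP H p c) ∧ ∃ c, RelM H p c

/-- Superanalytic and superconformal near the points with body `w`, with invertible derivative. -/
def SConfAt (w : ℂ) (H : SPoint → SPoint) : Prop :=
  SAnMap w H ∧ ∀ᶠ p in bn w,
    (∃ c : GEven, gbody c ≠ 0 ∧ RelP H p c) ∧ ∃ c : GEven, gbody c ≠ 0 ∧ RelM H p c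

theorem SConfAt.weak {w : ℂ} {H : SPoint → SPoint} (h : SConfAt w H) : WConfAt w H :=
  ⟨h.1, by filter_upwards [h.2] with p ⟨⟨c, _, hc⟩, ⟨d, _, hd⟩⟩ using ⟨⟨c, hc⟩, ⟨d, hd⟩⟩⟩

theorem SConfAt.eventually {w : ℂ} {H : SPoint → SPoint} (h : SConfAt w H) :
    ∀ᶠ w' in 𝓝 w, SConfAt w' H := by
  filter_upwards [h.1.eventually, eventually_eventually_bn h.2] with w' a b using ⟨a, b⟩

theorem RelP.congr {H G : SPoint → SPoint} {p : SPoint} {c : GEven} (h : RelP H p c)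
    (e : G p = H p) (e' : ∀ η, G (p.shP η) = H (p.shP η)) : RelP G p c := fun η => by
  rw [e', e, h η]

theorem RelM.congr {H G : SPoint → SPoint} {p : SPoint} {c : GEven} (h : RelM H p c)
    (e : G p = H p) (e' : ∀ η, G (p.shM η) = H (p.shM η)) : RelM G p c := fun η => by
  rw [e', e, h η]

theorem SConfAt.congr {w : ℂ} {H G : SPoint → SPoint} (h : SConfAt w H)
    (e : ∀ᶠ p in bn w, G p = H p) : SConfAt w G := by
  refine ⟨h.1.congr e, ?_⟩
  filter_upwards [h.2, e, eventually_bn_shP e, eventually_bn_shM e]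
    with p ⟨⟨c, hc, hc'⟩, ⟨d, hd, hd'⟩⟩ a a1 a2
    using ⟨⟨c, hc, hc'.congr a a1⟩, ⟨d, hd, hd'.congr a a2⟩⟩

/-- In this formulation the chain rule is two applications of the intertwining relation: the factors
multiply. -/
theorem RelP.comp {H G : SPoint → SPoint} {p : SPoint} {c d : GEven} (h : RelP H p c)
    (h' : RelP G (H p) d) : RelP (fun p => G (H p)) p (c * d) := fun η => by
  simp only [h η, h' _]
  congr 1
  ext
  simp [mul_assoc]

theorem RelM.comp {H G : SPoint → SPoint} {p : SPoint} {c d : GEven} (h : RelM H p c)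
    (h' : RelM G (H p) d) : RelM (fun p => G (H p)) p (c * d) := fun η => by
  simp only [h η, h' _]
  congr 1
  ext
  simp [mul_assoc]

theorem SConfAt.comp {w w' : ℂ} {G H : SPoint → SPoint} (hG : SConfAt w' G) (hH : SConfAt w H)
    {p : SPoint} (hp : p.body = w) (hp' : (H p).body = w') : SConfAt w (fun p => G (H p)) := by
  refine ⟨hG.1.comp hH.1 hp hp', ?_⟩
  filter_upwards [hH.2, (hH.1.tendsto hp hp').eventually hG.2]
    with p ⟨⟨c, hc, hc'⟩, ⟨d, hd, hd'⟩⟩ ⟨⟨e, he, he'⟩, ⟨f, hf, hf'⟩⟩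
  refine ⟨⟨c * e, ?_, hc'.comp he'⟩, ⟨d * f, ?_, hd'.comp hf'⟩⟩
  · simpa using ⟨hc, he⟩
  · simpa using ⟨hd, hf⟩

theorem shP_inj {p : SPoint} {η η' : GOdd} (h : p.shP η = p.shP η') : η = η' := by
  have := congrArg SPoint.tp h
  simpa [SPoint.shP] using this

theorem shM_inj {p : SPoint} {η η' : GOdd} (h : p.shM η = p.shM η') : η = η' := by
  have := congrArg SPoint.tm h
  simpa [SPoint.shM] using this

theorem relP_one_unique {p : SPoint} {c : GEven} (h : RelP (fun p => p) p c) : c = 1 := by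
  ext
  refine odd_cancel' fun η hη => ?_
  have := congrArg Subtype.val (shP_inj (h ⟨η, hη⟩))
  simpa using this.symm

theorem relM_one_unique {p : SPoint} {c : GEven} (h : RelM (fun p => p) p c) : c = 1 := by
  ext
  refine odd_cancel' fun η hη => ?_
  have := congrArg Subtype.val (shM_inj (h ⟨η, hη⟩))
  simpa using this.symm

theorem body_ne_zero_of_mul_eq_one {c d : GEven} (h : c * d = 1) : gbody c ≠ 0 := by
  intro hc
  have := congrArg (fun x : GEven => gbody x) h
  simp [hc] at this

/-- A superconformal map with superconformal inverse has invertible derivative. -/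
theorem WConfAt.sconfAt {w w' : ℂ} {G H : SPoint → SPoint} (hH : WConfAt w H) (hG : WConfAt w' G)
    {p : SPoint} (hp : p.body = w) (hp' : (H p).body = w') (e : ∀ᶠ p in bn w, G (H p) = p) :
    SConfAt w H := by
  refine ⟨hH.1, ?_⟩
  filter_upwards [hH.2, (hH.1.tendsto hp hp').eventually hG.2, e, eventually_bn_shP e,
    eventually_bn_shM e] with p ⟨⟨c, hc⟩, ⟨d, hd⟩⟩ ⟨⟨c', hc'⟩, ⟨d', hd'⟩⟩ a a1 a2
  -- The factors of `H` and `G` multiply to a factor of the identity, which is `1` by odd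
  -- cancellation. Bijectivity thus yields invertible derivatives.
  have h1 : c * c' = 1 := relP_one_unique ((hc.comp hc').congr a.symm fun η => (a1 η).symm)
  have h2 : d * d' = 1 := relM_one_unique ((hd.comp hd').congr a.symm fun η => (a2 η).symm)
  exact ⟨⟨c, body_ne_zero_of_mul_eq_one h1, hc⟩, ⟨d, body_ne_zero_of_mul_eq_one h2, hd⟩⟩

/-- The inverse of an even element with non-zero body. -/
theorem exists_even_inv {c : GEven} (h : gbody c ≠ 0) : ∃ d : GEven, d * c = 1 ∧ c * d = 1 :=
  ⟨⟨_, extend_even (fun w => w⁻¹) c.2⟩, Subtype.ext (exists_inverse c.2 h).1,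
    Subtype.ext (exists_inverse c.2 h).2⟩

/-- A superanalytic inverse of a superconformal map is superconformal. -/
theorem SConfAt.inverse {w w' : ℂ} {G H : SPoint → SPoint} (hH : SConfAt w H) (hG : SAnMap w' G)
    {q : SPoint} (hq : q.body = w') (hq' : (G q).body = w) (e : ∀ᶠ p in bn w, G (H p) = p)
    (e' : ∀ᶠ q in bn w', H (G q) = q) : SConfAt w' G := by
  refine ⟨hG, ?_⟩
  have t := hG.tendsto hq hq'
  filter_upwards [t.eventually hH.2, t.eventually e, t.eventually (eventually_bn_shP e),
    t.eventually (eventually_bn_shM e), e']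
    with q ⟨⟨c, hc, hc'⟩, ⟨d, hd, hd'⟩⟩ a a1 a2 a3
  obtain ⟨ci, h1, h2⟩ := exists_even_inv hc
  obtain ⟨di, h3, h4⟩ := exists_even_inv hd
  refine ⟨⟨ci, body_ne_zero_of_mul_eq_one h1, fun η => ?_⟩,
    ⟨di, body_ne_zero_of_mul_eq_one h3, fun η => ?_⟩⟩
  · have := hc' (oddSMul η ci)
    rw [← a1, this, a3]
    congr 2
    ext
    have : (ci : Grassmann) * c = 1 := congrArg Subtype.val h1
    simp only [coe_oddSMul, mul_assoc, this, mul_one]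
  · have := hd' (oddSMul η di)
    rw [← a2, this, a3]
    congr 2
    ext
    have : (di : Grassmann) * d = 1 := congrArg Subtype.val h3
    simp only [coe_oddSMul, mul_assoc, this, mul_one]

theorem relP_coords {H : SPoint → SPoint} {p : SPoint} {c : GEven} :
    RelP H p c ↔ ∀ η : GOdd, (H (p.shP η)).z = (H p).z + η * (c * (H p).tm) ∧
      (H (p.shP η)).tp = (H p).tp + η * c ∧ (H (p.shP η)).tm = (H p).tm := by
  refine forall_congr' fun η => ?_
  rw [SPoint.ext_iff]
  simp [SPoint.shP, mul_assoc]

theorem relM_coords {H : SPoint → SPoint} {p : SPoint} {c : GEven} :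
    RelM H p c ↔ ∀ η : GOdd, (H (p.shM η)).z = (H p).z + η * (c * (H p).tp) ∧
      (H (p.shM η)).tp = (H p).tp ∧ (H (p.shM η)).tm = (H p).tm + η * c := by
  refine forall_congr' fun η => ?_
  rw [SPoint.ext_iff]
  simp [SPoint.shM, mul_assoc]

/-! ### Parity of coefficients from parity of values -/

theorem even_of_odd_mul {c : Grassmann} (h : ∀ η ∈ GOdd, η * c ∈ GOdd) : c ∈ GEven := by
  rw [mem_even_iff]
  refine odd_cancel' fun η hη => ?_
  have := parity_odd (h η hη)
  rw [map_mul, parity_odd hη, neg_mul, neg_inj] at this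
  exact this

theorem odd_of_odd_mul {c : Grassmann} (h : ∀ η ∈ GOdd, η * c ∈ GEven) : c ∈ GOdd := by
  rw [mem_odd_iff]
  refine odd_cancel' fun η hη => ?_
  have := parity_even (h η hη)
  rw [map_mul, parity_odd hη, neg_mul] at this
  rw [mul_neg, ← this, neg_neg]

theorem assemble_even {v : Sector → Grassmann}
    (h : ∀ η ∈ GOdd, ∀ η' ∈ GOdd, assemble η η' v ∈ GEven) :
    v .one ∈ GEven ∧ v .p ∈ GOdd ∧ v .m ∈ GOdd ∧ v .pm ∈ GEven := by
  have h1 : v .one ∈ GEven := by simpa [assemble] using h 0 (zero_mem _) 0 (zero_mem _)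
  have h2 : v .p ∈ GOdd := odd_of_odd_mul fun η hη => by
    have := sub_mem (h η hη 0 (zero_mem _)) h1
    simpa [assemble] using this
  have h3 : v .m ∈ GOdd := odd_of_odd_mul fun η hη => by
    have := sub_mem (h 0 (zero_mem _) η hη) h1
    simpa [assemble] using this
  refine ⟨h1, h2, h3, even_of_odd_mul fun η hη => odd_of_odd_mul fun η' hη' => ?_⟩
  have := sub_mem (sub_mem (sub_mem (h η' hη' η hη) h1) (odd_mul_odd hη' h2)) (odd_mul_odd hη h3)
  rwa [assemble, add_assoc, add_assoc, add_sub_cancel_left, add_sub_cancel_left,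
    add_sub_cancel_left, mul_assoc] at this

theorem assemble_odd {v : Sector → Grassmann}
    (h : ∀ η ∈ GOdd, ∀ η' ∈ GOdd, assemble η η' v ∈ GOdd) :
    v .one ∈ GOdd ∧ v .p ∈ GEven ∧ v .m ∈ GEven ∧ v .pm ∈ GOdd := by
  have h1 : v .one ∈ GOdd := by simpa [assemble] using h 0 (zero_mem _) 0 (zero_mem _)
  have h2 : v .p ∈ GEven := even_of_odd_mul fun η hη => by
    have := sub_mem (h η hη 0 (zero_mem _)) h1
    simpa [assemble] using this
  have h3 : v .m ∈ GEven := even_of_odd_mul fun η hη => by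
    have := sub_mem (h 0 (zero_mem _) η hη) h1
    simpa [assemble] using this
  refine ⟨h1, h2, h3, odd_of_odd_mul fun η hη => even_of_odd_mul fun η' hη' => ?_⟩
  have := sub_mem (sub_mem (sub_mem (h η' hη' η hη) h1) (odd_mul_even hη' h2)) (odd_mul_even hη h3)
  rwa [assemble, add_assoc, add_assoc, add_sub_cancel_left, add_sub_cancel_left,
    add_sub_cancel_left, mul_assoc] at this

theorem SuperFn.coef_sec {F : SuperFn} {w : ℂ} (hF : F.AnAt w) (s : Sector) (k : Finset ℕ) :
    coef k (F.sec s (algebraMap ℂ Grassmann w)) = F s k w := by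
  obtain ⟨K, hK⟩ := hF.2
  rw [SuperFn.sec_eq_sum (algebraMap_even w) (by rw [gbody_algebraMap]; exact hK)]
  simp only [extend_algebraMap, map_sum, ← Algebra.smul_def, map_smul, coef_zeta, smul_eq_mul,
    mul_ite, mul_one, mul_zero, Finset.sum_ite_eq']
  split_ifs with hk
  · rfl
  · exact (hK.self_of_nhds s k hk).symm

/-- A function that is superanalytic near each point of a set of bodies is given there by a single
family of coefficient functions. -/
theorem exists_superFn {V : Set ℂ} {Φ : SPoint → Grassmann} (h : ∀ w ∈ V, SAn w Φ) :
    ∃ F : SuperFn, ∀ w ∈ V, F.AnAt w ∧ ∀ᶠ p in bn w, Φ p = F.eval p := by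
  classical
  choose! G hG hΦ using h
  -- On `V` the coefficient at `w` comes from the germ chosen at `w`. At a point outside `V`, which
  -- may still be near one of `V`, it comes from any chosen germ that represents `Φ` there. Germs
  -- representing `Φ` near the same point have equal coefficients, so the choices fit together.
  refine ⟨fun s k w => if w ∈ V then G w s k w else (if h : ∃ w' ∈ V, (G w').AnAt w ∧
    ∀ᶠ p in bn w, Φ p = (G w').eval p then G h.choose s k w else 0), fun w hw => ?_⟩
  have key : ∀ w₁ w₂ w, (G w₁).AnAt w → (G w₂).AnAt w → (∀ᶠ p in bn w, Φ p = (G w₁).eval p) →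
      (∀ᶠ p in bn w, Φ p = (G w₂).eval p) → ∀ s k, G w₁ s k w = G w₂ s k w := by
    intro w₁ w₂ w h1 h2 e1 e2 s k
    have h3 : SuperFn.AnAt (G w₁ + (-1 : ℂ) • G w₂) w := h1.add (h2.smul _)
    have := (SuperFn.eventually_zero_of_vanish h3 fun p hp => by
      rw [SuperFn.eval_add (by rw [hp]; exact h1) (by rw [hp]; exact h2.smul _),
        SuperFn.eval_smul (by rw [hp]; exact h2), ← of_eventually_bn e1 hp, ← of_eventually_bn e2 hp]
      simp).self_of_nhds s k
    change G w₁ s k w + (-1 : ℂ) • G w₂ s k w = 0 at this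
    rw [neg_one_smul] at this
    linear_combination this
  have ev : ∀ᶠ w' in 𝓝 w, ∀ s k, (if w' ∈ V then G w' s k w' else (if h : ∃ w'' ∈ V,
      (G w'').AnAt w' ∧ ∀ᶠ p in bn w', Φ p = (G w'').eval p then G h.choose s k w' else 0)) =
      G w s k w' := by
    filter_upwards [(hG w hw).eventually, eventually_eventually_bn (hΦ w hw)] with w' a b s k
    split_ifs with h1 h2
    · exact key _ _ _ (hG w' h1) a (hΦ w' h1) b s k
    · exact key _ _ _ h2.choose_spec.2.1 a h2.choose_spec.2.2 b s k
    · exact absurd ⟨w, hw, a, b⟩ h2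
  obtain ⟨h1, K, hK⟩ := hG w hw
  refine ⟨⟨fun s k => (h1 s k).congr (by filter_upwards [ev] with w' h using (h s k).symm), K, ?_⟩,
    ?_⟩
  · filter_upwards [ev, hK] with w' a b s k hk
    rw [a]; exact b s k hk
  · filter_upwards [hΦ w hw, eventually_bn_body ev.eventually_nhds] with p a b
    rw [a, SuperFn.eval_eq, SuperFn.eval_eq]
    congr 1
    funext s
    refine finsum_congr fun k => ?_
    rw [extend_congr]
    filter_upwards [b] with w h using (h s k).symm

/-- Coefficient functions that are finite sums at each point of an open set are locally finite
sums. -/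
theorem SuperFn.AnalyticOn.anAt {F : SuperFn} {V : Set ℂ} (hV : IsOpen V) (hF : F.AnalyticOn V)
    {w : ℂ} (hw : w ∈ V) : F.AnAt w := by
  refine ⟨fun s k => hF.1 s k w hw, ?_⟩
  obtain ⟨r, hr, hrV⟩ := Metric.isOpen_iff.1 hV w hw
  -- There are countably many finite index sets `K`, and the closed sets `C K` cover the plane. By
  -- Baire's theorem one of them has interior inside the ball, and the identity theorem spreads the
  -- vanishing of the coefficients outside `K` over the ball.
  let C : Finset (Finset ℕ) → Set ℂ := fun K =>
    {x | x ∈ Metric.ball w r → ∀ s, ∀ k ∉ K, F s k x = 0}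
  have hC : ∀ K, IsClosed (C K) := by
    intro K
    rw [← isOpen_compl_iff, isOpen_iff_mem_nhds]
    intro x hx
    simp only [C, Set.mem_compl_iff, Set.mem_ofPred_eq, not_forall] at hx
    obtain ⟨hxb, s, k, hk, hne⟩ := hx
    have hc : ContinuousAt (F s k) x := (hF.1 s k x (hrV hxb)).continuousAt
    filter_upwards [hc.eventually_ne hne, Metric.isOpen_ball.mem_nhds hxb] with y h1 h2 h3
    exact h1 (h3 h2 s k hk)
  have hU : ⋃ K, C K = Set.univ := by
    refine Set.eq_univ_of_forall fun x => ?_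
    by_cases hx : x ∈ Metric.ball w r
    · have hf := fun s => hF.2 s x (hrV hx)
      refine Set.mem_iUnion.2 ⟨(hf .one).toFinset ∪ (hf .p).toFinset ∪ (hf .m).toFinset ∪
        (hf .pm).toFinset, fun _ s k hk => ?_⟩
      by_contra hne
      refine hk ?_
      cases s <;> simp [hne]
    · exact Set.mem_iUnion.2 ⟨∅, fun h => absurd h hx⟩
  obtain ⟨x, hx, hxb⟩ := (dense_iUnion_interior_of_closed hC hU).exists_mem_open
    Metric.isOpen_ball ⟨w, Metric.mem_ball_self hr⟩
  obtain ⟨K, hK⟩ := Set.mem_iUnion.1 hx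
  have hz : ∀ s, ∀ k ∉ K, Set.EqOn (F s k) 0 (Metric.ball w r) := by
    intro s k hk
    have h1 : AnalyticOnNhd ℂ (F s k) (Metric.ball w r) := fun y hy => hF.1 s k y (hrV hy)
    refine h1.eqOn_zero_of_preconnected_of_eventuallyEq_zero
      (convex_ball w r).isPreconnected hxb ?_
    filter_upwards [mem_interior_iff_mem_nhds.1 hK, Metric.isOpen_ball.mem_nhds hxb] with y h2 h3
    exact h2 h3 s k hk
  refine ⟨K, ?_⟩
  filter_upwards [Metric.isOpen_ball.mem_nhds (Metric.mem_ball_self hr)] with y hy s k hk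
  exact hz s k hk hy

/-! ### Equivalence of the two descriptions of superconformal maps -/

theorem isOpen_iff_exists_body {U : Set SPoint} :
    IsOpen U ↔ ∃ O : Set ℂ, IsOpen O ∧ SPoint.body ⁻¹' O = U := isOpen_induced_iff

theorem body_image {U : Set SPoint} (hU : IsOpen U) :
    IsOpen (SPoint.body '' U) ∧ ∀ p : SPoint, p.body ∈ SPoint.body '' U → p ∈ U := by
  obtain ⟨O, hO, rfl⟩ := isOpen_iff_exists_body.1 hU
  have : SPoint.body '' (SPoint.body ⁻¹' O) = O :=
    Set.image_preimage_eq O fun w => ⟨SPoint.ofBody w, SPoint.body_ofBody w⟩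
  rw [this]
  exact ⟨hO, fun p hp => hp⟩

theorem mem_open_bn {U : Set SPoint} (hU : IsOpen U) {p : SPoint} (hp : p ∈ U) :
    ∀ᶠ q in bn p.body, q ∈ U := by
  rw [← nhds_eq_bn]; exact hU.mem_nhds hp

/-- Superconformal functions in the sense of coefficient functions are superconformal maps. -/
theorem IsSuperconformalOn.wconfAt {H : SPoint → SPoint} {U : Set SPoint}
    (h : IsSuperconformalOn H U) {p : SPoint} (hp : p ∈ U) : WConfAt p.body H := by
  obtain ⟨hU, Z, P, M, ⟨hZ, hP, hM⟩, _, hv, hr, _⟩ := h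
  obtain ⟨hV, hfib⟩ := body_image hU
  have hmem : ∀ {q : SPoint}, q ∈ U → q.body ∈ SPoint.body '' U := fun hq => ⟨_, hq, rfl⟩
  have aZ : ∀ {q : SPoint}, q ∈ U → Z.AnAt q.body := fun hq => hZ.anAt hV (hmem hq)
  have aP : ∀ {q : SPoint}, q ∈ U → P.AnAt q.body := fun hq => hP.anAt hV (hmem hq)
  have aM : ∀ {q : SPoint}, q ∈ U → M.AnAt q.body := fun hq => hM.anAt hV (hmem hq)
  have hev := mem_open_bn hU hp
  refine ⟨⟨⟨Z, aZ hp, ?_⟩, ⟨P, aP hp, ?_⟩, ⟨M, aM hp, ?_⟩⟩, ?_⟩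
  · filter_upwards [hev] with q hq using (hv q hq).1
  · filter_upwards [hev] with q hq using (hv q hq).2.1
  · filter_upwards [hev] with q hq using (hv q hq).2.2
  · filter_upwards [hev] with q hq
    have hq1 : ∀ η, q.shP η ∈ U := fun η => hfib _ (by rw [q.body_shP]; exact hmem hq)
    have hq2 : ∀ η, q.shM η ∈ U := fun η => hfib _ (by rw [q.body_shM]; exact hmem hq)
    obtain ⟨r1, r2, r3, r4⟩ := hr q hq
    obtain ⟨v1, v2, v3⟩ := hv q hq
    -- The product of the factor with any odd parameter is a difference of odd coordinates of `H`,
    -- which forces the factor to be even.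
    have c1 : P.DP.eval q ∈ GEven := even_of_odd_mul fun η hη => by
      have := sub_mem (H (q.shP ⟨η, hη⟩)).tp_odd (H q).tp_odd
      rw [(hv _ (hq1 _)).2.1, v2, SuperFn.eval_shP (aP hq), add_sub_cancel_left] at this
      exact this
    have c2 : M.DM.eval q ∈ GEven := even_of_odd_mul fun η hη => by
      have := sub_mem (H (q.shM ⟨η, hη⟩)).tm_odd (H q).tm_odd
      rw [(hv _ (hq2 _)).2.2, v3, SuperFn.eval_shM (aM hq), add_sub_cancel_left] at this
      exact this
    refine ⟨⟨⟨_, c1⟩, relP_coords.2 fun η => ?_⟩, ⟨⟨_, c2⟩, relM_coords.2 fun η => ?_⟩⟩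
    · obtain ⟨w1, w2, w3⟩ := hv _ (hq1 η)
      rw [w1, w2, w3, SuperFn.eval_shP (aP hq), SuperFn.eval_shP (aM hq), SuperFn.eval_shP (aZ hq),
        r1, sub_eq_zero.1 r3, ← v1, ← v2, ← v3, even_comm c1]
      simp
    · obtain ⟨w1, w2, w3⟩ := hv _ (hq2 η)
      rw [w1, w2, w3, SuperFn.eval_shM (aP hq), SuperFn.eval_shM (aM hq), SuperFn.eval_shM (aZ hq),
        r2, sub_eq_zero.1 r4, ← v1, ← v2, ← v3, even_comm c2]
      simp

theorem SuperFn.coef_eq_zero_of_even {F : SuperFn} {w : ℂ} (hF : F.AnAt w)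
    (h : ∀ p : SPoint, p.body = w → F.eval p ∈ GEven) (s : Sector) (k : Finset ℕ)
    (hk : Odd (s.card + k.card)) : F s k w = 0 := by
  have hE : F.sec .one (algebraMap ℂ Grassmann w) ∈ GEven ∧
      F.sec .p (algebraMap ℂ Grassmann w) ∈ GOdd ∧ F.sec .m (algebraMap ℂ Grassmann w) ∈ GOdd ∧
      F.sec .pm (algebraMap ℂ Grassmann w) ∈ GEven :=
    assemble_even (v := fun s => F.sec s (algebraMap ℂ Grassmann w)) fun η hη η' hη' =>
      h ⟨algebraMap ℂ Grassmann w, η, η', algebraMap_even w, hη, hη'⟩ (gbody_algebraMap w)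
  rw [← SuperFn.coef_sec hF s k]
  cases s
  · exact coef_of_even hE.1 (by rwa [Sector.card, zero_add] at hk)
  · exact coef_of_odd hE.2.1 (by rw [Sector.card] at hk; grind)
  · exact coef_of_odd hE.2.2.1 (by rw [Sector.card] at hk; grind)
  · exact coef_of_even hE.2.2.2 (by rw [Sector.card] at hk; grind)

theorem SuperFn.coef_eq_zero_of_odd {F : SuperFn} {w : ℂ} (hF : F.AnAt w)
    (h : ∀ p : SPoint, p.body = w → F.eval p ∈ GOdd) (s : Sector) (k : Finset ℕ)
    (hk : Even (s.card + k.card)) : F s k w = 0 := by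
  have hE : F.sec .one (algebraMap ℂ Grassmann w) ∈ GOdd ∧
      F.sec .p (algebraMap ℂ Grassmann w) ∈ GEven ∧ F.sec .m (algebraMap ℂ Grassmann w) ∈ GEven ∧
      F.sec .pm (algebraMap ℂ Grassmann w) ∈ GOdd :=
    assemble_odd (v := fun s => F.sec s (algebraMap ℂ Grassmann w)) fun η hη η' hη' =>
      h ⟨algebraMap ℂ Grassmann w, η, η', algebraMap_even w, hη, hη'⟩ (gbody_algebraMap w)
  rw [← SuperFn.coef_sec hF s k]
  cases s
  · exact coef_of_odd hE.1 (by rwa [Sector.card, zero_add] at hk)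
  · exact coef_of_even hE.2.1 (by rw [Sector.card] at hk; grind)
  · exact coef_of_even hE.2.2.1 (by rw [Sector.card] at hk; grind)
  · exact coef_of_odd hE.2.2.2 (by rw [Sector.card] at hk; grind)

/-- The derivatives of the components of a superconformal map. -/
theorem RelP.derivs {H : SPoint → SPoint} {q : SPoint} {c : GEven} (h : RelP H q c)
    {Z P M : SuperFn} (aZ : Z.AnAt q.body) (aP : P.AnAt q.body) (aM : M.AnAt q.body)
    (e : ∀ p : SPoint, p.body = q.body →
      (H p).z = Z.eval p ∧ (H p).tp = P.eval p ∧ (H p).tm = M.eval p) :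
    M.DP.eval q = 0 ∧ P.DP.eval q = c ∧ Z.DP.eval q = c * (H q).tm := by
  rw [relP_coords] at h
  obtain ⟨v1, v2, v3⟩ := e q rfl
  refine ⟨odd_cancel fun η hη => ?_, odd_cancel' fun η hη => ?_, odd_cancel' fun η hη => ?_⟩
  all_goals
    obtain ⟨w1, w2, w3⟩ := e (q.shP ⟨η, hη⟩) (q.body_shP _)
    obtain ⟨h1, h2, h3⟩ := h ⟨η, hη⟩
  · rw [w3, v3, SuperFn.eval_shP aM, add_eq_left] at h3
    exact h3
  · rw [w2, v2, SuperFn.eval_shP aP, add_right_inj] at h2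
    exact h2
  · rw [w1, v1, SuperFn.eval_shP aZ, add_right_inj] at h1
    exact h1

theorem RelM.derivs {H : SPoint → SPoint} {q : SPoint} {c : GEven} (h : RelM H q c)
    {Z P M : SuperFn} (aZ : Z.AnAt q.body) (aP : P.AnAt q.body) (aM : M.AnAt q.body)
    (e : ∀ p : SPoint, p.body = q.body →
      (H p).z = Z.eval p ∧ (H p).tp = P.eval p ∧ (H p).tm = M.eval p) :
    P.DM.eval q = 0 ∧ M.DM.eval q = c ∧ Z.DM.eval q = c * (H q).tp := by
  rw [relM_coords] at h
  obtain ⟨v1, v2, v3⟩ := e q rfl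
  refine ⟨odd_cancel fun η hη => ?_, odd_cancel' fun η hη => ?_, odd_cancel' fun η hη => ?_⟩
  all_goals
    obtain ⟨w1, w2, w3⟩ := e (q.shM ⟨η, hη⟩) (q.body_shM _)
    obtain ⟨h1, h2, h3⟩ := h ⟨η, hη⟩
  · rw [w2, v2, SuperFn.eval_shM aP, add_eq_left] at h2
    exact h2
  · rw [w3, v3, SuperFn.eval_shM aM, add_right_inj] at h3
    exact h3
  · rw [w1, v1, SuperFn.eval_shM aZ, add_right_inj] at h1
    exact h1

theorem SuperFn.analyticOn_of_anAt {F : SuperFn} {V : Set ℂ} (hF : ∀ w ∈ V, F.AnAt w) :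
    F.AnalyticOn V := by
  refine ⟨fun s k w hw => (hF w hw).1 s k, fun s w hw => ?_⟩
  obtain ⟨K, hK⟩ := (hF w hw).2
  refine K.finite_toSet.subset fun k hk => ?_
  by_contra hkK
  exact hk (hK.self_of_nhds s k hkK)

/-- Superconformal maps with invertible derivative are superconformal in the sense of coefficient
functions. -/
theorem isSuperconformalOn_of {H : SPoint → SPoint} {U : Set SPoint} (hU : IsOpen U)
    (h : ∀ p ∈ U, SConfAt p.body H) : IsSuperconformalOn H U := by
  obtain ⟨hV, hfib⟩ := body_image hU
  have hw : ∀ w ∈ SPoint.body '' U, SConfAt w H := by rintro _ ⟨p, hp, rfl⟩; exact h p hp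
  obtain ⟨Z, hZ⟩ := exists_superFn fun w hw' => (hw w hw').1.1
  obtain ⟨P, hP⟩ := exists_superFn fun w hw' => (hw w hw').1.2.1
  obtain ⟨M, hM⟩ := exists_superFn fun w hw' => (hw w hw').1.2.2
  have hv : ∀ w ∈ SPoint.body '' U, ∀ q : SPoint, q.body = w →
      (H q).z = Z.eval q ∧ (H q).tp = P.eval q ∧ (H q).tm = M.eval q := fun w hw q hq =>
    ⟨of_eventually_bn (hZ w hw).2 hq, of_eventually_bn (hP w hw).2 hq,
      of_eventually_bn (hM w hw).2 hq⟩
  have hmem : ∀ {q : SPoint}, q ∈ U → q.body ∈ SPoint.body '' U := fun hq => ⟨_, hq, rfl⟩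
  have hP' : ∀ q ∈ U, ∃ c : GEven, gbody c ≠ 0 ∧
      M.DP.eval q = 0 ∧ P.DP.eval q = c ∧ Z.DP.eval q = c * (H q).tm := fun q hq => by
    obtain ⟨⟨c, hc, hc'⟩, _⟩ := of_eventually_bn (h q hq).2 rfl
    exact ⟨c, hc, hc'.derivs (hZ _ (hmem hq)).1 (hP _ (hmem hq)).1 (hM _ (hmem hq)).1
      (hv _ (hmem hq))⟩
  have hM' : ∀ q ∈ U, ∃ c : GEven, gbody c ≠ 0 ∧
      P.DM.eval q = 0 ∧ M.DM.eval q = c ∧ Z.DM.eval q = c * (H q).tp := fun q hq => by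
    obtain ⟨_, ⟨c, hc, hc'⟩⟩ := of_eventually_bn (h q hq).2 rfl
    exact ⟨c, hc, hc'.derivs (hZ _ (hmem hq)).1 (hP _ (hmem hq)).1 (hM _ (hmem hq)).1
      (hv _ (hmem hq))⟩
  refine ⟨hU, Z, P, M, ⟨SuperFn.analyticOn_of_anAt fun w hw => (hZ w hw).1,
    SuperFn.analyticOn_of_anAt fun w hw => (hP w hw).1,
    SuperFn.analyticOn_of_anAt fun w hw => (hM w hw).1⟩, ⟨?_, ?_, ?_⟩,
    fun q hq => hv _ (hmem hq) q rfl, fun q hq => ?_, fun ⟨q, hq⟩ => ⟨⟨q, hq, ?_⟩, ⟨q, hq, ?_⟩⟩⟩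
  · intro s k hk w hw
    refine SuperFn.coef_eq_zero_of_even (hZ w hw).1 (fun p hp => ?_) s k hk
    rw [← (hv w hw p hp).1]; exact (H p).z_even
  · intro s k hk w hw
    refine SuperFn.coef_eq_zero_of_odd (hP w hw).1 (fun p hp => ?_) s k hk
    rw [← (hv w hw p hp).2.1]; exact (H p).tp_odd
  · intro s k hk w hw
    refine SuperFn.coef_eq_zero_of_odd (hM w hw).1 (fun p hp => ?_) s k hk
    rw [← (hv w hw p hp).2.2]; exact (H p).tm_odd
  · obtain ⟨c, _, c1, c2, c3⟩ := hP' q hq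
    obtain ⟨d, _, d1, d2, d3⟩ := hM' q hq
    rw [c2, c3, d2, d3]
    exact ⟨c1, d1, by rw [even_comm c.2, sub_self], by rw [even_comm d.2, sub_self]⟩
  · obtain ⟨c, hc, _, c2, _⟩ := hP' q hq
    rw [c2]
    rintro h0
    rw [h0, gbody_zero] at hc
    exact hc rfl
  · obtain ⟨c, hc, _, c2, _⟩ := hM' q hq
    rw [c2]
    rintro h0
    rw [h0, gbody_zero] at hc
    exact hc rfl

/-! ### Formal series and their values at nilpotent points -/

/-- The value `∑ a_n z^n` at a nilpotent `z`. -/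
def evz (z : Grassmann) : (ℕ → Grassmann) →ₗ[ℂ] Grassmann where
  toFun a := ∑ n ∈ Finset.range (nilpotencyClass z), a n * z ^ n
  map_add' a b := by simp [add_mul, Finset.sum_add_distrib]
  map_smul' c a := by simp [Finset.smul_sum]

/-- The nilpotency class may be replaced by any exponent that annihilates `z`, which permits a
common range of summation for several points. -/
theorem evz_eq {z : Grassmann} {M : ℕ} (h : z ^ M = 0) (a : ℕ → Grassmann) :
    evz z a = ∑ n ∈ Finset.range M, a n * z ^ n := by
  have h1 : nilpotencyClass z ≤ M := Nat.sInf_le h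
  have h2 : z ^ nilpotencyClass z = 0 := pow_nilpotencyClass ⟨M, h⟩
  refine Finset.sum_subset (Finset.range_mono h1) fun n _ hn => ?_
  rw [pow_eq_zero_of_le (not_lt.1 fun h => hn (Finset.mem_range.2 h)) h2, mul_zero]

theorem evz_congr {z : Grassmann} {M : ℕ} (h : z ^ M = 0) {a b : ℕ → Grassmann}
    (e : ∀ n < M, a n = b n) : evz z a = evz z b := by
  rw [evz_eq h, evz_eq h]
  exact Finset.sum_congr rfl fun n hn => by rw [e n (Finset.mem_range.1 hn)]

theorem evz_zero_point (a : ℕ → Grassmann) : evz 0 a = a 0 := by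
  rw [evz_eq (M := 1) (by simp)]; simp

theorem evz_mul_left (z c : Grassmann) (a : ℕ → Grassmann) :
    evz z (fun n => c * a n) = c * evz z a := by
  simp [evz, Finset.mul_sum, mul_assoc]

theorem evz_shift {z : Grassmann} (hz : z ∈ GEven) (hn : IsNilpotent z) (k : ℕ)
    (a : ℕ → Grassmann) :
    evz z (fun n => if k ≤ n then a (n - k) else 0) = z ^ k * evz z a := by
  obtain ⟨M, hM⟩ := hn
  rw [evz_eq (M := k + M) (pow_eq_zero_of_le (Nat.le_add_left _ _) hM), evz_eq hM,
    Finset.sum_range_add, Finset.mul_sum,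
    Finset.sum_eq_zero fun n hn => by rw [if_neg (by simpa using hn), zero_mul], zero_add]
  refine Finset.sum_congr rfl fun n _ => ?_
  rw [if_pos (Nat.le_add_right _ _), Nat.add_sub_cancel_left, ← mul_assoc,
    even_comm (pow_mem hz k : z ^ k ∈ GEven), mul_assoc, ← pow_add]

theorem evz_add_sq {z t : Grassmann} (hz : z ∈ GEven) (hn : IsNilpotent z) (ht' : t ∈ GEven)
    (ht : t * t = 0) (a : ℕ → Grassmann) :
    evz (z + t) a = evz z a + t * evz z (fun n => ((n : ℂ) + 1) • a (n + 1)) := by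
  obtain ⟨M, hM⟩ := hn
  have h1 : z ^ (M + 1) = 0 := pow_eq_zero_of_le (Nat.le_succ _) hM
  have h2 : (z + t) ^ (M + 1) = 0 := by
    rw [add_pow_of_sq hz ht, h1, hM, zero_mul, smul_zero, add_zero]
  rw [evz_eq h2, evz_eq h1, evz_eq hM, Finset.mul_sum]
  rw [Finset.sum_range_succ', Finset.sum_range_succ' _ M]
  simp only [add_pow_of_sq hz ht, mul_add, Finset.sum_add_distrib, pow_zero]
  rw [add_right_comm]
  congr 1
  refine Finset.sum_congr rfl fun n _ => ?_
  rw [mul_smul_comm, smul_mul_assoc, mul_smul_comm, even_comm ht', mul_assoc]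

theorem SPoint.nilpotent {p : SPoint} (hp : p.body = 0) : IsNilpotent p.z := by
  have := even_soul_nilpotent p.z_even
  rwa [gsoul, show gbody p.z = 0 from hp, map_zero, sub_zero] at this

/-- The value of a formal series at a point with body `0`. -/
def ev (p : SPoint) : SSeries →ₗ[ℂ] Grassmann where
  toFun u := assemble p.tp p.tm fun s => evz p.z (u s)
  map_add' u v := by
    simp only [Pi.add_apply, map_add]
    exact assemble_add _ _ (fun s => evz p.z (u s)) (fun s => evz p.z (v s))
  map_smul' c u := by
    simp only [Pi.smul_apply, map_smul]
    exact assemble_smul _ _ c (fun s => evz p.z (u s))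

theorem ev_apply (p : SPoint) (u : SSeries) :
    ev p u = assemble p.tp p.tm fun s => evz p.z (u s) := rfl

theorem ev_congr {p : SPoint} {M : ℕ} (h : p.z ^ M = 0) {u v : SSeries}
    (e : ∀ s, ∀ n < M, u s n = v s n) : ev p u = ev p v := by
  rw [ev_apply, ev_apply]
  simp only [fun s => evz_congr h (e s)]

theorem ev_origin (u : SSeries) : ev SPoint.origin u = u .one 0 := by
  simp [ev_apply, SPoint.origin, assemble, evz_zero_point]

theorem ev_thetaP (p : SPoint) (u : SSeries) : ev p (thetaP u) = p.tp * ev p u := by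
  simp only [ev_apply, assemble, thetaP, map_zero, mul_zero, add_zero, zero_add, mul_add]
  simp only [← mul_assoc, odd_mul_self p.tp_odd, zero_mul, add_zero]

theorem ev_thetaM (p : SPoint) (u : SSeries) : ev p (thetaM u) = p.tm * ev p u := by
  simp only [ev_apply, assemble, thetaM, map_zero, mul_zero, add_zero, zero_add, mul_add, map_neg,
    mul_neg]
  simp only [← mul_assoc, odd_mul_self p.tm_odd, zero_mul, add_zero, odd_mul_mul_self p.tm_odd,
    odd_anticomm p.tm_odd p.tp_odd, neg_mul]

theorem ev_xpow {p : SPoint} (hp : p.body = 0) (k : ℕ) (u : SSeries) :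
    ev p (xpow k u) = p.z ^ k * ev p u := by
  have h := pow_mem p.z_even k
  have e : ∀ s, evz p.z (xpow k u s) = p.z ^ k * evz p.z (u s) := fun s =>
    evz_shift p.z_even (p.nilpotent hp) k (u s)
  simp only [ev_apply, assemble, e, mul_add]
  simp only [← mul_assoc, even_comm h]

theorem ev_evenMul (p : SPoint) {a : Grassmann} (ha : a ∈ GEven) (u : SSeries) :
    ev p (evenMul a u) = a * ev p u := by
  have e : ∀ s, evz p.z (evenMul a u s) = a * evz p.z (u s) := fun s => evz_mul_left _ _ _
  simp only [ev_apply, assemble, e, mul_add]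
  simp only [← mul_assoc, even_comm ha]

theorem ev_oddMul (p : SPoint) {a : Grassmann} (ha : a ∈ GOdd) (u : SSeries) :
    ev p (oddMul a u) = a * ev p u := by
  have e : ∀ s, evz p.z (oddMul a u s) = ((-1 : ℂ) ^ s.card) • (a * evz p.z (u s)) := fun s => by
    rw [← evz_mul_left, ← map_smul]; rfl
  simp only [ev_apply, assemble, e, mul_add, Sector.card]
  simp only [← mul_assoc, odd_anticomm ha p.tp_odd, odd_anticomm ha p.tm_odd, pow_zero, one_smul,
    pow_one, neg_smul, mul_neg, neg_mul, neg_one_sq]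
  rw [mul_assoc p.tp a p.tm, odd_anticomm ha p.tm_odd, mul_neg, neg_mul, neg_neg, ← mul_assoc]

/-- The point `(z, θ⁺ + η, θ⁻)`. -/
def SPoint.addP (p : SPoint) (η : GOdd) : SPoint :=
  ⟨p.z, p.tp + η, p.tm, p.z_even, add_mem p.tp_odd η.2, p.tm_odd⟩

/-- The point `(z, θ⁺, θ⁻ + η)`. -/
def SPoint.addM (p : SPoint) (η : GOdd) : SPoint :=
  ⟨p.z, p.tp, p.tm + η, p.z_even, p.tp_odd, add_mem p.tm_odd η.2⟩

theorem ev_addP (p : SPoint) (η : GOdd) (u : SSeries) :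
    ev (p.addP η) u = ev p u + η * ev p (dThetaP u) := by
  simp only [ev_apply, assemble, SPoint.addP, dThetaP, map_zero, mul_zero, add_zero, add_mul, mul_add,
    mul_assoc]
  abel

theorem ev_addM (p : SPoint) (η : GOdd) (u : SSeries) :
    ev (p.addM η) u = ev p u + η * ev p (dThetaM u) := by
  simp only [ev_apply, assemble, SPoint.addM, dThetaM, map_zero, mul_zero, add_zero, add_mul, mul_add,
    map_neg, mul_neg]
  rw [odd_anticomm p.tp_odd η.2]
  simp only [mul_assoc, neg_mul]
  abel

theorem ev_shZ {p : SPoint} (hp : p.body = 0) (t : GEven) (ht : (t : Grassmann) * t = 0)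
    (u : SSeries) : ev (p.shZ t) u = ev p u + t * ev p (dx u) := by
  have e : ∀ s, evz (p.z + t) (u s) = evz p.z (u s) + t * evz p.z (dx u s) := fun s =>
    evz_add_sq p.z_even (p.nilpotent hp) t.2 ht (u s)
  simp only [ev_apply, assemble, SPoint.shZ, e, mul_add]
  simp only [← mul_assoc, even_comm t.2]
  abel

/-- `D⁺` on formal series. -/
def dPs : SSeries →ₗ[ℂ] SSeries where
  toFun u := dThetaP u + thetaM (dx u)
  map_add' u v := by
    funext s n; cases s <;> simp [dThetaP, thetaM, dx] <;> abel
  map_smul' c u := by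
    funext s n; cases s <;> simp [dThetaP, thetaM, dx, smul_comm c]

/-- `D⁻` on formal series. -/
def dMs : SSeries →ₗ[ℂ] SSeries where
  toFun u := dThetaM u + thetaP (dx u)
  map_add' u v := by
    funext s n; cases s <;> simp [dThetaM, thetaP, dx] <;> abel
  map_smul' c u := by
    funext s n; cases s <;> simp [dThetaM, thetaP, dx, smul_comm c]

theorem dPs_apply (u : SSeries) : dPs u = dThetaP u + thetaM (dx u) := rfl

theorem dMs_apply (u : SSeries) : dMs u = dThetaM u + thetaP (dx u) := rfl

/-- The shift along `D⁺` is an odd translation followed by an even translation of square zero, so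
its first-order expansion combines those of `∂/∂θ⁺` and `∂/∂x`. -/
theorem SPoint.shP_eq (p : SPoint) (η : GOdd) :
    p.shP η = (p.addP η).shZ ⟨η * p.tm, odd_mul_odd η.2 p.tm_odd⟩ := rfl

theorem SPoint.shM_eq (p : SPoint) (η : GOdd) :
    p.shM η = (p.addM η).shZ ⟨η * p.tp, odd_mul_odd η.2 p.tp_odd⟩ := rfl

theorem ev_shP {p : SPoint} (hp : p.body = 0) (η : GOdd) (u : SSeries) :
    ev (p.shP η) u = ev p u + η * ev p (dPs u) := by
  rw [SPoint.shP_eq, ev_shZ (p := p.addP η) hp _ (odd_sq_mul η.2 _), ev_addP, ev_addP, dPs_apply, map_add,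
    ev_thetaM, mul_add, mul_add, mul_assoc, mul_assoc, ← mul_assoc p.tm, ← mul_assoc (η : Grassmann) (p.tm * η),
    odd_mul_mul_self η.2, zero_mul, add_zero, add_assoc]

theorem ev_shM {p : SPoint} (hp : p.body = 0) (η : GOdd) (u : SSeries) :
    ev (p.shM η) u = ev p u + η * ev p (dMs u) := by
  rw [SPoint.shM_eq, ev_shZ (p := p.addM η) hp _ (odd_sq_mul η.2 _), ev_addM, ev_addM, dMs_apply, map_add,
    ev_thetaP, mul_add, mul_add, mul_assoc, mul_assoc, ← mul_assoc p.tp, ← mul_assoc (η : Grassmann) (p.tp * η),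
    odd_mul_mul_self η.2, zero_mul, add_zero, add_assoc]

theorem SPoint.body_shZ_sq (p : SPoint) {t : GEven} (ht : (t : Grassmann) * t = 0) :
    (p.shZ t).body = p.body := p.body_shZ (gbody_of_sq ht)

theorem even_cancel {x y : Grassmann} (h : ∀ t : GEven, (t : Grassmann) * t = 0 → t * x = t * y) :
    x = y := by
  refine odd_cancel' fun η hη => odd_cancel' fun η' hη' => ?_
  rw [← mul_assoc, ← mul_assoc]
  exact h ⟨η' * η, odd_mul_odd hη' hη⟩ (odd_sq_mul hη' η)

/-- A formal series is determined by its values. -/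
theorem ev_injective {u v : SSeries} (h : ∀ p : SPoint, p.body = 0 → ev p u = ev p v) : u = v := by
  suffices H : ∀ w : SSeries, (∀ p : SPoint, p.body = 0 → ev p w = 0) → w = 0 by
    refine sub_eq_zero.1 (H _ fun p hp => ?_)
    rw [map_sub, h p hp, sub_self]
  intro w hw
  have hz : ∀ z : GEven, gbody z = 0 → ∀ s, evz z (w s) = 0 := fun z hz =>
    congrFun (assemble_eq_zero (v := fun s => evz z (w s)) fun η hη η' hη' =>
      hw ⟨z, η, η', z.2, hη, hη'⟩ hz)
  clear h hw
  -- Square-zero shifts pass the vanishing of all values on to the derivative, so every coefficient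
  -- reduces to a constant term, the value at `z = 0`.
  have key : ∀ n, ∀ w : SSeries, (∀ z : GEven, gbody z = 0 → ∀ s, evz z (w s) = 0) →
      ∀ s, w s n = 0 := by
    intro n
    induction n with
    | zero =>
      intro w hw s
      rw [← evz_zero_point (w s)]
      exact hw 0 (by simp) s
    | succ n ih =>
      intro w hw s
      have := ih (dx w) (fun z hz s => even_cancel fun t ht => by
        have hn : IsNilpotent (z : Grassmann) :=
          SPoint.nilpotent (p := ⟨z, 0, 0, z.2, zero_mem _, zero_mem _⟩) hz
        have h1 := evz_add_sq z.2 hn t.2 ht (w s)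
        rw [hw z hz, show evz ((z : Grassmann) + t) (w s) = 0 from
            hw (z + t) (by simp [hz, gbody_of_sq ht]) s, zero_add] at h1
        rw [mul_zero]; exact h1.symm) s
      rw [dx, smul_eq_zero] at this
      exact this.resolve_left (by exact_mod_cast Nat.succ_ne_zero n)
  funext s n
  exact key n w hz s

set_option linter.unusedSimpArgs false

/-! ### The vector fields -/

theorem dx_serX : dx serX = fun s n => match s with | .one => if n = 0 then 1 else 0 | _ => 0 := by
  funext s n
  cases s <;> simp only [dx, serX, smul_zero]
  rcases n with _ | n <;> simp

theorem dx_serP : dx serP = 0 := by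
  funext s n
  cases s <;> simp [dx, serP]

theorem dx_serM : dx serM = 0 := by
  funext s n
  cases s <;> simp [dx, serM]

/-- For fixed `n` at most one index contributes: in each sector, the part of the field of a given
index sends a coordinate to a single monomial. -/
theorem sum_shift {X : Type*} [AddCommMonoid X] (f : ℕ → ℕ → X) (g : ℕ → X) (k n : ℕ)
    (h : ∀ i, f i (i + k) = g i) (h' : ∀ i, i + k ≠ n → f i n = 0) :
    ∑ i ∈ Finset.range (n + 1), f i n = if k ≤ n then g (n - k) else 0 := by
  split_ifs with hk
  · rw [Finset.sum_eq_single (n - k)]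
    · have := h (n - k)
      rwa [Nat.sub_add_cancel hk] at this
    · intro i _ hi
      exact h' i (by omega)
    · intro hi
      exact absurd (Finset.mem_range.2 (by omega)) hi
  · exact Finset.sum_eq_zero fun i _ => h' i (by omega)

/-- The part of the field of index `i`. -/
def InfData.term (B : InfData) (i : ℕ) (u : SSeries) : SSeries :=
  -(evenMul (B.AP i) (opL (i + 1) u) + evenMul (B.AM i) (opJ (i + 1) u) +
    oddMul (B.MP i) (opGP (i + 1) u) + oddMul (B.MM i) (opGM (i + 1) u))

theorem InfData.field_apply (B : InfData) (u : SSeries) (s : Sector) (n : ℕ) :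
    B.field u s n = ∑ i ∈ Finset.range (n + 1), B.term i u s n := by
  rw [InfData.field, ← Finset.sum_neg_distrib]
  rfl

theorem InfData.field_shift {B : InfData} {u : SSeries} {s : Sector} (g : ℕ → Grassmann) (k n : ℕ)
    (h : ∀ i, B.term i u s (i + k) = g i) (h' : ∀ i, i + k ≠ n → B.term i u s n = 0) :
    B.field u s n = if k ≤ n then g (n - k) else 0 :=
  (B.field_apply u s n).trans (sum_shift (fun i n => B.term i u s n) g k n h h')

/-- The coefficients of the field on the three coordinates are listed here sector by sector. They
determine the field because it is a derivation (`ev_field_eq`). -/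
theorem InfData.field_serX_one (B : InfData) (n : ℕ) :
    B.field serX .one n = if 2 ≤ n then (B.AP (n - 2) : Grassmann) else 0 := by
  refine InfData.field_shift (fun i : ℕ => (B.AP i : Grassmann)) 2 n (fun i => ?_) fun i hi => ?_
  · simp [InfData.term, evenMul, oddMul, opL, opJ, opGP, opGM, xpow, dx_serX, dx_serP, dx_serM, thetaP,
      thetaM, dThetaP, dThetaM, serX, serP, serM, Sector.card]
  · simp [InfData.term, evenMul, oddMul, opL, opJ, opGP, opGM, xpow, dx_serX, dx_serP, dx_serM, thetaP,
      thetaM, dThetaP, dThetaM, serX, serP, serM, Sector.card]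
    grind

theorem InfData.field_serX_p (B : InfData) (n : ℕ) :
    B.field serX .p n = if 1 ≤ n then (B.MM (n - 1) : Grassmann) else 0 := by
  refine InfData.field_shift (fun i : ℕ => (B.MM i : Grassmann)) 1 n (fun i => ?_) fun i hi => ?_
  · simp [InfData.term, evenMul, oddMul, opL, opJ, opGP, opGM, xpow, dx_serX, dx_serP, dx_serM, thetaP,
      thetaM, dThetaP, dThetaM, serX, serP, serM, Sector.card]
  · simp [InfData.term, evenMul, oddMul, opL, opJ, opGP, opGM, xpow, dx_serX, dx_serP, dx_serM, thetaP,
      thetaM, dThetaP, dThetaM, serX, serP, serM, Sector.card]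
    grind

theorem InfData.field_serX_m (B : InfData) (n : ℕ) :
    B.field serX .m n = if 1 ≤ n then (B.MP (n - 1) : Grassmann) else 0 := by
  refine InfData.field_shift (fun i : ℕ => (B.MP i : Grassmann)) 1 n (fun i => ?_) fun i hi => ?_
  · simp [InfData.term, evenMul, oddMul, opL, opJ, opGP, opGM, xpow, dx_serX, dx_serP, dx_serM, thetaP,
      thetaM, dThetaP, dThetaM, serX, serP, serM, Sector.card]
  · simp [InfData.term, evenMul, oddMul, opL, opJ, opGP, opGM, xpow, dx_serX, dx_serP, dx_serM, thetaP,
      thetaM, dThetaP, dThetaM, serX, serP, serM, Sector.card]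
    grind

theorem InfData.field_serX_pm (B : InfData) (n : ℕ) : B.field serX .pm n = 0 := by
  rw [InfData.field_apply]
  refine Finset.sum_eq_zero fun i _ => ?_
  simp [InfData.term, evenMul, oddMul, opL, opJ, opGP, opGM, xpow, dx_serX, dx_serP, dx_serM, thetaP,
      thetaM, dThetaP, dThetaM, serX, serP, serM, Sector.card]

theorem InfData.field_serP_one (B : InfData) (n : ℕ) :
    B.field serP .one n = if 1 ≤ n then (B.MP (n - 1) : Grassmann) else 0 := by
  refine InfData.field_shift (fun i : ℕ => (B.MP i : Grassmann)) 1 n (fun i => ?_) fun i hi => ?_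
  · simp [InfData.term, evenMul, oddMul, opL, opJ, opGP, opGM, xpow, dx_serX, dx_serP, dx_serM, thetaP,
      thetaM, dThetaP, dThetaM, serX, serP, serM, Sector.card]
  · simp [InfData.term, evenMul, oddMul, opL, opJ, opGP, opGM, xpow, dx_serX, dx_serP, dx_serM, thetaP,
      thetaM, dThetaP, dThetaM, serX, serP, serM, Sector.card]
    grind

theorem InfData.field_serP_p (B : InfData) (n : ℕ) :
    B.field serP .p n = if 1 ≤ n then ((((n - 1 : ℕ) : ℂ) + 1 + 1) / 2) • (B.AP (n - 1) : Grassmann) +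
      B.AM (n - 1) else 0 := by
  refine InfData.field_shift (fun i : ℕ => ((((i : ℂ) + 1 + 1) / 2) • (B.AP i : Grassmann) + B.AM i : Grassmann)) 1 n (fun i => ?_) fun i hi => ?_
  · simp [InfData.term, evenMul, oddMul, opL, opJ, opGP, opGM, xpow, dx_serX, dx_serP, dx_serM, thetaP,
      thetaM, dThetaP, dThetaM, serX, serP, serM, Sector.card]
    abel
  · simp [InfData.term, evenMul, oddMul, opL, opJ, opGP, opGM, xpow, dx_serX, dx_serP, dx_serM, thetaP,
      thetaM, dThetaP, dThetaM, serX, serP, serM, Sector.card]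
    grind

theorem InfData.field_serP_m (B : InfData) (n : ℕ) : B.field serP .m n = 0 := by
  rw [InfData.field_apply]
  refine Finset.sum_eq_zero fun i _ => ?_
  simp [InfData.term, evenMul, oddMul, opL, opJ, opGP, opGM, xpow, dx_serX, dx_serP, dx_serM, thetaP,
      thetaM, dThetaP, dThetaM, serX, serP, serM, Sector.card]

theorem InfData.field_serP_pm (B : InfData) (n : ℕ) :
    B.field serP .pm n = ((n : ℂ) + 1) • (B.MP n : Grassmann) := by
  refine InfData.field_shift (fun i : ℕ => (((i : ℂ) + 1) • (B.MP i : Grassmann) : Grassmann)) 0 n (fun i => ?_) fun i hi => ?_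
  · simp [InfData.term, evenMul, oddMul, opL, opJ, opGP, opGM, xpow, dx_serX, dx_serP, dx_serM, thetaP,
      thetaM, dThetaP, dThetaM, serX, serP, serM, Sector.card]
  · simp [InfData.term, evenMul, oddMul, opL, opJ, opGP, opGM, xpow, dx_serX, dx_serP, dx_serM, thetaP,
      thetaM, dThetaP, dThetaM, serX, serP, serM, Sector.card]
    grind

theorem InfData.field_serM_one (B : InfData) (n : ℕ) :
    B.field serM .one n = if 1 ≤ n then (B.MM (n - 1) : Grassmann) else 0 := by
  refine InfData.field_shift (fun i : ℕ => (B.MM i : Grassmann)) 1 n (fun i => ?_) fun i hi => ?_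
  · simp [InfData.term, evenMul, oddMul, opL, opJ, opGP, opGM, xpow, dx_serX, dx_serP, dx_serM, thetaP,
      thetaM, dThetaP, dThetaM, serX, serP, serM, Sector.card]
  · simp [InfData.term, evenMul, oddMul, opL, opJ, opGP, opGM, xpow, dx_serX, dx_serP, dx_serM, thetaP,
      thetaM, dThetaP, dThetaM, serX, serP, serM, Sector.card]
    grind

theorem InfData.field_serM_p (B : InfData) (n : ℕ) : B.field serM .p n = 0 := by
  rw [InfData.field_apply]
  refine Finset.sum_eq_zero fun i _ => ?_
  simp [InfData.term, evenMul, oddMul, opL, opJ, opGP, opGM, xpow, dx_serX, dx_serP, dx_serM, thetaP,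
      thetaM, dThetaP, dThetaM, serX, serP, serM, Sector.card]

theorem InfData.field_serM_m (B : InfData) (n : ℕ) :
    B.field serM .m n = if 1 ≤ n then ((((n - 1 : ℕ) : ℂ) + 1 + 1) / 2) • (B.AP (n - 1) : Grassmann) -
      B.AM (n - 1) else 0 := by
  refine InfData.field_shift (fun i : ℕ => ((((i : ℂ) + 1 + 1) / 2) • (B.AP i : Grassmann) - B.AM i : Grassmann)) 1 n (fun i => ?_) fun i hi => ?_
  · simp [InfData.term, evenMul, oddMul, opL, opJ, opGP, opGM, xpow, dx_serX, dx_serP, dx_serM, thetaP,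
      thetaM, dThetaP, dThetaM, serX, serP, serM, Sector.card]
    abel
  · simp [InfData.term, evenMul, oddMul, opL, opJ, opGP, opGM, xpow, dx_serX, dx_serP, dx_serM, thetaP,
      thetaM, dThetaP, dThetaM, serX, serP, serM, Sector.card]
    grind

theorem InfData.field_serM_pm (B : InfData) (n : ℕ) :
    B.field serM .pm n = -(((n : ℂ) + 1) • (B.MM n : Grassmann)) := by
  refine InfData.field_shift (fun i : ℕ => (-(((i : ℂ) + 1) • (B.MM i : Grassmann)) : Grassmann)) 0 n (fun i => ?_) fun i hi => ?_
  · simp [InfData.term, evenMul, oddMul, opL, opJ, opGP, opGM, xpow, dx_serX, dx_serP, dx_serM, thetaP,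
      thetaM, dThetaP, dThetaM, serX, serP, serM, Sector.card]
  · simp [InfData.term, evenMul, oddMul, opL, opJ, opGP, opGM, xpow, dx_serX, dx_serP, dx_serM, thetaP,
      thetaM, dThetaP, dThetaM, serX, serP, serM, Sector.card]
    grind

theorem evz_one {z : Grassmann} (hz : IsNilpotent z) :
    evz z (fun n => if n = 0 then 1 else 0) = 1 := by
  obtain ⟨M, hM⟩ := hz
  rw [evz_eq (M := M + 1) (pow_eq_zero_of_le (Nat.le_succ _) hM), Finset.sum_range_succ']
  simp

/-- The series `1`. -/
def serOne : SSeries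
  | .one, n => if n = 0 then 1 else 0
  | _, _ => 0

theorem ev_serOne {p : SPoint} (hp : p.body = 0) : ev p serOne = 1 := by
  have e1 : evz p.z (serOne .one) = 1 := evz_one (p.nilpotent hp)
  have e2 : serOne .p = 0 ∧ serOne .m = 0 ∧ serOne .pm = 0 := ⟨rfl, rfl, rfl⟩
  simp [ev_apply, assemble, e1, e2.1, e2.2.1, e2.2.2]

theorem serX_eq : serX = xpow 1 serOne := by
  funext s n
  cases s <;> simp [serX, xpow, serOne]
  grind

theorem serP_eq : serP = thetaP serOne := by
  funext s n
  cases s <;> simp [serP, thetaP, serOne]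

theorem serM_eq : serM = thetaM serOne := by
  funext s n
  cases s <;> simp [serM, thetaM, serOne]

theorem ev_serX {p : SPoint} (hp : p.body = 0) : ev p serX = p.z := by
  rw [serX_eq, ev_xpow hp, ev_serOne hp]; simp

theorem ev_serP {p : SPoint} (hp : p.body = 0) : ev p serP = p.tp := by
  rw [serP_eq, ev_thetaP, ev_serOne hp]; simp

theorem ev_serM {p : SPoint} (hp : p.body = 0) : ev p serM = p.tm := by
  rw [serM_eq, ev_thetaM, ev_serOne hp]; simp

theorem dx_serX_eq : dx serX = serOne := by
  funext s n
  cases s <;> simp only [dx, serX, serOne, smul_zero]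
  rcases n with _ | n <;> simp

theorem dThetaP_ser : dThetaP serX = 0 ∧ dThetaP serP = serOne ∧ dThetaP serM = 0 := by
  refine ⟨?_, ?_, ?_⟩ <;> funext s n <;> cases s <;> rfl

theorem dThetaM_ser : dThetaM serX = 0 ∧ dThetaM serP = 0 ∧ dThetaM serM = serOne := by
  refine ⟨?_, ?_, ?_⟩ <;> funext s n <;> cases s <;> simp [dThetaM, serX, serP, serM, serOne]

theorem dx_add (u v : SSeries) : dx (u + v) = dx u + dx v := by
  funext s n; simp [dx]

theorem dx_smul (c : ℂ) (u : SSeries) : dx (c • u) = c • dx u := by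
  funext s n; simp [dx, smul_comm c]

theorem dThetaP_add (u v : SSeries) : dThetaP (u + v) = dThetaP u + dThetaP v := by
  funext s n; cases s <;> simp [dThetaP]

theorem dThetaP_smul (c : ℂ) (u : SSeries) : dThetaP (c • u) = c • dThetaP u := by
  funext s n; cases s <;> simp [dThetaP]

theorem dThetaM_add (u v : SSeries) : dThetaM (u + v) = dThetaM u + dThetaM v := by
  funext s n; cases s <;> simp [dThetaM, add_comm]

theorem dThetaM_smul (c : ℂ) (u : SSeries) : dThetaM (c • u) = c • dThetaM u := by
  funext s n; cases s <;> simp [dThetaM]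

theorem ev_term (B : InfData) (i : ℕ) {p : SPoint} (hp : p.body = 0) (u : SSeries) :
    ev p (B.term i u) = -(B.AP i * -(p.z ^ (i + 2) * ev p (dx u) + (((i : ℂ) + 1 + 1) / 2) •
      (p.z ^ (i + 1) * (p.tp * ev p (dThetaP u) + p.tm * ev p (dThetaM u)))) +
      B.AM i * -(p.z ^ (i + 1) * (p.tp * ev p (dThetaP u) - p.tm * ev p (dThetaM u))) +
      B.MP i * -(p.z ^ (i + 1) * (ev p (dThetaP u) - p.tm * ev p (dx u)) +
        ((i : ℂ) + 1) • (p.z ^ i * (p.tp * (p.tm * ev p (dThetaP u))))) +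
      B.MM i * -(p.z ^ (i + 1) * (ev p (dThetaM u) - p.tp * ev p (dx u)) -
        ((i : ℂ) + 1) • (p.z ^ i * (p.tp * (p.tm * ev p (dThetaM u)))))) := by
  simp only [InfData.term, opL, opJ, opGP, opGM, map_neg, map_add, map_sub, map_smul,
    ev_evenMul p (B.AP i).2, ev_evenMul p (B.AM i).2, ev_oddMul p (B.MP i).2, ev_oddMul p (B.MM i).2,
    ev_xpow hp, ev_thetaP, ev_thetaM, Nat.add_sub_cancel, Nat.cast_add, Nat.cast_one]

/-- Every summand is a combination of `∂/∂x`, `∂/∂φ⁺`, `∂/∂φ⁻` with coefficients on the left;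
inserting the coordinate series recovers these coefficients. -/
theorem ev_term_eq (B : InfData) (i : ℕ) {p : SPoint} (hp : p.body = 0) (u : SSeries) :
    ev p (B.term i u) = ev p (B.term i serX) * ev p (dx u) + ev p (B.term i serP) * ev p (dThetaP u) +
      ev p (B.term i serM) * ev p (dThetaM u) := by
  simp only [ev_term B i hp, dx_serX_eq, dx_serP, dx_serM, dThetaP_ser, dThetaM_ser, ev_serOne hp,
    map_zero, mul_zero, mul_one, add_zero, zero_add, sub_zero, zero_sub, smul_zero, neg_zero]
  simp only [add_mul, mul_add, neg_mul, mul_neg, sub_mul, mul_sub, smul_mul_assoc, mul_smul_comm,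
    mul_assoc, smul_add, neg_neg, neg_add, sub_eq_add_neg, smul_neg]
  abel

/-- The part of index `i` affects only coefficients of `x ^ n` with `n ≥ i`, so parts with `i ≥ M`
are invisible at a point with `z ^ M = 0`. -/
theorem ev_field (B : InfData) {p : SPoint} {M : ℕ} (hp : p.body = 0) (hM : p.z ^ M = 0) (u : SSeries) :
    ev p (B.field u) = ∑ i ∈ Finset.range M, ev p (B.term i u) := by
  rw [← map_sum]
  refine ev_congr hM fun s n hn => ?_
  rw [B.field_apply, Finset.sum_apply, Finset.sum_apply]
  refine Finset.sum_subset (Finset.range_mono (by omega)) fun i _ hi => ?_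
  have h1 : ¬ (i + 1 + 1 ≤ n) := by simp at hi; omega
  have h2 : ¬ (i + 1 ≤ n) := by simp at hi; omega
  have h3 : ¬ (i ≤ n) := by simp at hi; omega
  simp [InfData.term, opL, opJ, opGP, opGM, xpow, h1, h2, h3, evenMul, oddMul]

/-- The field is a derivation, determined by its values on `x, φ⁺, φ⁻`. -/
theorem ev_field_eq (B : InfData) {p : SPoint} (hp : p.body = 0) (u : SSeries) :
    ev p (B.field u) = ev p (B.field serX) * ev p (dx u) + ev p (B.field serP) * ev p (dThetaP u) +
      ev p (B.field serM) * ev p (dThetaM u) := by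
  obtain ⟨M, hM⟩ := p.nilpotent hp
  simp only [ev_field B hp hM, Finset.sum_mul, ← Finset.sum_add_distrib]
  exact Finset.sum_congr rfl fun i _ => ev_term_eq B i hp u

/-- The field as a linear map. -/
def InfData.fieldL (B : InfData) : SSeries →ₗ[ℂ] SSeries where
  toFun := B.field
  map_add' u v := ev_injective fun p hp => by
    rw [map_add, ev_field_eq B hp, ev_field_eq B hp u, ev_field_eq B hp v, dx_add, dThetaP_add,
      dThetaM_add]
    simp only [map_add, mul_add]
    abel
  map_smul' c u := ev_injective fun p hp => by
    rw [RingHom.id_apply, map_smul, ev_field_eq B hp, ev_field_eq B hp u, dx_smul, dThetaP_smul,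
      dThetaM_smul]
    simp only [map_smul, mul_smul_comm, smul_add]

theorem InfData.fieldL_apply (B : InfData) (u : SSeries) : B.fieldL u = B.field u := rfl

/-! ### Products and parities of formal series -/

/-- The Cauchy product. -/
def conv (a b : ℕ → Grassmann) (n : ℕ) : Grassmann :=
  ∑ ij ∈ Finset.HasAntidiagonal.antidiagonal n, a ij.1 * b ij.2

/-- Used for products of series at nilpotent points, and again for products of terminating
exponentials. -/
theorem cauchy_sum {f g : ℕ → Grassmann} {K L N : ℕ} (hf : ∀ i, K ≤ i → f i = 0)
    (hg : ∀ i, L ≤ i → g i = 0) (hN : K + L ≤ N) :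
    ∑ n ∈ Finset.range N, conv f g n =
      (∑ i ∈ Finset.range K, f i) * ∑ j ∈ Finset.range L, g j := by
  rw [Finset.sum_mul_sum, ← Finset.sum_product',
    ← Finset.sum_fiberwise_of_maps_to (g := fun ij : ℕ × ℕ => ij.1 + ij.2) (t := Finset.range N)]
  · refine Finset.sum_congr rfl fun n _ => ?_
    rw [conv]
    refine (Finset.sum_subset_zero_on_sdiff ?_ ?_ fun _ _ => rfl).symm
    · intro ij h
      simp only [Finset.mem_filter, Finset.mem_product, Finset.mem_range] at h
      exact Finset.HasAntidiagonal.mem_antidiagonal.2 h.2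
    · intro ij h
      simp only [Finset.mem_sdiff, Finset.HasAntidiagonal.mem_antidiagonal, Finset.mem_filter, Finset.mem_product,
        Finset.mem_range, not_and] at h
      by_cases h1 : K ≤ ij.1
      · rw [hf _ h1, zero_mul]
      · by_cases h2 : L ≤ ij.2
        · rw [hg _ h2, mul_zero]
        · exact absurd h.1 (h.2 ⟨by omega, by omega⟩)
  · intro ij h
    simp only [Finset.mem_product, Finset.mem_range] at h ⊢
    omega

theorem evz_conv {z : Grassmann} (hz : z ∈ GEven) (hn : IsNilpotent z) (a b : ℕ → Grassmann) :
    evz z (conv a b) = evz z a * evz z b := by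
  obtain ⟨M, hM⟩ := hn
  have h0 : ∀ n, M ≤ n → z ^ n = 0 := fun n hn => pow_eq_zero_of_le hn hM
  rw [evz_eq (h0 (M + M) (Nat.le_add_left _ _)), evz_eq hM, evz_eq hM,
    ← cauchy_sum (N := M + M) (fun i hi => by rw [h0 i hi, mul_zero])
      (fun i hi => by rw [h0 i hi, mul_zero]) le_rfl]
  refine Finset.sum_congr rfl fun n _ => ?_
  rw [conv, conv, Finset.sum_mul]
  refine Finset.sum_congr rfl fun ij h => ?_
  rw [← Finset.HasAntidiagonal.mem_antidiagonal.1 h, pow_add, mul_assoc, mul_assoc, ← mul_assoc (b ij.2),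
    ← even_comm (pow_mem hz ij.1 : z ^ ij.1 ∈ GEven) (b ij.2), mul_assoc]

theorem evz_apply (z : Grassmann) (a : ℕ → Grassmann) :
    evz z a = ∑ n ∈ Finset.range (nilpotencyClass z), a n * z ^ n := rfl

theorem evz_parity {z : Grassmann} (hz : z ∈ GEven) (a : ℕ → Grassmann) :
    evz z (fun n => parity (a n)) = parity (evz z a) := by
  simp only [evz, LinearMap.coe_mk, AddHom.coe_mk, map_sum, map_mul, map_pow, parity_even hz]

/-- The product of formal series. -/
def mulS (u v : SSeries) : SSeries
  | .one => conv (u .one) (v .one)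
  | .p => conv (fun n => parity (u .one n)) (v .p) + conv (u .p) (v .one)
  | .m => conv (fun n => parity (u .one n)) (v .m) + conv (u .m) (v .one)
  | .pm => conv (u .one) (v .pm) + conv (fun n => parity (u .p n)) (v .m) -
      conv (fun n => parity (u .m n)) (v .p) + conv (u .pm) (v .one)

theorem mul_odd_comm {a : Grassmann} (ha : a ∈ GOdd) (x : Grassmann) : x * a = a * parity x := by
  rw [odd_mul_comm ha, parity_parity]

/-- The parity twists in `mulS` record the passage of an odd variable of the right factor across the
coefficients of the left one; with them evaluation is multiplicative. -/
theorem ev_mulS {p : SPoint} (hp : p.body = 0) (u v : SSeries) :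
    ev p (mulS u v) = ev p u * ev p v := by
  have hn := p.nilpotent hp
  have e := fun a b => evz_conv p.z_even hn a b
  have hp' := p.tp_odd
  have hm' := p.tm_odd
  simp only [ev_apply, assemble, mulS, map_add, map_sub, e, evz_parity p.z_even]
  generalize evz p.z (u .one) = u1
  generalize evz p.z (u .p) = u2
  generalize evz p.z (u .m) = u3
  generalize evz p.z (u .pm) = u4
  generalize evz p.z (v .one) = v1
  generalize evz p.z (v .p) = v2
  generalize evz p.z (v .m) = v3
  generalize evz p.z (v .pm) = v4
  generalize p.tp = a at *
  generalize p.tm = b at *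
  have c1 : ∀ x y, x * (a * y) = a * (parity x * y) := fun x y => by
    rw [← mul_assoc, mul_odd_comm hp', mul_assoc]
  have c2 : ∀ x y, x * (b * y) = b * (parity x * y) := fun x y => by
    rw [← mul_assoc, mul_odd_comm hm', mul_assoc]
  have c3 : ∀ y, a * (a * y) = 0 := fun y => by rw [← mul_assoc, odd_mul_self hp', zero_mul]
  have c4 : ∀ y, b * (b * y) = 0 := fun y => by rw [← mul_assoc, odd_mul_self hm', zero_mul]
  have c5 : ∀ y, b * (a * y) = -(a * (b * y)) := fun y => by
    rw [← mul_assoc, odd_anticomm hm' hp', neg_mul, mul_assoc]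
  simp only [mul_add, add_mul, mul_assoc, mul_sub]
  simp only [c1 u1, c1 u2, c1 u3, c1 u4, c2 u1, c2 u2, c2 u3, c2 u4, c2 (parity u1), c2 (parity u2),
    c2 (parity u3), c2 (parity u4), parity_parity, c3, c4, c5, mul_zero, mul_neg,
    neg_zero, add_zero]
  abel

/-- All values are even. -/
def EvenS (u : SSeries) : Prop := ∀ p : SPoint, p.body = 0 → ev p u ∈ GEven

/-- All values are odd. -/
def OddS (u : SSeries) : Prop := ∀ p : SPoint, p.body = 0 → ev p u ∈ GOdd

theorem evz_mem {z : Grassmann} (hz : z ∈ GEven) {a : ℕ → Grassmann} :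
    ((∀ n, a n ∈ GEven) → evz z a ∈ GEven) ∧ ((∀ n, a n ∈ GOdd) → evz z a ∈ GOdd) :=
  ⟨fun h => by rw [evz_apply]; exact sum_mem fun n _ => even_mul_even (h n) (pow_mem hz n),
    fun h => by rw [evz_apply]; exact sum_mem fun n _ => odd_mul_even (h n) (pow_mem hz n)⟩

theorem evenS_of_coef {u : SSeries} (h1 : ∀ n, u .one n ∈ GEven) (h2 : ∀ n, u .p n ∈ GOdd)
    (h3 : ∀ n, u .m n ∈ GOdd) (h4 : ∀ n, u .pm n ∈ GEven) : EvenS u := fun p _ => by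
  have e := fun a => evz_mem p.z_even (a := a)
  exact add_mem (add_mem (add_mem ((e _).1 h1) (odd_mul_odd p.tp_odd ((e _).2 h2)))
    (odd_mul_odd p.tm_odd ((e _).2 h3))) (even_mul_even (odd_mul_odd p.tp_odd p.tm_odd) ((e _).1 h4))

theorem oddS_of_coef {u : SSeries} (h1 : ∀ n, u .one n ∈ GOdd) (h2 : ∀ n, u .p n ∈ GEven)
    (h3 : ∀ n, u .m n ∈ GEven) (h4 : ∀ n, u .pm n ∈ GOdd) : OddS u := fun p _ => by
  have e := fun a => evz_mem p.z_even (a := a)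
  exact add_mem (add_mem (add_mem ((e _).2 h1) (odd_mul_even p.tp_odd ((e _).1 h2)))
    (odd_mul_even p.tm_odd ((e _).1 h3))) (even_mul_odd (odd_mul_odd p.tp_odd p.tm_odd) ((e _).2 h4))

theorem even_of_sq_mul {c : Grassmann} (h : ∀ t : GEven, (t : Grassmann) * t = 0 → t * c ∈ GEven) :
    c ∈ GEven :=
  even_of_odd_mul fun η hη => odd_of_odd_mul fun η' hη' => by
    rw [← mul_assoc]; exact h ⟨η' * η, odd_mul_odd hη' hη⟩ (odd_sq_mul hη' _)

theorem odd_of_sq_mul {c : Grassmann} (h : ∀ t : GEven, (t : Grassmann) * t = 0 → t * c ∈ GOdd) :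
    c ∈ GOdd :=
  odd_of_odd_mul fun η hη => even_of_odd_mul fun η' hη' => by
    rw [← mul_assoc]; exact h ⟨η' * η, odd_mul_odd hη' hη⟩ (odd_sq_mul hη' _)

theorem EvenS.derivs {u : SSeries} (h : EvenS u) :
    EvenS (dx u) ∧ OddS (dThetaP u) ∧ OddS (dThetaM u) := by
  refine ⟨fun p hp => even_of_sq_mul fun t ht => ?_, fun p hp => odd_of_odd_mul fun η hη => ?_,
    fun p hp => odd_of_odd_mul fun η hη => ?_⟩
  · have := sub_mem (h (p.shZ t) (by rwa [p.body_shZ_sq ht])) (h p hp)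
    rwa [ev_shZ hp t ht, add_sub_cancel_left] at this
  · have := sub_mem (h (p.addP ⟨η, hη⟩) hp) (h p hp)
    rwa [ev_addP, add_sub_cancel_left] at this
  · have := sub_mem (h (p.addM ⟨η, hη⟩) hp) (h p hp)
    rwa [ev_addM, add_sub_cancel_left] at this

theorem OddS.derivs {u : SSeries} (h : OddS u) :
    OddS (dx u) ∧ EvenS (dThetaP u) ∧ EvenS (dThetaM u) := by
  refine ⟨fun p hp => odd_of_sq_mul fun t ht => ?_, fun p hp => even_of_odd_mul fun η hη => ?_,
    fun p hp => even_of_odd_mul fun η hη => ?_⟩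
  · have := sub_mem (h (p.shZ t) (by rwa [p.body_shZ_sq ht])) (h p hp)
    rwa [ev_shZ hp t ht, add_sub_cancel_left] at this
  · have := sub_mem (h (p.addP ⟨η, hη⟩) hp) (h p hp)
    rwa [ev_addP, add_sub_cancel_left] at this
  · have := sub_mem (h (p.addM ⟨η, hη⟩) hp) (h p hp)
    rwa [ev_addM, add_sub_cancel_left] at this

theorem OddS.dPs {u : SSeries} (h : OddS u) : EvenS (N2Sphere.dPs u) := fun p hp => by
  rw [dPs_apply, map_add, ev_thetaM]
  exact add_mem (h.derivs.2.1 p hp) (odd_mul_odd p.tm_odd (h.derivs.1 p hp))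

theorem OddS.dMs {u : SSeries} (h : OddS u) : EvenS (N2Sphere.dMs u) := fun p hp => by
  rw [dMs_apply, map_add, ev_thetaP]
  exact add_mem (h.derivs.2.2 p hp) (odd_mul_odd p.tp_odd (h.derivs.1 p hp))


section FieldIteration

variable (B : InfData)

theorem smul_even (c : ℂ) {x : Grassmann} (h : x ∈ GEven) : c • x ∈ GEven := GEven.smul_mem h c

theorem field_even_serX : EvenS (B.field serX) := by
  refine evenS_of_coef (fun n => ?_) (fun n => ?_) (fun n => ?_) fun n => ?_
  · rw [B.field_serX_one]; split_ifs; exacts [(B.AP _).2, zero_mem _]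
  · rw [B.field_serX_p]; split_ifs; exacts [(B.MM _).2, zero_mem _]
  · rw [B.field_serX_m]; split_ifs; exacts [(B.MP _).2, zero_mem _]
  · rw [B.field_serX_pm]; exact zero_mem _

theorem field_odd_serP : OddS (B.field serP) := by
  refine oddS_of_coef (fun n => ?_) (fun n => ?_) (fun n => ?_) fun n => ?_
  · rw [B.field_serP_one]; split_ifs; exacts [(B.MP _).2, zero_mem _]
  · rw [B.field_serP_p]; split_ifs
    exacts [add_mem (smul_even _ (B.AP _).2) (B.AM _).2, zero_mem _]
  · rw [B.field_serP_m]; exact zero_mem _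
  · rw [B.field_serP_pm]; exact GOdd.smul_mem _ (B.MP _).2

theorem field_odd_serM : OddS (B.field serM) := by
  refine oddS_of_coef (fun n => ?_) (fun n => ?_) (fun n => ?_) fun n => ?_
  · rw [B.field_serM_one]; split_ifs; exacts [(B.MM _).2, zero_mem _]
  · rw [B.field_serM_p]; exact zero_mem _
  · rw [B.field_serM_m]; split_ifs
    exacts [sub_mem (smul_even _ (B.AP _).2) (B.AM _).2, zero_mem _]
  · rw [B.field_serM_pm]; exact neg_mem (GOdd.smul_mem _ (B.MM _).2)

theorem EvenS.field {u : SSeries} (h : EvenS u) : EvenS (B.field u) := fun p hp => by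
  rw [ev_field_eq B hp]
  exact add_mem (add_mem (even_mul_even (field_even_serX B p hp) (h.derivs.1 p hp))
    (odd_mul_odd (field_odd_serP B p hp) (h.derivs.2.1 p hp)))
    (odd_mul_odd (field_odd_serM B p hp) (h.derivs.2.2 p hp))

theorem OddS.field {u : SSeries} (h : OddS u) : OddS (B.field u) := fun p hp => by
  rw [ev_field_eq B hp]
  exact add_mem (add_mem (even_mul_odd (field_even_serX B p hp) (h.derivs.1 p hp))
    (odd_mul_even (field_odd_serP B p hp) (h.derivs.2.1 p hp)))
    (odd_mul_even (field_odd_serM B p hp) (h.derivs.2.2 p hp))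

/-! ### Commutation with the superderivatives -/

/-- This lemma and the next three are the superconformal equations linearised at the identity. They
hold by the particular form of the operators `L_j`, `J_j`, `G^±_{j-1/2}`. -/
theorem dPs_field_serM : dPs (B.field serM) = 0 := by
  funext s n
  cases s <;> simp [dPs_apply, dThetaP, thetaM, dx, B.field_serM_one, B.field_serM_p,
    B.field_serM_pm]

theorem dMs_field_serP : dMs (B.field serP) = 0 := by
  funext s n
  cases s <;> simp [dMs_apply, dThetaM, thetaP, dx, B.field_serP_one, B.field_serP_m,
    B.field_serP_pm]

theorem dPs_field_serX :
    dPs (B.field serX) = B.field serM + thetaM (dPs (B.field serP)) := by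
  funext s n
  cases s
  · simp [dPs_apply, dThetaP, thetaM, dx, B.field_serX_p, B.field_serM_one]
  · simp [dPs_apply, dThetaP, thetaM, dx, B.field_serM_p]
  · rcases n with _ | n
    · simp [dPs_apply, dThetaP, thetaM, dx, B.field_serX_pm, B.field_serX_one, B.field_serM_m,
        B.field_serP_p]
    · simp [dPs_apply, dThetaP, thetaM, dx, B.field_serX_pm, B.field_serX_one, B.field_serM_m,
        B.field_serP_p]
      module
  · simp [dPs_apply, dThetaP, thetaM, dx, B.field_serX_p, B.field_serM_pm]

theorem dMs_field_serX :
    dMs (B.field serX) = B.field serP + thetaP (dMs (B.field serM)) := by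
  funext s n
  cases s
  · simp [dMs_apply, dThetaM, thetaP, dx, B.field_serX_m, B.field_serP_one]
  · rcases n with _ | n
    · simp [dMs_apply, dThetaM, thetaP, dx, B.field_serX_pm, B.field_serX_one, B.field_serM_m,
        B.field_serP_p]
    · simp [dMs_apply, dThetaM, thetaP, dx, B.field_serX_pm, B.field_serX_one, B.field_serM_m,
        B.field_serP_p]
      module
  · simp [dMs_apply, dThetaM, thetaP, dx, B.field_serP_m]
  · simp [dMs_apply, dThetaM, thetaP, dx, B.field_serX_m, B.field_serP_pm]

theorem dPs_comm (u : SSeries) : dx (dPs u) = dPs (dx u) ∧ dThetaP (dPs u) = -dPs (dThetaP u) ∧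
    dThetaM (dPs u) = dx u - dPs (dThetaM u) := by
  refine ⟨?_, ?_, ?_⟩ <;> funext s n <;> cases s <;>
    simp [dPs_apply, dx, dThetaP, dThetaM, thetaM, add_comm]

theorem dMs_comm (u : SSeries) : dx (dMs u) = dMs (dx u) ∧
    dThetaP (dMs u) = dx u - dMs (dThetaP u) ∧ dThetaM (dMs u) = -dMs (dThetaM u) := by
  refine ⟨?_, ?_, ?_⟩ <;> funext s n <;> cases s <;>
    simp [dMs_apply, dx, dThetaP, dThetaM, thetaP, sub_eq_add_neg, add_comm]

/-- A Leibniz expansion to first order in `η`; the minus signs arise when `η` is moved to the left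
past the odd coefficients `P` and `M`. -/
theorem odd_expand {X P M η : Grassmann} (hX : X ∈ GEven) (hP : P ∈ GOdd) (hM : M ∈ GOdd)
    (hη : η ∈ GOdd) (Y L N a a' b b' c c' : Grassmann) :
    (X + η * Y) * (a + η * a') + (P + η * L) * (b + η * b') + (M + η * N) * (c + η * c') =
      (X * a + P * b + M * c) +
        η * (Y * a + X * a' + (L * b - P * b') + (N * c - M * c')) := by
  have h1 : ∀ x y, η * (x * (η * y)) = 0 := fun x y => by
    rw [← mul_assoc x, ← mul_assoc, odd_mul_mul_self hη, zero_mul]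
  have h2 : ∀ y, X * (η * y) = η * (X * y) := fun y => by
    rw [← mul_assoc, even_comm hX, mul_assoc]
  have h3 : ∀ y, P * (η * y) = -(η * (P * y)) := fun y => by
    rw [← mul_assoc, odd_anticomm hP hη, neg_mul, mul_assoc]
  have h4 : ∀ y, M * (η * y) = -(η * (M * y)) := fun y => by
    rw [← mul_assoc, odd_anticomm hM hη, neg_mul, mul_assoc]
  simp only [mul_add, add_mul, mul_sub, mul_assoc, h1, h2, h3, h4]
  abel

/-- The derivation formula is evaluated at a shifted point and compared to first order in `η`. The
linearised superconformal equations cancel every term that is not `T D⁺u` or a multiple of `D⁺u`, so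
the commutator of `D⁺` and `T` is proportional to `D⁺`. -/
theorem dPs_field (u : SSeries) :
    dPs (B.field u) = B.field (dPs u) + mulS (dPs (B.field serP)) (dPs u) := by
  refine ev_injective fun p hp => odd_cancel' fun η hη => ?_
  obtain ⟨c1, c2, c3⟩ := dPs_comm u
  have h := ev_shP hp ⟨η, hη⟩ (B.field u)
  have hp' : (p.shP ⟨η, hη⟩).body = 0 := by rw [p.body_shP, hp]
  rw [ev_field_eq B hp'] at h
  simp only [ev_shP hp] at h
  rw [odd_expand (field_even_serX B p hp) (field_odd_serP B p hp) (field_odd_serM B p hp) hη,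
    ← ev_field_eq B hp u, add_right_inj] at h
  rw [← h, dPs_field_serM, dPs_field_serX, map_add, map_add, ev_mulS hp, ev_thetaM,
    ev_field_eq B hp (dPs u), c1, c2, c3, dPs_apply u, map_add, ev_thetaM]
  have hc := even_comm ((field_odd_serP B).dPs p hp) p.tm
  generalize ev p (dPs (B.field serP)) = L at hc ⊢
  simp only [map_neg, map_sub, map_zero, zero_mul, mul_zero, zero_add, add_zero,
    mul_add, add_mul, mul_sub, mul_neg]
  rw [← mul_assoc L p.tm, hc]
  abel

theorem dMs_field (u : SSeries) :
    dMs (B.field u) = B.field (dMs u) + mulS (dMs (B.field serM)) (dMs u) := by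
  refine ev_injective fun p hp => odd_cancel' fun η hη => ?_
  obtain ⟨c1, c2, c3⟩ := dMs_comm u
  have h := ev_shM hp ⟨η, hη⟩ (B.field u)
  have hp' : (p.shM ⟨η, hη⟩).body = 0 := by rw [p.body_shM, hp]
  rw [ev_field_eq B hp'] at h
  simp only [ev_shM hp] at h
  rw [odd_expand (field_even_serX B p hp) (field_odd_serP B p hp) (field_odd_serM B p hp) hη,
    ← ev_field_eq B hp u, add_right_inj] at h
  rw [← h, dMs_field_serP, dMs_field_serX, map_add, map_add, ev_mulS hp, ev_thetaP,
    ev_field_eq B hp (dMs u), c1, c2, c3, dMs_apply u, map_add, ev_thetaP]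
  have hc := even_comm ((field_odd_serM B).dMs p hp) p.tp
  generalize ev p (dMs (B.field serM)) = L at hc ⊢
  simp only [map_neg, map_sub, map_zero, zero_mul, mul_zero, zero_add, add_zero,
    mul_add, add_mul, mul_sub, mul_neg]
  rw [← mul_assoc L p.tp, hc]
  abel

end FieldIteration

/-! ### Weights -/

/-- The terms of doubled weight less than `m` vanish. -/
def Wt (m : ℕ) (u : SSeries) : Prop := ∀ s n, 2 * n + s.card < m → u s n = 0

theorem Wt.mono {m m' : ℕ} {u : SSeries} (h : Wt m u) (hm : m' ≤ m) : Wt m' u :=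
  fun s n hn => h s n (by omega)

theorem Wt.add {m : ℕ} {u v : SSeries} (h : Wt m u) (h' : Wt m v) : Wt m (u + v) :=
  fun s n hn => by simp [h s n hn, h' s n hn]

theorem Wt.neg {m : ℕ} {u : SSeries} (h : Wt m u) : Wt m (-u) :=
  fun s n hn => by simp [h s n hn]

theorem Wt.sub {m : ℕ} {u v : SSeries} (h : Wt m u) (h' : Wt m v) : Wt m (u - v) :=
  fun s n hn => by simp [h s n hn, h' s n hn]

theorem Wt.smul {m : ℕ} {u : SSeries} (h : Wt m u) (c : ℂ) : Wt m (c • u) :=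
  fun s n hn => by simp [h s n hn]

theorem Wt.dx {m : ℕ} {u : SSeries} (h : Wt m u) : Wt (m - 2) (dx u) :=
  fun s n hn => by simp [N2Sphere.dx, h s (n + 1) (by omega)]

theorem Wt.dThetaP {m : ℕ} {u : SSeries} (h : Wt m u) : Wt (m - 1) (dThetaP u) := by
  intro s n hn
  cases s <;> simp only [N2Sphere.dThetaP, Sector.card] at hn ⊢
  · exact h _ _ (by simp only [Sector.card]; omega)
  · rfl
  · exact h _ _ (by simp only [Sector.card]; omega)
  · rfl

theorem Wt.dThetaM {m : ℕ} {u : SSeries} (h : Wt m u) : Wt (m - 1) (dThetaM u) := by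
  intro s n hn
  cases s <;> simp only [N2Sphere.dThetaM, Sector.card] at hn ⊢
  · exact h _ _ (by simp only [Sector.card]; omega)
  · rw [Pi.neg_apply, h _ _ (by simp only [Sector.card]; omega), neg_zero]
  · rfl
  · rfl

theorem Wt.thetaP {m : ℕ} {u : SSeries} (h : Wt m u) : Wt (m + 1) (thetaP u) := by
  intro s n hn
  cases s <;> simp only [N2Sphere.thetaP, Sector.card] at hn ⊢
  · rfl
  · exact h _ _ (by simp only [Sector.card]; omega)
  · rfl
  · exact h _ _ (by simp only [Sector.card]; omega)

theorem Wt.thetaM {m : ℕ} {u : SSeries} (h : Wt m u) : Wt (m + 1) (thetaM u) := by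
  intro s n hn
  cases s <;> simp only [N2Sphere.thetaM, Sector.card] at hn ⊢
  · rfl
  · rfl
  · exact h _ _ (by simp only [Sector.card]; omega)
  · rw [Pi.neg_apply, h _ _ (by simp only [Sector.card]; omega), neg_zero]

theorem Wt.xpow {m : ℕ} {u : SSeries} (h : Wt m u) (k : ℕ) : Wt (m + 2 * k) (xpow k u) := by
  intro s n hn
  simp only [N2Sphere.xpow]
  split_ifs
  · exact h _ _ (by omega)
  · rfl

theorem Wt.evenMul {m m' : ℕ} {u : SSeries} (h : Wt m u) {a : Grassmann} (ha : a ≠ 0 → m' ≤ m) :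
    Wt m' (evenMul a u) := by
  intro s n hn
  by_cases h0 : a = 0
  · simp [N2Sphere.evenMul, h0]
  · simp [N2Sphere.evenMul, h s n (by have := ha h0; omega)]

theorem Wt.oddMul {m m' : ℕ} {u : SSeries} (h : Wt m u) {a : Grassmann} (ha : a ≠ 0 → m' ≤ m) :
    Wt m' (oddMul a u) := by
  intro s n hn
  by_cases h0 : a = 0
  · simp [N2Sphere.oddMul, h0]
  · simp [N2Sphere.oddMul, h s n (by have := ha h0; omega)]

/-- The data of doubled weight less than `w` vanish. -/
def InfData.WtGe (B : InfData) (w : ℕ) : Prop :=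
  ∀ i, (2 * i + 1 < w → B.MP i = 0 ∧ B.MM i = 0) ∧ (2 * i + 2 < w → B.AP i = 0 ∧ B.AM i = 0)

theorem InfData.wtGe_one (B : InfData) : B.WtGe 1 := fun i => ⟨fun h => by omega, fun h => by omega⟩

theorem InfData.WtGe.term {B : InfData} {w : ℕ} (hB : B.WtGe w) {m : ℕ} {u : SSeries} (h : Wt m u)
    (i : ℕ) : Wt (m + w) (B.term i u) := by
  obtain ⟨h1, h2⟩ := hB i
  -- With `j = i + 1`, the operators `L_j` and `J_j` raise the doubled weight by `2 i + 2`, and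
  -- `G^±_{j-1/2}` raise it by `2 i + 1`.
  have e1 : (B.AP i : Grassmann) ≠ 0 → w ≤ 2 * i + 2 := fun h => by
    by_contra hc; exact h (by rw [(h2 (by omega)).1]; rfl)
  have e2 : (B.AM i : Grassmann) ≠ 0 → w ≤ 2 * i + 2 := fun h => by
    by_contra hc; exact h (by rw [(h2 (by omega)).2]; rfl)
  have e3 : (B.MP i : Grassmann) ≠ 0 → w ≤ 2 * i + 1 := fun h => by
    by_contra hc; exact h (by rw [(h1 (by omega)).1]; rfl)
  have e4 : (B.MM i : Grassmann) ≠ 0 → w ≤ 2 * i + 1 := fun h => by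
    by_contra hc; exact h (by rw [(h1 (by omega)).2]; rfl)
  refine (((Wt.evenMul (m := m + 2 * i + 2) ?_ ?_).add
    (Wt.evenMul (m := m + 2 * i + 2) ?_ ?_)).add
    (Wt.oddMul (m := m + 2 * i + 1) ?_ ?_)).add (Wt.oddMul (m := m + 2 * i + 1) ?_ ?_) |>.neg
  · exact (((h.dx.xpow _).mono (by omega)).add
      (((h.dThetaP.thetaP.mono (m' := m) (by omega)).add
        (h.dThetaM.thetaM.mono (m' := m) (by omega))).xpow _ |>.smul _ |>.mono (by omega))).neg
  · intro h; have := e1 h; omega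
  · exact (((h.dThetaP.thetaP.mono (m' := m) (by omega)).sub
        (h.dThetaM.thetaM.mono (m' := m) (by omega))).xpow _ |>.mono (by omega)).neg
  · intro h; have := e2 h; omega
  · exact ((((h.dThetaP.mono (m' := m - 1) (by omega)).sub
      (h.dx.thetaM.mono (m' := m - 1) (by omega))).xpow _ |>.mono (by omega)).add
      ((h.dThetaP.thetaM.thetaP.xpow _).smul _ |>.mono (by omega))).neg
  · intro h; have := e3 h; omega
  · exact ((((h.dThetaM.mono (m' := m - 1) (by omega)).sub
      (h.dx.thetaP.mono (m' := m - 1) (by omega))).xpow _ |>.mono (by omega)).sub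
      ((h.dThetaM.thetaM.thetaP.xpow _).smul _ |>.mono (by omega))).neg
  · intro h; have := e4 h; omega

theorem InfData.WtGe.field {B : InfData} {w : ℕ} (hB : B.WtGe w) {m : ℕ} {u : SSeries} (h : Wt m u) :
    Wt (m + w) (B.field u) := fun s n hn => by
  rw [B.field_apply]
  exact Finset.sum_eq_zero fun i _ => hB.term h i s n hn

theorem Wt.iterate {m : ℕ} {u : SSeries} (h : Wt m u) (B : InfData) (k : ℕ) :
    Wt (m + k) (B.field^[k] u) := by
  induction k with
  | zero => exact h
  | succ k ih => rw [Function.iterate_succ_apply']; exact B.wtGe_one.field ih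

theorem ev_of_wt {p : SPoint} {M m : ℕ} (hM : p.z ^ M = 0) {u : SSeries} (h : Wt m u)
    (hm : 2 * M < m) : ev p u = 0 := by
  rw [ev_congr (v := 0) hM, map_zero]
  intro s n hn
  refine h s n ?_
  cases s <;> simp only [Sector.card] <;> omega

/-! ### The exponential -/

/-- Partial sums of the exponential series. -/
def InfData.expSum (B : InfData) (K : ℕ) (u : SSeries) : SSeries :=
  ∑ k ∈ Finset.range K, ((k.factorial : ℂ))⁻¹ • B.field^[k] u

/-- The `k`-th iterate has doubled weight at least `k`, while a coefficient of `x ^ n` has doubled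
weight at most `2 n + 2`. -/
theorem InfData.exp_eq (B : InfData) (u : SSeries) (s : Sector) {n K : ℕ} (hK : 2 * n + 3 ≤ K) :
    B.exp u s n = B.expSum K u s n := by
  rw [InfData.expSum, Finset.sum_apply, Finset.sum_apply, InfData.exp]
  refine Finset.sum_subset (Finset.range_mono hK) fun k _ hk => ?_
  have h0 : Wt 0 u := fun s n h => by omega
  rw [h0.iterate B k s n, smul_zero]
  simp at hk
  cases s <;> simp only [Sector.card] <;> omega

theorem InfData.ev_exp (B : InfData) {p : SPoint} {M : ℕ} (hM : p.z ^ M = 0) (u : SSeries) {K : ℕ}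
    (hK : 2 * M + 3 ≤ K) : ev p (B.exp u) = ev p (B.expSum K u) ∧
      ev p (dPs (B.exp u)) = ev p (dPs (B.expSum K u)) ∧
      ev p (dMs (B.exp u)) = ev p (dMs (B.expSum K u)) := by
  -- The index `n = M` is included because the superderivatives at index `n` involve the coefficient
  -- of index `n + 1`.
  have e : ∀ s, ∀ n ≤ M, B.exp u s n = B.expSum K u s n := fun s n hn =>
    B.exp_eq u s (by omega)
  refine ⟨ev_congr hM fun s n hn => e s n hn.le, ev_congr hM fun s n hn => ?_,
    ev_congr hM fun s n hn => ?_⟩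
  · cases s <;> simp [dPs_apply, dThetaP, thetaM, dx, e _ n hn.le, e _ (n + 1) hn]
  · cases s <;> simp [dMs_apply, dThetaM, thetaP, dx, e _ n hn.le, e _ (n + 1) hn]

theorem InfData.exp_of_wt (B : InfData) {u : SSeries} {m : ℕ} (h : Wt m u) {s : Sector} {n : ℕ}
    (hn : 2 * n + s.card ≤ m) : B.exp u s n = u s n := by
  rw [InfData.exp, Finset.sum_range_succ']
  rw [Finset.sum_eq_zero fun k _ => by
    rw [h.iterate B (k + 1) s n (by omega), smul_zero], zero_add]
  simp

theorem EvenS.iterate {u : SSeries} (h : EvenS u) (B : InfData) (k : ℕ) : EvenS (B.field^[k] u) := by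
  induction k with
  | zero => exact h
  | succ k ih => rw [Function.iterate_succ_apply']; exact ih.field B

theorem OddS.iterate {u : SSeries} (h : OddS u) (B : InfData) (k : ℕ) : OddS (B.field^[k] u) := by
  induction k with
  | zero => exact h
  | succ k ih => rw [Function.iterate_succ_apply']; exact ih.field B

theorem EvenS.exp {u : SSeries} (h : EvenS u) (B : InfData) : EvenS (B.exp u) := fun p hp => by
  obtain ⟨M, hM⟩ := p.nilpotent hp
  rw [(B.ev_exp hM u le_rfl).1, InfData.expSum, map_sum]
  refine sum_mem fun k _ => ?_
  rw [map_smul]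
  exact smul_even _ (h.iterate B k p hp)

theorem OddS.exp {u : SSeries} (h : OddS u) (B : InfData) : OddS (B.exp u) := fun p hp => by
  obtain ⟨M, hM⟩ := p.nilpotent hp
  rw [(B.ev_exp hM u le_rfl).1, InfData.expSum, map_sum]
  refine sum_mem fun k _ => ?_
  rw [map_smul]
  exact GOdd.smul_mem _ (h.iterate B k p hp)

/-- Multiplication by a series, as a linear map. -/
def mulSL (a : SSeries) : SSeries →ₗ[ℂ] SSeries where
  toFun := mulS a
  map_add' u v := ev_injective fun p hp => by
    rw [map_add, ev_mulS hp, ev_mulS hp, ev_mulS hp, map_add, mul_add]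
  map_smul' c u := ev_injective fun p hp => by
    rw [RingHom.id_apply, map_smul, ev_mulS hp, ev_mulS hp, map_smul, mul_smul_comm]

theorem mulSL_apply (a u : SSeries) : mulSL a u = mulS a u := rfl

/-- The binomial formula when `S` obeys a Leibniz rule in which `T` acts on the left factor. It is
applied with `S = T + l`, the term of order zero being absorbed by the right factor. -/
theorem derivation_pow {T S : SSeries →ₗ[ℂ] SSeries} {m : SSeries → SSeries → SSeries}
    (hadd : ∀ (a b : SSeries), S (m a b) = m (T a) b + m a (S b)) (a b : SSeries) (n : ℕ) :
    (S ^ n) (m a b) = ∑ ij ∈ Finset.HasAntidiagonal.antidiagonal n,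
      n.choose ij.1 • m ((T ^ ij.1) a) ((S ^ ij.2) b) := by
  induction n with
  | zero => simp
  | succ n ih =>
    rw [pow_succ', Module.End.mul_apply, ih,
      Finset.sum_antidiagonal_choose_succ_nsmul (fun i j => m ((T ^ i) a) ((S ^ j) b)), map_sum,
      ← Finset.sum_add_distrib]
    refine Finset.sum_congr rfl fun ij h => ?_
    have : n.choose ij.2 = n.choose ij.1 := by
      rw [← Finset.HasAntidiagonal.mem_antidiagonal.1 h, Nat.choose_symm_add]
    rw [map_nsmul, hadd, this, ← Module.End.mul_apply, ← Module.End.mul_apply, ← pow_succ',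
      ← pow_succ', nsmul_add, add_comm]

theorem ev_mulS_derivs {p : SPoint} (hp : p.body = 0) (a b : SSeries) :
    ev p (dx (mulS a b)) = ev p (dx a) * ev p b + ev p a * ev p (dx b) ∧
    ev p (dThetaP (mulS a b)) = ev p (dThetaP a) * ev p b + parity (ev p a) * ev p (dThetaP b) ∧
    ev p (dThetaM (mulS a b)) = ev p (dThetaM a) * ev p b + parity (ev p a) * ev p (dThetaM b) := by
  have hodd : ∀ η ∈ GOdd, ∀ x y x' y' : Grassmann, (x + η * x') * (y + η * y') =
      x * y + η * (x' * y + parity x * y') := fun η hη x y x' y' => by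
    have h1 : η * (x' * (η * y')) = 0 := by
      rw [← mul_assoc x', ← mul_assoc, odd_mul_mul_self hη, zero_mul]
    have h2 : x * (η * y') = η * (parity x * y') := by
      rw [← mul_assoc, mul_odd_comm hη, mul_assoc]
    simp only [add_mul, mul_add, mul_assoc, h1, h2]
    abel
  refine ⟨even_cancel fun t ht => ?_, odd_cancel' fun η hη => ?_, odd_cancel' fun η hη => ?_⟩
  · have h := ev_shZ hp t ht (mulS a b)
    have h1 : (t : Grassmann) * (ev p (dx a) * (t * ev p (dx b))) = 0 := by
      rw [even_comm t.2, mul_assoc, mul_assoc, ← even_comm t.2 (ev p (dx b)), ← mul_assoc (t : Grassmann) t,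
        ht, zero_mul, mul_zero]
    have h2 : ev p a * ((t : Grassmann) * ev p (dx b)) = t * (ev p a * ev p (dx b)) := by
      rw [← mul_assoc, ← even_comm t.2, mul_assoc]
    rw [ev_mulS (by rwa [p.body_shZ_sq ht]), ev_shZ hp t ht, ev_shZ hp t ht, ev_mulS hp] at h
    simp only [add_mul, mul_add, mul_assoc, h1, h2] at h
    rw [add_zero, add_assoc, add_right_inj] at h
    rw [mul_add, ← h, add_comm]
  · have h := ev_addP p ⟨η, hη⟩ (mulS a b)
    rw [ev_mulS (p := p.addP ⟨η, hη⟩) hp, ev_addP, ev_addP, ev_mulS hp, hodd η hη, add_right_inj] at h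
    exact h.symm
  · have h := ev_addM p ⟨η, hη⟩ (mulS a b)
    rw [ev_mulS (p := p.addM ⟨η, hη⟩) hp, ev_addM, ev_addM, ev_mulS hp, hodd η hη, add_right_inj] at h
    exact h.symm

theorem field_mulS (B : InfData) (a b : SSeries) :
    B.field (mulS a b) = mulS (B.field a) b + mulS a (B.field b) := by
  refine ev_injective fun p hp => ?_
  obtain ⟨h1, h2, h3⟩ := ev_mulS_derivs hp a b
  rw [map_add, ev_mulS hp, ev_mulS hp, ev_field_eq B hp, ev_field_eq B hp a, ev_field_eq B hp b, h1,
    h2, h3]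
  have e1 := even_comm (field_even_serX B p hp) (ev p a)
  have e2 : ev p (B.field serP) * parity (ev p a) = ev p a * ev p (B.field serP) := by
    rw [odd_mul_comm (field_odd_serP B p hp), parity_parity]
  have e3 : ev p (B.field serM) * parity (ev p a) = ev p a * ev p (B.field serM) := by
    rw [odd_mul_comm (field_odd_serM B p hp), parity_parity]
  simp only [mul_add, add_mul, ← mul_assoc, e1, e2, e3]
  abel

/-- As `l` is even, `l (a b) = a (l b)`, so the multiplication term goes entirely to the second
factor. -/
theorem fieldL_add_mulSL (B : InfData) {l : SSeries} (hl : EvenS l) (a b : SSeries) :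
    (B.fieldL + mulSL l) (mulS a b) = mulS (B.fieldL a) b + mulS a ((B.fieldL + mulSL l) b) := by
  rw [LinearMap.add_apply, LinearMap.add_apply, B.fieldL_apply, B.fieldL_apply, B.fieldL_apply,
    field_mulS, mulSL_apply, mulSL_apply, add_assoc]
  congr 1
  refine ev_injective fun p hp => ?_
  rw [map_add, ev_mulS hp, ev_mulS hp, ev_mulS hp, ev_mulS hp, map_add, ev_mulS hp, mul_add,
    ← mul_assoc, ← mul_assoc, even_comm (hl p hp)]

theorem InfData.fieldL_pow (B : InfData) (k : ℕ) (u : SSeries) :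
    (B.fieldL ^ k) u = B.field^[k] u := Module.End.pow_apply _ _ _

theorem mulS_serOne (u : SSeries) : mulS u serOne = u :=
  ev_injective fun p hp => by rw [ev_mulS hp, ev_serOne hp, mul_one]

/-- The commutation relation says `D⁺ T = (T + l) D⁺` with `l = D⁺(Tφ⁺)`, and it iterates. -/
theorem dPs_iterate (B : InfData) (u : SSeries) (k : ℕ) : dPs (B.field^[k] u) =
    ((B.fieldL + mulSL (dPs (B.field serP))) ^ k) (dPs u) := by
  induction k with
  | zero => rfl
  | succ k ih =>
    rw [Function.iterate_succ_apply', dPs_field, ih, pow_succ', Module.End.mul_apply]; rfl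

theorem dMs_iterate (B : InfData) (u : SSeries) (k : ℕ) : dMs (B.field^[k] u) =
    ((B.fieldL + mulSL (dMs (B.field serM))) ^ k) (dMs u) := by
  induction k with
  | zero => rfl
  | succ k ih =>
    rw [Function.iterate_succ_apply', dMs_field, ih, pow_succ', Module.End.mul_apply]; rfl

theorem dPs_ser : dPs serX = serM ∧ dPs serP = serOne ∧ dPs serM = 0 := by
  obtain ⟨h1, h2, h3⟩ := dThetaP_ser
  refine ⟨?_, ?_, ?_⟩
  · rw [dPs_apply, h1, dx_serX_eq, serM_eq, zero_add]
  · rw [dPs_apply, h2, dx_serP]; funext s n; cases s <;> simp [thetaM]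
  · rw [dPs_apply, h3, dx_serM]; funext s n; cases s <;> simp [thetaM]

theorem dMs_ser : dMs serX = serP ∧ dMs serP = 0 ∧ dMs serM = serOne := by
  obtain ⟨h1, h2, h3⟩ := dThetaM_ser
  refine ⟨?_, ?_, ?_⟩
  · rw [dMs_apply, h1, dx_serX_eq, serP_eq, zero_add]
  · rw [dMs_apply, h2, dx_serP]; funext s n; cases s <;> simp [thetaP]
  · rw [dMs_apply, h3, dx_serM]; funext s n; cases s <;> simp [thetaP]

theorem Wt.dPs {m : ℕ} {u : SSeries} (h : Wt m u) : Wt (m - 1) (dPs u) :=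
  h.dThetaP.add (h.dx.thetaM.mono (by omega))

theorem Wt.dMs {m : ℕ} {u : SSeries} (h : Wt m u) : Wt (m - 1) (dMs u) :=
  h.dThetaM.add (h.dx.thetaP.mono (by omega))

/-- Writing `a = a · 1`, the binomial formula gives `exp(S) a = exp(T) a · exp(S) 1`. At a nilpotent
point both exponentials terminate after `K` terms, so the range `N ≥ 2 K` contains the full Cauchy
product. -/
theorem exp_product {S : SSeries →ₗ[ℂ] SSeries} {p : SPoint} (hp : p.body = 0) (B : InfData)
    (hS : ∀ a b : SSeries, S (mulS a b) = mulS (B.fieldL a) b + mulS a (S b)) (a : SSeries) {K N : ℕ}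
    (h1 : ∀ k, K ≤ k → ev p (B.field^[k] a) = 0) (h2 : ∀ k, K ≤ k → ev p ((S ^ k) serOne) = 0)
    (hN : K + K ≤ N) :
    ∑ k ∈ Finset.range N, ((k.factorial : ℂ))⁻¹ • ev p ((S ^ k) a) =
      (∑ k ∈ Finset.range N, ((k.factorial : ℂ))⁻¹ • ev p (B.field^[k] a)) *
        ∑ k ∈ Finset.range N, ((k.factorial : ℂ))⁻¹ • ev p ((S ^ k) serOne) := by
  have trunc : ∀ f : ℕ → Grassmann, (∀ k, K ≤ k → f k = 0) →
      ∑ k ∈ Finset.range N, ((k.factorial : ℂ))⁻¹ • f k =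
        ∑ k ∈ Finset.range K, ((k.factorial : ℂ))⁻¹ • f k := fun f hf =>
    (Finset.sum_subset (Finset.range_mono (by omega)) fun k _ hk => by
      rw [hf k (by simpa using hk), smul_zero]).symm
  rw [trunc _ h1, trunc _ h2, ← cauchy_sum (N := N) (fun k hk => by rw [h1 k hk, smul_zero])
    (fun k hk => by rw [h2 k hk, smul_zero]) hN]
  refine Finset.sum_congr rfl fun n _ => ?_
  have := derivation_pow hS a serOne n
  rw [mulS_serOne] at this
  rw [this, conv, map_sum, Finset.smul_sum]
  refine Finset.sum_congr rfl fun ij hij => ?_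
  have hn := Finset.HasAntidiagonal.mem_antidiagonal.1 hij
  rw [map_nsmul, ev_mulS hp, B.fieldL_pow, smul_mul_smul_comm, ← Nat.cast_smul_eq_nsmul ℂ, smul_smul]
  congr 1
  subst hn
  have h0 : ((ij.1 + ij.2).choose ij.1 : ℂ) * ij.1.factorial * ij.2.factorial =
      (ij.1 + ij.2).factorial := by
    have := Nat.choose_mul_factorial_mul_factorial (Nat.le_add_right ij.1 ij.2)
    rw [Nat.add_sub_cancel_left] at this
    exact_mod_cast this
  have h1 : ((ij.1 + ij.2).factorial : ℂ) ≠ 0 := by exact_mod_cast Nat.factorial_ne_zero _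
  have h2 : (ij.1.factorial : ℂ) ≠ 0 := by exact_mod_cast Nat.factorial_ne_zero _
  have h3 : (ij.2.factorial : ℂ) ≠ 0 := by exact_mod_cast Nat.factorial_ne_zero _
  field_simp
  linear_combination h0

theorem map_expSum {E : Type*} [AddCommGroup E] [Module ℂ E] (f : SSeries →ₗ[ℂ] E) (B : InfData)
    (K : ℕ) (u : SSeries) : f (B.expSum K u) =
      ∑ k ∈ Finset.range K, ((k.factorial : ℂ))⁻¹ • f (B.field^[k] u) := by
  rw [InfData.expSum, map_sum]
  simp only [map_smul]

/-- The exponential satisfies the superconformal equations. -/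
theorem exp_conformal (B : InfData) {p : SPoint} (hp : p.body = 0) :
    ev p (dPs (B.exp serM)) = 0 ∧ ev p (dMs (B.exp serP)) = 0 ∧
    ev p (dPs (B.exp serX)) = ev p (B.exp serM) * ev p (dPs (B.exp serP)) ∧
    ev p (dMs (B.exp serX)) = ev p (B.exp serP) * ev p (dMs (B.exp serM)) := by
  obtain ⟨M, hM⟩ := p.nilpotent hp
  obtain ⟨a1, a2, a3⟩ := dPs_ser
  obtain ⟨b1, b2, b3⟩ := dMs_ser
  have h0 : ∀ u, Wt 0 u := fun u s n h => by omega
  have e1 : ∀ u k, 2 * M + 3 ≤ k → ev p (B.field^[k] u) = 0 := fun u k hk =>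
    ev_of_wt hM ((h0 u).iterate B k) (by omega)
  -- For `D u = 1` and `D v = a`: `D exp(T) v = exp(T + l) a = exp(T) a · exp(T + l) 1 = exp(T) a ·
  -- D exp(T) u`. The cases are `D⁺` with `u = φ⁺`, `v = x`, `a = φ⁻`, and the same with the signs
  -- exchanged.
  have key : ∀ (D : SSeries →ₗ[ℂ] SSeries) (l a u v : SSeries), EvenS l →
      (∀ k, D (B.field^[k] u) = ((B.fieldL + mulSL l) ^ k) serOne) →
      (∀ k, D (B.field^[k] v) = ((B.fieldL + mulSL l) ^ k) a) →
      (∀ k, 2 * M + 3 ≤ k → ev p (D (B.field^[k] u)) = 0) → ∀ N, (2 * M + 3) + (2 * M + 3) ≤ N →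
      ev p (D (B.expSum N v)) = ev p (B.expSum N a) * ev p (D (B.expSum N u)) := by
    intro D l a u v hl hu hv h N hN
    have := map_expSum (ev p ∘ₗ D) B N
    simp only [LinearMap.comp_apply] at this
    rw [this, this, map_expSum]
    simp only [hu, hv] at h ⊢
    exact exp_product hp B (fieldL_add_mulSL B hl) a (e1 a) h hN
  have f := fun u => B.ev_exp hM u (K := (2 * M + 3) + (2 * M + 3)) (by omega)
  have g1 := map_expSum (ev p ∘ₗ dPs) B ((2 * M + 3) + (2 * M + 3)) serM
  have g2 := map_expSum (ev p ∘ₗ dMs) B ((2 * M + 3) + (2 * M + 3)) serP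
  simp only [LinearMap.comp_apply, dPs_iterate, dMs_iterate, a3, b2, map_zero, smul_zero,
    Finset.sum_const_zero] at g1 g2
  refine ⟨(f _).2.1.trans g1, (f _).2.2.trans g2, ?_, ?_⟩
  · rw [(f _).2.1, (f _).2.1, (f _).1]
    refine key dPs _ serM serP serX ((field_odd_serP B).dPs) (fun k => by rw [dPs_iterate, a2])
      (fun k => by rw [dPs_iterate, a1]) (fun k hk => ?_) _ le_rfl
    exact ev_of_wt hM ((h0 serP).iterate B k).dPs (by omega)
  · rw [(f _).2.2, (f _).2.2, (f _).1]
    refine key dMs _ serP serM serX ((field_odd_serM B).dMs) (fun k => by rw [dMs_iterate, b3])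
      (fun k => by rw [dMs_iterate, b1]) (fun k hk => ?_) _ le_rfl
    exact ev_of_wt hM ((h0 serM).iterate B k).dMs (by omega)

/-! ### Formal superconformal maps -/

/-- `H` has the expansion `h` at `0`. -/
def FormalMap.Rep (h : FormalMap) (H : SPoint → SPoint) : Prop :=
  ∀ p : SPoint, p.body = 0 → (H p).z = ev p h.z ∧ (H p).tp = ev p h.tp ∧ (H p).tm = ev p h.tm

/-- `H` is superconformal at the points with body `0`, with invertible derivative, and fixes `0`. -/
def ConfZero (H : SPoint → SPoint) : Prop :=
  H SPoint.origin = SPoint.origin ∧ ∀ p : SPoint, p.body = 0 →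
    (∃ c : GEven, gbody c ≠ 0 ∧ RelP H p c) ∧ ∃ c : GEven, gbody c ≠ 0 ∧ RelM H p c

/-- `h` is the expansion of a superconformal map. -/
def FormalMap.Conf (h : FormalMap) : Prop := ∃ H, h.Rep H ∧ ConfZero H

theorem gbody_evz {z : Grassmann} (hz : gbody z = 0) (hn : IsNilpotent z) (a : ℕ → Grassmann) :
    gbody (evz z a) = gbody (a 0) := by
  obtain ⟨M, hM⟩ := hn
  rw [evz_eq (M := M + 1) (pow_eq_zero_of_le (Nat.le_succ _) hM), Finset.sum_range_succ']
  have : ∀ n ∈ Finset.range M, gbodyL (a (n + 1) * z ^ (n + 1)) = 0 := fun n _ => by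
    rw [gbodyL_apply, pow_succ, gbody_mul, gbody_mul, hz, mul_zero, mul_zero]
  rw [gbody_add, ← gbodyL_apply, map_sum, Finset.sum_eq_zero this]
  simp

theorem gbody_ev {p : SPoint} (hp : p.body = 0) (u : SSeries) :
    gbody (ev p u) = gbody (u .one 0) := by
  simp [ev_apply, assemble, gbody_odd p.tp_odd, gbody_odd p.tm_odd,
    gbody_evz hp (p.nilpotent hp)]

theorem FormalMap.Rep.parity {h : FormalMap} {H : SPoint → SPoint} (hr : h.Rep H) :
    EvenS h.z ∧ OddS h.tp ∧ OddS h.tm := by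
  refine ⟨fun p hp => ?_, fun p hp => ?_, fun p hp => ?_⟩
  · rw [← (hr p hp).1]; exact (H p).z_even
  · rw [← (hr p hp).2.1]; exact (H p).tp_odd
  · rw [← (hr p hp).2.2]; exact (H p).tm_odd

/-- Cancelling the odd parameter turns the intertwining relation into differential equations between
the values of the series. -/
theorem FormalMap.Rep.relP {h : FormalMap} {H : SPoint → SPoint} (hr : h.Rep H) {p : SPoint}
    (hp : p.body = 0) {c : GEven} : RelP H p c ↔
      ev p (dPs h.tp) = c ∧ ev p (dPs h.tm) = 0 ∧ ev p (dPs h.z) = c * ev p h.tm := by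
  obtain ⟨v1, v2, v3⟩ := hr p hp
  have w := fun η => hr (p.shP η) (by rw [p.body_shP, hp])
  rw [relP_coords]
  simp only [w, v1, v2, v3, ev_shP hp, add_right_inj, add_eq_left]
  refine ⟨fun H => ⟨odd_cancel' fun η hη => (H ⟨η, hη⟩).2.1, odd_cancel fun η hη => (H ⟨η, hη⟩).2.2,
    odd_cancel' fun η hη => (H ⟨η, hη⟩).1⟩, fun ⟨h1, h2, h3⟩ η => ?_⟩
  rw [h1, h2, h3, mul_zero]
  exact ⟨rfl, rfl, rfl⟩

theorem FormalMap.Rep.relM {h : FormalMap} {H : SPoint → SPoint} (hr : h.Rep H) {p : SPoint}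
    (hp : p.body = 0) {c : GEven} : RelM H p c ↔
      ev p (dMs h.tm) = c ∧ ev p (dMs h.tp) = 0 ∧ ev p (dMs h.z) = c * ev p h.tp := by
  obtain ⟨v1, v2, v3⟩ := hr p hp
  have w := fun η => hr (p.shM η) (by rw [p.body_shM, hp])
  rw [relM_coords]
  simp only [w, v1, v2, v3, ev_shM hp, add_right_inj, add_eq_left]
  refine ⟨fun H => ⟨odd_cancel' fun η hη => (H ⟨η, hη⟩).2.2, odd_cancel fun η hη => (H ⟨η, hη⟩).2.1,
    odd_cancel' fun η hη => (H ⟨η, hη⟩).1⟩, fun ⟨h1, h2, h3⟩ η => ?_⟩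
  rw [h1, h2, h3, mul_zero]
  exact ⟨rfl, rfl, rfl⟩

/-- A map with the given expansion at `0`. -/
theorem FormalMap.exists_rep {h : FormalMap} (h1 : EvenS h.z) (h2 : OddS h.tp) (h3 : OddS h.tm) :
    ∃ H, h.Rep H := by
  classical
  refine ⟨fun p => if hp : p.body = 0 then ⟨_, _, _, h1 p hp, h2 p hp, h3 p hp⟩ else p,
    fun p hp => ?_⟩
  simp only [dif_pos hp, and_self]

/-- The equations are those of `exp_conformal`. Since the exponential is the identity up to terms of
higher weight, it fixes the origin and its odd derivatives have body one. -/
theorem Etilde_conf (B : InfData) : (Etilde B).Conf := by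
  have wX : Wt 2 serX := fun s n hn => by
    cases s <;> simp only [serX, Sector.card] at hn ⊢
    exact if_neg (by omega)
  have wP : Wt 1 serP := fun s n hn => by
    cases s <;> simp only [serP, Sector.card] at hn ⊢
    exact if_neg (by omega)
  have wM : Wt 1 serM := fun s n hn => by
    cases s <;> simp only [serM, Sector.card] at hn ⊢
    exact if_neg (by omega)
  have eX : EvenS serX := fun p hp => by rw [ev_serX hp]; exact p.z_even
  have eP : OddS serP := fun p hp => by rw [ev_serP hp]; exact p.tp_odd
  have eM : OddS serM := fun p hp => by rw [ev_serM hp]; exact p.tm_odd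
  obtain ⟨H, hH⟩ := FormalMap.exists_rep (h := Etilde B) (eX.exp B) (eP.exp B) (eM.exp B)
  refine ⟨H, hH, ?_, fun p hp => ?_⟩
  · obtain ⟨v1, v2, v3⟩ := hH SPoint.origin (by simp [SPoint.body, SPoint.origin])
    rw [ev_origin] at v1 v2 v3
    ext
    · rw [v1]
      change B.exp serX .one 0 = 0
      rw [B.exp_of_wt wX (by simp [Sector.card])]; simp [serX]
    · rw [v2]
      change B.exp serP .one 0 = 0
      rw [B.exp_of_wt wP (by simp [Sector.card])]; simp [serP]
    · rw [v3]
      change B.exp serM .one 0 = 0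
      rw [B.exp_of_wt wM (by simp [Sector.card])]; simp [serM]
  · obtain ⟨c1, c2, c3, c4⟩ := exp_conformal B hp
    have k1 := (eP.exp B).dPs p hp
    have k2 := (eM.exp B).dMs p hp
    refine ⟨⟨⟨_, k1⟩, ?_, (hH.relP hp).2 ⟨rfl, c1, ?_⟩⟩, ⟨_, k2⟩, ?_, (hH.relM hp).2 ⟨rfl, c2, ?_⟩⟩
    · rw [gbody_ev hp]
      have : (dPs (B.exp serP)) .one 0 = 1 := by
        simp only [dPs_apply, Pi.add_apply, dThetaP, thetaM]
        rw [B.exp_of_wt wP (by simp [Sector.card])]; simp [serP]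
      rw [this]; simp
    · rw [even_comm k1]; exact c3
    · rw [gbody_ev hp]
      have : (dMs (B.exp serM)) .one 0 = 1 := by
        simp only [dMs_apply, Pi.add_apply, dThetaM, thetaP]
        rw [B.exp_of_wt wM (by simp [Sector.card])]; simp [serM]
      rw [this]; simp
    · rw [even_comm k2]; exact c4

/-- The scaling `(z, θ⁺, θ⁻) ↦ (vwz, vθ⁺, wθ⁻)`. -/
def SPoint.scale (v w : GEven) (p : SPoint) : SPoint :=
  ⟨v * w * p.z, v * p.tp, w * p.tm, even_mul_even (even_mul_even v.2 w.2) p.z_even,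
    even_mul_odd v.2 p.tp_odd, even_mul_odd w.2 p.tm_odd⟩

theorem relP_scale (v w : GEven) (p : SPoint) : RelP (SPoint.scale v w) p v := fun η => by
  have h := even_comm v.2 (η : Grassmann)
  have h' := even_comm w.2 (η : Grassmann)
  ext
  · simp only [SPoint.scale, SPoint.shP, mul_add, coe_oddSMul, ← mul_assoc, ← h]
    rw [mul_assoc (v : Grassmann) w η, h', ← mul_assoc]
  · simp only [SPoint.scale, SPoint.shP, mul_add, coe_oddSMul, ← h]
  · rfl

theorem relM_scale (v w : GEven) (p : SPoint) : RelM (SPoint.scale v w) p w := fun η => by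
  have h := even_comm v.2 (η : Grassmann)
  have h' := even_comm w.2 (η : Grassmann)
  ext
  · simp only [SPoint.scale, SPoint.shM, mul_add, coe_oddSMul, ← mul_assoc, ← h']
    rw [even_comm v.2 w, mul_assoc (w : Grassmann) v η, h, ← mul_assoc]
  · rfl
  · simp only [SPoint.scale, SPoint.shM, mul_add, coe_oddSMul, ← h']

theorem scale_origin (v w : GEven) : SPoint.scale v w SPoint.origin = SPoint.origin := by
  ext <;> simp [SPoint.scale, SPoint.origin]

/-- The scaling of a formal map. -/
def FormalMap.scale (v w : GEven) (h : FormalMap) : FormalMap :=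
  ⟨evenMul (v * w) h.z, evenMul v h.tp, evenMul w h.tm⟩

theorem FormalMap.Rep.scale {h : FormalMap} {H : SPoint → SPoint} (hr : h.Rep H) (v w : GEven) :
    (h.scale v w).Rep fun p => (H p).scale v w := fun p hp => by
  obtain ⟨v1, v2, v3⟩ := hr p hp
  simp only [FormalMap.scale, SPoint.scale, ev_evenMul p v.2, ev_evenMul p w.2,
    ev_evenMul p (even_mul_even v.2 w.2), v1, v2, v3, and_self]

theorem ConfZero.scale {H : SPoint → SPoint} (h : ConfZero H) {v w : GEven} (hv : gbody v ≠ 0)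
    (hw : gbody w ≠ 0) : ConfZero fun p => (H p).scale v w := by
  refine ⟨by simp only [h.1, scale_origin], fun p hp => ?_⟩
  obtain ⟨⟨c, hc, hc'⟩, ⟨d, hd, hd'⟩⟩ := h.2 p hp
  exact ⟨⟨c * v, by simp [hc, hv], hc'.comp (relP_scale v w _)⟩,
    ⟨d * w, by simp [hd, hw], hd'.comp (relM_scale v w _)⟩⟩

theorem FormalMap.Conf.scale {h : FormalMap} (hc : h.Conf) {v w : GEven} (hv : gbody v ≠ 0)
    (hw : gbody w ≠ 0) : (h.scale v w).Conf := by
  obtain ⟨H, hr, hz⟩ := hc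
  exact ⟨_, hr.scale v w, hz.scale hv hw⟩

/-- Each Taylor coefficient is, up to a non-zero factor, the value at the origin of an iterated
derivative, so the parity of values passes to coefficients. -/
theorem OddS.mem {u : SSeries} (h : OddS u) (n : ℕ) : u .one n ∈ GOdd ∧ u .p n ∈ GEven ∧
    u .m n ∈ GEven := by
  have key : ∀ n, (∀ u : SSeries, OddS u → u .one n ∈ GOdd) ∧ ∀ u : SSeries, EvenS u → u .one n ∈ GEven := by
    intro n
    induction n with
    | zero => exact ⟨fun u h => by rw [← ev_origin u]; exact h _ (by simp [SPoint.body, SPoint.origin]),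
        fun u h => by rw [← ev_origin u]; exact h _ (by simp [SPoint.body, SPoint.origin])⟩
    | succ n ih =>
      have hn : ((n : ℂ) + 1) ≠ 0 := by exact_mod_cast Nat.succ_ne_zero n
      exact ⟨fun u h => (GOdd.smul_mem_iff hn).1 (ih.1 _ h.derivs.1),
        fun u h => by
          have := ih.2 _ h.derivs.1
          have h2 := smul_even ((n : ℂ) + 1)⁻¹ this
          rwa [dx, smul_smul, inv_mul_cancel₀ hn, one_smul] at h2⟩
  exact ⟨(key n).1 u h, (key n).2 _ h.derivs.2.1, (key n).2 _ h.derivs.2.2⟩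

theorem FormalMap.Conf.eqs {h : FormalMap} (hc : h.Conf) :
    dPs h.tm = 0 ∧ dMs h.tp = 0 ∧ (h.z .one 0 = 0 ∧ h.tp .one 0 = 0 ∧ h.tm .one 0 = 0) ∧
    gbody (h.tp .p 0) ≠ 0 ∧ gbody (h.tm .m 0) ≠ 0 := by
  obtain ⟨H, hr, h0, hz⟩ := hc
  have ho : SPoint.origin.body = 0 := by simp [SPoint.body, SPoint.origin]
  refine ⟨ev_injective fun p hp => ?_, ev_injective fun p hp => ?_, ?_, ?_, ?_⟩
  · obtain ⟨⟨c, _, hc'⟩, _⟩ := hz p hp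
    rw [((hr.relP hp).1 hc').2.1, map_zero]
  · obtain ⟨_, ⟨c, _, hc'⟩⟩ := hz p hp
    rw [((hr.relM hp).1 hc').2.1, map_zero]
  · obtain ⟨v1, v2, v3⟩ := hr SPoint.origin ho
    rw [ev_origin, h0] at v1 v2 v3
    exact ⟨v1.symm, v2.symm, v3.symm⟩
  · obtain ⟨⟨c, hc, hc'⟩, _⟩ := hz _ ho
    rw [← ((hr.relP ho).1 hc').1, ev_origin] at hc
    simpa [dPs_apply, dThetaP, thetaM] using hc
  · obtain ⟨_, ⟨c, hc, hc'⟩⟩ := hz _ ho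
    rw [← ((hr.relM ho).1 hc').1, ev_origin] at hc
    simpa [dMs_apply, dThetaM, thetaP] using hc

/-- `D⁻u = 0` is a chirality condition: the coefficient of `φ⁻` is zero and that of `φ⁺φ⁻` is the
derivative of the coefficient of `1`. -/
theorem eq_of_dMs_eq_zero {u u' : SSeries} (h : dMs u = 0) (h' : dMs u' = 0) (h1 : u .one = u' .one)
    (h2 : u .p = u' .p) : u = u' := by
  have e1 := fun s n => congrFun (congrFun h s) n
  have e2 := fun s n => congrFun (congrFun h' s) n
  funext s n
  cases s
  · rw [h1]
  · rw [h2]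
  · have a := e1 .one n
    have b := e2 .one n
    simp only [dMs_apply, Pi.add_apply, dThetaM, thetaP, Pi.zero_apply, add_zero] at a b
    rw [a, b]
  · have a := e1 .p n
    have b := e2 .p n
    simp only [dMs_apply, Pi.add_apply, dThetaM, thetaP, Pi.zero_apply, Pi.neg_apply, dx,
      neg_add_eq_zero] at a b
    rw [a, b, h1]

theorem eq_of_dPs_eq_zero {u u' : SSeries} (h : dPs u = 0) (h' : dPs u' = 0) (h1 : u .one = u' .one)
    (h2 : u .m = u' .m) : u = u' := by
  have e1 := fun s n => congrFun (congrFun h s) n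
  have e2 := fun s n => congrFun (congrFun h' s) n
  funext s n
  cases s
  · rw [h1]
  · have a := e1 .one n
    have b := e2 .one n
    simp only [dPs_apply, Pi.add_apply, dThetaP, thetaM, Pi.zero_apply, add_zero] at a b
    rw [a, b]
  · rw [h2]
  · have a := e1 .m n
    have b := e2 .m n
    simp only [dPs_apply, Pi.add_apply, dThetaP, thetaM, Pi.zero_apply, dx] at a b
    rw [eq_neg_of_add_eq_zero_left a, eq_neg_of_add_eq_zero_left b, h1]

/-- `D⁺` and `D⁻` anticommute to `2 ∂/∂x`, so a series killed by both is constant; the components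
show this directly, since `∂u_1 + u_pm` and `∂u_1 - u_pm` vanish. -/
theorem eq_zero_of_derivs {u : SSeries} (h : dPs u = 0) (h' : dMs u = 0) (h0 : u .one 0 = 0) :
    u = 0 := by
  have e1 := fun s n => congrFun (congrFun h s) n
  have e2 := fun s n => congrFun (congrFun h' s) n
  have k : ∀ n, u .pm n = 0 ∧ u .one (n + 1) = 0 := fun n => by
    have a := e1 .m n
    have b := e2 .p n
    simp only [dPs_apply, dMs_apply, Pi.add_apply, dThetaP, dThetaM, thetaP, thetaM, Pi.zero_apply,
      Pi.neg_apply, dx] at a b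
    have c : (2 : ℂ) • u .pm n = 0 := by
      rw [two_smul]
      have := congrArg₂ (· - ·) a b
      simpa using this
    have d : u .pm n = 0 := by simpa using c
    rw [d, zero_add, smul_eq_zero] at a
    exact ⟨d, a.resolve_left (by exact_mod_cast Nat.succ_ne_zero n)⟩
  funext s n
  cases s
  · rcases n with _ | n
    · exact h0
    · exact (k n).2
  · have := e1 .one n
    simpa [dPs_apply, dThetaP, thetaM] using this
  · have := e2 .one n
    simpa [dMs_apply, dThetaM, thetaP] using this
  · exact (k n).1

/-- Superconformal maps with the same leading terms of the odd components are equal. -/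
theorem FormalMap.Conf.ext {h h' : FormalMap} (hc : h.Conf) (hc' : h'.Conf)
    (h1 : h.tp .one = h'.tp .one) (h2 : h.tp .p = h'.tp .p) (h3 : h.tm .one = h'.tm .one)
    (h4 : h.tm .m = h'.tm .m) : h = h' := by
  obtain ⟨a1, a2, ⟨a3, _⟩, _⟩ := hc.eqs
  obtain ⟨b1, b2, ⟨b3, _⟩, _⟩ := hc'.eqs
  have e1 : h.tp = h'.tp := eq_of_dMs_eq_zero a2 b2 h1 h2
  have e2 : h.tm = h'.tm := eq_of_dPs_eq_zero a1 b1 h3 h4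
  obtain ⟨H, hr, h0, hz⟩ := hc
  obtain ⟨H', hr', h0', hz'⟩ := hc'
  -- The odd components determine `D^±` of the even one, which therefore is determined up to a
  -- constant; the constant is zero because the origin is fixed.
  have e3 : h.z = h'.z := by
    refine sub_eq_zero.1 (eq_zero_of_derivs ?_ ?_ ?_)
    · refine ev_injective fun p hp => ?_
      obtain ⟨⟨c, _, hc⟩, _⟩ := hz p hp
      obtain ⟨⟨c', _, hc'⟩, _⟩ := hz' p hp
      obtain ⟨c1, _, c3⟩ := (hr.relP hp).1 hc
      obtain ⟨d1, _, d3⟩ := (hr'.relP hp).1 hc'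
      rw [map_sub, map_sub, map_zero, c3, d3, ← c1, ← d1, e1, e2, sub_self]
    · refine ev_injective fun p hp => ?_
      obtain ⟨_, c, _, hc⟩ := hz p hp
      obtain ⟨_, c', _, hc'⟩ := hz' p hp
      obtain ⟨c1, _, c3⟩ := (hr.relM hp).1 hc
      obtain ⟨d1, _, d3⟩ := (hr'.relM hp).1 hc'
      rw [map_sub, map_sub, map_zero, c3, d3, ← c1, ← d1, e1, e2, sub_self]
    · rw [Pi.sub_apply, Pi.sub_apply, a3, b3, sub_zero]
  cases h; cases h'
  simp_all

/-! ### The data of a formal superconformal map -/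

/-- The difference of data. -/
def InfData.sub (B B' : InfData) : InfData :=
  ⟨fun i => B.AP i - B'.AP i, fun i => B.AM i - B'.AM i, fun i => B.MP i - B'.MP i,
    fun i => B.MM i - B'.MM i⟩

theorem InfData.field_sub (B B' : InfData) (u : SSeries) :
    (B.sub B').field u = B.field u - B'.field u := by
  funext s n
  rw [Pi.sub_apply, Pi.sub_apply, InfData.field_apply, InfData.field_apply, InfData.field_apply,
    ← Finset.sum_sub_distrib]
  refine Finset.sum_congr rfl fun i _ => ?_
  simp only [InfData.term, InfData.sub, evenMul, oddMul, Pi.add_apply, Pi.neg_apply,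
    AddSubgroupClass.coe_sub, sub_mul, smul_sub]
  abel

/-- The difference telescopes into terms with exactly one factor `T - T'`, which raises the doubled
weight by `w`; each of the other `k` factors raises it by at least one. -/
theorem iterate_sub {B B' : InfData} {w m : ℕ} (h : (B.sub B').WtGe w) {u : SSeries} (hu : Wt m u)
    (k : ℕ) : Wt (m + w + k) (B.field^[k + 1] u - B'.field^[k + 1] u) := by
  induction k with
  | zero =>
    rw [zero_add, Function.iterate_one, Function.iterate_one, ← InfData.field_sub]
    exact h.field hu
  | succ k ih =>
    rw [Function.iterate_succ_apply', Function.iterate_succ_apply' _ (k + 1)]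
    have e : B.field (B.field^[k + 1] u) - B'.field (B'.field^[k + 1] u) =
        B.field (B.field^[k + 1] u - B'.field^[k + 1] u) + (B.sub B').field (B'.field^[k + 1] u) := by
      rw [InfData.field_sub, ← B.fieldL_apply (_ - _), map_sub, B.fieldL_apply, B.fieldL_apply]
      abel
    rw [e]
    exact (B.wtGe_one.field ih).add ((h.field (hu.iterate B' (k + 1))).mono (by omega))

/-- The leading term of the difference of two exponentials. -/
theorem exp_sub {B B' : InfData} {w m : ℕ} (h : (B.sub B').WtGe w) {u : SSeries} (hu : Wt m u)
    {s : Sector} {n : ℕ} (hn : 2 * n + s.card ≤ m + w) :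
    B.exp u s n - B'.exp u s n = (B.sub B').field u s n := by
  rw [InfData.exp, InfData.exp, ← Finset.sum_sub_distrib, Finset.sum_eq_single 1]
  · simp [InfData.field_sub]
  · intro k _ hk
    rw [← smul_sub]
    rcases k with _ | _ | k
    · simp
    · exact absurd rfl hk
    · have := iterate_sub h hu (k + 1) s n (by omega)
      rw [Pi.sub_apply, Pi.sub_apply] at this
      rw [this, smul_zero]
  · intro h; simp at h

theorem wt_serP : Wt 1 serP := fun s n hn => by
  cases s <;> simp only [serP, Sector.card] at hn ⊢
  exact if_neg (by omega)

theorem wt_serM : Wt 1 serM := fun s n hn => by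
  cases s <;> simp only [serM, Sector.card] at hn ⊢
  exact if_neg (by omega)

theorem oddS_serP : OddS serP := fun p hp => by rw [ev_serP hp]; exact p.tp_odd

theorem oddS_serM : OddS serM := fun p hp => by rw [ev_serM hp]; exact p.tm_odd

/-- The coefficient of `x ^ (i + 1)` in the odd series has doubled weight `2 i + 2`, the weight one
of `φ^±` plus that of `M^±` of index `i`, so only the linear term of the exponential contributes. -/
theorem exp_odd_sub {B B' : InfData} {w i : ℕ} (h : (B.sub B').WtGe w) (hw : 2 * i + 1 ≤ w) :
    B.exp serP .one (i + 1) - B'.exp serP .one (i + 1) = (B.MP i - B'.MP i : GOdd) ∧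
    B.exp serM .one (i + 1) - B'.exp serM .one (i + 1) = (B.MM i - B'.MM i : GOdd) := by
  rw [exp_sub h wt_serP (by simp only [Sector.card]; omega),
    exp_sub h wt_serM (by simp only [Sector.card]; omega)]
  simp [InfData.field_serP_one, InfData.field_serM_one, InfData.sub]

theorem exp_even_sub {B B' : InfData} {w i : ℕ} (h : (B.sub B').WtGe w) (hw : 2 * i + 2 ≤ w) :
    B.exp serP .p (i + 1) - B'.exp serP .p (i + 1) =
      (((i : ℂ) + 1 + 1) / 2) • (B.AP i - B'.AP i : Grassmann) + (B.AM i - B'.AM i) ∧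
    B.exp serM .m (i + 1) - B'.exp serM .m (i + 1) =
      (((i : ℂ) + 1 + 1) / 2) • (B.AP i - B'.AP i : Grassmann) - (B.AM i - B'.AM i) := by
  rw [exp_sub h wt_serP (by simp only [Sector.card]; omega),
    exp_sub h wt_serM (by simp only [Sector.card]; omega)]
  simp [InfData.field_serP_p, InfData.field_serM_m, InfData.sub]

theorem add_sub_zero {c : ℂ} (hc : c ≠ 0) {x y : Grassmann} (h : c • x + y = 0) (h' : c • x - y = 0) :
    x = 0 ∧ y = 0 := by
  have h1 : (2 : ℂ) • y = 0 := by
    rw [two_smul]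
    calc y + y = (c • x + y) - (c • x - y) := by abel
      _ = 0 := by rw [h, h', sub_zero]
  have h2 : y = 0 := by simpa using h1
  subst h2
  simpa [hc] using h

theorem half_ne_zero (i : ℕ) : ((i : ℂ) + 1 + 1) / 2 ≠ 0 := by
  have : ((i : ℂ) + 1 + 1) ≠ 0 := by exact_mod_cast Nat.succ_ne_zero (i + 1)
  simpa using this

/-- Induction on the weight: if the data agree below some weight, the exponentials differ in that
weight by the field of the difference of the data. In even weights the sum and the difference of
multiples of `A⁺` and `A⁻` appear, which separate the two. -/
theorem Etilde_injective {B B' : InfData} (h : Etilde B = Etilde B') : B = B' := by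
  have hP : B.exp serP = B'.exp serP := congrArg FormalMap.tp h
  have hM : B.exp serM = B'.exp serM := congrArg FormalMap.tm h
  have key : ∀ w, (B.sub B').WtGe w := by
    intro w
    induction w with
    | zero => exact fun i => ⟨fun h => by omega, fun h => by omega⟩
    | succ w ih =>
      refine fun i => ⟨fun h => ?_, fun h => ?_⟩
      · rcases (Nat.lt_succ_iff.1 h).lt_or_eq with h | h
        · exact (ih i).1 h
        · have := exp_odd_sub ih h.le
          rw [hP, hM, sub_self, sub_self] at this
          exact ⟨Subtype.ext this.1.symm, Subtype.ext this.2.symm⟩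
      · rcases (Nat.lt_succ_iff.1 h).lt_or_eq with h | h
        · exact (ih i).2 h
        · have := exp_even_sub ih h.le
          rw [hP, hM, sub_self, sub_self] at this
          have := add_sub_zero (half_ne_zero i) this.1.symm this.2.symm
          exact ⟨Subtype.ext this.1, Subtype.ext this.2⟩
  cases B; cases B'
  congr
  · funext i; exact sub_eq_zero.1 ((key (2 * i + 3) i).2 (by omega)).1
  · funext i; exact sub_eq_zero.1 ((key (2 * i + 3) i).2 (by omega)).2
  · funext i; exact sub_eq_zero.1 ((key (2 * i + 3) i).1 (by omega)).1
  · funext i; exact sub_eq_zero.1 ((key (2 * i + 3) i).1 (by omega)).2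

/-- The correction of the data of doubled weight `w` towards the given series. -/
def improve {U V : SSeries} (hU : OddS U) (hV : OddS V) (w : ℕ) (B : InfData) : InfData where
  -- With `d⁺` and `d⁻` the defects in the coefficients of `φ^± x ^ (i + 1)`, the corrections solve
  -- `((i + 2) / 2) δA⁺ ± δA⁻ = d^±`, that is `δA⁺ = (d⁺ + d⁻) / (i + 2)` and `δA⁻ = (d⁺ - d⁻) / 2`.
  AP i := if 2 * i + 2 = w then B.AP i + (((i : ℂ) + 1 + 1)⁻¹ : ℂ) •
    ((⟨_, (hU.mem (i + 1)).2.1⟩ - ⟨_, ((oddS_serP.exp B).mem (i + 1)).2.1⟩ : GEven) +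
      (⟨_, (hV.mem (i + 1)).2.2⟩ - ⟨_, ((oddS_serM.exp B).mem (i + 1)).2.2⟩ : GEven)) else B.AP i
  AM i := if 2 * i + 2 = w then B.AM i + (2⁻¹ : ℂ) •
    ((⟨_, (hU.mem (i + 1)).2.1⟩ - ⟨_, ((oddS_serP.exp B).mem (i + 1)).2.1⟩ : GEven) -
      (⟨_, (hV.mem (i + 1)).2.2⟩ - ⟨_, ((oddS_serM.exp B).mem (i + 1)).2.2⟩ : GEven)) else B.AM i
  MP i := if 2 * i + 1 = w then B.MP i +
    (⟨_, (hU.mem (i + 1)).1⟩ - ⟨_, ((oddS_serP.exp B).mem (i + 1)).1⟩) else B.MP i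
  MM i := if 2 * i + 1 = w then B.MM i +
    (⟨_, (hV.mem (i + 1)).1⟩ - ⟨_, ((oddS_serM.exp B).mem (i + 1)).1⟩) else B.MM i

theorem improve_sub {U V : SSeries} (hU : OddS U) (hV : OddS V) (w : ℕ) (B : InfData) :
    ((improve hU hV w B).sub B).WtGe w := by
  refine fun i => ⟨fun h => ?_, fun h => ?_⟩
  · simp only [InfData.sub, improve, if_neg h.ne, sub_self, and_self]
  · simp only [InfData.sub, improve, if_neg h.ne, sub_self, and_self]

theorem improve_odd {U V : SSeries} (hU : OddS U) (hV : OddS V) (i : ℕ) (B : InfData) :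
    (improve hU hV (2 * i + 1) B).exp serP .one (i + 1) = U .one (i + 1) ∧
    (improve hU hV (2 * i + 1) B).exp serM .one (i + 1) = V .one (i + 1) := by
  obtain ⟨h1, h2⟩ := exp_odd_sub (improve_sub hU hV (2 * i + 1) B) le_rfl
  rw [sub_eq_iff_eq_add] at h1 h2
  rw [h1, h2]
  simp [improve]

theorem improve_even {U V : SSeries} (hU : OddS U) (hV : OddS V) (i : ℕ) (B : InfData) :
    (improve hU hV (2 * i + 2) B).exp serP .p (i + 1) = U .p (i + 1) ∧
    (improve hU hV (2 * i + 2) B).exp serM .m (i + 1) = V .m (i + 1) := by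
  obtain ⟨h1, h2⟩ := exp_even_sub (improve_sub hU hV (2 * i + 2) B) le_rfl
  rw [sub_eq_iff_eq_add] at h1 h2
  rw [h1, h2]
  have h3 : ((i : ℂ) + 1 + 1) / 2 * ((i : ℂ) + 1 + 1)⁻¹ = 2⁻¹ := by
    have : ((i : ℂ) + 1 + 1) ≠ 0 := by exact_mod_cast Nat.succ_ne_zero (i + 1)
    field_simp
  simp only [improve, if_true]
  push_cast
  simp only [add_sub_cancel_left, smul_smul, h3]
  constructor <;> module

/-- Successive approximations to the data of a formal map. -/
def approx {U V : SSeries} (hU : OddS U) (hV : OddS V) : ℕ → InfData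
  | 0 => ⟨0, 0, 0, 0⟩
  | w + 1 => improve hU hV w (approx hU hV w)

theorem approx_sub {U V : SSeries} (hU : OddS U) (hV : OddS V) {w w' : ℕ} (h : w ≤ w') :
    ((approx hU hV w').sub (approx hU hV w)).WtGe w := by
  induction w', h using Nat.le_induction with
  | base => exact fun i => by simp [InfData.sub]
  | succ w' h ih =>
    have h1 := improve_sub hU hV w' (approx hU hV w')
    refine fun i => ⟨fun hi => ?_, fun hi => ?_⟩
    · have a := (ih i).1 hi
      have b := (h1 i).1 (by omega)
      simp only [InfData.sub, sub_eq_zero, approx] at a b ⊢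
      exact ⟨b.1.trans a.1, b.2.trans a.2⟩
    · have a := (ih i).2 hi
      have b := (h1 i).2 (by omega)
      simp only [InfData.sub, sub_eq_zero, approx] at a b ⊢
      exact ⟨b.1.trans a.1, b.2.trans a.2⟩

theorem exists_data {U V : SSeries} (hU : OddS U) (hV : OddS V) : ∃ B : InfData, ∀ i,
    B.exp serP .one (i + 1) = U .one (i + 1) ∧ B.exp serM .one (i + 1) = V .one (i + 1) ∧
    B.exp serP .p (i + 1) = U .p (i + 1) ∧ B.exp serM .m (i + 1) = V .m (i + 1) := by
  -- Stage `w` alters only data of doubled weight `w`, so entries of weight `2 i + 2` are final from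
  -- stage `2 i + 3` on and those of weight `2 i + 1` from stage `2 i + 2` on. The limit takes these
  -- final values.
  set L : InfData := ⟨fun i => (approx hU hV (2 * i + 3)).AP i, fun i => (approx hU hV (2 * i + 3)).AM i,
    fun i => (approx hU hV (2 * i + 2)).MP i, fun i => (approx hU hV (2 * i + 2)).MM i⟩ with hL
  have hsub : ∀ w, (L.sub (approx hU hV w)).WtGe w := by
    refine fun w i => ⟨fun hi => ?_, fun hi => ?_⟩
    · have a := (approx_sub hU hV (show 2 * i + 2 ≤ w by omega) i).1 (by omega)
      simp only [InfData.sub, sub_eq_zero, hL] at a ⊢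
      exact ⟨a.1.symm, a.2.symm⟩
    · have a := (approx_sub hU hV (show 2 * i + 3 ≤ w by omega) i).2 (by omega)
      simp only [InfData.sub, sub_eq_zero, hL] at a ⊢
      exact ⟨a.1.symm, a.2.symm⟩
  refine ⟨L, fun i => ?_⟩
  obtain ⟨a1, a2⟩ := exp_odd_sub (hsub (2 * i + 2)) (i := i) (by omega)
  obtain ⟨a3, a4⟩ := exp_even_sub (hsub (2 * i + 3)) (i := i) (by omega)
  obtain ⟨b1, b2⟩ := improve_odd hU hV i (approx hU hV (2 * i + 1))
  obtain ⟨b3, b4⟩ := improve_even hU hV i (approx hU hV (2 * i + 2))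
  have e1 : L.MP i = (approx hU hV (2 * i + 2)).MP i := rfl
  have e2 : L.MM i = (approx hU hV (2 * i + 2)).MM i := rfl
  have e3 : L.AP i = (approx hU hV (2 * i + 3)).AP i := rfl
  have e4 : L.AM i = (approx hU hV (2 * i + 3)).AM i := rfl
  rw [e1, sub_self, ZeroMemClass.coe_zero, sub_eq_zero] at a1
  rw [e2, sub_self, ZeroMemClass.coe_zero, sub_eq_zero] at a2
  rw [e3, e4, sub_self, sub_self, smul_zero, add_zero, sub_eq_zero] at a3
  rw [e3, e4, sub_self, sub_self, smul_zero, sub_zero, sub_eq_zero] at a4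
  exact ⟨a1.trans b1, a2.trans b2, a3.trans b3, a4.trans b4⟩

theorem exp_leading (B : InfData) : (B.exp serP .one 0 = 0 ∧ B.exp serM .one 0 = 0) ∧
    B.exp serP .p 0 = 1 ∧ B.exp serM .m 0 = 1 := by
  refine ⟨⟨?_, ?_⟩, ?_, ?_⟩
  · rw [B.exp_of_wt wt_serP (by simp [Sector.card])]; simp [serP]
  · rw [B.exp_of_wt wt_serM (by simp [Sector.card])]; simp [serM]
  · rw [B.exp_of_wt wt_serP (by simp [Sector.card])]; simp [serP]
  · rw [B.exp_of_wt wt_serM (by simp [Sector.card])]; simp [serM]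

/-- The data reproduce the four sequences of coefficients that determine a superconformal map; the
terms of index zero are fixed by the normalization. -/
theorem FormalMap.Conf.exists_Etilde {h : FormalMap} (hc : h.Conf) (h1 : h.tp .p 0 = 1)
    (h2 : h.tm .m 0 = 1) : ∃ B, h = Etilde B := by
  obtain ⟨_, _, ⟨_, k1, k2⟩, _⟩ := hc.eqs
  have hc' := hc
  obtain ⟨H, hr, _⟩ := hc'
  obtain ⟨B, hB⟩ := exists_data hr.parity.2.1 hr.parity.2.2
  obtain ⟨⟨l1, l2⟩, l3, l4⟩ := exp_leading B
  refine ⟨B, hc.ext (Etilde_conf B) ?_ ?_ ?_ ?_⟩ <;> funext n <;> rcases n with _ | n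
  · exact k1.trans l1.symm
  · exact (hB n).1.symm
  · exact h1.trans l3.symm
  · exact (hB n).2.2.1.symm
  · exact k2.trans l2.symm
  · exact (hB n).2.1.symm
  · exact h2.trans l4.symm
  · exact (hB n).2.2.2.symm

/-! ### Leading coefficients and the sign ambiguity -/

/-- The scaling factors `ab` and `ab⁻¹`. -/
theorem Ehat_eq_scale (a b : GEvenˣ) (B : InfData) :
    Ehat a b B = (Etilde B).scale (a * b : GEvenˣ) (a * b⁻¹ : GEvenˣ) := by
  have : ((a * a : GEvenˣ) : GEven) = (a * b : GEvenˣ) * (a * b⁻¹ : GEvenˣ) := by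
    rw [← Units.val_mul]
    congr 1
    have : a * b = b * a := Units.ext (Subtype.ext (even_comm a.1.2 _))
    rw [mul_assoc, ← mul_assoc b, ← this, mul_inv_cancel_right]
  rw [Ehat, this]; rfl

theorem evenMul_evenMul (a b : Grassmann) (u : SSeries) : evenMul a (evenMul b u) = evenMul (a * b) u := by
  funext s n; simp [evenMul, mul_assoc]

theorem evenMul_one (u : SSeries) : evenMul 1 u = u := by
  funext s n; simp [evenMul]

theorem FormalMap.scale_scale {v w v' w' : GEven} (hv : v' * v = 1) (hw : w' * w = 1) (h : FormalMap) :
    (h.scale v w).scale v' w' = h := by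
  have hv' : (v' : Grassmann) * v = 1 := congrArg Subtype.val hv
  have hw' : (w' : Grassmann) * w = 1 := congrArg Subtype.val hw
  have : (v' : Grassmann) * w' * (v * w) = 1 := by
    rw [mul_assoc, ← mul_assoc (w' : Grassmann) v, even_comm w'.2 v, mul_assoc (v : Grassmann), hw', mul_one, hv']
  cases h
  simp [FormalMap.scale, evenMul_evenMul, hv', hw', this, evenMul_one]

theorem unit_body_ne_zero (a : GEvenˣ) : gbody ((a : GEven) : Grassmann) ≠ 0 :=
  body_ne_zero_of_mul_eq_one (d := ((a⁻¹ : GEvenˣ) : GEven)) (Units.mul_inv a)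

theorem exists_unit {c : GEven} (h : gbody c ≠ 0) : ∃ u : GEvenˣ, (u : GEven) = c := by
  obtain ⟨d, h1, h2⟩ := exists_even_inv h
  exact ⟨⟨c, d, h2, h1⟩, rfl⟩

theorem units_comm (a b : GEvenˣ) : a * b = b * a := Units.ext (Subtype.ext (even_comm a.1.2 _))

/-- Every formal superconformal map is given by data. -/
theorem FormalMap.Conf.exists_Ehat {h : FormalMap} (hc : h.Conf) : ∃ a b B, h = Ehat a b B := by
  obtain ⟨_, _, _, h1, h2⟩ := hc.eqs
  obtain ⟨H, hr, _⟩ := id hc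
  obtain ⟨v, hv⟩ := exists_unit (c := ⟨_, (hr.parity.2.1.mem 0).2.1⟩) h1
  obtain ⟨w, hw⟩ := exists_unit (c := ⟨_, (hr.parity.2.2.mem 0).2.2⟩) h2
  have hvw : gbody ((v * w : GEvenˣ) : GEven) ≠ 0 := unit_body_ne_zero _
  -- The leading coefficients `v` and `w` are to be `a b` and `a b⁻¹`, so `a` is a square root of `v
  -- w` and `b = a⁻¹ v`.
  obtain ⟨s, hs, hs'⟩ := exists_sqrt (v * w : GEvenˣ).1.2 hvw
  obtain ⟨a, ha⟩ := exists_unit (c := ⟨s, hs⟩) (by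
    intro h0
    rw [← hs', gbody_mul, h0, mul_zero] at hvw
    exact hvw rfl)
  have haa : a * a = v * w := Units.ext (Subtype.ext (by
    rw [Units.val_mul, ha]; exact hs'))
  obtain ⟨B, hB⟩ := (hc.scale (unit_body_ne_zero v⁻¹) (unit_body_ne_zero w⁻¹)).exists_Etilde (by
      have : h.tp .p 0 = ((v : GEven) : Grassmann) := by rw [hv]
      simp only [FormalMap.scale, evenMul, this]
      exact congrArg Subtype.val (Units.inv_mul v)) (by
      have : h.tm .m 0 = ((w : GEven) : Grassmann) := by rw [hw]
      simp only [FormalMap.scale, evenMul, this]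
      exact congrArg Subtype.val (Units.inv_mul w))
  refine ⟨a, a⁻¹ * v, B, ?_⟩
  have e1 : a * (a⁻¹ * v) = v := mul_inv_cancel_left a v
  have e2 : a * (a⁻¹ * v)⁻¹ = w := by
    rw [mul_inv_rev, inv_inv, units_comm v⁻¹, ← mul_assoc, haa, units_comm v, mul_inv_cancel_right]
  rw [Ehat_eq_scale, e1, e2, ← hB]
  exact (FormalMap.scale_scale (Units.mul_inv v) (Units.mul_inv w) h).symm

theorem Ehat_leading (a b : GEvenˣ) (B : InfData) :
    (Ehat a b B).tp .p 0 = ((a * b : GEvenˣ) : GEven) ∧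
    (Ehat a b B).tm .m 0 = ((a * b⁻¹ : GEvenˣ) : GEven) := by
  obtain ⟨_, h1, h2⟩ := exp_leading B
  simp [Ehat, Etilde, evenMul, h1, h2]

/-- The even part has zero divisors but is local. The bodies of `x - y` and `x + y` cannot both
vanish, so one of the two is a unit and, their product being zero, the other vanishes. -/
theorem sq_eq_sq_even {x y : GEven} (hx : gbody x ≠ 0) (h : x * x = y * y) : x = y ∨ x = -y := by
  have hxy : x * y = y * x := Subtype.ext (even_comm x.2 _)
  have h1 : (x - y) * (x + y) = 0 := by
    rw [sub_mul, mul_add, mul_add, h, hxy]; abel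
  have h1' : (x + y) * (x - y) = 0 := by
    rw [add_mul, mul_sub, mul_sub, h, hxy]; abel
  by_cases hb : gbody (x + y) = 0
  · right
    have hb' : gbody (x - y : GEven) ≠ 0 := by
      intro h0
      rw [AddSubgroupClass.coe_sub, gbody_sub, sub_eq_zero] at h0
      rw [gbody_add, ← h0] at hb
      exact hx (by linear_combination hb / 2)
    obtain ⟨d, hd, _⟩ := exists_even_inv hb'
    have : x + y = 0 := by
      obtain ⟨_, hd2⟩ : True ∧ (x - y) * d = 1 := ⟨trivial, by
        rw [← hd]; exact Subtype.ext (even_comm (x - y).2 _)⟩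
      rw [← mul_one (x + y), ← hd2, ← mul_assoc, h1', zero_mul]
    exact eq_neg_of_add_eq_zero_left this
  · left
    obtain ⟨d, _, hd⟩ := exists_even_inv (c := x + y) hb
    have : x - y = 0 := by rw [← mul_one (x - y), ← hd, ← mul_assoc, h1, zero_mul]
    exact sub_eq_zero.1 this

/-- The leading coefficients give `a b` and `a b⁻¹`, hence `a²`; so `a` is known up to sign, and `b`
acquires the same sign. After division by the leading coefficients the exponentials themselves
agree. -/
theorem Ehat_injective {a b a' b' : GEvenˣ} {B B' : InfData} (h : Ehat a b B = Ehat a' b' B') :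
    B = B' ∧ (QuotientGroup.mk (a, b) : Scale) = QuotientGroup.mk (a', b') := by
  have h1 : a * b = a' * b' := by
    ext
    rw [← (Ehat_leading a b B).1, h, (Ehat_leading a' b' B').1]
  have h2 : a * b⁻¹ = a' * b'⁻¹ := by
    ext
    rw [← (Ehat_leading a b B).2, h, (Ehat_leading a' b' B').2]
  refine ⟨Etilde_injective ?_, ?_⟩
  · rw [Ehat_eq_scale, Ehat_eq_scale, ← h1, ← h2] at h
    have := congrArg (FormalMap.scale ((a * b)⁻¹ : GEvenˣ) ((a * b⁻¹)⁻¹ : GEvenˣ)) h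
    rwa [FormalMap.scale_scale (Units.inv_mul _) (Units.inv_mul _),
      FormalMap.scale_scale (Units.inv_mul _) (Units.inv_mul _)] at this
  · have h3 : a * a = a' * a' := by
      have e : ∀ a b : GEvenˣ, a * b * (a * b⁻¹) = a * a := fun a b => by
        rw [mul_assoc, ← mul_assoc b, ← units_comm a b, mul_inv_cancel_right]
      rw [← e a b, h1, h2, e]
    rw [QuotientGroup.eq]
    rcases sq_eq_sq_even (unit_body_ne_zero a) (congrArg Units.val h3) with h4 | h4
    · have h4 : a = a' := Units.ext h4
      subst h4
      have : b = b' := mul_left_cancel h1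
      subst this
      rw [inv_mul_cancel]; exact Subgroup.one_mem _
    · have h4 : a = -a' := Units.ext h4
      have h5 : b = -b' := by
        rw [h4, neg_mul] at h1
        refine mul_left_cancel (a := a') ?_
        rw [mul_neg, ← h1, neg_neg]
      refine Subgroup.mem_zpowers_iff.2 ⟨1, ?_⟩
      rw [h4, h5, zpow_one]
      refine Prod.ext ?_ ?_ <;> simp

theorem Ehat_congr {a b a' b' : GEvenˣ}
    (h : (QuotientGroup.mk (a, b) : Scale) = QuotientGroup.mk (a', b')) (B : InfData) :
    Ehat a b B = Ehat a' b' B := by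
  rw [QuotientGroup.eq] at h
  have hs : (-1 : GEvenˣ × GEvenˣ) * -1 = 1 :=
    Prod.ext (neg_mul_neg _ _ |>.trans (mul_one _)) (neg_mul_neg _ _ |>.trans (mul_one _))
  have hk2 : ∀ m : ℤ, (-1 : GEvenˣ × GEvenˣ) ^ (2 * m) = 1 := fun m => by
    rw [zpow_mul, zpow_ofNat, pow_two, hs, one_zpow]
  have : ((a, b)⁻¹ * (a', b') : GEvenˣ × GEvenˣ) = 1 ∨
      ((a, b)⁻¹ * (a', b') : GEvenˣ × GEvenˣ) = -1 := by
    obtain ⟨k, hk⟩ := Subgroup.mem_zpowers_iff.1 h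
    rw [← hk]
    rcases Int.even_or_odd' k with ⟨m, hk | hk⟩
    · left; rw [hk, hk2]
    · right; rw [hk, zpow_add, hk2, one_mul, zpow_one]
  rcases this with h | h
  · rw [inv_mul_eq_one] at h
    cases h; rfl
  · rw [inv_mul_eq_iff_eq_mul] at h
    obtain ⟨h1, h2⟩ := Prod.ext_iff.1 h
    have h1 : a' = -a := by simpa using h1
    have h2 : b' = -b := by simpa using h2
    have e1 : a' * b' = a * b := by rw [h1, h2, neg_mul_neg]
    have e2 : a' * b'⁻¹ = a * b⁻¹ := by rw [h1, h2, inv_neg, neg_mul_neg]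
    rw [Ehat_eq_scale, Ehat_eq_scale, e1, e2]

/-! ### Convergence -/

theorem powerSeries_analytic {c : ℕ → ℂ} {r : ℝ} (hr : 0 < r)
    (h : ∀ w ∈ Metric.ball (0 : ℂ) r, Summable fun n => c n * w ^ n) :
    AnalyticOnNhd ℂ (fun w => ∑' n, c n * w ^ n) (Metric.ball 0 r) ∧
      ∀ n, tay (fun w => ∑' n, c n * w ^ n) 0 n = c n := by
  have hf : HasFPowerSeriesOnBall (fun w => ∑' n, c n * w ^ n)
      (FormalMultilinearSeries.ofScalars ℂ c) 0 (ENNReal.ofReal r) := by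
    refine ⟨le_of_forall_lt_imp_le_of_dense fun s hs => ?_, by simpa using hr, fun {y} hy => ?_⟩
    · lift s to NNReal using hs.ne_top
      have hs' : (s : ℝ) < r := by
        rwa [ENNReal.lt_ofReal_iff_toReal_lt ENNReal.coe_ne_top, ENNReal.coe_toReal] at hs
      apply FormalMultilinearSeries.le_radius_of_summable
      have := (h s (by simpa using hs')).norm
      simpa [norm_mul, FormalMultilinearSeries.ofScalars_norm] using this
    · have hy' : y ∈ Metric.ball (0 : ℂ) r := by
        rwa [Metric.eball_ofReal] at hy
      have := (h y hy').hasSum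
      simpa [FormalMultilinearSeries.ofScalars_apply_eq, mul_comm] using this
  refine ⟨?_, fun n => ?_⟩
  · have := hf.analyticOnNhd
    rwa [Metric.eball_ofReal] at this
  · have e := hf.analyticAt.hasFPowerSeriesAt.eq_formalMultilinearSeries hf.hasFPowerSeriesAt
    have := congrArg (fun p => FormalMultilinearSeries.coeff p n) e
    simp only [FormalMultilinearSeries.coeff_ofScalars] at this
    rw [tay, ← this]; ring

/-- Square-zero induction: adding `t` to the point adds the series of `f'` times `t`, shifted by one
index and convergent on the same ball. The left factor `c` is arbitrary so that `t` can be absorbed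
into it. -/
theorem hasSum_extend {r : ℝ} {z : Grassmann} (hz : z ∈ GEven) (hb : gbody z ∈ Metric.ball (0 : ℂ) r)
    {f : ℂ → ℂ} (hf : AnalyticOnNhd ℂ f (Metric.ball 0 r)) (l : Grassmann →ₗ[ℂ] ℂ) (c : Grassmann) :
    HasSum (fun n => tay f 0 n * l (c * z ^ n)) (l (c * extend f z)) := by
  induction z, hz using even_sq_induction generalizing f c with
  | scalar w =>
    rw [gbody_algebraMap] at hb
    lift r to NNReal using (Metric.pos_of_mem_ball hb).le
    have := (Complex.hasSum_taylorSeries_on_ball hf.differentiableOn hb).mul_right (l c)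
    rw [extend_algebraMap, ← Algebra.commutes, ← Algebra.smul_def, map_smul, smul_eq_mul]
    refine this.congr_fun fun n => ?_
    rw [← map_pow, ← Algebra.commutes, ← Algebra.smul_def, map_smul, tay]
    simp only [smul_eq_mul, sub_zero]
    ring
  | add z t hz ht ht0 htb ih =>
    rw [gbody_add, htb, add_zero] at hb
    have h1 := ih hb hf c
    have h2 := ih hb hf.deriv (c * t)
    rw [extend_add_sq f hz ht ht0, mul_add, map_add, ← even_comm ht, ← mul_assoc]
    have h3 : HasSum (fun n => match n with | 0 => 0 | n + 1 => tay (deriv f) 0 n * l (c * t * z ^ n))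
        (l (c * t * extend (deriv f) z)) := by
      rw [← hasSum_nat_add_iff' 1]
      simpa using h2
    refine (h1.add h3).congr_fun fun n => ?_
    rcases n with _ | n
    · simp
    · simp only [add_pow_of_sq hz ht0, mul_add, map_add, mul_smul_comm, map_smul, tay_deriv, smul_eq_mul]
      rw [even_comm (pow_mem hz n : z ^ n ∈ GEven) t, mul_assoc c]
      ring

/-- The Taylor series at `0`. -/
def SuperFn.ser (F : SuperFn) : SSeries := fun s n => ∑ᶠ k : Finset ℕ, tay (F s k) 0 n • zeta k

theorem SuperFn.ser_eq_sum {F : SuperFn} {K : Finset (Finset ℕ)}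
    (hK : ∀ᶠ w in 𝓝 (0 : ℂ), ∀ s, ∀ k ∉ K, F s k w = 0) (s : Sector) (n : ℕ) :
    F.ser s n = ∑ k ∈ K, tay (F s k) 0 n • zeta k := by
  refine finsum_eq_sum_of_support_subset _ fun k hk => ?_
  by_contra hkK
  refine hk ?_
  have : F s k =ᶠ[𝓝 0] fun _ => 0 := by filter_upwards [hK] with w hw using hw s k hkK
  show tay (F s k) 0 n • zeta k = 0
  rw [tay_congr this]
  simp [tay]

theorem SuperFn.ev_ser {F : SuperFn} (hF : F.AnAt 0) {p : SPoint} (hp : p.body = 0) :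
    ev p F.ser = F.eval p := by
  obtain ⟨_, K, hK⟩ := hF
  rw [SuperFn.eval_eq, ev_apply]
  congr 1
  funext s
  obtain ⟨M, hM⟩ := p.nilpotent hp
  have hs : gsoul p.z = p.z := by
    rw [gsoul, show gbody p.z = 0 from hp, map_zero, sub_zero]
  rw [SuperFn.sec_eq_sum p.z_even (by rw [show gbody p.z = 0 from hp]; exact hK), evz_eq hM]
  simp only [SuperFn.ser_eq_sum hK, Finset.sum_mul]
  rw [Finset.sum_comm]
  refine Finset.sum_congr rfl fun k _ => ?_
  rw [extend_eq_sum (M := M) _ (by rw [hs]; exact hM), Finset.sum_mul, hs, show gbody p.z = 0 from hp]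
  refine Finset.sum_congr rfl fun n _ => ?_
  rw [smul_mul_assoc, smul_mul_assoc, even_comm (pow_mem p.z_even n : p.z ^ n ∈ GEven)]

theorem SuperFn.hasValue_ser {F : SuperFn} (hF : F.AnAt 0) :
    ∀ᶠ p in bn 0, F.ser.HasValue p.z p.tp p.tm (F.eval p) := by
  obtain ⟨h1, K, hK⟩ := hF
  have h2 : ∀ᶠ w in 𝓝 (0 : ℂ), ∀ s, ∀ k ∈ K, AnalyticAt ℂ (F s k) w := by
    have := fun s => (Finset.eventually_all K).2 fun k _ => (h1 s k).eventually_analyticAt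
    filter_upwards [this .one, this .p, this .m, this .pm] with w a b c d s
    cases s <;> assumption
  obtain ⟨r, hr, hball⟩ := Metric.eventually_nhds_iff_ball.1 (h2.and hK.eventually_nhds)
  refine eventually_bn.2 (Metric.eventually_nhds_iff_ball.2 ⟨r, hr, fun w hw p hp => ?_⟩)
  refine ⟨fun s => F.sec s p.z, fun s k' => ?_, rfl⟩
  show HasSum (fun n => coef k' (F.ser s n * p.z ^ n)) (coef k' (F.sec s p.z))
  have hb : gbody p.z = w := hp
  rw [SuperFn.sec_eq_sum p.z_even (by rw [hb]; exact (hball w hw).2)]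
  simp only [SuperFn.ser_eq_sum hK]
  have h3 := hasSum_sum fun k (hk : k ∈ K) => hasSum_extend (r := r) p.z_even (by rwa [hb])
    (fun w hw => (hball w hw).1 s k hk) (coef k') (zeta k)
  rw [map_sum]
  simp only [even_comm (extend_even _ p.z_even) (zeta _)]
  refine h3.congr_fun fun n => ?_
  rw [Finset.sum_mul, map_sum]
  simp only [smul_mul_assoc, map_smul, smul_eq_mul]

theorem HasGSum.unique {a : ℕ → Grassmann} {v v' : Grassmann} (h : HasGSum a v) (h' : HasGSum a v') :
    v = v' := zeta.repr.injective (Finsupp.ext fun k => (h k).unique (h' k))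

theorem SSeries.HasValue.unique {u : SSeries} {z tp tm v v' : Grassmann}
    (h : SSeries.HasValue u z tp tm v) (h' : SSeries.HasValue u z tp tm v') : v = v' := by
  obtain ⟨f, hf, rfl⟩ := h
  obtain ⟨f', hf', rfl⟩ := h'
  rw [funext fun s => (hf s).unique (hf' s)]

theorem FormalMap.HasValue.unique {E : FormalMap} {z tp tm : Grassmann} {y y' : SPoint}
    (h : E.HasValue z tp tm y) (h' : E.HasValue z tp tm y') : y = y' :=
  SPoint.ext (SSeries.HasValue.unique h.1 h'.1) (SSeries.HasValue.unique h.2.1 h'.2.1)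
    (SSeries.HasValue.unique h.2.2 h'.2.2)

/-- Convergent series are Taylor series. -/
theorem exists_superFn_of_hasValue {u : SSeries} {r : ℝ} (hr : 0 < r)
    (h : ∀ x : SPoint, ‖x.body‖ < r → ∃ v, u.HasValue x.z x.tp x.tm v) :
    ∃ F : SuperFn, F.AnAt 0 ∧ F.ser = u := by
  have h1 : ∀ w ∈ Metric.ball (0 : ℂ) r, ∃ f : Sector → Grassmann, ∀ s k,
      HasSum (fun n => coef k (u s n) * w ^ n) (coef k (f s)) := fun w hw => by
    obtain ⟨v, f, hf, _⟩ := h (SPoint.ofBody w) (by rw [SPoint.body_ofBody]; simpa using hw)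
    refine ⟨f, fun s k => (hf s k).congr_fun fun n => ?_⟩
    change _ = coef k (u s n * (algebraMap ℂ Grassmann w) ^ n)
    rw [← map_pow, ← Algebra.commutes, ← Algebra.smul_def, map_smul, smul_eq_mul, mul_comm]
  have h2 := fun s k => powerSeries_analytic (c := fun n => coef k (u s n)) hr fun w hw => by
    obtain ⟨f, hf⟩ := h1 w hw
    exact (hf s k).summable
  refine ⟨fun s k w => ∑' n, coef k (u s n) * w ^ n, ?_, ?_⟩
  -- The values lie in `⋀_∞`, so at each point of the ball only finitely many coefficients are
  -- non-zero; the Baire argument makes this locally uniform.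
  · refine SuperFn.AnalyticOn.anAt (V := Metric.ball 0 r) Metric.isOpen_ball
      ⟨fun s k => (h2 s k).1, fun s w hw => ?_⟩ (Metric.mem_ball_self hr)
    obtain ⟨f, hf⟩ := h1 w hw
    refine (zeta.repr (f s)).support.finite_toSet.subset fun k hk => ?_
    by_contra hk'
    refine hk ?_
    simp only [(hf s k).tsum_eq, coef_support _ k hk']
  · funext s n
    simp only [SuperFn.ser, fun k => (h2 s k).2 n]
    rw [finsum_eq_sum_of_support_subset (s := (zeta.repr (u s n)).support)]
    · exact sum_coef _ (coef_support _)
    · intro k hk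
      by_contra hk'
      exact hk (by simp [coef_support _ k hk'])

/-- A superanalytic map that satisfies the superconformal equations at the points with body `w`
satisfies them near these points. -/
theorem SAnMap.sconfAt {w : ℂ} {H : SPoint → SPoint} (hH : SAnMap w H) (h : ∀ p : SPoint, p.body = w →
    (∃ c : GEven, gbody c ≠ 0 ∧ RelP H p c) ∧ ∃ c : GEven, gbody c ≠ 0 ∧ RelM H p c) :
    SConfAt w H := by
  refine ⟨hH, ?_⟩
  obtain ⟨⟨Z, aZ, eZ⟩, ⟨P, aP, eP⟩, ⟨M, aM, eM⟩⟩ := hH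
  have e : ∀ᶠ q in bn w, (H q).z = Z.eval q ∧ (H q).tp = P.eval q ∧ (H q).tm = M.eval q := by
    filter_upwards [eZ, eP, eM] with q a b c using ⟨a, b, c⟩
  have sAn : ∀ {F : SuperFn}, F.AnAt w → SAn w F.eval := fun hF => ⟨_, hF, Eventually.of_forall fun _ => rfl⟩
  have d1 : ∀ q : SPoint, q.body = w → ∃ c : GEven, gbody c ≠ 0 ∧
      M.DP.eval q = 0 ∧ P.DP.eval q = c ∧ Z.DP.eval q - P.DP.eval q * M.eval q = 0 := fun q hq => by
    obtain ⟨⟨c, hc, hc'⟩, _⟩ := h q hq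
    subst hq
    obtain ⟨k1, k2, k3⟩ := hc'.derivs aZ aP aM fun p hp => of_eventually_bn e hp
    exact ⟨c, hc, k1, k2, by rw [k3, k2, (of_eventually_bn e rfl).2.2, sub_self]⟩
  have d2 : ∀ q : SPoint, q.body = w → ∃ c : GEven, gbody c ≠ 0 ∧
      P.DM.eval q = 0 ∧ M.DM.eval q = c ∧ Z.DM.eval q - M.DM.eval q * P.eval q = 0 := fun q hq => by
    obtain ⟨_, c, hc, hc'⟩ := h q hq
    subst hq
    obtain ⟨k1, k2, k3⟩ := hc'.derivs aZ aP aM fun p hp => of_eventually_bn e hp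
    exact ⟨c, hc, k1, k2, by rw [k3, k2, (of_eventually_bn e rfl).2.1, sub_self]⟩
  -- Each superconformal equation is the vanishing of a superanalytic function on the fibre over
  -- `w`, which implies vanishing near the fibre.
  have f1 := (sAn aM.DP).eventually_zero fun p hp => (d1 p hp).choose_spec.2.1
  have f2 := ((sAn aZ.DP).sub ((sAn aP.DP).mul (sAn aM))).eventually_zero fun p hp =>
    (d1 p hp).choose_spec.2.2.2
  have f3 := (sAn aP.DM).eventually_zero fun p hp => (d2 p hp).choose_spec.2.1
  have f4 := ((sAn aZ.DM).sub ((sAn aM.DM).mul (sAn aP))).eventually_zero fun p hp =>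
    (d2 p hp).choose_spec.2.2.2
  have hbody : ∀ {F : SuperFn}, F.AnAt w → (∃ q : SPoint, q.body = w ∧ gbody (F.eval q) ≠ 0) →
      ∀ᶠ q in bn w, gbody (F.eval q) ≠ 0 := fun hF ⟨q, hq, hq0⟩ => by
    obtain ⟨f, hf, hfe⟩ := (sAn hF).body
    have : f w ≠ 0 := by rw [← hq, ← of_eventually_bn hfe hq]; exact hq0
    filter_upwards [hfe, eventually_bn_body (hf.continuousAt.eventually_ne this)] with p a b
    rwa [a]
  have g1 := hbody aP.DP ⟨_, SPoint.body_ofBody w, by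
    obtain ⟨c, hc, _, k, _⟩ := d1 _ (SPoint.body_ofBody w)
    rwa [k]⟩
  have g2 := hbody aM.DM ⟨_, SPoint.body_ofBody w, by
    obtain ⟨c, hc, _, k, _⟩ := d2 _ (SPoint.body_ofBody w)
    rwa [k]⟩
  filter_upwards [e, eventually_bn_shP e, eventually_bn_shM e, f1, f2, f3, f4, g1, g2,
    eventually_bn_body aZ.eventually, eventually_bn_body aP.eventually,
    eventually_bn_body aM.eventually] with q ⟨v1, v2, v3⟩ eP eM f1 f2 f3 f4 g1 g2 aZ aP aM
  have c1 : P.DP.eval q ∈ GEven := even_of_odd_mul fun η hη => by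
    have := sub_mem (H (q.shP ⟨η, hη⟩)).tp_odd (H q).tp_odd
    rwa [(eP _).2.1, v2, SuperFn.eval_shP aP, add_sub_cancel_left] at this
  have c2 : M.DM.eval q ∈ GEven := even_of_odd_mul fun η hη => by
    have := sub_mem (H (q.shM ⟨η, hη⟩)).tm_odd (H q).tm_odd
    rwa [(eM _).2.2, v3, SuperFn.eval_shM aM, add_sub_cancel_left] at this
  refine ⟨⟨⟨_, c1⟩, g1, relP_coords.2 fun η => ?_⟩, ⟨⟨_, c2⟩, g2, relM_coords.2 fun η => ?_⟩⟩
  · obtain ⟨w1, w2, w3⟩ := eP η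
    rw [w1, w2, w3, SuperFn.eval_shP aP, SuperFn.eval_shP aM, SuperFn.eval_shP aZ, f1,
      sub_eq_zero.1 f2, v1, v2, v3]
    simp
  · obtain ⟨w1, w2, w3⟩ := eM η
    rw [w1, w2, w3, SuperFn.eval_shM aP, SuperFn.eval_shM aM, SuperFn.eval_shM aZ, f3,
      sub_eq_zero.1 f4, v1, v2, v3]
    simp

theorem SAn.exists_ser {Φ : SPoint → Grassmann} (h : SAn 0 Φ) : ∃ u : SSeries,
    (∀ p : SPoint, p.body = 0 → Φ p = ev p u) ∧ ∀ᶠ p in bn 0, u.HasValue p.z p.tp p.tm (Φ p) := by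
  obtain ⟨F, hF, h⟩ := h
  refine ⟨F.ser, fun p hp => by rw [of_eventually_bn h hp, SuperFn.ev_ser hF hp], ?_⟩
  filter_upwards [h, SuperFn.hasValue_ser hF] with p a b
  rwa [a]

theorem SAnMap.exists_rep {H : SPoint → SPoint} (hH : SAnMap 0 H) : ∃ h : FormalMap, h.Rep H := by
  obtain ⟨u1, h1, _⟩ := hH.1.exists_ser
  obtain ⟨u2, h2, _⟩ := hH.2.1.exists_ser
  obtain ⟨u3, h3, _⟩ := hH.2.2.exists_ser
  exact ⟨⟨u1, u2, u3⟩, fun p hp => ⟨h1 p hp, h2 p hp, h3 p hp⟩⟩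

theorem FormalMap.Rep.unique {h h' : FormalMap} {H : SPoint → SPoint} (hr : h.Rep H)
    (hr' : h'.Rep H) : h = h' := by
  cases h; cases h'
  congr
  · exact ev_injective fun p hp => (hr p hp).1.symm.trans (hr' p hp).1
  · exact ev_injective fun p hp => (hr p hp).2.1.symm.trans (hr' p hp).2.1
  · exact ev_injective fun p hp => (hr p hp).2.2.symm.trans (hr' p hp).2.2

theorem FormalMap.Rep.hasValue {h : FormalMap} {H : SPoint → SPoint} (hr : h.Rep H)
    (hH : SAnMap 0 H) : ∀ᶠ p in bn 0, h.HasValue p.z p.tp p.tm (H p) := by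
  obtain ⟨u1, h1, k1⟩ := hH.1.exists_ser
  obtain ⟨u2, h2, k2⟩ := hH.2.1.exists_ser
  obtain ⟨u3, h3, k3⟩ := hH.2.2.exists_ser
  have : h = ⟨u1, u2, u3⟩ := hr.unique fun p hp => ⟨h1 p hp, h2 p hp, h3 p hp⟩
  subst this
  filter_upwards [k1, k2, k3] with p a b c using ⟨a, b, c⟩

/-- Maps with the same expansion agree. -/
theorem FormalMap.Rep.eventually_eq {h : FormalMap} {H H' : SPoint → SPoint} (hr : h.Rep H)
    (hr' : h.Rep H') (hH : SAnMap 0 H) (hH' : SAnMap 0 H') : ∀ᶠ p in bn 0, H p = H' p := by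
  filter_upwards [hr.hasValue hH, hr'.hasValue hH'] with p a b using a.unique b

theorem exists_ball_of_eventually {w : ℂ} {Q : SPoint → Prop} (h : ∀ᶠ p in bn w, Q p) :
    ∃ r : ℝ, 0 < r ∧ ∀ p : SPoint, ‖p.body - w‖ < r → Q p := by
  obtain ⟨r, hr, h⟩ := Metric.eventually_nhds_iff.1 (eventually_bn.1 h)
  exact ⟨r, hr, fun p hp => h (by rwa [dist_eq_norm]) p rfl⟩

theorem ConfZero.of_rep {h : FormalMap} {H H' : SPoint → SPoint} (hz : ConfZero H) (hr : h.Rep H)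
    (hr' : h.Rep H') : ConfZero H' := by
  have e : ∀ p : SPoint, p.body = 0 → H' p = H p := fun p hp => by
    obtain ⟨a1, a2, a3⟩ := hr p hp
    obtain ⟨b1, b2, b3⟩ := hr' p hp
    exact SPoint.ext (b1.trans a1.symm) (b2.trans a2.symm) (b3.trans a3.symm)
  refine ⟨by rw [e _ (by simp [SPoint.body, SPoint.origin]), hz.1], fun p hp => ?_⟩
  obtain ⟨⟨c, hc, hc'⟩, ⟨d, hd, hd'⟩⟩ := hz.2 p hp
  exact ⟨⟨c, hc, hc'.congr (e p hp) fun η => e _ (by rw [p.body_shP, hp])⟩,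
    ⟨d, hd, hd'.congr (e p hp) fun η => e _ (by rw [p.body_shM, hp])⟩⟩

/-- Convergent formal superconformal maps are expansions of superconformal maps. -/
theorem FormalMap.Conf.exists_map {h : FormalMap} (hc : h.Conf) {r : ℝ} (hr : 0 < r)
    (hv : ∀ x : SPoint, ‖x.body‖ < r → ∃ y, h.HasValue x.z x.tp x.tm y) :
    ∃ H, SConfAt 0 H ∧ h.Rep H ∧ ConfZero H := by
  classical
  obtain ⟨Z, aZ, eZ⟩ := exists_superFn_of_hasValue (u := h.z) hr fun x hx =>
    let ⟨y, hy⟩ := hv x hx; ⟨y.z, hy.1⟩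
  obtain ⟨P, aP, eP⟩ := exists_superFn_of_hasValue (u := h.tp) hr fun x hx =>
    let ⟨y, hy⟩ := hv x hx; ⟨y.tp, hy.2.1⟩
  obtain ⟨M, aM, eM⟩ := exists_superFn_of_hasValue (u := h.tm) hr fun x hx =>
    let ⟨y, hy⟩ := hv x hx; ⟨y.tm, hy.2.2⟩
  choose! H hH using hv
  have hball : ∀ᶠ p in bn 0, ‖p.body‖ < r := eventually_bn_body (by
    filter_upwards [Metric.ball_mem_nhds (0 : ℂ) hr] with w hw; simpa using hw)
  have e : ∀ᶠ q in bn 0, (H q).z = Z.eval q ∧ (H q).tp = P.eval q ∧ (H q).tm = M.eval q := by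
    filter_upwards [hball, SuperFn.hasValue_ser aZ, SuperFn.hasValue_ser aP,
      SuperFn.hasValue_ser aM] with q hq a b c
    rw [eZ] at a; rw [eP] at b; rw [eM] at c
    exact ⟨(hH q hq).1.unique a, (hH q hq).2.1.unique b, (hH q hq).2.2.unique c⟩
  have hS : SAnMap 0 H := ⟨⟨Z, aZ, e.mono fun _ h => h.1⟩, ⟨P, aP, e.mono fun _ h => h.2.1⟩,
    ⟨M, aM, e.mono fun _ h => h.2.2⟩⟩
  have hrep : h.Rep H := fun p hp => by
    obtain ⟨a, b, c⟩ := of_eventually_bn e hp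
    rw [a, b, c, ← SuperFn.ev_ser aZ hp, ← SuperFn.ev_ser aP hp, ← SuperFn.ev_ser aM hp, eZ, eP, eM]
    exact ⟨rfl, rfl, rfl⟩
  obtain ⟨H', hr', hz'⟩ := hc
  have hz := hz'.of_rep hr' hrep
  exact ⟨H, hS.sconfAt hz.2, hrep, hz⟩

theorem sanMap_scale (v w : GEven) (b : ℂ) : SAnMap b (SPoint.scale v w) :=
  ⟨(SAn.z b).const_mul _, (SAn.tp b).const_mul _, (SAn.tm b).const_mul _⟩

/-- Data in `𝓗` define superconformal maps. -/
theorem exists_map_of_calH {B : InfData} (hB : B ∈ calH) (a b : GEvenˣ) :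
    ∃ H, SConfAt 0 H ∧ (Ehat a b B).Rep H ∧ ConfZero H := by
  obtain ⟨r, hr, hv⟩ := hB
  obtain ⟨H, h1, h2, h3⟩ := (Etilde_conf B).exists_map hr hv
  rw [Ehat_eq_scale]
  have h4 := h3.scale (unit_body_ne_zero (a * b)) (unit_body_ne_zero (a * b⁻¹))
  have ho : SPoint.origin.body = 0 := by simp [SPoint.body, SPoint.origin]
  exact ⟨_, SAnMap.sconfAt ((sanMap_scale _ _ _).comp h1.1 ho rfl) h4.2, h2.scale _ _, h4⟩

theorem SConfAt.confZero {H : SPoint → SPoint} (h : SConfAt 0 H)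
    (h0 : H SPoint.origin = SPoint.origin) : ConfZero H :=
  ⟨h0, fun _ hp => of_eventually_bn h.2 hp⟩

/-- Superconformal maps that fix `0` are given by data in `𝓗`. -/
theorem SConfAt.exists_Ehat {H : SPoint → SPoint} (h : SConfAt 0 H)
    (h0 : H SPoint.origin = SPoint.origin) : ∃ a b, ∃ B ∈ calH, (Ehat a b B).Rep H := by
  obtain ⟨u, hu⟩ := h.1.exists_rep
  obtain ⟨a, b, B, rfl⟩ := FormalMap.Conf.exists_Ehat ⟨H, hu, h.confZero h0⟩
  refine ⟨a, b, B, ?_, hu⟩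
  have hu' := hu
  rw [Ehat_eq_scale] at hu'
  -- After the scaling is undone, `Ẽ(B)` itself is the expansion of a superanalytic map and
  -- therefore converges, which places `B` in `𝓗`.
  have h1 := hu'.scale ((a * b)⁻¹ : GEvenˣ) ((a * b⁻¹)⁻¹ : GEvenˣ)
  rw [FormalMap.scale_scale (Units.inv_mul _) (Units.inv_mul _)] at h1
  have ho : SPoint.origin.body = 0 := by simp [SPoint.body, SPoint.origin]
  obtain ⟨r, hr, hv⟩ := exists_ball_of_eventually
    (h1.hasValue ((sanMap_scale _ _ _).comp h.1 ho rfl))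
  exact ⟨r, hr, fun x hx => ⟨_, hv x (by rwa [sub_zero])⟩⟩

/-! ### Congruences modulo a generator -/

/-- `a` and `b` agree modulo the ideal generated by `ζ_N`. -/
def Cong (N : ℕ) (a b : Grassmann) : Prop := gen N * a = gen N * b

theorem Cong.refl (N : ℕ) (a : Grassmann) : Cong N a a := rfl

theorem Cong.symm {N : ℕ} {a b : Grassmann} (h : Cong N a b) : Cong N b a := Eq.symm h

theorem Cong.add {N : ℕ} {a b a' b' : Grassmann} (h : Cong N a b) (h' : Cong N a' b') :
    Cong N (a + a') (b + b') := by
  unfold Cong at *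
  rw [mul_add, mul_add, h, h']

theorem Cong.mul {N : ℕ} {a b a' b' : Grassmann} (h : Cong N a b) (h' : Cong N a' b') :
    Cong N (a * a') (b * b') := by
  unfold Cong at *
  rw [← mul_assoc, h, odd_mul_comm (gen_odd N), mul_assoc, h', ← mul_assoc,
    ← odd_mul_comm (gen_odd N), mul_assoc]

theorem Cong.sum {N : ℕ} {ι : Type} {s : Finset ι} {f g : ι → Grassmann}
    (h : ∀ i ∈ s, Cong N (f i) (g i)) : Cong N (∑ i ∈ s, f i) (∑ i ∈ s, g i) := by
  unfold Cong at *
  rw [Finset.mul_sum, Finset.mul_sum]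
  exact Finset.sum_congr rfl h

theorem eq_gen_mul {N : ℕ} {x : Grassmann} (h : gen N * x = 0) : x = gen N * contr N x := by
  have := contr_gen_mul N x
  rw [h, map_zero] at this
  exact (sub_eq_zero.1 this.symm)

theorem Cong.gbody_eq {N : ℕ} {a b : Grassmann} (h : Cong N a b) : gbody a = gbody b := by
  have h' : gen N * (a - b) = 0 := by rw [mul_sub, h, sub_self]
  have := congrArg gbody (eq_gen_mul h')
  rwa [gbody_mul, gbody_odd (gen_odd N), zero_mul, gbody_sub, sub_eq_zero] at this

/-- The difference of congruent even elements is a multiple of `ζ_N` and has square zero, so the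
extension changes by a multiple of that difference. -/
theorem Cong.extend {N : ℕ} {a b : Grassmann} (h : Cong N a b) (ha : a ∈ GEven) (hb : b ∈ GEven)
    (f : ℂ → ℂ) : Cong N (extend f a) (extend f b) := by
  have h' : gen N * (b - a) = 0 := by rw [mul_sub, h, sub_self]
  have ht : b - a ∈ GEven := sub_mem hb ha
  have ht0 : (b - a) * (b - a) = 0 := by
    rw [eq_gen_mul h']; exact odd_sq_mul (gen_odd N) _
  have := extend_add_sq f ha ht ht0
  rw [add_sub_cancel] at this
  unfold Cong
  rw [this, mul_add, ← even_comm ht, ← mul_assoc, h', zero_mul, add_zero]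

/-- A factor `y` annihilated by `ζ_N` is a multiple of `ζ_N`, and such a multiple sees the other
factor only modulo `ζ_N`. -/
theorem Cong.mul_eq {N : ℕ} {a b y : Grassmann} (h : Cong N a b) (hy : gen N * y = 0) :
    a * y = b * y := by
  have h2 : gen N * parity a = gen N * parity b := by
    have := congrArg parity (show gen N * a = gen N * b from h)
    rwa [map_mul, map_mul, parity_odd (gen_odd N), neg_mul, neg_mul, neg_inj] at this
  rw [eq_gen_mul hy, ← mul_assoc, ← mul_assoc]
  congr 1
  have e : ∀ x : Grassmann, x * gen N = gen N * parity x := fun x => by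
    rw [odd_mul_comm (gen_odd N), parity_parity]
  rw [e, e, h2]

theorem gen_eq_zeta (N : ℕ) : gen N = zeta {N} := by
  have h := ExteriorAlgebra.basis_apply_ofCard (n := 1)
    (Finsupp.basisSingleOne : Module.Basis ℕ ℂ (ℕ →₀ ℂ)) (s := {N}) (Finset.card_singleton N)
  refine Eq.symm (h.trans ((ExteriorAlgebra.ιMulti_apply _).trans ?_))
  have hm := (Set.powersetCard.mem_range_ofFinEmbEquiv_symm_iff_mem
    (Set.powersetCard.ofCard (Finset.card_singleton N)) _).1 ⟨0, rfl⟩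
  have hN := Finset.mem_singleton.1 hm
  simp only [List.ofFn_succ, List.ofFn_zero, List.prod_singleton, Function.comp_apply, hN]
  rfl

theorem gen_mul_zeta {N : ℕ} {k : Finset ℕ} (h : N ∈ k) : gen N * zeta k = 0 := by
  rw [gen_eq_zeta]
  exact ExteriorAlgebra.basis_mul_of_not_disjoint _
    (Set.powersetCard.ofCard (Finset.card_singleton N)) (Set.powersetCard.ofCard (s := k) rfl)
    (by simpa [Finset.disjoint_singleton_left] using h)

/-- Points that agree modulo `ζ_N`. -/
def PCong (N : ℕ) (p q : SPoint) : Prop := Cong N p.z q.z ∧ Cong N p.tp q.tp ∧ Cong N p.tm q.tm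

theorem PCong.body_eq {N : ℕ} {p q : SPoint} (h : PCong N p q) : p.body = q.body := h.1.gbody_eq

theorem PCong.mon {N : ℕ} {p q : SPoint} (h : PCong N p q) (s : Sector) :
    Cong N (p.mon s) (q.mon s) := by
  cases s
  · exact Cong.refl _ _
  · exact h.2.1
  · exact h.2.2
  · exact h.2.1.mul h.2.2

theorem PCong.eval {N : ℕ} {p q : SPoint} (h : PCong N p q) {F : SuperFn} (hF : F.AnAt p.body) :
    Cong N (F.eval p) (F.eval q) := by
  obtain ⟨K, hK⟩ := hF.2
  have e : ∀ s, Cong N (p.mon s * F.sec s p.z) (q.mon s * F.sec s q.z) := fun s => by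
    rw [SuperFn.sec_eq_sum p.z_even hK,
      SuperFn.sec_eq_sum q.z_even (by rw [← h.1.gbody_eq]; exact hK)]
    exact (h.mon s).mul (Cong.sum fun k _ =>
      (h.1.extend p.z_even q.z_even _).mul (Cong.refl _ _))
  rw [SuperFn.eval_eq, SuperFn.eval_eq, assemble_eq_mon, assemble_eq_mon]
  exact (((e _).add (e _)).add (e _)).add (e _)

/-- Every surviving monomial contains `ζ_N`, so a change of the point by multiples of `ζ_N` has no
effect. This makes a single correction step exact in the inverse function theorem. -/
theorem PCong.eval_eq {N : ℕ} {p q : SPoint} (h : PCong N p q) {F : SuperFn} (hF : F.AnAt p.body)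
    (h0 : ∀ᶠ w in 𝓝 p.body, ∀ s k, N ∉ k → F s k w = 0) : F.eval p = F.eval q := by
  obtain ⟨K, hK⟩ := hF.2
  have e : ∀ s, p.mon s * F.sec s p.z = q.mon s * F.sec s q.z := fun s => by
    rw [SuperFn.sec_eq_sum p.z_even hK,
      SuperFn.sec_eq_sum q.z_even (by rw [← h.1.gbody_eq]; exact hK), Finset.mul_sum,
      Finset.mul_sum]
    refine Finset.sum_congr rfl fun k _ => ?_
    by_cases hk : N ∈ k
    · rw [← mul_assoc, ← mul_assoc]
      exact ((h.mon s).mul (h.1.extend p.z_even q.z_even _)).mul_eq (gen_mul_zeta hk)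
    · rw [extend_of_eventually_zero p.z_even (by filter_upwards [h0] with w hw using hw s k hk),
        extend_of_eventually_zero q.z_even (by
          rw [← h.1.gbody_eq]; filter_upwards [h0] with w hw using hw s k hk)]
      simp
  rw [SuperFn.eval_eq, SuperFn.eval_eq, assemble_eq_mon, assemble_eq_mon]
  simp only [e]

theorem gen_mul_eval {N : ℕ} {p : SPoint} {F : SuperFn} (hF : F.AnAt p.body)
    (h0 : ∀ᶠ w in 𝓝 p.body, ∀ s k, N ∉ k → F s k w = 0) : gen N * F.eval p = 0 := by
  obtain ⟨K, hK⟩ := hF.2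
  have e : ∀ s, gen N * (p.mon s * F.sec s p.z) = 0 := fun s => by
    rw [SuperFn.sec_eq_sum p.z_even hK, Finset.mul_sum, Finset.mul_sum]
    refine Finset.sum_eq_zero fun k _ => ?_
    by_cases hk : N ∈ k
    · rw [← mul_assoc (p.mon s), ← mul_assoc, odd_mul_comm (gen_odd N), mul_assoc, gen_mul_zeta hk,
        mul_zero]
    · rw [extend_of_eventually_zero p.z_even (by filter_upwards [h0] with w hw using hw s k hk)]
      simp
  rw [SuperFn.eval_eq, assemble_eq_mon]
  simp only [mul_add, e, add_zero]

theorem SAn.cong {N : ℕ} {w : ℂ} {Φ : SPoint → Grassmann} (h : SAn w Φ) :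
    ∀ᶠ p in bn w, ∀ q, PCong N p q → Cong N (Φ p) (Φ q) := by
  obtain ⟨F, hF, e⟩ := h
  filter_upwards [eventually_bn_body (eventually_eventually_bn e), eventually_bn_body hF.eventually]
    with p a b q hq
  rw [of_eventually_bn a rfl, of_eventually_bn a hq.body_eq.symm]
  exact hq.eval b

theorem SAnMap.cong {N : ℕ} {w : ℂ} {H : SPoint → SPoint} (h : SAnMap w H) :
    ∀ᶠ p in bn w, ∀ q, PCong N p q → PCong N (H p) (H q) := by
  filter_upwards [h.1.cong, h.2.1.cong, h.2.2.cong] with p a b c q hq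
    using ⟨a q hq, b q hq, c q hq⟩

open Classical in
/-- The part of a superfunction that does not involve `ζ_N`. -/
def SuperFn.low (N : ℕ) (F : SuperFn) : SuperFn := fun s k => if N ∈ k then 0 else F s k

open Classical in
/-- The part of a superfunction that involves `ζ_N`. -/
def SuperFn.high (N : ℕ) (F : SuperFn) : SuperFn := fun s k => if N ∈ k then F s k else 0

theorem SuperFn.low_add_high (N : ℕ) (F : SuperFn) : F.low N + F.high N = F := by
  funext s k
  simp only [SuperFn.low, SuperFn.high, Pi.add_apply]
  split_ifs <;> simp

theorem SuperFn.AnAt.low {F : SuperFn} {w : ℂ} (h : F.AnAt w) (N : ℕ) : (F.low N).AnAt w := by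
  obtain ⟨h1, K, hK⟩ := h
  refine ⟨fun s k => ?_, K, ?_⟩
  · unfold SuperFn.low; split_ifs; exacts [analyticAt_const, h1 s k]
  · filter_upwards [hK] with w' h s k hk
    unfold SuperFn.low; split_ifs; exacts [rfl, h s k hk]

theorem SuperFn.AnAt.high {F : SuperFn} {w : ℂ} (h : F.AnAt w) (N : ℕ) : (F.high N).AnAt w := by
  obtain ⟨h1, K, hK⟩ := h
  refine ⟨fun s k => ?_, K, ?_⟩
  · unfold SuperFn.high; split_ifs; exacts [h1 s k, analyticAt_const]
  · filter_upwards [hK] with w' h s k hk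
    unfold SuperFn.high; split_ifs; exacts [h s k hk, rfl]

theorem SuperFn.high_eq_zero (N : ℕ) (F : SuperFn) (w : ℂ) (s : Sector) (k : Finset ℕ)
    (h : N ∉ k) : F.high N s k w = 0 := by
  simp [SuperFn.high, h]

theorem parity_mon (p : SPoint) (s : Sector) : parity (p.mon s) = (-1 : ℂ) ^ s.card • p.mon s := by
  cases s
  · simp [SPoint.mon, Sector.card]
  · simp [SPoint.mon, Sector.card, parity_odd p.tp_odd]
  · simp [SPoint.mon, Sector.card, parity_odd p.tm_odd]
  · simp [SPoint.mon, Sector.card, parity_odd p.tp_odd, parity_odd p.tm_odd]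

theorem SuperFn.parity_eval {F : SuperFn} {p : SPoint} (hF : F.AnAt p.body) {ε : ℂ}
    (h : ∀ᶠ w in 𝓝 p.body, ∀ s k, (-1 : ℂ) ^ (s.card + k.card) ≠ ε → F s k w = 0) :
    parity (F.eval p) = ε • F.eval p := by
  obtain ⟨K, hK⟩ := hF.2
  have e : ∀ s, parity (p.mon s * F.sec s p.z) = ε • (p.mon s * F.sec s p.z) := fun s => by
    rw [SuperFn.sec_eq_sum p.z_even hK, Finset.mul_sum, map_sum, Finset.smul_sum]
    refine Finset.sum_congr rfl fun k _ => ?_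
    by_cases hk : (-1 : ℂ) ^ (s.card + k.card) = ε
    · rw [map_mul, map_mul, parity_mon, parity_zeta, parity_even (extend_even _ p.z_even), ← hk,
        pow_add]
      simp only [smul_mul_assoc, mul_smul_comm, smul_smul, mul_comm]
    · rw [extend_of_eventually_zero p.z_even (by filter_upwards [h] with w hw using hw s k hk)]
      simp
  rw [SuperFn.eval_eq, assemble_eq_mon]
  simp only [map_add, e, smul_add]

theorem SuperFn.eval_mem_even {F : SuperFn} {p : SPoint} (hF : F.AnAt p.body)
    (h : ∀ᶠ w in 𝓝 p.body, ∀ s k, Odd (s.card + k.card) → F s k w = 0) : F.eval p ∈ GEven := by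
  rw [mem_even_iff, SuperFn.parity_eval (ε := 1) hF, one_smul]
  filter_upwards [h] with w h s k hk
  exact h s k (by
    rw [← Nat.not_even_iff_odd]; exact fun h => hk h.neg_one_pow)

theorem SuperFn.eval_mem_odd {F : SuperFn} {p : SPoint} (hF : F.AnAt p.body)
    (h : ∀ᶠ w in 𝓝 p.body, ∀ s k, Even (s.card + k.card) → F s k w = 0) : F.eval p ∈ GOdd := by
  rw [mem_odd_iff, SuperFn.parity_eval (ε := -1) hF, neg_one_smul]
  filter_upwards [h] with w h s k hk
  exact h s k (by
    rw [← Nat.not_odd_iff_even]; exact fun h => hk h.neg_one_pow)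

/-! ### The inverse function theorem -/

/-- `H` has a superanalytic inverse near the points with body `w`. -/
def HasInv (w : ℂ) (H : SPoint → SPoint) : Prop :=
  ∃ (G : SPoint → SPoint) (w' : ℂ), SAnMap w' G ∧ (∀ p : SPoint, p.body = w → (H p).body = w') ∧
    (∀ᶠ p in bn w, G (H p) = p) ∧ ∀ᶠ q in bn w', H (G q) = q

/-- The coefficient functions of a superanalytic map whose odd derivatives at the body are
those of an invertible superconformal map. -/
structure Nondeg (w : ℂ) (Z P M : SuperFn) : Prop where
  anZ : Z.AnAt w
  anP : P.AnAt w
  anM : M.AnAt w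
  evenZ : ∀ᶠ w' in 𝓝 w, ∀ s k, Odd (s.card + k.card) → Z s k w' = 0
  oddP : ∀ᶠ w' in 𝓝 w, ∀ s k, Even (s.card + k.card) → P s k w' = 0
  oddM : ∀ᶠ w' in 𝓝 w, ∀ s k, Even (s.card + k.card) → M s k w' = 0
  derivZ : deriv (Z .one ∅) w ≠ 0
  pmZ : ∀ᶠ w' in 𝓝 w, Z .pm ∅ w' = 0
  pP : P .p ∅ w ≠ 0
  mP : ∀ᶠ w' in 𝓝 w, P .m ∅ w' = 0
  mM : M .m ∅ w ≠ 0
  pM : ∀ᶠ w' in 𝓝 w, M .p ∅ w' = 0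

/-- The conditions other than parity and analyticity concern coefficients without generators, which
are not affected by dropping `ζ_N`. -/
theorem Nondeg.low {w : ℂ} {Z P M : SuperFn} (h : Nondeg w Z P M) (N : ℕ) :
    Nondeg w (Z.low N) (P.low N) (M.low N) := by
  have e : ∀ (F : SuperFn) s, F.low N s ∅ = F s ∅ := fun F s => by simp [SuperFn.low]
  have e' : ∀ (F : SuperFn) s k w, F s k w = 0 → F.low N s k w = 0 := fun F s k w h => by
    unfold SuperFn.low; split_ifs; exacts [rfl, h]
  obtain ⟨h1, h2, h3, h4, h5, h6, h7, h8, h9, h10, h11, h12⟩ := h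
  refine ⟨h1.low N, h2.low N, h3.low N, ?_, ?_, ?_, ?_, ?_, ?_, ?_, ?_, ?_⟩ <;>
    try simpa only [e]
  · filter_upwards [h4] with w' h s k hk using e' _ _ _ _ (h s k hk)
  · filter_upwards [h5] with w' h s k hk using e' _ _ _ _ (h s k hk)
  · filter_upwards [h6] with w' h s k hk using e' _ _ _ _ (h s k hk)

/-- `H` is given by the coefficient functions `Z, P, M` near the points with body `w`. -/
def GivenBy (w : ℂ) (Z P M : SuperFn) (H : SPoint → SPoint) : Prop :=
  ∀ᶠ p in bn w, (H p).z = Z.eval p ∧ (H p).tp = P.eval p ∧ (H p).tm = M.eval p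

theorem Nondeg.exists_map {w : ℂ} {Z P M : SuperFn} (h : Nondeg w Z P M) :
    ∃ H, GivenBy w Z P M H := by
  have : ∀ᶠ p in bn w, ∃ q : SPoint, q.z = Z.eval p ∧ q.tp = P.eval p ∧ q.tm = M.eval p := by
    filter_upwards [eventually_bn_body h.anZ.eventually, eventually_bn_body h.anP.eventually,
      eventually_bn_body h.anM.eventually, eventually_bn_body h.evenZ.eventually_nhds,
      eventually_bn_body h.oddP.eventually_nhds, eventually_bn_body h.oddM.eventually_nhds]
      with p a1 a2 a3 b1 b2 b3
    exact ⟨⟨_, _, _, SuperFn.eval_mem_even a1 b1, SuperFn.eval_mem_odd a2 b2,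
      SuperFn.eval_mem_odd a3 b3⟩, rfl, rfl, rfl⟩
  choose! H hH using (fun p (hp : ∃ q : SPoint, q.z = Z.eval p ∧ q.tp = P.eval p ∧
    q.tm = M.eval p) => hp)
  exact ⟨H, this.mono hH⟩

theorem GivenBy.sanMap {w : ℂ} {Z P M : SuperFn} {H : SPoint → SPoint} (e : GivenBy w Z P M H)
    (h : Nondeg w Z P M) : SAnMap w H :=
  ⟨⟨Z, h.anZ, e.mono fun _ h => h.1⟩, ⟨P, h.anP, e.mono fun _ h => h.2.1⟩,
    ⟨M, h.anM, e.mono fun _ h => h.2.2⟩⟩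

/-- The inverse of a map whose coefficients do not involve any generators. -/
theorem Nondeg.hasInv_bosonic {w : ℂ} {Z P M : SuperFn} (h : Nondeg w Z P M)
    (hs : ∀ᶠ w' in 𝓝 w, ∀ s k, k ≠ ∅ → Z s k w' = 0 ∧ P s k w' = 0 ∧ M s k w' = 0)
    {H : SPoint → SPoint} (e : GivenBy w Z P M H) : HasInv w H := by
  set f := Z .one ∅ with hf
  set a := P .p ∅ with ha
  set d := M .m ∅ with hd
  have af : AnalyticAt ℂ f w := h.anZ.1 _ _
  have aa : AnalyticAt ℂ a w := h.anP.1 _ _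
  have ad : AnalyticAt ℂ d w := h.anM.1 _ _
  set g := af.hasStrictDerivAt.localInverse _ _ _ h.derivZ with hg
  have ag : AnalyticAt ℂ g (f w) := af.analyticAt_localInverse h.derivZ
  have gf : ∀ᶠ x in 𝓝 w, g (f x) = x := af.hasStrictDerivAt.eventually_left_inverse h.derivZ
  have fg : ∀ᶠ y in 𝓝 (f w), f (g y) = y := af.hasStrictDerivAt.eventually_right_inverse h.derivZ
  have gw : g (f w) = w := gf.self_of_nhds
  have sec : ∀ (F : SuperFn), F.AnAt w → (∀ᶠ w' in 𝓝 w, ∀ s k, k ≠ ∅ → F s k w' = 0) →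
      ∀ᶠ p in bn w, ∀ s, F.sec s p.z = extend (F s ∅) p.z := fun F hF h0 => by
    filter_upwards [eventually_bn_body h0.eventually_nhds] with p hp s
    rw [SuperFn.sec_eq_sum (K := {∅}) p.z_even (by
      filter_upwards [hp] with w' h s k hk using h s k (by simpa using hk)), Finset.sum_singleton,
      zeta_empty, mul_one]
  have z0 : ∀ {F : ℂ → ℂ}, (∀ᶠ w' in 𝓝 w, F w' = 0) → ∀ᶠ p in bn w, extend F p.z = 0 := fun h => by
    filter_upwards [eventually_bn_body h.eventually_nhds] with p hp using
      extend_of_eventually_zero p.z_even hp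
  -- Parity and the vanishing conditions leave the map `(f(z), θ⁺ a(z), θ⁻ d(z))`, whose inverse is
  -- written down from the local inverse `g` of `f` and the functions `1 / a(g)` and `1 / d(g)`.
  have e' : ∀ᶠ p in bn w, (H p).z = extend f p.z ∧ (H p).tp = p.tp * extend a p.z ∧
      (H p).tm = p.tm * extend d p.z := by
    filter_upwards [e, sec Z h.anZ (hs.mono fun w h s k hk => (h s k hk).1),
      sec P h.anP (hs.mono fun w h s k hk => (h s k hk).2.1),
      sec M h.anM (hs.mono fun w h s k hk => (h s k hk).2.2),
      z0 h.pmZ, z0 h.mP, z0 h.pM,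
      z0 (F := Z .p ∅) (h.evenZ.mono fun w h => h _ _ (by decide)),
      z0 (F := Z .m ∅) (h.evenZ.mono fun w h => h _ _ (by decide)),
      z0 (F := P .one ∅) (h.oddP.mono fun w h => h _ _ (by decide)),
      z0 (F := P .pm ∅) (h.oddP.mono fun w h => h _ _ (by decide)),
      z0 (F := M .one ∅) (h.oddM.mono fun w h => h _ _ (by decide)),
      z0 (F := M .pm ∅) (h.oddM.mono fun w h => h _ _ (by decide))]
      with p ⟨e1, e2, e3⟩ s1 s2 s3 y1 y2 y3 y4 y5 y6 y7 y8 y9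
    rw [e1, e2, e3]
    simp only [SuperFn.eval_eq, assemble, s1, s2, s3, y1, y2, y3, y4, y5, y6, y7, y8, y9]
    simp [hf, ha, hd]
  have ia : AnalyticAt ℂ (fun y => (a (g y))⁻¹) (f w) :=
    ((by rwa [gw] : AnalyticAt ℂ a (g (f w))).comp ag).inv (by
      show a (g (f w)) ≠ 0; rw [gw]; exact h.pP)
  have id' : AnalyticAt ℂ (fun y => (d (g y))⁻¹) (f w) :=
    ((by rwa [gw] : AnalyticAt ℂ d (g (f w))).comp ag).inv (by
      show d (g (f w)) ≠ 0; rw [gw]; exact h.mM)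
  have na : ∀ᶠ x in 𝓝 w, a x ≠ 0 := aa.continuousAt.eventually_ne h.pP
  have nd : ∀ᶠ x in 𝓝 w, d x ≠ 0 := ad.continuousAt.eventually_ne h.mM
  have tf : Tendsto f (𝓝 w) (𝓝 (f w)) := af.continuousAt
  have tg : Tendsto g (𝓝 (f w)) (𝓝 w) := by simpa [ContinuousAt, gw] using ag.continuousAt
  refine ⟨fun q => ⟨extend g q.z, q.tp * extend (fun y => (a (g y))⁻¹) q.z,
    q.tm * extend (fun y => (d (g y))⁻¹) q.z, extend_even _ q.z_even,
    odd_mul_even q.tp_odd (extend_even _ q.z_even), odd_mul_even q.tm_odd (extend_even _ q.z_even)⟩,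
    f w, ⟨SAn.extend_z ag, (SAn.tp _).mul (SAn.extend_z ia), (SAn.tm _).mul (SAn.extend_z id')⟩,
    fun p hp => ?_, ?_, ?_⟩
  · rw [SPoint.body, (of_eventually_bn e' hp).1, gbody_extend _ p.z_even]
    exact congrArg f hp
  · have key : ∀ {b : ℂ → ℂ}, AnalyticAt ℂ b w → AnalyticAt ℂ (fun y => (b (g y))⁻¹) (f w) →
        (∀ᶠ x in 𝓝 w, b x ≠ 0) → ∀ᶠ p in bn w,
        extend b p.z * extend (fun y => (b (g y))⁻¹) (extend f p.z) = 1 := fun {b} hb hb' hb0 => by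
      filter_upwards [eventually_bn_body af.eventually_analyticAt,
        eventually_bn_body hb.eventually_analyticAt,
        eventually_bn_body (tf.eventually hb'.eventually_analyticAt),
        eventually_bn_body (hb0.and gf).eventually_nhds] with p k1 k2 k3 k4
      rw [← extend_comp p.z_even k1 k3, ← extend_mul (g := fun w => (b (g (f w)))⁻¹) p.z_even k2 (k3.comp k1),
        extend_congr (g := fun _ => 1), extend_const _ p.z_even, map_one]
      filter_upwards [k4] with x ⟨x1, x2⟩
      simp [x2, x1]
    filter_upwards [e', key aa ia na, key ad id' nd, eventually_bn_body af.eventually_analyticAt,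
      eventually_bn_body (tf.eventually ag.eventually_analyticAt),
      eventually_bn_body gf.eventually_nhds] with p ⟨e1, e2, e3⟩ k1 k2 k3 k4 k5
    refine SPoint.ext ?_ ?_ ?_
    · show extend g (H p).z = p.z
      rw [e1, ← extend_comp p.z_even k3 k4, extend_congr k5, extend_id p.z_even]
    · show (H p).tp * extend _ (H p).z = _
      rw [e1, e2, mul_assoc, k1, mul_one]
    · show (H p).tm * extend _ (H p).z = _
      rw [e1, e3, mul_assoc, k2, mul_one]
  · have key : ∀ {b : ℂ → ℂ}, AnalyticAt ℂ b w → AnalyticAt ℂ (fun y => (b (g y))⁻¹) (f w) →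
        (∀ᶠ x in 𝓝 w, b x ≠ 0) → ∀ᶠ q in bn (f w),
        extend (fun y => (b (g y))⁻¹) q.z * extend b (extend g q.z) = 1 := fun {b} hb hb' hb0 => by
      filter_upwards [eventually_bn_body ag.eventually_analyticAt,
        eventually_bn_body (tg.eventually hb.eventually_analyticAt),
        eventually_bn_body hb'.eventually_analyticAt,
        eventually_bn_body (tg.eventually hb0).eventually_nhds] with q k1 k2 k3 k4
      rw [← extend_comp q.z_even k1 k2, ← extend_mul (g := fun w => b (g w)) q.z_even k3 (k2.comp k1),
        extend_congr (g := fun _ => 1), extend_const _ q.z_even, map_one]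
      filter_upwards [k4] with x x1
      simp [x1]
    have t : Tendsto (fun q : SPoint => (⟨extend g q.z, q.tp * extend (fun y => (a (g y))⁻¹) q.z,
        q.tm * extend (fun y => (d (g y))⁻¹) q.z, extend_even _ q.z_even,
        odd_mul_even q.tp_odd (extend_even _ q.z_even),
        odd_mul_even q.tm_odd (extend_even _ q.z_even)⟩ : SPoint)) (bn (f w)) (bn w) := by
      refine tendsto_comap_iff.2 ((tg.comp tendsto_comap).congr fun q => ?_)
      exact (gbody_extend g q.z_even).symm
    filter_upwards [t.eventually e', key aa ia na, key ad id' nd,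
      eventually_bn_body ag.eventually_analyticAt,
      eventually_bn_body (tg.eventually af.eventually_analyticAt),
      eventually_bn_body fg.eventually_nhds] with q ⟨e1, e2, e3⟩ k1 k2 k3 k4 k5
    refine SPoint.ext ?_ ?_ ?_
    · rw [e1, ← extend_comp q.z_even k3 k4, extend_congr k5, extend_id q.z_even]
    · rw [e2, mul_assoc, k1, mul_one]
    · rw [e3, mul_assoc, k2, mul_one]

/-- The point `q + q - p`. -/
def SPoint.reflect (p q : SPoint) : SPoint :=
  ⟨q.z + q.z - p.z, q.tp + q.tp - p.tp, q.tm + q.tm - p.tm,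
    sub_mem (add_mem q.z_even q.z_even) p.z_even, sub_mem (add_mem q.tp_odd q.tp_odd) p.tp_odd,
    sub_mem (add_mem q.tm_odd q.tm_odd) p.tm_odd⟩

/-- The points `p - q` and `p' - q'` agree. -/
def SameDiff (p q p' q' : SPoint) : Prop :=
  p.z - q.z = p'.z - q'.z ∧ p.tp - q.tp = p'.tp - q'.tp ∧ p.tm - q.tm = p'.tm - q'.tm

theorem SameDiff.reflect_eq {p q q' : SPoint} (h : SameDiff p q q q') : p.reflect q = q' := by
  obtain ⟨h1, h2, h3⟩ := h
  refine SPoint.ext ?_ ?_ ?_ <;> simp only [SPoint.reflect]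
  · rw [add_sub_assoc, ← neg_sub, h1]; abel
  · rw [add_sub_assoc, ← neg_sub, h2]; abel
  · rw [add_sub_assoc, ← neg_sub, h3]; abel

theorem SameDiff.eq_of_reflect {p q r : SPoint} (h : SameDiff r (p.reflect q) p q) : r = q := by
  obtain ⟨h1, h2, h3⟩ := h
  simp only [SPoint.reflect] at h1 h2 h3
  refine SPoint.ext ?_ ?_ ?_
  · rw [sub_eq_iff_eq_add.1 h1]; abel
  · rw [sub_eq_iff_eq_add.1 h2]; abel
  · rw [sub_eq_iff_eq_add.1 h3]; abel

theorem PCong.reflect {N : ℕ} {p q : SPoint} (h : PCong N p q) : PCong N q (p.reflect q) := by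
  obtain ⟨h1, h2, h3⟩ := h
  refine ⟨?_, ?_, ?_⟩ <;> unfold Cong at * <;> simp only [SPoint.reflect, mul_sub, mul_add]
  · rw [h1]; abel
  · rw [h2]; abel
  · rw [h3]; abel

/-- Inverses modulo a generator can be corrected. -/
theorem HasInv.of_low {w : ℂ} {Z P M : SuperFn} (h : Nondeg w Z P M) (N : ℕ) {H H₀ : SPoint → SPoint}
    (e : GivenBy w Z P M H) (e₀ : GivenBy w (Z.low N) (P.low N) (M.low N) H₀) (h₀ : HasInv w H₀) :
    HasInv w H := by
  obtain ⟨G, w', hG, hw, gh, hg⟩ := h₀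
  have s := e.sanMap h
  -- `H` and `H₀` differ by a multiple of `ζ_N`, and this difference depends on the point only
  -- modulo `ζ_N`.
  have near : ∀ᶠ p in bn w, PCong N (H p) (H₀ p) ∧
      ∀ q, PCong N p q → SameDiff (H p) (H₀ p) (H q) (H₀ q) := by
    filter_upwards [eventually_bn_body (eventually_eventually_bn e),
      eventually_bn_body (eventually_eventually_bn e₀),
      eventually_bn_body h.anZ.eventually, eventually_bn_body h.anP.eventually,
      eventually_bn_body h.anM.eventually] with p a a₀ a2 a3 a4
    have split : ∀ {F : SuperFn}, F.AnAt p.body → ∀ q : SPoint, q.body = p.body →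
        F.eval q - (F.low N).eval q = (F.high N).eval q := fun {F} hF q hq => by
      have := SuperFn.eval_add (p := q) (hq ▸ hF.low N) (hq ▸ hF.high N)
      rw [SuperFn.low_add_high] at this
      rw [this, add_sub_cancel_left]
    have hz : ∀ F : SuperFn, ∀ᶠ w in 𝓝 p.body, ∀ s k, N ∉ k → F.high N s k w = 0 := fun F =>
      Eventually.of_forall fun w s k hk => SuperFn.high_eq_zero _ _ _ _ _ hk
    obtain ⟨b1, b2, b3⟩ := of_eventually_bn a rfl
    obtain ⟨c1, c2, c3⟩ := of_eventually_bn a₀ rfl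
    constructor
    · refine ⟨?_, ?_, ?_⟩ <;> unfold Cong <;> rw [← sub_eq_zero, ← mul_sub]
      · rw [b1, c1, split a2 p rfl]; exact gen_mul_eval (a2.high N) (hz Z)
      · rw [b2, c2, split a3 p rfl]; exact gen_mul_eval (a3.high N) (hz P)
      · rw [b3, c3, split a4 p rfl]; exact gen_mul_eval (a4.high N) (hz M)
    · intro q hq
      have hb := hq.body_eq.symm
      obtain ⟨b1', b2', b3'⟩ := of_eventually_bn a hb
      obtain ⟨c1', c2', c3'⟩ := of_eventually_bn a₀ hb
      refine ⟨?_, ?_, ?_⟩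
      · rw [b1, c1, b1', c1', split a2 p rfl, split a2 q hb]
        exact hq.eval_eq (a2.high N) (hz Z)
      · rw [b2, c2, b2', c2', split a3 p rfl, split a3 q hb]
        exact hq.eval_eq (a3.high N) (hz P)
      · rw [b3, c3, b3', c3', split a4 p rfl, split a4 q hb]
        exact hq.eval_eq (a4.high N) (hz M)
  have hHw : ∀ p : SPoint, p.body = w → (H p).body = w' := fun p hp => by
    rw [(of_eventually_bn near hp).1.body_eq, hw p hp]
  have o := SPoint.body_ofBody w
  have hGw : ∀ q : SPoint, q.body = w' → (G q).body = w := fun q hq => by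
    rw [hG.body_eq hq (hw _ o), of_eventually_bn gh o, o]
  have tH := s.tendsto o (hHw _ o)
  have o' := SPoint.body_ofBody w'
  have tG := hG.tendsto o' (hGw _ o')
  have sHG := s.comp hG o' (hGw _ o')
  have sT : SAnMap w' fun q => (H (G q)).reflect q :=
    ⟨((SAn.z _).add (SAn.z _)).sub sHG.1, ((SAn.tp _).add (SAn.tp _)).sub sHG.2.1,
      ((SAn.tm _).add (SAn.tm _)).sub sHG.2.2⟩
  have cT : ∀ᶠ q in bn w', PCong N q ((H (G q)).reflect q) := by
    filter_upwards [tG.eventually near, hg] with q a b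
    have := a.1
    rw [b] at this
    exact this.reflect
  have hT : ∀ q : SPoint, q.body = w' → ((H (G q)).reflect q).body = w' := fun q hq => by
    rw [← (of_eventually_bn cT hq).body_eq, hq]
  have tT := sT.tendsto o' (hT _ o')
  -- `G` inverts `H` up to the error `H(G q) - q`, a multiple of `ζ_N`. Subtracting this error from
  -- `q` before applying `G` gives the exact inverse, since the error does not change under a
  -- further displacement by multiples of `ζ_N`.
  refine ⟨fun q => G ((H (G q)).reflect q), w', hG.comp sT o' (hT _ o'), hHw, ?_, ?_⟩
  · filter_upwards [near, tH.eventually hG.cong, gh, tH.eventually hg] with p a b c d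
    have h1 := b _ a.1
    rw [c] at h1
    have h2 := a.2 _ ⟨h1.1.symm, h1.2.1.symm, h1.2.2.symm⟩
    rw [d] at h2
    rw [SameDiff.reflect_eq (q' := H₀ p) ⟨h2.1.symm, h2.2.1.symm, h2.2.2.symm⟩, c]
  · filter_upwards [cT, hG.cong, tG.eventually near, hg, tT.eventually hg] with q a b c d d'
    have h1 := c.2 _ (b _ a)
    rw [d, d'] at h1
    exact SameDiff.eq_of_reflect ⟨h1.1.symm, h1.2.1.symm, h1.2.2.symm⟩

/-- Induction on the number of generators allowed in the coefficients: dropping the last one leaves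
a non-degenerate map, and the inverse of that map is corrected. -/
theorem Nondeg.hasInv {w : ℂ} (n : ℕ) {Z P M : SuperFn} (h : Nondeg w Z P M)
    (hs : ∀ᶠ w' in 𝓝 w, ∀ s k, ¬ k ⊆ Finset.range n → Z s k w' = 0 ∧ P s k w' = 0 ∧ M s k w' = 0)
    {H : SPoint → SPoint} (e : GivenBy w Z P M H) : HasInv w H := by
  induction n generalizing Z P M H with
  | zero =>
    refine h.hasInv_bosonic ?_ e
    filter_upwards [hs] with w' h s k hk using h s k (by simpa using hk)
  | succ n ih =>
    obtain ⟨H₀, e₀⟩ := (h.low n).exists_map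
    refine HasInv.of_low h n e e₀ (ih (h.low n) ?_ e₀)
    filter_upwards [hs] with w' h s k hk
    by_cases hn : n ∈ k
    · simp [SuperFn.low, hn]
    · simp only [SuperFn.low, hn, if_false]
      refine h s k fun hk' => hk fun i hi => ?_
      have := Finset.mem_range.1 (hk' hi)
      have : i ≠ n := fun h => hn (h ▸ hi)
      exact Finset.mem_range.2 (by omega)

theorem SuperFn.gbody_eval {F : SuperFn} {p : SPoint} (hF : F.AnAt p.body) :
    gbody (F.eval p) = F .one ∅ p.body := by
  obtain ⟨K, hK⟩ := hF.2
  rw [SuperFn.eval_eq, assemble]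
  simp only [gbody_add, gbody_mul, gbody_odd p.tp_odd, gbody_odd p.tm_odd, zero_mul, add_zero]
  rw [SuperFn.sec_eq_sum (K := insert ∅ K) p.z_even (by
    filter_upwards [hK] with w h s k hk using h s k fun h => hk (Finset.mem_insert_of_mem h))]
  rw [← gbodyL_apply, map_sum, Finset.sum_eq_single ∅]
  · rw [gbodyL_apply, zeta_empty, mul_one, gbody_extend _ p.z_even]; rfl
  · intro k _ hk
    rw [gbodyL_apply, gbody_mul, gbody_zeta hk, mul_zero]
  · intro h; exact absurd (Finset.mem_insert_self _ _) h

theorem gbody_parity (x : Grassmann) : gbody (parity x) = gbody x := by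
  rw [gbody_eq_repr, gbody_eq_repr, ← coef_apply, ← coef_apply, coef_parity]
  simp

/-- The body of the contraction is a derivation. -/
theorem gbody_contr_mul (N : ℕ) (x y : Grassmann) :
    gbody (contr N (x * y)) = gbody (contr N x) * gbody y + gbody x * gbody (contr N y) := by
  rw [contr_mul, gbody_add, gbody_mul, gbody_mul]
  rw [gbody_parity]

theorem SuperFn.gbody_sec {F : SuperFn} {w : ℂ} (hF : F.AnAt w) (s : Sector) :
    gbody (F.sec s (algebraMap ℂ Grassmann w)) = F s ∅ w := by
  rw [gbody_eq_repr, ← coef_apply, SuperFn.coef_sec hF]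

/-- Superconformal maps are non-degenerate. -/
theorem SConfAt.nondeg {w : ℂ} {H : SPoint → SPoint} (h : SConfAt w H) :
    ∃ Z P M : SuperFn, Nondeg w Z P M ∧ GivenBy w Z P M H := by
  obtain ⟨⟨⟨Z, aZ, eZ⟩, ⟨P, aP, eP⟩, ⟨M, aM, eM⟩⟩, hr⟩ := h
  have e : GivenBy w Z P M H := by
    filter_upwards [eZ, eP, eM] with q a b c using ⟨a, b, c⟩
  have near : ∀ᶠ w' in 𝓝 w, (∀ q : SPoint, q.body = w' →
      ∃ c : GEven, gbody c ≠ 0 ∧ M.DP.eval q = 0 ∧ P.DP.eval q = c ∧ Z.DP.eval q = c * (H q).tm) ∧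
      (∀ q : SPoint, q.body = w' →
      ∃ c : GEven, gbody c ≠ 0 ∧ P.DM.eval q = 0 ∧ M.DM.eval q = c ∧ Z.DM.eval q = c * (H q).tp) := by
    filter_upwards [eventually_bn.1 hr, eventually_bn.1 e, aZ.eventually, aP.eventually,
      aM.eventually] with w' h1 h2 a1 a2 a3
    refine ⟨fun q hq => ?_, fun q hq => ?_⟩ <;> subst hq <;>
      obtain ⟨⟨c, hc, hc'⟩, ⟨d, hd, hd'⟩⟩ := h1 q rfl
    · exact ⟨c, hc, hc'.derivs a1 a2 a3 h2⟩
    · exact ⟨d, hd, hd'.derivs a1 a2 a3 h2⟩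
  have coefs : ∀ᶠ w' in 𝓝 w, Z .pm ∅ w' = 0 ∧ deriv (Z .one ∅) w' ≠ 0 ∧ P .p ∅ w' ≠ 0 ∧
      M .m ∅ w' ≠ 0 ∧ P .m ∅ w' = 0 ∧ M .p ∅ w' = 0 := by
    filter_upwards [near, eventually_bn.1 e, aZ.eventually, aP.eventually,
      aM.eventually] with w' ⟨h1, h2⟩ h3 a1 a2 a3
    obtain ⟨n1, k1⟩ := exists_contr_eq_zero (Z.DP.sec .one (algebraMap ℂ Grassmann w'))
    obtain ⟨n2, k2⟩ := exists_contr_eq_zero (Z.DM.sec .one (algebraMap ℂ Grassmann w'))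
    obtain ⟨n3, k3⟩ := exists_contr_eq_zero (P.sec .one (algebraMap ℂ Grassmann w'))
    obtain ⟨n4, k4⟩ := exists_contr_eq_zero (M.sec .one (algebraMap ℂ Grassmann w'))
    -- The generator `ζ_N` does not occur in the four relevant coefficients. Used as the value of
    -- one odd variable, it lets contraction followed by the body extract the coefficient of that
    -- variable.
    set N := n1 + n2 + n3 + n4
    have cg : ∀ x, gbody (contr N (gen N * x)) = gbody x := fun x => by
      rw [contr_gen_mul, gbody_sub, gbody_mul, gbody_odd (gen_odd N), zero_mul, sub_zero]
    let q : SPoint := ⟨algebraMap ℂ Grassmann w', 0, gen N, algebraMap_even w', zero_mem _, gen_odd N⟩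
    let q' : SPoint := ⟨algebraMap ℂ Grassmann w', gen N, 0, algebraMap_even w', gen_odd N, zero_mem _⟩
    have hq : q.body = w' := gbody_algebraMap w'
    have hq' : q'.body = w' := gbody_algebraMap w'
    have cq : ∀ {F : SuperFn}, F.AnAt w' → contr N (F.sec .one (algebraMap ℂ Grassmann w')) = 0 →
        gbody (contr N (F.eval q)) = F .m ∅ w' := fun {F} hF h0 => by
      rw [SuperFn.eval_eq, assemble]
      simp only [q, zero_mul, add_zero, map_add, h0, zero_add, cg, SuperFn.gbody_sec hF]
    have cq' : ∀ {F : SuperFn}, F.AnAt w' → contr N (F.sec .one (algebraMap ℂ Grassmann w')) = 0 →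
        gbody (contr N (F.eval q')) = F .p ∅ w' := fun {F} hF h0 => by
      rw [SuperFn.eval_eq, assemble]
      simp only [q', zero_mul, mul_zero, add_zero, map_add, h0, zero_add, cg, SuperFn.gbody_sec hF]
    obtain ⟨c, hc, c1, c2, c3⟩ := h1 q hq
    obtain ⟨d, hd, d1, d2, d3⟩ := h2 q' hq'
    have x1 : M .p ∅ w' = 0 := by
      have := SuperFn.gbody_eval (F := M.DP) (p := q) (by rw [hq]; exact a3.DP)
      rw [c1, gbody_zero, hq] at this
      simpa [SuperFn.DP, dThetaP, thetaM] using this.symm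
    have x2 : P .m ∅ w' = 0 := by
      have := SuperFn.gbody_eval (F := P.DM) (p := q') (by rw [hq']; exact a2.DM)
      rw [d1, gbody_zero, hq'] at this
      simpa [SuperFn.DM, dThetaM, thetaP] using this.symm
    have x3 : gbody c = P .p ∅ w' := by
      have := SuperFn.gbody_eval (F := P.DP) (p := q) (by rw [hq]; exact a2.DP)
      rw [c2, hq] at this
      simpa [SuperFn.DP, dThetaP, thetaM] using this
    have x4 : gbody d = M .m ∅ w' := by
      have := SuperFn.gbody_eval (F := M.DM) (p := q') (by rw [hq']; exact a3.DM)
      rw [d2, hq'] at this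
      simpa [SuperFn.DM, dThetaM, thetaP] using this
    -- In bodies, this is the `θ⁻`-component of `D⁺z̃ = θ̃⁻ D⁺θ̃⁺`, and `y2` is the `θ⁺`-component
    -- of its counterpart. Their sum gives `f' = a d`, which is non-zero, and their difference gives
    -- the vanishing of the coefficient of `θ⁺θ⁻`.
    have y1 : Z .pm ∅ w' + deriv (Z .one ∅) w' = P .p ∅ w' * M .m ∅ w' := by
      have := cq a1.DP (k1 N (by omega))
      rw [c3, gbody_contr_mul, gbody_odd (H q).tm_odd, mul_zero, zero_add, (h3 q hq).2.2,
        cq a3 (k4 N (by omega)), x3] at this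
      rw [this]
      simp [SuperFn.DP, dThetaP, thetaM, SuperFn.dz]
    have y2 : -Z .pm ∅ w' + deriv (Z .one ∅) w' = P .p ∅ w' * M .m ∅ w' := by
      have := cq' a1.DM (k2 N (by omega))
      rw [d3, gbody_contr_mul, gbody_odd (H q').tp_odd, mul_zero, zero_add, (h3 q' hq').2.1,
        cq' a2 (k3 N (by omega)), x4] at this
      rw [mul_comm, this]
      simp [SuperFn.DM, dThetaM, thetaP, SuperFn.dz]
    rw [x3] at hc
    rw [x4] at hd
    have y3 : Z .pm ∅ w' = 0 := by linear_combination (y1 - y2) / 2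
    refine ⟨y3, ?_, hc, hd, x2, x1⟩
    rw [y3, zero_add] at y1
    rw [y1]
    exact mul_ne_zero hc hd
  have par := eventually_bn.1 e
  obtain ⟨-, z1, z2, z3, -, -⟩ := coefs.self_of_nhds
  refine ⟨Z, P, M, ⟨aZ, aP, aM, ?_, ?_, ?_, z1, coefs.mono fun _ h => h.1, z2,
    coefs.mono fun _ h => h.2.2.2.2.1, z3, coefs.mono fun _ h => h.2.2.2.2.2⟩, e⟩
  · filter_upwards [par, aZ.eventually] with w' h a s k hk
    exact SuperFn.coef_eq_zero_of_even a (fun p hp => (h p hp).1 ▸ (H p).z_even) s k hk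
  · filter_upwards [par, aP.eventually] with w' h a s k hk
    exact SuperFn.coef_eq_zero_of_odd a (fun p hp => (h p hp).2.1 ▸ (H p).tp_odd) s k hk
  · filter_upwards [par, aM.eventually] with w' h a s k hk
    exact SuperFn.coef_eq_zero_of_odd a (fun p hp => (h p hp).2.2 ▸ (H p).tm_odd) s k hk

/-- Superconformal maps with invertible derivative have superconformal inverses. -/
theorem SConfAt.exists_inverse {w : ℂ} {H : SPoint → SPoint} (h : SConfAt w H) :
    ∃ (G : SPoint → SPoint) (w' : ℂ), SConfAt w' G ∧ (∀ p : SPoint, p.body = w → (H p).body = w') ∧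
      (∀ᶠ p in bn w, G (H p) = p) ∧ ∀ᶠ q in bn w', H (G q) = q := by
  obtain ⟨Z, P, M, hn, e⟩ := h.nondeg
  obtain ⟨K1, hK1⟩ := hn.anZ.2
  obtain ⟨K2, hK2⟩ := hn.anP.2
  obtain ⟨K3, hK3⟩ := hn.anM.2
  -- Only finitely many monomials occur near `w`, so the indices of all generators involved have a
  -- common bound, at which the induction starts.
  have hb : ∀ K : Finset (Finset ℕ), ∃ n, ∀ k, ∀ m ≥ n, ¬ k ⊆ Finset.range m → k ∉ K := fun K => by
    obtain ⟨n, hn⟩ := (K.biUnion id).exists_nat_subset_range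
    refine ⟨n, fun k m hm hk hkK => hk fun i hi => ?_⟩
    have := Finset.mem_range.1 (hn (Finset.mem_biUnion.2 ⟨k, hkK, hi⟩))
    exact Finset.mem_range.2 (by omega)
  obtain ⟨n1, h1⟩ := hb K1
  obtain ⟨n2, h2⟩ := hb K2
  obtain ⟨n3, h3⟩ := hb K3
  obtain ⟨G, w', hG, hw, gh, hg⟩ := hn.hasInv (n1 + n2 + n3) (by
    filter_upwards [hK1, hK2, hK3] with w' a b c s k hk
    exact ⟨a s k (h1 k _ (by omega) hk), b s k (h2 k _ (by omega) hk), c s k (h3 k _ (by omega) hk)⟩) e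
  refine ⟨G, w', h.inverse hG (hw _ (SPoint.body_ofBody w)) ?_ gh hg, hw, gh, hg⟩
  rw [of_eventually_bn gh (SPoint.body_ofBody w), SPoint.body_ofBody]

/-! ### The inversion -/

theorem mul_mul_of_mul {a b c : Grassmann} (h : a * b = c) (x : Grassmann) : a * (b * x) = c * x := by
  rw [← mul_assoc, h]

/-- The map `(z, θ⁺, θ⁻) ↦ (1/z, c θ⁺/z, c θ⁻/z)`. -/
def SPoint.inv (c : ℂ) (p : SPoint) : SPoint :=
  ⟨extend (fun w => w⁻¹) p.z, c • (p.tp * extend (fun w => w⁻¹) p.z),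
    c • (p.tm * extend (fun w => w⁻¹) p.z), extend_even _ p.z_even,
    Submodule.smul_mem _ _ (odd_mul_even p.tp_odd (extend_even _ p.z_even)),
    Submodule.smul_mem _ _ (odd_mul_even p.tm_odd (extend_even _ p.z_even))⟩

theorem SPoint.body_inv (c : ℂ) (p : SPoint) : (p.inv c).body = p.body⁻¹ :=
  gbody_extend _ p.z_even

theorem SPoint.inv_inv {c d : ℂ} (h : c * d = 1) {p : SPoint} (hp : p.body ≠ 0) :
    (p.inv c).inv d = p := by
  obtain ⟨h1, h2⟩ := exists_inverse p.z_even hp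
  have hz : extend (fun w => w⁻¹) (p.inv c).z = p.z := by
    have hb : gbody (p.inv c).z ≠ 0 := by
      rw [show gbody (p.inv c).z = p.body⁻¹ from p.body_inv c]; exact inv_ne_zero hp
    have := (exists_inverse (p.inv c).z_even hb).1
    calc _ = extend (fun w => w⁻¹) (p.inv c).z * ((p.inv c).z * p.z) := by
          rw [show (p.inv c).z * p.z = 1 from h1, mul_one]
      _ = p.z := by rw [← mul_assoc, this, one_mul]
  have e : ∀ x : Grassmann, d • (c • (x * extend (fun w => w⁻¹) p.z) * p.z) = x := fun x => by
    rw [smul_mul_assoc, smul_smul, mul_comm d, h, one_smul, mul_assoc, h1, mul_one]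
  exact SPoint.ext hz (by show d • ((p.inv c).tp * _) = _; rw [hz]; exact e _)
    (by show d • ((p.inv c).tm * _) = _; rw [hz]; exact e _)

theorem isInversion_iff {q p : SPoint} :
    IsInversion q p ↔ p.body ≠ 0 ∧ q = p.inv (-Complex.I) := by
  have hI : -Complex.I * Complex.I = 1 := by simp
  constructor
  · rintro ⟨h1, h2, h3, h4⟩
    have hb : p.body ≠ 0 := fun h => by
      have := congrArg gbody h1
      rw [gbody_mul, show gbody p.z = 0 from h, mul_zero, gbody_one] at this
      exact zero_ne_one this
    refine ⟨hb, ?_⟩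
    obtain ⟨k1, k2⟩ := exists_inverse p.z_even hb
    have hz : q.z = extend (fun w => w⁻¹) p.z := by
      calc q.z = q.z * (p.z * extend (fun w => w⁻¹) p.z) := by rw [k2, mul_one]
        _ = _ := by rw [← mul_assoc, h1, one_mul]
    have e : ∀ x : Grassmann, x = -Complex.I • (Complex.I • (x * p.z) * extend (fun w => w⁻¹) p.z) :=
      fun x => by rw [smul_mul_assoc, smul_smul, hI, one_smul, mul_assoc, k2, mul_one]
    exact SPoint.ext hz ((e q.tp).trans (by rw [← h3]; rfl))
      ((e q.tm).trans (by rw [← h4]; rfl))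
  · rintro ⟨hb, rfl⟩
    obtain ⟨k1, k2⟩ := exists_inverse p.z_even hb
    have e : ∀ x : Grassmann, x = Complex.I • (-Complex.I • (x * extend (fun w => w⁻¹) p.z) * p.z) :=
      fun x => by
        rw [smul_mul_assoc, smul_smul, mul_comm Complex.I, hI, one_smul, mul_assoc, k1, mul_one]
    exact ⟨k1, k2, e _, e _⟩

theorem sanMap_inv (c : ℂ) {w : ℂ} (hw : w ≠ 0) : SAnMap w (SPoint.inv c) :=
  ⟨SAn.extend_z (analyticAt_inv hw), ((SAn.tp w).mul (SAn.extend_z (analyticAt_inv hw))).smul c,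
    ((SAn.tm w).mul (SAn.extend_z (analyticAt_inv hw))).smul c⟩

theorem deriv_inv_extend {z : Grassmann} (hz : z ∈ GEven) (hb : gbody z ≠ 0) :
    extend (deriv fun w : ℂ => w⁻¹) z =
      -(extend (fun w => w⁻¹) z * extend (fun w => w⁻¹) z) := by
  have a := analyticAt_inv (𝕜 := ℂ) hb
  rw [← extend_mul hz a a, ← neg_one_smul ℂ, ← extend_smul _ _ hz]
  refine extend_congr ?_
  filter_upwards [isOpen_ne.mem_nhds hb] with w hw
  simp [pow_two]

/-- The derivative of `1 / z` contributes `-1 / z²`, and `D⁺z̃ = θ̃⁻ D⁺θ̃⁺` matches this with `c² /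
z²`; hence the condition `c² = -1`. Both roots are used, for `I` and for its inverse. -/
theorem sconfAt_inv {c : ℂ} (hc : c * c = -1) {w : ℂ} (hw : w ≠ 0) : SConfAt w (SPoint.inv c) := by
  refine (sanMap_inv c hw).sconfAt fun p hp => ?_
  subst hp
  have hz := p.z_even
  have hc0 : c ≠ 0 := by rintro rfl; simp at hc
  have hv := extend_even (fun w : ℂ => w⁻¹) hz
  have hb := gbody_extend (fun w : ℂ => w⁻¹) hz
  set v := extend (fun w : ℂ => w⁻¹) p.z with hvdef
  have e : ∀ η : GOdd, ∀ t ∈ GOdd, extend (fun w : ℂ => w⁻¹) (p.z + η * t) = v - v * v * (η * t) :=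
    fun η t ht => by
      rw [extend_add_sq _ hz (odd_mul_odd η.2 ht) (odd_sq_mul η.2 _), deriv_inv_extend hz hw, neg_mul,
        sub_eq_add_neg]
  have c1 : ∀ x : Grassmann, x * v = v * x := fun x => (even_comm hv x).symm
  -- The factors are the derivatives `D⁺(c θ⁺ / z)` and `D⁻(c θ⁻ / z)`.
  refine ⟨⟨⟨c • (v + v * v * (p.tp * p.tm)), ?_⟩, ?_, relP_coords.2 fun η => ?_⟩,
    ⟨⟨c • (v + v * v * (p.tm * p.tp)), ?_⟩, ?_, relM_coords.2 fun η => ?_⟩⟩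
  · exact Subalgebra.smul_mem _ (add_mem hv (even_mul_even (even_mul_even hv hv)
      (odd_mul_odd p.tp_odd p.tm_odd))) _
  · simp only [gbody_smul, gbody_add, gbody_mul, gbody_odd p.tp_odd, zero_mul, mul_zero, add_zero, hb]
    exact mul_ne_zero hc0 (inv_ne_zero hw)
  · simp only [SPoint.shP, SPoint.inv, e η _ p.tm_odd, ← hvdef]
    have a1 := odd_anticomm p.tp_odd η.2
    have a2 := odd_anticomm p.tm_odd η.2
    have s1 := odd_mul_self η.2
    have s3 := odd_mul_self p.tm_odd
    have b1 := c1 η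
    have b2 := c1 p.tp
    have b3 := c1 p.tm
    generalize (η : Grassmann) = η at *
    generalize p.tp = x at *
    generalize p.tm = y at *
    refine ⟨?_, ?_, ?_⟩ <;>
    simp only [mul_add, add_mul, mul_sub, smul_mul_assoc, mul_smul_comm, mul_assoc, s3, b1, b2, b3, mul_mul_of_mul a1, mul_mul_of_mul a2,
      mul_mul_of_mul s1, mul_mul_of_mul b1, mul_mul_of_mul b2,
      mul_mul_of_mul b3, mul_neg, neg_mul, mul_zero, zero_mul, smul_smul, hc] <;> module
  · exact Subalgebra.smul_mem _ (add_mem hv (even_mul_even (even_mul_even hv hv)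
      (odd_mul_odd p.tm_odd p.tp_odd))) _
  · simp only [gbody_smul, gbody_add, gbody_mul, gbody_odd p.tp_odd, zero_mul, mul_zero, add_zero, hb]
    exact mul_ne_zero hc0 (inv_ne_zero hw)
  · simp only [SPoint.shM, SPoint.inv, e η _ p.tp_odd, ← hvdef]
    have a1 := odd_anticomm p.tp_odd η.2
    have a2 := odd_anticomm p.tm_odd η.2
    have s1 := odd_mul_self η.2
    have s2 := odd_mul_self p.tp_odd
    have b1 := c1 η
    have b2 := c1 p.tp
    have b3 := c1 p.tm
    generalize (η : Grassmann) = η at *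
    generalize p.tp = x at *
    generalize p.tm = y at *
    refine ⟨?_, ?_, ?_⟩ <;>
    simp only [mul_add, add_mul, mul_sub, smul_mul_assoc, mul_smul_comm, mul_assoc, s2, b1, b2, b3, mul_mul_of_mul a1, mul_mul_of_mul a2,
      mul_mul_of_mul s1, mul_mul_of_mul s2, mul_mul_of_mul b1, mul_mul_of_mul b2,
      mul_mul_of_mul b3, mul_neg, neg_mul, mul_zero, zero_mul, smul_smul, hc] <;> module

/-! ### The sphere -/

/-- The factor of the change of coordinates. -/
def Pole.factor : Pole → ℂ
  | .south => -Complex.I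
  | .north => Complex.I

open Classical in
/-- The change of coordinates from the first chart to the second. -/
def trans (c d : Pole) (p : SPoint) : SPoint := if c = d then p else p.inv c.factor

/-- The overlap of the charts. -/
def Overlap (c d : Pole) (p : SPoint) : Prop := c = d ∨ p.body ≠ 0

theorem pt_eq_iff {c d : Pole} {p q : SPoint} :
    pt c p = pt d q ↔ Overlap c d p ∧ q = trans c d p := by
  have h : pt c p = pt d q ↔ glue (match c with | .south => .inl p | .north => .inr p)
      (match d with | .south => .inl q | .north => .inr q) := by
    cases c <;> cases d <;> exact Quotient.eq
  rw [h]
  cases c <;> cases d <;> simp only [glue, Overlap, trans, reduceCtorEq, if_true, if_false, true_or,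
    true_and, false_or, Pole.factor]
  · exact eq_comm
  · exact isInversion_iff
  · rw [isInversion_iff]
    constructor
    · rintro ⟨h1, rfl⟩
      exact ⟨by rw [SPoint.body_inv]; exact inv_ne_zero h1,
        (SPoint.inv_inv (by simp) h1).symm⟩
    · rintro ⟨h1, rfl⟩
      exact ⟨by rw [SPoint.body_inv]; exact inv_ne_zero h1,
        (SPoint.inv_inv (by simp) h1).symm⟩
  · exact eq_comm

theorem pt_injective (c : Pole) : Function.Injective (pt c) := fun p q h => by
  have := (pt_eq_iff.1 h).2
  simpa [trans] using this.symm

theorem pt_trans {c d : Pole} {p : SPoint} (h : Overlap c d p) : pt d (trans c d p) = pt c p :=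
  (pt_eq_iff.2 ⟨h, rfl⟩).symm

theorem exists_pt (x : Sphere) : ∃ c p, x = pt c p := by
  induction x using Quotient.inductionOn with
  | h a =>
    rcases a with p | q
    exacts [⟨.south, p, rfl⟩, ⟨.north, q, rfl⟩]

theorem sconfAt_id (w : ℂ) : SConfAt w fun p => p := by
  refine SAnMap.sconfAt ⟨SAn.z w, SAn.tp w, SAn.tm w⟩ fun p _ =>
    ⟨⟨1, ?_, fun η => ?_⟩, ⟨1, ?_, fun η => ?_⟩⟩
  · simp
  · rw [show oddSMul η 1 = η from Subtype.ext (mul_one _)]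
  · simp
  · rw [show oddSMul η 1 = η from Subtype.ext (mul_one _)]

theorem sconfAt_trans {c d : Pole} {p : SPoint} (h : Overlap c d p) : SConfAt p.body (trans c d) := by
  unfold trans
  by_cases hcd : c = d
  · simpa only [hcd, if_true] using sconfAt_id _
  · simp only [hcd, if_false]
    refine sconfAt_inv ?_ (h.resolve_left hcd)
    cases c <;> simp [Pole.factor]

theorem SPoint.continuous_body : Continuous SPoint.body := continuous_induced_dom

theorem SAnMap.continuousAt {p : SPoint} {H : SPoint → SPoint} (h : SAnMap p.body H) :
    ContinuousAt H p := by
  rw [ContinuousAt, nhds_eq_bn, nhds_eq_bn]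
  exact h.tendsto rfl rfl

theorem overlap_open (c d : Pole) : IsOpen {p | Overlap c d p} := by
  by_cases h : c = d
  · simp [Overlap, h]
  · simp only [Overlap, h, false_or]
    exact isOpen_ne.preimage SPoint.continuous_body

theorem eventually_overlap {c d : Pole} {p : SPoint} (h : Overlap c d p) :
    ∀ᶠ q in bn p.body, Overlap c d q := mem_open_bn (overlap_open c d) h

/-- The changes of coordinates are continuous on open overlaps, so the image of an open set of one
chart has open preimages in both charts. -/
theorem isOpenEmbedding_pt (c : Pole) : Topology.IsOpenEmbedding (pt c) := by
  have hc : ∀ d, Continuous (pt d) := fun d => by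
    cases d
    · exact continuous_quot_mk.comp continuous_inl
    · exact continuous_quot_mk.comp continuous_inr
  refine Topology.IsOpenEmbedding.of_continuous_injective_isOpenMap (hc c) (pt_injective c)
    fun U hU => ?_
  have key : ∀ d, IsOpen (pt d ⁻¹' (pt c '' U)) := fun d => by
    rw [isOpen_iff_mem_nhds]
    rintro p ⟨q, hq, hqp⟩
    obtain ⟨h1, h2⟩ := pt_eq_iff.1 hqp.symm
    subst h2
    filter_upwards [(sconfAt_trans h1).1.continuousAt.preimage_mem_nhds (hU.mem_nhds hq),
      (overlap_open d c).mem_nhds h1] with r a b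
    exact ⟨_, a, pt_trans b⟩
  refine isOpen_coinduced.2 ?_
  rw [isOpen_sum_iff]
  exact ⟨key .south, key .north⟩

theorem Pole.nbhd_open (c : Pole) : IsOpen c.nbhd := (isOpenEmbedding_pt c).isOpen_range

theorem nhds_pt (c : Pole) (p : SPoint) : 𝓝 (pt c p) = map (pt c) (bn p.body) := by
  rw [← nhds_eq_bn, (isOpenEmbedding_pt c).map_nhds_eq]

theorem eventually_pt {c : Pole} {p : SPoint} {Q : Sphere → Prop} :
    (∀ᶠ x in 𝓝 (pt c p), Q x) ↔ ∀ᶠ q in bn p.body, Q (pt c q) := by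
  rw [nhds_pt, eventually_map]

/-- The DeWitt topology cannot separate points with the same body. This chart-free description is
visibly preserved by homeomorphisms. -/
theorem sameBody_iff {x y : Sphere} : SameBody x y ↔ Inseparable x y := by
  constructor
  · rintro ⟨c, p, q, rfl, rfl, h⟩
    rw [Inseparable, nhds_pt, nhds_pt, h]
  · intro h
    obtain ⟨c, p, rfl⟩ := exists_pt x
    obtain ⟨q, rfl⟩ : y ∈ c.nbhd := (h.mem_open_iff c.nbhd_open).1 ⟨p, rfl⟩
    refine ⟨c, p, q, rfl, rfl, ?_⟩
    have := (isOpenEmbedding_pt c).isInducing.inseparable_iff.1 h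
    exact (this.map SPoint.continuous_body).eq

theorem not_mem_south {x : Sphere} (h : x ∉ Pole.south.nbhd) : ∃ q : SPoint, q.body = 0 ∧ x = pt .north q := by
  obtain ⟨c, q, rfl⟩ := exists_pt x
  cases c
  · exact absurd ⟨q, rfl⟩ h
  · refine ⟨q, ?_, rfl⟩
    by_contra hq
    exact h ⟨_, pt_trans (c := .north) (d := .south) (Or.inr hq)⟩

/-! ### Superconformal maps of the sphere -/

/-- `F` is superconformal with invertible derivative near `x`. -/
def ConfAt (F : Sphere → Sphere) (x : Sphere) : Prop :=
  ∃ c d p H, x = pt c p ∧ SConfAt p.body H ∧ ∀ᶠ q in bn p.body, F (pt c q) = pt d (H q)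

/-- Changes of coordinates are superconformal, so the charts witnessing conformality may be replaced
by any charts containing the point and its image. -/
theorem ConfAt.lift {F : Sphere → Sphere} {c d : Pole} {p q : SPoint} (h : ConfAt F (pt c p))
    (hq : F (pt c p) = pt d q) :
    ∃ H, SConfAt p.body H ∧ H p = q ∧ ∀ᶠ r in bn p.body, F (pt c r) = pt d (H r) := by
  obtain ⟨c', d', p', H, hx, hH, e⟩ := h
  obtain ⟨h1, rfl⟩ := pt_eq_iff.1 hx
  have t1 := sconfAt_trans h1
  have e0 := of_eventually_bn e rfl
  rw [pt_trans h1, hq] at e0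
  obtain ⟨h2, h2'⟩ := pt_eq_iff.1 e0.symm
  have t2 := sconfAt_trans h2
  refine ⟨_, t2.comp (hH.comp t1 rfl rfl) rfl rfl, h2'.symm, ?_⟩
  filter_upwards [(t1.1.tendsto rfl rfl).eventually e, eventually_overlap h1,
    (t1.1.tendsto rfl rfl).eventually ((hH.1.tendsto rfl rfl).eventually (eventually_overlap h2))]
    with r a b b'
  rw [← pt_trans b, a, pt_trans b']

theorem ConfAt.of_lift {F : Sphere → Sphere} {c d : Pole} {p : SPoint} {H : SPoint → SPoint}
    (hH : SConfAt p.body H) (e : ∀ᶠ q in bn p.body, F (pt c q) = pt d (H q)) : ConfAt F (pt c p) :=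
  ⟨c, d, p, H, rfl, hH, e⟩

theorem ConfAt.id (x : Sphere) : ConfAt (fun x => x) x := by
  obtain ⟨c, p, rfl⟩ := exists_pt x
  exact ConfAt.of_lift (sconfAt_id _) (Eventually.of_forall fun _ => rfl)

theorem ConfAt.comp {F G : Sphere → Sphere} {x : Sphere} (hG : ConfAt G (F x)) (hF : ConfAt F x) :
    ConfAt (fun x => G (F x)) x := by
  obtain ⟨c, d, p, H, rfl, hH, e⟩ := hF
  have e0 := of_eventually_bn e rfl
  rw [e0] at hG
  obtain ⟨d', q', hq'⟩ := exists_pt (G (pt d (H p)))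
  obtain ⟨K, hK, _, e'⟩ := hG.lift hq'
  refine ConfAt.of_lift (hK.comp hH rfl rfl) (d := d') ?_
  filter_upwards [e, (hH.1.tendsto rfl rfl).eventually e'] with r a b
  rw [a, b]

theorem ConfAt.continuousAt {F : Sphere → Sphere} {x : Sphere} (h : ConfAt F x) : ContinuousAt F x := by
  obtain ⟨c, d, p, H, rfl, hH, e⟩ := h
  rw [ContinuousAt, of_eventually_bn e rfl, nhds_pt, nhds_pt, tendsto_map'_iff]
  exact (tendsto_map.comp (hH.1.tendsto rfl rfl)).congr' (e.mono fun _ h => h.symm)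

/-- A left inverse of a conformal map near `x` is conformal. -/
theorem ConfAt.of_leftInverse {F G : Sphere → Sphere} {x : Sphere} (h : ConfAt F x)
    (e : ∀ᶠ y in 𝓝 x, G (F y) = y) : ConfAt G (F x) := by
  obtain ⟨c, d, p, H, rfl, hH, e'⟩ := h
  obtain ⟨K, w', hK, hw', kh, hk⟩ := hH.exists_inverse
  have hw := hw' p rfl
  subst hw
  rw [of_eventually_bn e' rfl]
  refine ConfAt.of_lift hK (d := c) ?_
  have t := hK.1.tendsto rfl (by rw [of_eventually_bn kh rfl])
  filter_upwards [hk, t.eventually (eventually_pt.1 e), t.eventually e'] with q a b b'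
  rw [b', a] at b
  exact b

/-! ### Automorphisms and local coordinates of the sphere -/

/-- Superconformal automorphisms of the sphere. -/
def AutConf (F : Sphere ≃ Sphere) : Prop := ∀ x, ConfAt F x

theorem AutConf.refl : AutConf (Equiv.refl Sphere) := ConfAt.id

theorem AutConf.symm {F : Sphere ≃ Sphere} (h : AutConf F) : AutConf F.symm := fun y => by
  have := (h (F.symm y)).of_leftInverse (G := F.symm)
    (Eventually.of_forall fun z => F.symm_apply_apply z)
  rwa [F.apply_symm_apply] at this

theorem AutConf.trans {F G : Sphere ≃ Sphere} (hF : AutConf F) (hG : AutConf G) :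
    AutConf (F.trans G) := fun x => (hG (F x)).comp (hF x)

theorem AutConf.continuous {F : Sphere ≃ Sphere} (h : AutConf F) : Continuous F :=
  continuous_iff_continuousAt.2 fun x => (h x).continuousAt

/-- The automorphism as a homeomorphism. -/
def AutConf.homeo {F : Sphere ≃ Sphere} (h : AutConf F) : Sphere ≃ₜ Sphere where
  toEquiv := F
  continuous_toFun := h.continuous
  continuous_invFun := h.symm.continuous

theorem isSuperconformalMap_of {F : Sphere → Sphere} (h : ∀ x, ConfAt F x) :
    IsSuperconformalMap F := fun c d => by
  have hF : Continuous F := continuous_iff_continuousAt.2 fun x => (h x).continuousAt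
  have : ∀ x, F (pt c x) ∈ d.nbhd → ∃ y, pt d y = F (pt c x) := fun x hx => hx
  choose! H hH using this
  refine ⟨H, isSuperconformalOn_of (d.nbhd_open.preimage (hF.comp (isOpenEmbedding_pt c).continuous))
    fun p hp => ?_, hH⟩
  obtain ⟨K, hK, _, e⟩ := (h (pt c p)).lift (hH p hp).symm
  refine hK.congr (e.mono fun q hq => pt_injective d ?_)
  rw [hH q ⟨_, hq.symm⟩, hq]

/-- Superconformality in the charts provides only factors of the shifts; their invertibility comes
from the same property of the inverse. -/
theorem autConf_iff {F : Sphere ≃ Sphere} :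
    AutConf F ↔ IsSuperconformalMap F ∧ IsSuperconformalMap F.symm := by
  refine ⟨fun h => ⟨isSuperconformalMap_of h, isSuperconformalMap_of h.symm⟩, fun ⟨h1, h2⟩ x => ?_⟩
  obtain ⟨c, p, rfl⟩ := exists_pt x
  obtain ⟨d, q, hq⟩ := exists_pt (F (pt c p))
  obtain ⟨H, hH, eH⟩ := h1 c d
  obtain ⟨G, hG, eG⟩ := h2 d c
  have hp : p ∈ {x | F (pt c x) ∈ d.nbhd} := ⟨q, hq.symm⟩
  have hev := mem_open_bn hH.1 hp
  have gh : ∀ r, F (pt c r) ∈ d.nbhd → F.symm (pt d (H r)) = pt c r := fun r hr => by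
    rw [eH r hr, F.symm_apply_apply]
  refine ConfAt.of_lift (WConfAt.sconfAt (hH.wconfAt hp)
    (hG.wconfAt (show F.symm (pt d (H p)) ∈ c.nbhd by rw [gh p hp]; exact ⟨p, rfl⟩)) rfl rfl ?_)
    (d := d) (hev.mono fun r hr => (eH r hr).symm)
  filter_upwards [hev] with r hr
  apply pt_injective c
  rw [eG _ (by rw [gh r hr]; exact ⟨r, rfl⟩), gh r hr]

instance : Nonempty SPoint := ⟨SPoint.origin⟩

/-- Composition with the southern parametrization makes a coordinate a map into the sphere, so that
one notion of conformality serves for coordinates and automorphisms. -/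
theorem IsSuperconformalChart.confAt {Om : OpenPartialHomeomorph Sphere SPoint}
    (h : IsSuperconformalChart Om) {x : Sphere} (hx : x ∈ Om.source) :
    ConfAt (fun x => pt .south (Om x)) x := by
  obtain ⟨c, p, rfl⟩ := exists_pt x
  obtain ⟨h1, G, hG, eG⟩ := h c
  have hp : p ∈ pt c ⁻¹' Om.source := hx
  have gh : ∀ r, pt c r ∈ Om.source → Om (pt c r) ∈ {y | y ∈ Om.target ∧ Om.symm y ∈ c.nbhd} :=
    fun r hr => ⟨Om.map_source hr, by rw [Om.left_inv hr]; exact ⟨r, rfl⟩⟩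
  refine ConfAt.of_lift (WConfAt.sconfAt (h1.wconfAt hp) (hG.wconfAt (gh p hp)) rfl rfl ?_)
    (d := .south) (Eventually.of_forall fun _ => rfl)
  filter_upwards [mem_open_bn h1.1 hp] with r hr
  apply pt_injective c
  rw [eG _ (gh r hr).1 (gh r hr).2, Om.left_inv hr]

theorem isSuperconformalChart_of {Om : OpenPartialHomeomorph Sphere SPoint}
    (h : ∀ x ∈ Om.source, ConfAt (fun x => pt .south (Om x)) x) : IsSuperconformalChart Om := by
  refine fun c => ⟨isSuperconformalOn_of ?_ fun p hp => ?_, ?_⟩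
  · exact Om.open_source.preimage (isOpenEmbedding_pt c).continuous
  · obtain ⟨H, hH, _, e⟩ := (h _ hp).lift (d := .south) rfl
    exact hH.congr (e.mono fun q hq => pt_injective .south hq)
  · have : ∀ y, y ∈ Om.target ∧ Om.symm y ∈ c.nbhd → ∃ q, pt c q = Om.symm y := fun y hy => hy.2
    choose! H hH using this
    have ho : IsOpen {y | y ∈ Om.target ∧ Om.symm y ∈ c.nbhd} :=
      Om.isOpen_inter_preimage_symm c.nbhd_open
    refine ⟨H, isSuperconformalOn_of ho fun y hy => ?_, fun y h1 h2 => hH y ⟨h1, h2⟩⟩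
    have hs := Om.map_target hy.1
    have hl := Function.leftInverse_invFun (pt_injective .south)
    have := (h _ hs).of_leftInverse (G := fun x => Om.symm (Function.invFun (pt .south) x)) (by
      filter_upwards [Om.open_source.mem_nhds hs] with x hx
      rw [hl, Om.left_inv hx])
    simp only [Om.right_inv hy.1] at this
    obtain ⟨K, hK, _, e⟩ := this.lift (d := c) (q := H y) (by
      show Om.symm (Function.invFun (pt .south) (pt .south y)) = _
      rw [hl, hH y hy])
    refine hK.congr ?_
    filter_upwards [e, mem_open_bn ho hy] with q a b
    apply pt_injective c
    rw [hH q b, ← a]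
    exact congrArg Om.symm (hl q).symm

/-- Superconformal maps give local coordinates. -/
theorem exists_chart (c : Pole) {p : SPoint} {K : SPoint → SPoint} (hK : SConfAt p.body K) :
    ∃ Om : OpenPartialHomeomorph Sphere SPoint, IsSuperconformalChart Om ∧
      ∀ᶠ q in bn p.body, pt c q ∈ Om.source ∧ Om (pt c q) = K q := by
  obtain ⟨G, w', hG, hw', gh, hg⟩ := hK.exists_inverse
  have hw := hw' p rfl
  subst hw
  rw [← nhds_eq_bn] at gh hg
  obtain ⟨U, hU, oU, pU⟩ := eventually_nhds_iff.1
    (gh.and (by rw [nhds_eq_bn]; exact eventually_bn_body hK.eventually))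
  obtain ⟨V, hV, oV, pV⟩ := eventually_nhds_iff.1
    (hg.and (by rw [nhds_eq_bn]; exact eventually_bn_body hG.eventually))
  have cK : ContinuousOn K U := fun q hq => (hU q hq).2.1.continuousAt.continuousWithinAt
  have cG : ContinuousOn G V := fun q hq => (hV q hq).2.1.continuousAt.continuousWithinAt
  -- Both neighbourhoods are shrunk to the points whose image lies in the other one, which makes the
  -- two local inverses bijective between open sets.
  let e : OpenPartialHomeomorph SPoint SPoint :=
    { toFun := K
      invFun := G
      source := U ∩ K ⁻¹' V
      target := V ∩ G ⁻¹' U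
      map_source' := fun q hq => ⟨hq.2, by
        show G (K q) ∈ U
        rw [(hU q hq.1).1]; exact hq.1⟩
      map_target' := fun q hq => ⟨hq.2, by
        show K (G q) ∈ V
        rw [(hV q hq.1).1]; exact hq.1⟩
      left_inv' := fun q hq => (hU q hq.1).1
      right_inv' := fun q hq => (hV q hq.1).1
      open_source := cK.isOpen_inter_preimage oU oV
      open_target := cG.isOpen_inter_preimage oV oU
      continuousOn_toFun := cK.mono Set.inter_subset_left
      continuousOn_invFun := cG.mono Set.inter_subset_left }
  let Om := ((isOpenEmbedding_pt c).toOpenPartialHomeomorph (pt c)).symm.trans e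
  have hl : ∀ q, ((isOpenEmbedding_pt c).toOpenPartialHomeomorph (pt c)).symm (pt c q) = q := fun q =>
    ((isOpenEmbedding_pt c).toOpenPartialHomeomorph (pt c)).left_inv (Set.mem_univ q)
  have hOm : ∀ q, Om (pt c q) = K q := fun q => congrArg K (hl q)
  have hs : ∀ q, pt c q ∈ Om.source ↔ q ∈ U ∩ K ⁻¹' V := fun q => by
    have : Om.source = _ := OpenPartialHomeomorph.trans_source _ _
    rw [this]
    simp [hl, e]
  refine ⟨Om, isSuperconformalChart_of fun x hx => ?_, ?_⟩
  · obtain ⟨q, rfl⟩ : x ∈ c.nbhd := by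
      have : Om.source = _ := OpenPartialHomeomorph.trans_source _ _
      rw [this] at hx
      have h := hx.1
      rwa [OpenPartialHomeomorph.symm_source,
        Topology.IsOpenEmbedding.toOpenPartialHomeomorph_target] at h
    exact ConfAt.of_lift (hU q ((hs q).1 hx).1).2 (d := .south)
      (Eventually.of_forall fun r => congrArg (pt .south) (hOm r))
  · have ho : IsOpen (U ∩ K ⁻¹' V) := e.open_source
    filter_upwards [mem_open_bn ho ⟨pU, pV⟩] with q hq using ⟨(hs q).2 hq, hOm q⟩

/-! ### Superconformal equivalence -/

/-- The neighbourhood in the definition can be recovered afterwards by intersecting with the domains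
of the coordinates, so only germs matter. -/
theorem superconformallyEquivalent_iff {n : ℕ} {S T : TubedSphere n} :
    SuperconformallyEquivalent S T ↔ ∃ F : Sphere ≃ Sphere, AutConf F ∧ ∀ j,
      F (S.puncture j) = T.puncture j ∧
      ∀ᶠ x in 𝓝 (S.puncture j), S.coord j x = T.coord j (F x) := by
  constructor
  · rintro ⟨F, h1, h2, h3⟩
    refine ⟨F, autConf_iff.2 ⟨h1, h2⟩, fun j => ⟨(h3 j).1, ?_⟩⟩
    obtain ⟨_, W, hW, hj, _, h⟩ := h3 j
    filter_upwards [hW.mem_nhds hj] with x hx using (h x hx).2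
  · rintro ⟨F, h1, h3⟩
    refine ⟨F, (autConf_iff.1 h1).1, (autConf_iff.1 h1).2, fun j => ⟨(h3 j).1, ?_⟩⟩
    have e1 : ∀ᶠ x in 𝓝 (S.puncture j), x ∈ (S.coord j).source :=
      (S.coord j).open_source.mem_nhds (S.mem_source j)
    obtain ⟨W, hW, oW, hj⟩ := eventually_nhds_iff.1 ((h3 j).2.and (e1.and
      (h1.continuous.continuousAt.preimage_mem_nhds ((T.coord j).open_source.mem_nhds
        (by rw [(h3 j).1]; exact T.mem_source j)))))
    exact ⟨W, oW, hj, fun x hx => (hW x hx).2.1, fun x hx => ⟨(hW x hx).2.2, (hW x hx).1⟩⟩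

theorem superconformallyEquivalent_equivalence (n : ℕ) :
    Equivalence (SuperconformallyEquivalent (n := n)) where
  refl S := superconformallyEquivalent_iff.2
    ⟨Equiv.refl _, AutConf.refl, fun j => ⟨rfl, Eventually.of_forall fun _ => rfl⟩⟩
  symm {S T} h := by
    obtain ⟨F, hF, h⟩ := superconformallyEquivalent_iff.1 h
    refine superconformallyEquivalent_iff.2 ⟨F.symm, hF.symm, fun j => ?_⟩
    have e : F.symm (T.puncture j) = S.puncture j := by rw [← (h j).1, F.symm_apply_apply]
    refine ⟨e, ?_⟩
    have t : Tendsto F.symm (𝓝 (T.puncture j)) (𝓝 (S.puncture j)) := by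
      rw [← e]; exact hF.symm.continuous.continuousAt
    filter_upwards [t.eventually (h j).2] with x hx
    rw [hx, F.apply_symm_apply]
  trans {S T R} h h' := by
    obtain ⟨F, hF, h⟩ := superconformallyEquivalent_iff.1 h
    obtain ⟨G, hG, h'⟩ := superconformallyEquivalent_iff.1 h'
    refine superconformallyEquivalent_iff.2 ⟨F.trans G, hF.trans hG, fun j => ⟨?_, ?_⟩⟩
    · rw [Equiv.trans_apply, (h j).1, (h' j).1]
    · have t : Tendsto F (𝓝 (S.puncture j)) (𝓝 (T.puncture j)) := by
        rw [← (h j).1]; exact hF.continuous.continuousAt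
      filter_upwards [(h j).2, t.eventually (h' j).2] with x a b
      rw [a, b, Equiv.trans_apply]

/-- The image of a sphere with tubes under an automorphism. -/
def TubedSphere.push {n : ℕ} (S : TubedSphere n) {F : Sphere ≃ Sphere} (hF : AutConf F) :
    TubedSphere n where
  puncture j := F (S.puncture j)
  distinct j k hjk h := S.distinct j k hjk (by
    rw [sameBody_iff] at h ⊢
    exact hF.homeo.isInducing.inseparable_iff.1 h)
  coord j := hF.homeo.symm.transOpenPartialHomeomorph (S.coord j)
  coord_superconformal j := isSuperconformalChart_of fun x hx =>
    ((S.coord_superconformal j).confAt (x := F.symm x) hx).comp (hF.symm x)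
  mem_source j := by
    show F.symm (F (S.puncture j)) ∈ (S.coord j).source
    rw [F.symm_apply_apply]; exact S.mem_source j
  vanishing j := by
    show S.coord j (F.symm (F (S.puncture j))) = _
    rw [F.symm_apply_apply]; exact S.vanishing j

theorem TubedSphere.push_coord {n : ℕ} (S : TubedSphere n) {F : Sphere ≃ Sphere} (hF : AutConf F)
    (j : Fin (n + 1)) (x : Sphere) : (S.push hF).coord j x = S.coord j (F.symm x) := rfl

theorem TubedSphere.equivalent_push {n : ℕ} (S : TubedSphere n) {F : Sphere ≃ Sphere}
    (hF : AutConf F) : SuperconformallyEquivalent S (S.push hF) :=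
  superconformallyEquivalent_iff.2 ⟨F, hF, fun j => ⟨rfl, Eventually.of_forall fun x => by
    rw [S.push_coord, F.symm_apply_apply]⟩⟩

theorem trans_north_south (p : SPoint) : trans .north .south p = p.inv Complex.I := by
  simp [trans, Pole.factor]

theorem trans_south_north (p : SPoint) : trans .south .north p = p.inv (-Complex.I) := by
  simp [trans, Pole.factor]

/-! ### Removable singularities -/

/-- The coefficient functions vanish off `w` near `w`, and zeros of non-zero analytic functions are
isolated. -/
theorem SAn.eventually_zero_of_punctured {w : ℂ} {Φ : SPoint → Grassmann} (h : SAn w Φ)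
    (h0 : ∀ᶠ p in bn w, p.body ≠ w → Φ p = 0) : ∀ᶠ p in bn w, Φ p = 0 := by
  obtain ⟨F, hF, e⟩ := h
  have hz : ∀ᶠ w' in 𝓝 w, w' ≠ w → ∀ s k, F s k w' = 0 := by
    filter_upwards [hF.eventually, eventually_bn.1 (e.and h0)] with w' h1 h2 hne
    exact (SuperFn.eventually_zero_of_vanish h1 fun p hp => by
      rw [← (h2 p hp).1, (h2 p hp).2 (by rwa [hp])]).self_of_nhds
  refine SAn.eventually_zero ⟨F, hF, e⟩ fun p hp => ?_
  have hw : ∀ s k, ∀ᶠ w' in 𝓝 w, F s k w' = 0 := fun s k => by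
    have h1 : ∀ᶠ w' in 𝓝[≠] w, F s k w' = 0 := eventually_nhdsWithin_iff.2 (by
      filter_upwards [hz] with w' h hne using h hne s k)
    rcases (hF.1 s k).eventually_eq_zero_or_eventually_ne_zero with h2 | h2
    · exact h2
    · obtain ⟨x, hx, hx'⟩ := (h1.and h2).exists
      exact absurd hx hx'
  have : ∀ s, F.sec s p.z = 0 := fun s => finsum_eq_zero_of_forall_eq_zero fun k => by
    rw [extend_of_eventually_zero p.z_even (by rw [show gbody p.z = w from hp]; exact hw s k),
      zero_mul]
  rw [of_eventually_bn e hp, SuperFn.eval_eq]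
  simp [this, assemble]

theorem SAnMap.eventually_eq_of_punctured {w : ℂ} {H G : SPoint → SPoint} (hH : SAnMap w H)
    (hG : SAnMap w G) (h : ∀ᶠ p in bn w, p.body ≠ w → H p = G p) : ∀ᶠ p in bn w, H p = G p := by
  filter_upwards [(hH.1.sub hG.1).eventually_zero_of_punctured (by
      filter_upwards [h] with p hp hne; rw [hp hne, sub_self]),
    (hH.2.1.sub hG.2.1).eventually_zero_of_punctured (by
      filter_upwards [h] with p hp hne; rw [hp hne, sub_self]),
    (hH.2.2.sub hG.2.2).eventually_zero_of_punctured (by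
      filter_upwards [h] with p hp hne; rw [hp hne, sub_self])] with p a b c
  exact SPoint.ext (sub_eq_zero.1 a) (sub_eq_zero.1 b) (sub_eq_zero.1 c)

/-- The superconformal equations are vanishing conditions on superanalytic functions and so extend
over the missing fibre. This serves at infinity, where a map is known from its southern expression
only off the fibre. -/
theorem SAnMap.wconfAt_of_punctured {w : ℂ} {H : SPoint → SPoint} (hH : SAnMap w H)
    (h : ∀ᶠ p in bn w, p.body ≠ w → (∃ c, RelP H p c) ∧ ∃ c, RelM H p c) : WConfAt w H := by
  refine ⟨hH, ?_⟩
  obtain ⟨⟨Z, aZ, eZ⟩, ⟨P, aP, eP⟩, ⟨M, aM, eM⟩⟩ := hH.1.exists_DP, hH.2.1.exists_DP, hH.2.2.exists_DP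
  obtain ⟨⟨Z', aZ', eZ'⟩, ⟨P', aP', eP'⟩, ⟨M', aM', eM'⟩⟩ :=
    hH.1.exists_DM, hH.2.1.exists_DM, hH.2.2.exists_DM
  have f1 := aM.eventually_zero_of_punctured (by
    filter_upwards [h, eM] with p a b hne
    obtain ⟨⟨c, hc⟩, _⟩ := a hne
    exact odd_cancel fun η hη => by
      have := (relP_coords.1 hc ⟨η, hη⟩).2.2
      rwa [b, add_eq_left] at this)
  have f2 := (aZ.sub (aP.mul hH.2.2)).eventually_zero_of_punctured (by
    filter_upwards [h, eZ, eP] with p a b b' hne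
    obtain ⟨⟨c, hc⟩, _⟩ := a hne
    exact odd_cancel fun η hη => by
      obtain ⟨k1, k2, _⟩ := relP_coords.1 hc ⟨η, hη⟩
      rw [b, add_right_inj] at k1
      rw [b', add_right_inj] at k2
      rw [mul_sub, k1, ← mul_assoc, ← mul_assoc, k2, sub_self])
  have f3 := aP'.eventually_zero_of_punctured (by
    filter_upwards [h, eP'] with p a b hne
    obtain ⟨_, c, hc⟩ := a hne
    exact odd_cancel fun η hη => by
      have := (relM_coords.1 hc ⟨η, hη⟩).2.1
      rwa [b, add_eq_left] at this)
  have f4 := (aZ'.sub (aM'.mul hH.2.1)).eventually_zero_of_punctured (by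
    filter_upwards [h, eZ', eM'] with p a b b' hne
    obtain ⟨_, c, hc⟩ := a hne
    exact odd_cancel fun η hη => by
      obtain ⟨k1, _, k2⟩ := relM_coords.1 hc ⟨η, hη⟩
      rw [b, add_right_inj] at k1
      rw [b', add_right_inj] at k2
      rw [mul_sub, k1, ← mul_assoc, ← mul_assoc, k2, sub_self])
  filter_upwards [eZ, eP, eM, eZ', eP', eM', f1, f2, f3, f4] with p eZ eP eM eZ' eP' eM' f1 f2 f3 f4
  have c1 : P p ∈ GEven := even_of_odd_mul fun η hη => by
    have := sub_mem (H (p.shP ⟨η, hη⟩)).tp_odd (H p).tp_odd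
    rwa [eP, add_sub_cancel_left] at this
  have c2 : M' p ∈ GEven := even_of_odd_mul fun η hη => by
    have := sub_mem (H (p.shM ⟨η, hη⟩)).tm_odd (H p).tm_odd
    rwa [eM', add_sub_cancel_left] at this
  refine ⟨⟨⟨_, c1⟩, relP_coords.2 fun η => ⟨?_, eP η, ?_⟩⟩,
    ⟨⟨_, c2⟩, relM_coords.2 fun η => ⟨?_, ?_, eM' η⟩⟩⟩
  · rw [eZ, sub_eq_zero.1 f2]
  · rw [eM, f1, mul_zero, add_zero]
  · rw [eZ', sub_eq_zero.1 f4]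
  · rw [eP', f3, mul_zero, add_zero]

/-! ### Automorphisms of the sphere -/

theorem SConfAt.of_eq_zero {w : ℂ} {H : SPoint → SPoint} (h : SConfAt w H) {p : SPoint}
    (hp : p.body = w) : (∃ c, RelP H p c) ∧ ∃ c, RelM H p c := of_eventually_bn h.weak.2 hp

/-- The map of the sphere given by `f` and `g` in the southern and the northern chart. -/
def sphereLift (f g : SPoint → Sphere) (h : ∀ p, p.body ≠ 0 → f p = g (p.inv (-Complex.I))) :
    Sphere → Sphere :=
  Quotient.lift (Sum.elim f g) fun x y hxy => by
    rcases x with p | p <;> rcases y with q | q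
    · exact congrArg f hxy
    · obtain ⟨h1, rfl⟩ := isInversion_iff.1 hxy
      exact h p h1
    · obtain ⟨h1, rfl⟩ := isInversion_iff.1 hxy
      exact (h q h1).symm
    · exact congrArg g hxy

/-- A superconformal automorphism of the southern chart, and its expression near infinity. -/
structure AffinePair (A K : SPoint → SPoint) : Prop where
  conf : ∀ w, SConfAt w A
  an : SAnMap 0 K
  body : ∀ q : SPoint, q.body = 0 → (K q).body = 0
  rel : ∀ᶠ q in bn 0, q.body ≠ 0 → pt .south (A (q.inv Complex.I)) = pt .north (K q)

theorem AffinePair.wconfAt {A K : SPoint → SPoint} (h : AffinePair A K) : WConfAt 0 K := by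
  refine h.an.wconfAt_of_punctured ?_
  filter_upwards [eventually_bn_body (eventually_eventually_bn h.rel)] with q hq hne
  have hq1 := of_eventually_bn hq rfl hne
  have hO : Overlap .north .south q := Or.inr hne
  have t1 := sconfAt_trans hO
  simp only [funext trans_north_south] at t1
  obtain ⟨hO', e'⟩ := pt_eq_iff.1 hq1
  have t := (sconfAt_trans hO').comp ((h.conf _).comp t1 rfl rfl) (p := q) rfl rfl
  refine (t.congr ?_).of_eq_zero rfl
  filter_upwards [hq, eventually_overlap hO] with r a b
  exact (pt_eq_iff.1 (a (b.resolve_left (by simp)))).2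

theorem AffinePair.inverse {A K A' K' : SPoint → SPoint} (h : AffinePair A K)
    (h' : AffinePair A' K') (e : ∀ p, A' (A p) = p) : ∀ᶠ q in bn 0, K' (K q) = q := by
  have o : SPoint.origin.body = 0 := by simp [SPoint.body, SPoint.origin]
  refine (h'.an.comp h.an o (h.body _ o)).eventually_eq_of_punctured (sconfAt_id 0).1 ?_
  filter_upwards [h.rel, (h.an.tendsto o (h.body _ o)).eventually h'.rel] with q a b hne
  obtain ⟨k1, k2⟩ := pt_eq_iff.1 (a hne).symm
  have hKq : (K q).body ≠ 0 := k1.resolve_left (by simp)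
  have h3 := b hKq
  have k2' : A (q.inv Complex.I) = (K q).inv Complex.I := by rw [k2, trans_north_south]
  rw [← k2', e] at h3
  apply pt_injective .north
  rw [← h3, ← trans_north_south]
  exact pt_trans (c := .north) (d := .south) (Or.inr hne)

theorem AffinePair.exists_aut {A K A' K' : SPoint → SPoint} (h : AffinePair A K)
    (h' : AffinePair A' K') (e : ∀ p, A' (A p) = p) (e' : ∀ p, A (A' p) = p) :
    ∃ F : Sphere ≃ Sphere, AutConf F ∧ (∀ p, F (pt .south p) = pt .south (A p)) ∧
      ∀ᶠ q in bn 0, F (pt .north q) = pt .north (K q) := by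
  classical
  have o : SPoint.origin.body = 0 := by simp [SPoint.body, SPoint.origin]
  have kk := h.inverse h' e
  have kk' := h'.inverse h e'
  have hK : SConfAt 0 K := h.wconfAt.sconfAt h'.wconfAt o (h.body _ o) kk
  -- Off the fibre over infinity the northern value is dictated by `A`; on the fibre it is given by
  -- `K`. The relation between `A` and `K` makes the glued map equal to `K` in a whole
  -- neighbourhood.
  let mk : (SPoint → SPoint) → (SPoint → SPoint) → Sphere → Sphere := fun A K =>
    sphereLift (fun p => pt .south (A p))
      (fun q => if q.body = 0 then pt .north (K q) else pt .south (A (q.inv Complex.I)))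
      fun p hp => by
        rw [if_neg (by rw [SPoint.body_inv]; exact inv_ne_zero hp), SPoint.inv_inv (by simp) hp]
  have mkS : ∀ A K p, mk A K (pt .south p) = pt .south (A p) := fun A K p => rfl
  have mkN : ∀ A K (q : SPoint), q.body = 0 → mk A K (pt .north q) = pt .north (K q) :=
    fun A K q hq => if_pos hq
  have inv : ∀ {A K A' K' : SPoint → SPoint}, AffinePair A K → (∀ p, A' (A p) = p) →
      (∀ᶠ q in bn 0, K' (K q) = q) → ∀ x, mk A' K' (mk A K x) = x := fun {A K A' K'} h e kk x => by
    by_cases hx : x ∈ Pole.south.nbhd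
    · obtain ⟨p, rfl⟩ := hx
      rw [mkS, mkS, e]
    · obtain ⟨q, hq, rfl⟩ := not_mem_south hx
      rw [mkN _ _ _ hq, mkN _ _ _ (h.body q hq), of_eventually_bn kk hq]
  have near : ∀ᶠ q in bn 0, mk A K (pt .north q) = pt .north (K q) := by
    filter_upwards [h.rel] with q hq
    by_cases hb : q.body = 0
    · exact mkN _ _ _ hb
    · rw [← hq hb]
      exact if_neg hb
  refine ⟨⟨mk A K, mk A' K', inv h e kk, inv h' e' kk'⟩, fun x => ?_, mkS A K, near⟩
  by_cases hx : x ∈ Pole.south.nbhd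
  · obtain ⟨p, rfl⟩ := hx
    exact ConfAt.of_lift (h.conf _) (d := .south) (Eventually.of_forall fun q => mkS A K q)
  · obtain ⟨q, hq, rfl⟩ := not_mem_south hx
    exact ConfAt.of_lift (by rw [hq]; exact hK) (d := .north) (by rw [hq]; exact near)

theorem sconfAt_scale {v w : GEven} (hv : gbody v ≠ 0) (hw : gbody w ≠ 0) (b : ℂ) :
    SConfAt b (SPoint.scale v w) :=
  (sanMap_scale v w b).sconfAt fun p _ => ⟨⟨v, hv, relP_scale v w p⟩, ⟨w, hw, relM_scale v w p⟩⟩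

theorem scale_scale {v w v' w' : GEven} (hv : v' * v = 1) (hw : w' * w = 1) (p : SPoint) :
    SPoint.scale v' w' (SPoint.scale v w p) = p := by
  have h1 : (v' : Grassmann) * v = 1 := congrArg Subtype.val hv
  have h2 : (w' : Grassmann) * w = 1 := congrArg Subtype.val hw
  refine SPoint.ext ?_ ?_ ?_
  · show (v' : Grassmann) * w' * (v * w * p.z) = p.z
    rw [mul_assoc (v' : Grassmann), mul_assoc (v : Grassmann), ← mul_assoc (w' : Grassmann),
      ← even_comm v.2, mul_assoc, ← mul_assoc (w' : Grassmann), h2, one_mul, ← mul_assoc, h1, one_mul]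
  · show (v' : Grassmann) * (v * p.tp) = p.tp
    rw [← mul_assoc, h1, one_mul]
  · show (w' : Grassmann) * (w * p.tm) = p.tm
    rw [← mul_assoc, h2, one_mul]

/-- Since `1 / z` is multiplied by `1 / (v w)` and `θ⁺ / z` by `v / (v w)`, the scaling by `(v, w)`
becomes the scaling by `(w⁻¹, v⁻¹)` at infinity. -/
theorem affinePair_scale {v w v' w' : GEven} (hv : v' * v = 1) (hw : w' * w = 1) :
    AffinePair (SPoint.scale v w) (SPoint.scale w' v') := by
  have h1 : (v' : Grassmann) * v = 1 := congrArg Subtype.val hv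
  have h2 : (w' : Grassmann) * w = 1 := congrArg Subtype.val hw
  refine ⟨sconfAt_scale ?_ ?_, sanMap_scale _ _ 0, fun q hq => ?_, Eventually.of_forall fun q hq => ?_⟩
  · exact body_ne_zero_of_mul_eq_one (by rw [← hv]; exact Subtype.ext (even_comm v.2 _))
  · exact body_ne_zero_of_mul_eq_one (by rw [← hw]; exact Subtype.ext (even_comm w.2 _))
  · show gbody (_ * q.z) = 0
    rw [gbody_mul, show gbody q.z = 0 from hq, mul_zero]
  · obtain ⟨k1, k2⟩ := exists_inverse q.z_even hq
    have c : ∀ (a : GEven) (x y : Grassmann), x * (a * y) = a * (x * y) := fun a x y => by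
      rw [← mul_assoc, ← even_comm a.2, mul_assoc]
    have d : ∀ {a b : Grassmann}, a * b = 1 → ∀ y : Grassmann, a * (b * y) = y := fun h y => by
      rw [← mul_assoc, h, one_mul]
    have h3 : (v : Grassmann) * v' = 1 := by rw [even_comm v.2, h1]
    have h4 : (w : Grassmann) * w' = 1 := by rw [even_comm w.2, h2]
    refine Quotient.sound ⟨?_, ?_, ?_, ?_⟩ <;> simp only [SPoint.scale, SPoint.inv] <;>
      generalize extend (fun w => w⁻¹) q.z = u at * <;>
      simp only [mul_assoc, smul_mul_assoc, mul_smul_comm, c v q.z, c w q.z, c v q.tp, c w q.tp,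
        c v q.tm, c w q.tm, c v w', c v' u, c w' u, d h1, d h2, d h3, d h4, k1, k2]

/-! ### Translations -/

/-- The supertranslation by `q`. -/
def SPoint.transl (q p : SPoint) : SPoint :=
  ⟨p.z + q.z + p.tp * q.tm + p.tm * q.tp, p.tp + q.tp, p.tm + q.tm,
    add_mem (add_mem (add_mem p.z_even q.z_even) (odd_mul_odd p.tp_odd q.tm_odd))
      (odd_mul_odd p.tm_odd q.tp_odd), add_mem p.tp_odd q.tp_odd, add_mem p.tm_odd q.tm_odd⟩

/-- The point with the opposite coordinates. -/
def SPoint.opp (q : SPoint) : SPoint :=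
  ⟨-q.z, -q.tp, -q.tm, neg_mem q.z_even, neg_mem q.tp_odd, neg_mem q.tm_odd⟩

theorem SPoint.opp_opp (q : SPoint) : q.opp.opp = q := by
  ext <;> simp [SPoint.opp]

theorem transl_opp (q p : SPoint) : q.transl (q.opp.transl p) = p := by
  have h := odd_anticomm q.tm_odd q.tp_odd
  refine SPoint.ext ?_ ?_ ?_ <;> simp only [SPoint.transl, SPoint.opp, mul_neg, add_mul, neg_mul]
  · rw [h]; abel
  · abel
  · abel

theorem opp_transl (q p : SPoint) : q.opp.transl (q.transl p) = p := by
  have := transl_opp q.opp p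
  rwa [q.opp_opp] at this

theorem transl_origin (q : SPoint) : q.transl SPoint.origin = q := by
  ext <;> simp [SPoint.transl, SPoint.origin]

theorem opp_transl_self (q : SPoint) : q.opp.transl q = SPoint.origin := by
  have := opp_transl q SPoint.origin
  rwa [transl_origin] at this

theorem body_transl (q p : SPoint) : (q.transl p).body = p.body + q.body := by
  simp [SPoint.transl, SPoint.body, gbody_odd p.tp_odd, gbody_odd p.tm_odd]

theorem sconfAt_transl (q : SPoint) (w : ℂ) : SConfAt w q.transl := by
  refine SAnMap.sconfAt ⟨(((SAn.z w).add (SAn.const w _)).add ((SAn.tp w).mul (SAn.const w _))).add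
    ((SAn.tm w).mul (SAn.const w _)), (SAn.tp w).add (SAn.const w _),
    (SAn.tm w).add (SAn.const w _)⟩ fun p _ => ⟨⟨1, by simp, relP_coords.2 fun η => ?_⟩,
    ⟨1, by simp, relM_coords.2 fun η => ?_⟩⟩
  · simp only [SPoint.transl, SPoint.shP, OneMemClass.coe_one, one_mul, mul_one, add_mul, mul_add]
    exact ⟨by abel, by abel, trivial⟩
  · simp only [SPoint.transl, SPoint.shM, OneMemClass.coe_one, one_mul, mul_one, add_mul, mul_add]
    exact ⟨by abel, trivial, by abel⟩

/-- The denominator of a supertranslation in the northern chart. -/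
def translDen (q p : SPoint) : Grassmann :=
  1 + p.z * q.z + Complex.I • (p.tp * q.tm) + Complex.I • (p.tm * q.tp)

theorem translDen_even (q p : SPoint) : translDen q p ∈ GEven :=
  add_mem (add_mem (add_mem (one_mem _) (even_mul_even p.z_even q.z_even))
    (Subalgebra.smul_mem _ (odd_mul_odd p.tp_odd q.tm_odd) _))
    (Subalgebra.smul_mem _ (odd_mul_odd p.tm_odd q.tp_odd) _)

theorem gbody_translDen (q p : SPoint) : gbody (translDen q p) = 1 + p.body * q.body := by
  simp [translDen, SPoint.body, gbody_odd p.tp_odd, gbody_odd p.tm_odd]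

/-- The expression of a supertranslation in the northern chart. -/
def SPoint.ntransl (q p : SPoint) : SPoint :=
  ⟨p.z * extend (fun w => w⁻¹) (translDen q p),
    (p.tp - Complex.I • (p.z * q.tp)) * extend (fun w => w⁻¹) (translDen q p),
    (p.tm - Complex.I • (p.z * q.tm)) * extend (fun w => w⁻¹) (translDen q p),
    even_mul_even p.z_even (extend_even _ (translDen_even q p)),
    odd_mul_even (sub_mem p.tp_odd (Submodule.smul_mem _ _ (even_mul_odd p.z_even q.tp_odd)))
      (extend_even _ (translDen_even q p)),
    odd_mul_even (sub_mem p.tm_odd (Submodule.smul_mem _ _ (even_mul_odd p.z_even q.tm_odd)))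
      (extend_even _ (translDen_even q p))⟩

/-- Multiplying the inverted translation above and below by `z` removes the pole: the new
denominator `translDen` has body one on the fibre over zero. -/
theorem affinePair_transl (q : SPoint) : AffinePair q.transl q.ntransl := by
  have hV : SAn 0 fun p => extend (fun w => w⁻¹) (translDen q p) := by
    refine SAn.extend_comp (b := 1) ?_ (Eventually.of_forall fun p => translDen_even q p)
      (fun p hp => by rw [gbody_translDen, hp, zero_mul, add_zero]) (analyticAt_inv one_ne_zero)
    exact (((SAn.const 0 1).add ((SAn.z 0).mul (SAn.const 0 _))).add
      (((SAn.tp 0).mul (SAn.const 0 _)).smul _)).add (((SAn.tm 0).mul (SAn.const 0 _)).smul _)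
  refine ⟨sconfAt_transl q, ⟨(SAn.z 0).mul hV,
    ((SAn.tp 0).sub (((SAn.z 0).mul (SAn.const 0 _)).smul _)).mul hV,
    ((SAn.tm 0).sub (((SAn.z 0).mul (SAn.const 0 _)).smul _)).mul hV⟩, fun p hp => ?_, ?_⟩
  · show gbody (p.z * _) = 0
    rw [gbody_mul, show gbody p.z = 0 from hp, zero_mul]
  · have hD : ∀ᶠ w in 𝓝 (0 : ℂ), 1 + w * q.body ≠ 0 :=
      ContinuousAt.eventually_ne (by fun_prop) (by simp)
    filter_upwards [eventually_bn_body hD] with p hp hne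
    rw [← gbody_translDen] at hp
    obtain ⟨k1, k2⟩ := exists_inverse p.z_even hne
    obtain ⟨l1, l2⟩ := exists_inverse (translDen_even q p) hp
    have hu := extend_even (fun w : ℂ => w⁻¹) p.z_even
    have hv := extend_even (fun w : ℂ => w⁻¹) (translDen_even q p)
    have hDz : ((p.inv Complex.I).z + q.z + (p.inv Complex.I).tp * q.tm + (p.inv Complex.I).tm * q.tp)
        = extend (fun w => w⁻¹) p.z * translDen q p := by
      simp only [SPoint.inv, translDen, mul_add, mul_one, smul_mul_assoc, mul_smul_comm, ← mul_assoc,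
        k1, one_mul, ← even_comm hu]
    have c : ∀ {a : Grassmann}, a ∈ GEven → ∀ x y : Grassmann, x * (a * y) = a * (x * y) :=
      fun ha x y => by rw [← mul_assoc, ← even_comm ha, mul_assoc]
    have d : ∀ {a b : Grassmann}, a * b = 1 → ∀ y : Grassmann, a * (b * y) = y := fun h y => by
      rw [← mul_assoc, h, one_mul]
    have key : ∀ x t : Grassmann, Complex.I • (x * extend (fun w => w⁻¹) p.z) + t =
        Complex.I • ((x - Complex.I • (p.z * t)) * extend (fun w => w⁻¹) (translDen q p) *
          (extend (fun w => w⁻¹) p.z * translDen q p)) := fun x t => by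
      rw [mul_assoc, c hu, l1, mul_one, sub_mul, smul_mul_assoc, even_comm p.z_even t, mul_assoc,
        k2, mul_one, smul_sub, smul_smul, Complex.I_mul_I]
      module
    refine Quotient.sound ⟨?_, ?_, ?_, ?_⟩ <;> simp only [SPoint.transl, SPoint.ntransl] <;>
      try rw [hDz]
    · rw [mul_assoc, c hu, l1, mul_one, k2]
    · rw [mul_assoc, c p.z_even, l2, mul_one, k1]
    · exact key _ _
    · exact key _ _

/-! ### Transitivity -/

theorem exists_transl (q : SPoint) : ∃ F : Sphere ≃ Sphere, AutConf F ∧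
    (∀ p, F (pt .south p) = pt .south (q.transl p)) ∧
    ∀ᶠ p in bn 0, F (pt .north p) = pt .north (q.ntransl p) :=
  (affinePair_transl q).exists_aut (affinePair_transl q.opp) (opp_transl q) (transl_opp q)

theorem scale_neg_one (p : SPoint) : (SPoint.scale (-1) (-1) p).z = p.z ∧
    (SPoint.scale (-1) (-1) p).tp = -p.tp ∧ (SPoint.scale (-1) (-1) p).tm = -p.tm := by
  simp [SPoint.scale]

theorem scale_neg_one_neg_one (p : SPoint) :
    SPoint.scale (-1) (-1) (SPoint.scale (-1) (-1) p) = p :=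
  scale_scale (by simp) (by simp) p

/-- The automorphism that interchanges the two charts. -/
theorem exists_swap : ∃ F : Sphere ≃ Sphere, AutConf F ∧ ∀ p, F (pt .south p) = pt .north p := by
  have hs : ∀ p : SPoint, SPoint.scale (-1) (-1) (p.inv (-Complex.I)) = p.inv Complex.I := fun p => by
    obtain ⟨h1, h2, h3⟩ := scale_neg_one (p.inv (-Complex.I))
    refine SPoint.ext h1 (h2.trans ?_) (h3.trans ?_) <;> simp [SPoint.inv]
  -- Southern coordinates are reused as northern ones. Applying `I` twice changes the sign of the
  -- odd coordinates, so compatibility forces a sign on the way back, and the fourth power is the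
  -- identity.
  let f := sphereLift (pt .north) (fun p => pt .south (SPoint.scale (-1) (-1) p)) fun p hp => by
    rw [hs, ← pt_trans (c := .north) (d := .south) (Or.inr hp), trans_north_south]
  have f1 : ∀ p, f (pt .south p) = pt .north p := fun p => rfl
  have f2 : ∀ p, f (pt .north p) = pt .south (SPoint.scale (-1) (-1) p) := fun p => rfl
  have f4 : ∀ x, f (f (f (f x))) = x := fun x => by
    obtain ⟨c, p, rfl⟩ := exists_pt x
    cases c
    · rw [f1, f2, f1, f2, scale_neg_one_neg_one]
    · rw [f2, f1, f2, f1, scale_neg_one_neg_one]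
  refine ⟨⟨f, fun x => f (f (f x)), f4, f4⟩, fun x => ?_, f1⟩
  obtain ⟨c, p, rfl⟩ := exists_pt x
  cases c
  · exact ConfAt.of_lift (sconfAt_id _) (d := .north) (Eventually.of_forall f1)
  · exact ConfAt.of_lift (sconfAt_scale (by simp) (by simp) _) (d := .south) (Eventually.of_forall f2)

/-- A southern point is translated to zero and then interchanged with infinity; a northern point is
first brought into the southern chart by the inverse interchange. -/
theorem exists_move_infinity (x : Sphere) :
    ∃ F : Sphere ≃ Sphere, AutConf F ∧ F x = pt .north SPoint.origin := by
  obtain ⟨R, hR, hR'⟩ := exists_swap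
  have key : ∀ p, ∃ F : Sphere ≃ Sphere, AutConf F ∧ F (pt .south p) = pt .north SPoint.origin :=
    fun p => by
      obtain ⟨F, hF, h, _⟩ := exists_transl p.opp
      exact ⟨F.trans R, hF.trans hR, by rw [Equiv.trans_apply, h, opp_transl_self, hR']⟩
  obtain ⟨c, p, rfl⟩ := exists_pt x
  cases c
  · exact key p
  · obtain ⟨F, hF, h⟩ := key p
    exact ⟨R.symm.trans F, hR.symm.trans hF, by
      rw [Equiv.trans_apply, ← hR', R.symm_apply_apply, h]⟩

theorem ntransl_origin (q : SPoint) : q.ntransl SPoint.origin = SPoint.origin := by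
  ext <;> simp [SPoint.ntransl, SPoint.origin]

theorem origin_body : SPoint.origin.body = 0 := by simp [SPoint.body, SPoint.origin]

/-- Translations fix the point at infinity. -/
theorem exists_transl' (q : SPoint) : ∃ F : Sphere ≃ Sphere, AutConf F ∧
    (∀ p, F (pt .south p) = pt .south (q.transl p)) ∧
    F (pt .north SPoint.origin) = pt .north SPoint.origin ∧
    ∀ᶠ p in bn 0, F (pt .north p) = pt .north (q.ntransl p) := by
  obtain ⟨F, h1, h2, h3⟩ := exists_transl q
  exact ⟨F, h1, h2, by rw [of_eventually_bn h3 origin_body, ntransl_origin], h3⟩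

theorem exists_scale {v w v' w' : GEven} (hv : v' * v = 1) (hw : w' * w = 1) :
    ∃ F : Sphere ≃ Sphere, AutConf F ∧ (∀ p, F (pt .south p) = pt .south (SPoint.scale v w p)) ∧
    F (pt .north SPoint.origin) = pt .north SPoint.origin ∧
    ∀ᶠ p in bn 0, F (pt .north p) = pt .north (SPoint.scale w' v' p) := by
  have c : ∀ {a b : GEven}, a * b = 1 → b * a = 1 := fun {a b} h => by
    rw [← h]; exact Subtype.ext (even_comm b.2 _)
  obtain ⟨F, h1, h2, h3⟩ := (affinePair_scale hv hw).exists_aut (affinePair_scale (c hv) (c hw))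
    (scale_scale hv hw) (scale_scale (c hv) (c hw))
  exact ⟨F, h1, h2, by rw [of_eventually_bn h3 origin_body, scale_origin], h3⟩

/-! ### Entire functions with a pole at infinity -/

/-- Liouville's theorem: an entire function with a limit at infinity is constant. -/
theorem eq_of_analytic_at_infinity {f g : ℂ → ℂ} (hf : Differentiable ℂ f) (hg : ContinuousAt g 0)
    (h : ∀ᶠ w in 𝓝 (0 : ℂ), w ≠ 0 → f w⁻¹ = g w) (z : ℂ) : f z = g 0 := by
  have t : Tendsto f (cocompact ℂ) (𝓝 (g 0)) := by
    rw [← Metric.cobounded_eq_cocompact]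
    refine ((hg.tendsto.mono_left nhdsWithin_le_nhds).comp
      (tendsto_inv₀_cobounded' (α := ℂ))).congr' ?_
    filter_upwards [(tendsto_inv₀_cobounded' (α := ℂ)).eventually (eventually_nhdsWithin_iff.2 h)]
      with w hw
    rw [Function.comp_apply, ← hw, inv_inv]
  exact congrFun (hf.eq_const_of_tendsto_cocompact t) z

/-- The slope of `f` at zero is entire and has a limit at infinity, hence is constant. -/
theorem eq_affine_of_simple_pole {f g : ℂ → ℂ} (hf : Differentiable ℂ f) (hg : ContinuousAt g 0)
    (h : ∀ᶠ w in 𝓝 (0 : ℂ), w ≠ 0 → w * f w⁻¹ = g w) (z : ℂ) : f z = f 0 + z * g 0 := by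
  have hd : Differentiable ℂ (dslope f 0) := by
    rw [← differentiableOn_univ] at hf ⊢
    exact (Complex.differentiableOn_dslope univ_mem).2 hf
  have e : ∀ w, w * dslope f 0 w = f w - f 0 := fun w => by
    simpa using sub_smul_dslope f 0 w
  have := eq_of_analytic_at_infinity (g := fun w => g w - w * f 0) hd
    (hg.sub (by fun_prop)) (by
      filter_upwards [h] with w hw hne
      rw [← hw hne, ← mul_sub, ← e, mul_inv_cancel_left₀ hne]) z
  rw [← sub_eq_iff_eq_add', ← e, this]; simp

theorem SuperFn.exists_factor {F : SuperFn} (hF : F.AnAt 0) (h : ∀ s k, F s k 0 = 0) :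
    ∃ G : SuperFn, G.AnAt 0 ∧ (∀ s k w, F s k w = w * G s k w) ∧
      (∀ s k, G s k 0 = deriv (F s k) 0) ∧ ∀ᶠ p in bn 0, F.eval p = p.z * G.eval p := by
  have e : ∀ s k w, F s k w = w * dslope (F s k) 0 w := fun s k w => by
    have := sub_smul_dslope (F s k) 0 w
    rw [h, sub_zero, sub_zero] at this
    exact this.symm
  obtain ⟨K, hK⟩ := hF.2
  have hK' : ∀ᶠ w in 𝓝 (0 : ℂ), ∀ s, ∀ k ∉ K, dslope (F s k) 0 w = 0 := by
    filter_upwards [hK] with w hw s k hk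
    rcases eq_or_ne w 0 with rfl | hne
    · rw [dslope_same]
      have : F s k =ᶠ[𝓝 0] fun _ => 0 := hK.mono fun w hw => hw s k hk
      rw [this.deriv_eq, deriv_const]
    · exact (mul_eq_zero.1 ((e s k w).symm.trans (hw s k hk))).resolve_left hne
  have hG : SuperFn.AnAt (fun s k => dslope (F s k) 0) 0 := by
    refine ⟨fun s k => ?_, K, hK'⟩
    obtain ⟨p, hp⟩ := hF.1 s k
    exact hp.has_fpower_series_dslope_fslope.analyticAt
  refine ⟨_, hG, e, fun s k => dslope_same _ _, ?_⟩
  filter_upwards [eventually_bn_body hG.eventually, eventually_bn_body hK.eventually_nhds,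
    eventually_bn_body hK'.eventually_nhds] with p a b c
  have es : ∀ s, F.sec s p.z = p.z * SuperFn.sec (fun s k => dslope (F s k) 0) s p.z := fun s => by
    rw [SuperFn.sec_eq_sum p.z_even b, SuperFn.sec_eq_sum p.z_even c, Finset.mul_sum]
    refine Finset.sum_congr rfl fun k _ => ?_
    have hm := extend_mul (f := fun w => w) p.z_even analyticAt_id (a.1 s k)
    rw [extend_id p.z_even] at hm
    rw [← mul_assoc, ← hm]
    congr 2
    exact funext (e s k)
  simp only [SuperFn.eval_eq, es, assemble, mul_add]
  have c : ∀ x y : Grassmann, x * (p.z * y) = p.z * (x * y) := fun x y => by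
    rw [← mul_assoc, ← even_comm p.z_even, mul_assoc]
  simp only [c]

theorem extend_affine (a b : ℂ) {z : Grassmann} (hz : z ∈ GEven) :
    extend (fun w => a + w * b) z = algebraMap ℂ Grassmann a + b • z := by
  have h := extend_add (f := fun _ => a) (g := (fun w => w) * fun _ => b) hz analyticAt_const
    (analyticAt_id.mul analyticAt_const)
  rw [extend_mul (f := fun w => w) hz analyticAt_id analyticAt_const, extend_const _ hz, extend_const _ hz,
    extend_id hz, ← Algebra.commutes, ← Algebra.smul_def] at h
  exact h

/-- An entire superanalytic function with a pole of order at most one at infinity. -/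
theorem eq_affine_of_simple_pole_super {Φ Ψ : SPoint → Grassmann} (hΦ : ∀ w, SAn w Φ)
    (hΨ : SAn 0 Ψ)
    (h : ∀ᶠ q in bn 0, q.body ≠ 0 → q.z * Φ (q.inv Complex.I) = Ψ q) :
    ∃ c₀ c₁ cp cm : Grassmann, ∀ p, Φ p = c₀ + p.z * c₁ + p.tp * cp + p.tm * cm := by
  obtain ⟨F, hF⟩ := exists_superFn (V := Set.univ) fun w _ => hΦ w
  have aF : ∀ w, F.AnAt w := fun w => (hF w trivial).1
  have eF : ∀ p : SPoint, Φ p = F.eval p := fun p => of_eventually_bn (hF p.body trivial).2 rfl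
  obtain ⟨G, aG, eG⟩ := hΨ
  -- Multiplication by `z` and inversion give the sectors `1`, `θ^±`, `θ⁺θ⁻` the factors `w`, `i`,
  -- `-1 / w`. By Liouville the first sector is therefore affine, the middle ones are constant, and
  -- the last is zero.
  have key : ∀ᶠ w in 𝓝 (0 : ℂ), w ≠ 0 → ∀ k, w * F .one k w⁻¹ = G .one k w ∧
      F .p k w⁻¹ = -Complex.I * G .p k w ∧ F .m k w⁻¹ = -Complex.I * G .m k w ∧
      F .pm k w⁻¹ = -(w * G .pm k w) := by
    filter_upwards [eventually_bn.1 (h.and eG), aG.eventually] with w h1 h2 hne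
    have h3 : ∀ s, (Sector.rec w Complex.I Complex.I (-w⁻¹) s : ℂ) • F.sec s (algebraMap ℂ _ w⁻¹) -
        G.sec s (algebraMap ℂ _ w) = 0 := by
      refine fun s => congrFun (assemble_eq_zero (v := fun s =>
        (Sector.rec w Complex.I Complex.I (-w⁻¹) s : ℂ) • F.sec s (algebraMap ℂ _ w⁻¹) -
        G.sec s (algebraMap ℂ _ w)) fun η hη η' hη' => ?_) s
      have hq : (SPoint.mk (algebraMap ℂ _ w) η η' (Subalgebra.algebraMap_mem _ _) hη hη').body = w :=
        gbody_algebraMap w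
      obtain ⟨k1, k2⟩ := h1 _ hq
      have k3 := (k1 (by rw [hq]; exact hne)).trans k2
      rw [eF, SuperFn.eval_eq, SuperFn.eval_eq] at k3
      simp only [SPoint.inv, extend_algebraMap, assemble] at k3
      rw [← sub_eq_zero] at k3
      simp only [assemble]
      rw [← k3]
      simp only [← Algebra.commutes (w⁻¹ : ℂ), ← Algebra.smul_def, smul_mul_assoc, mul_smul_comm,
        smul_smul, mul_add, mul_sub]
      rw [show Complex.I * w⁻¹ * w = Complex.I by field_simp,
        show Complex.I * w⁻¹ * (Complex.I * w⁻¹) * w = -w⁻¹ by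
          field_simp; rw [Complex.I_sq]]
      module
    intro k
    have h4 := fun s => congrArg (coef k) (h3 s)
    have c1 := h4 .one
    have c2 := h4 .p
    have c3 := h4 .m
    have c4 := h4 .pm
    simp only [map_sub, map_smul, map_zero, SuperFn.coef_sec (aF _), SuperFn.coef_sec h2,
      smul_eq_mul, sub_eq_zero] at c1 c2 c3 c4
    refine ⟨c1, ?_, ?_, ?_⟩
    · rw [← c2, ← mul_assoc]; simp
    · rw [← c3, ← mul_assoc]; simp
    · rw [← c4]; field_simp
  have dF : ∀ s k, Differentiable ℂ (F s k) := fun s k w => ((aF w).1 s k).differentiableAt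
  have cG : ∀ s k, ContinuousAt (G s k) 0 := fun s k => (aG.1 s k).continuousAt
  have v1 : ∀ k, F .one k = fun z => F .one k 0 + z * G .one k 0 := fun k => funext
    (eq_affine_of_simple_pole (dF _ _) (cG _ _) (key.mono fun w hw hne => (hw hne k).1))
  have v2 : ∀ k, F .p k = fun _ => F .p k 0 := fun k => funext fun z => by
    have := eq_of_analytic_at_infinity (dF _ _) (continuousAt_const.mul (cG _ _))
      (key.mono fun w hw hne => (hw hne k).2.1)
    rw [this z, this 0]
  have v3 : ∀ k, F .m k = fun _ => F .m k 0 := fun k => funext fun z => by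
    have := eq_of_analytic_at_infinity (dF _ _) (continuousAt_const.mul (cG _ _))
      (key.mono fun w hw hne => (hw hne k).2.2.1)
    rw [this z, this 0]
  have v4 : ∀ k, F .pm k = fun _ => 0 := fun k => funext fun z => by
    have := eq_of_analytic_at_infinity (dF _ _) ((continuousAt_id.mul (cG _ _)).neg)
      (key.mono fun w hw hne => (hw hne k).2.2.2)
    rw [this z]; simp
  obtain ⟨K, hK⟩ := (aF 0).2
  obtain ⟨L, hL⟩ := aG.2
  have hK' : ∀ s, ∀ k ∉ K ∪ L, ∀ w, F s k w = 0 := fun s k hk w => by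
    simp only [Finset.mem_union, not_or] at hk
    have h0 := fun s => hK.self_of_nhds s k hk.1
    cases s
    · rw [v1, h0, hL.self_of_nhds _ _ hk.2]; simp
    · rw [v2, h0]
    · rw [v3, h0]
    · rw [v4]
  refine ⟨∑ k ∈ K ∪ L, F .one k 0 • zeta k, ∑ k ∈ K ∪ L, G .one k 0 • zeta k,
    ∑ k ∈ K ∪ L, F .p k 0 • zeta k, ∑ k ∈ K ∪ L, F .m k 0 • zeta k, fun p => ?_⟩
  have hs : ∀ s, F.sec s p.z = ∑ k ∈ K ∪ L, extend (F s k) p.z * zeta k :=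
    SuperFn.sec_eq_sum p.z_even (Eventually.of_forall fun w s k hk => hK' s k hk w)
  have s1 : F.sec .one p.z = ∑ k ∈ K ∪ L, F .one k 0 • zeta k +
      p.z * ∑ k ∈ K ∪ L, G .one k 0 • zeta k := by
    rw [hs, Finset.mul_sum, ← Finset.sum_add_distrib]
    refine Finset.sum_congr rfl fun k _ => ?_
    rw [v1, extend_affine _ _ p.z_even, add_mul, ← Algebra.smul_def, smul_mul_assoc, mul_smul_comm]
    simp
  have s2 : F.sec .p p.z = ∑ k ∈ K ∪ L, F .p k 0 • zeta k := by
    rw [hs]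
    refine Finset.sum_congr rfl fun k _ => ?_
    rw [v2, extend_const _ p.z_even, ← Algebra.smul_def]
  have s3 : F.sec .m p.z = ∑ k ∈ K ∪ L, F .m k 0 • zeta k := by
    rw [hs]
    refine Finset.sum_congr rfl fun k _ => ?_
    rw [v3, extend_const _ p.z_even, ← Algebra.smul_def]
  have s4 : F.sec .pm p.z = 0 := by
    rw [hs]
    refine Finset.sum_eq_zero fun k _ => ?_
    rw [v4, extend_const _ p.z_even, map_zero, zero_mul]
  rw [eF, SuperFn.eval_eq]
  simp only [assemble]
  rw [s1, s2, s3, s4, mul_zero, add_zero]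

/-! ### Automorphisms that fix zero and infinity -/

theorem InfData.field_coef_zero (B : InfData) {u : SSeries} (h : ∀ s, u s 0 = 0) (s : Sector) :
    B.field u s 0 = 0 := by
  cases s <;> simp [InfData.field, evenMul, oddMul, opL, opJ, opGP, opGM, xpow, thetaP, thetaM,
    dThetaP, dThetaM, h]

/-- The field preserves divisibility by `x`, sector by sector, and `x` itself is divisible by `x`.
-/
theorem Ehat_z_zero (a b : GEvenˣ) (B : InfData) (s : Sector) : (Ehat a b B).z s 0 = 0 := by
  have h : ∀ k s, (B.field^[k] serX) s 0 = 0 := fun k => by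
    induction k with
    | zero => intro s; cases s <;> simp [serX]
    | succ k ih =>
      rw [Function.iterate_succ_apply']
      exact B.field_coef_zero ih
  simp [Ehat, evenMul, Etilde, InfData.exp, h]

/-- The even component is divisible by `z` in all sectors, and its derivative has non-zero body, so
the quotient is invertible near the origin. The inverse of the quotient describes the pole of `1 /
z̃`. -/
theorem SConfAt.exists_factor {K : SPoint → SPoint} (h : SConfAt 0 K)
    (h0 : K SPoint.origin = SPoint.origin) : ∃ A : SPoint → Grassmann, SAn 0 A ∧
      ∀ᶠ q in bn 0, (K q).z = q.z * A q ∧ A q ∈ GEven ∧ gbody (A q) ≠ 0 := by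
  obtain ⟨Z, P, M, hn, hg⟩ := h.nondeg
  obtain ⟨a, b, B, -, hr⟩ := h.exists_Ehat h0
  have hz : ∀ s k, Z s k 0 = 0 := fun s k => by
    have e : (fun s => Z.sec s 0) = 0 := assemble_eq_zero fun η hη η' hη' => by
      have hq : (SPoint.mk 0 η η' (zero_mem _) hη hη').body = 0 := by simp [SPoint.body]
      have h1 := (hr _ hq).1
      rw [(of_eventually_bn hg hq).1, SuperFn.eval_eq, ev_apply] at h1
      simpa [evz_zero_point, Ehat_z_zero, assemble] using h1
    rw [← SuperFn.coef_sec hn.anZ, map_zero, congrFun e s, Pi.zero_apply, map_zero]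
  obtain ⟨G, aG, g1, g2, g3⟩ := SuperFn.exists_factor hn.anZ hz
  have g4 : ∀ᶠ w in 𝓝 (0 : ℂ), ∀ s k, Odd (s.card + Finset.card k) → G s k w = 0 := by
    filter_upwards [hn.evenZ] with w hw s k hk
    rcases eq_or_ne w 0 with rfl | hne
    · have : Z s k =ᶠ[𝓝 0] fun _ => 0 := hn.evenZ.mono fun w hw => hw s k hk
      rw [g2, this.deriv_eq, deriv_const]
    · exact (mul_eq_zero.1 ((g1 s k w).symm.trans (hw s k hk))).resolve_left hne
  have g5 : ∀ᶠ w in 𝓝 (0 : ℂ), G .one ∅ w ≠ 0 :=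
    (aG.1 .one ∅).continuousAt.eventually_ne (by rw [g2]; exact hn.derivZ)
  refine ⟨G.eval, ⟨G, aG, Eventually.of_forall fun _ => rfl⟩, ?_⟩
  filter_upwards [hg, g3, eventually_bn_body aG.eventually, eventually_bn_body g4.eventually_nhds,
    eventually_bn_body g5] with p a b c d e
  exact ⟨a.1.trans b, SuperFn.eval_mem_even c d, by rwa [SuperFn.gbody_eval c]⟩

theorem gbody_eq_zero_of_sq {t : Grassmann} (h : t * t = 0) : gbody t = 0 := by
  have := congrArg gbody h
  rw [gbody_mul, gbody_zero] at this
  exact mul_self_eq_zero.1 this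

/-- At infinity the even northern component vanishes exactly to first order, so all southern
components have at most simple poles there and are affine. Fixing zero and the superconformal
equations then leave only a scaling. -/
theorem eq_scale_of_lifts {H K : SPoint → SPoint} (hH : ∀ w, SConfAt w H) (hK : SConfAt 0 K)
    (H0 : H SPoint.origin = SPoint.origin) (K0 : K SPoint.origin = SPoint.origin)
    (h : ∀ᶠ q in bn 0, q.body ≠ 0 → H (q.inv Complex.I) = (K q).inv Complex.I) :
    ∃ v w : GEven, gbody v ≠ 0 ∧ gbody w ≠ 0 ∧ H = SPoint.scale v w := by
  obtain ⟨A, hA, hA'⟩ := hK.exists_factor K0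
  have hb : ∀ p : SPoint, p.body = 0 → gbody (A p) = gbody (A SPoint.origin) := fun p hp => by
    obtain ⟨f, -, hf⟩ := hA.body
    rw [of_eventually_bn hf hp, of_eventually_bn hf origin_body, hp, origin_body]
  have hI : SAn 0 fun p => extend (fun w => w⁻¹) (A p) := hA.extend_comp
    (hA'.mono fun p hp => hp.2.1) hb (analyticAt_inv (of_eventually_bn hA' origin_body).2.2)
  have key : ∀ᶠ q in bn 0, q.body ≠ 0 →
      q.z * extend (fun w => w⁻¹) (K q).z = extend (fun w => w⁻¹) (A q) := by
    filter_upwards [hA'] with q hq hne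
    obtain ⟨h1, h2, h3⟩ := hq
    obtain ⟨k1, k2⟩ := exists_inverse h2 h3
    obtain ⟨l1, l2⟩ := exists_inverse (K q).z_even (by
      rw [h1, gbody_mul]; exact mul_ne_zero hne h3)
    calc q.z * extend (fun w => w⁻¹) (K q).z
        = extend (fun w => w⁻¹) (A q) * (q.z * A q * extend (fun w => w⁻¹) (K q).z) := by
          rw [even_comm q.z_even (A q), mul_assoc, ← mul_assoc, k1, one_mul]
      _ = _ := by rw [← h1, l2, mul_one]
  obtain ⟨c0, c1, cp, cm, hc⟩ := eq_affine_of_simple_pole_super (fun w => (hH w).1.1) hI (by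
    filter_upwards [h, key] with q a b hne
    rw [a hne, ← b hne]; rfl)
  have hodd : ∀ q x : SPoint, ∀ t : Grassmann, q.z * Complex.I • (t * x.z) =
    Complex.I • (t * (q.z * x.z)) := fun q x t => by
      rw [mul_smul_comm, ← mul_assoc, even_comm q.z_even, mul_assoc]
  obtain ⟨e0, e1, ep, em, he⟩ := eq_affine_of_simple_pole_super (fun w => (hH w).1.2.1)
    ((hK.1.2.1.mul hI).smul Complex.I) (by
    filter_upwards [h, key] with q a b hne
    rw [a hne, ← b hne]; exact hodd q ((K q).inv Complex.I) _)
  obtain ⟨f0, f1, fp, fm, hf⟩ := eq_affine_of_simple_pole_super (fun w => (hH w).1.2.2)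
    ((hK.1.2.2.mul hI).smul Complex.I) (by
    filter_upwards [h, key] with q a b hne
    rw [a hne, ← b hne]; exact hodd q ((K q).inv Complex.I) _)
  have z0 : c0 = 0 ∧ e0 = 0 ∧ f0 = 0 := by
    have := hc SPoint.origin
    have h2 := he SPoint.origin
    have h3 := hf SPoint.origin
    rw [H0] at this h2 h3
    simp only [SPoint.origin, zero_mul, add_zero] at this h2 h3
    exact ⟨this.symm, h2.symm, h3.symm⟩
  obtain ⟨rfl, rfl, rfl⟩ := z0
  simp only [zero_add] at hc he hf
  have rel : ∀ p, (∃ c : GEven, gbody c ≠ 0 ∧ RelP H p c) ∧ ∃ c : GEven, gbody c ≠ 0 ∧ RelM H p c :=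
    fun p => of_eventually_bn (hH p.body).2 rfl
  -- The relations at the origin determine the coefficients of `θ^±`. Those at the point `(1, 0, 0)`
  -- then remove the terms in `z` of the odd components, and those at points `(0, 0, η')` identify
  -- the coefficient of `z` with `v w`.
  obtain ⟨⟨v, hv, rv⟩, w, hw, rw'⟩ := rel SPoint.origin
  have p1 : cp = 0 ∧ ep = v ∧ fp = 0 := by
    have h1 := fun η => relP_coords.1 rv η
    simp only [H0] at h1
    simp only [hc, he, hf, SPoint.shP, SPoint.origin, mul_zero, zero_mul, zero_add, add_zero] at h1
    refine ⟨odd_cancel fun η hη => (h1 ⟨η, hη⟩).1, ?_, odd_cancel fun η hη => (h1 ⟨η, hη⟩).2.2⟩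
    exact sub_eq_zero.1 (odd_cancel fun η hη => by rw [mul_sub, sub_eq_zero]; exact (h1 ⟨η, hη⟩).2.1)
  have p2 : cm = 0 ∧ em = 0 ∧ fm = w := by
    have h1 := fun η => relM_coords.1 rw' η
    simp only [H0] at h1
    simp only [hc, he, hf, SPoint.shM, SPoint.origin, mul_zero, zero_mul, zero_add, add_zero] at h1
    refine ⟨odd_cancel fun η hη => (h1 ⟨η, hη⟩).1, odd_cancel fun η hη => (h1 ⟨η, hη⟩).2.1, ?_⟩
    exact sub_eq_zero.1 (odd_cancel fun η hη => by rw [mul_sub, sub_eq_zero]; exact (h1 ⟨η, hη⟩).2.2)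
  obtain ⟨rfl, rfl, rfl⟩ := p1
  obtain ⟨rfl, rfl, rfl⟩ := p2
  simp only [mul_zero, add_zero] at hc he hf
  have cancel : ∀ {u : GEven} {x : Grassmann}, gbody u ≠ 0 → (u : Grassmann) * x = 0 → x = 0 :=
    fun {u x} hu hx => by
      have := (exists_inverse u.2 hu).1
      rw [← one_mul x, ← this, mul_assoc, hx, mul_zero]
  have f1z : f1 = 0 := by
    obtain ⟨c, hc0, rc⟩ := (rel (SPoint.ofBody 1)).1
    have h1 := fun η => relP_coords.1 rc η
    simp only [hc, hf, SPoint.shP, SPoint.ofBody, map_one, one_mul, mul_zero, zero_mul, add_zero,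
      left_eq_add] at h1
    exact cancel hc0 (odd_cancel fun η hη => (h1 ⟨η, hη⟩).1)
  have e1z : e1 = 0 := by
    obtain ⟨c, hc0, rc⟩ := (rel (SPoint.ofBody 1)).2
    have h1 := fun η => relM_coords.1 rc η
    simp only [hc, he, SPoint.shM, SPoint.ofBody, map_one, one_mul, mul_zero, zero_mul, add_zero,
      left_eq_add] at h1
    exact cancel hc0 (odd_cancel fun η hη => (h1 ⟨η, hη⟩).1)
  subst f1z e1z
  simp only [mul_zero, zero_add] at he hf
  have c1z : c1 = v * w := by
    refine sub_eq_zero.1 (odd_cancel fun η' hη' => odd_cancel fun η hη => ?_)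
    obtain ⟨c, -, rc⟩ := (rel ⟨0, 0, η', zero_mem _, zero_mem _, hη'⟩).1
    have hcv : ∀ t : GOdd, (t : Grassmann) * v = t * c := fun t => by
      simpa [he, SPoint.shP] using (relP_coords.1 rc t).2.1
    have := (relP_coords.1 rc ⟨η, hη⟩).1
    simp only [hc, hf, SPoint.shP, zero_mul, zero_add] at this
    rw [← mul_assoc, ← hcv ⟨η, hη⟩, mul_assoc, mul_assoc, ← mul_assoc (v : Grassmann) η',
      even_comm v.2 η', mul_assoc] at this
    rw [mul_sub, mul_sub, this, sub_self]
  refine ⟨v, w, hv, hw, funext fun p => SPoint.ext ?_ ?_ ?_⟩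
  · rw [hc, c1z, even_comm p.z_even]; rfl
  · rw [he, ← even_comm v.2]; rfl
  · rw [hf, ← even_comm w.2]; rfl

/-- Points outside the southern chart are exactly those that cannot be separated from infinity, and
homeomorphisms preserve inseparability. -/
theorem AutConf.maps_south {F : Sphere ≃ Sphere} (hF : AutConf F)
    (hN : F (pt .north SPoint.origin) = pt .north SPoint.origin) {x : Sphere}
    (hx : ¬ SameBody x (pt .north SPoint.origin)) : ∃ q, F x = pt .south q := by
  by_contra hcon
  obtain ⟨q, hq, e⟩ := not_mem_south (x := F x) fun ⟨q, hq⟩ => hcon ⟨q, hq.symm⟩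
  refine hx (sameBody_iff.2 (hF.homeo.isInducing.inseparable_iff.1 ?_))
  show Inseparable (F x) (F (pt .north SPoint.origin))
  rw [hN, e]
  exact sameBody_iff.1 ⟨.north, _, _, rfl, rfl, hq.trans origin_body.symm⟩

theorem not_sameBody_infinity (p : SPoint) : ¬ SameBody (pt .south p) (pt .north SPoint.origin) := by
  intro h
  obtain ⟨q', hq'⟩ := ((sameBody_iff.1 h).mem_open_iff Pole.south.nbhd_open).1 ⟨p, rfl⟩
  exact (pt_eq_iff.1 hq'.symm).1.elim (by simp) fun h => h origin_body

theorem AutConf.eq_scale {F : Sphere ≃ Sphere} (hF : AutConf F)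
    (hN : F (pt .north SPoint.origin) = pt .north SPoint.origin)
    (hS : F (pt .south SPoint.origin) = pt .south SPoint.origin) :
    ∃ v w : GEven, gbody v ≠ 0 ∧ gbody w ≠ 0 ∧
      ∀ p, F (pt .south p) = pt .south (SPoint.scale v w p) := by
  have hs := fun p => hF.maps_south hN (not_sameBody_infinity p)
  choose H hH using hs
  have H0 : H SPoint.origin = SPoint.origin := pt_injective .south (by rw [← hH, hS])
  have cH : ∀ w, SConfAt w H := fun w => by
    obtain ⟨H', h1, -, h2⟩ := (hF (pt .south (SPoint.ofBody w))).lift (hH _)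
    rw [SPoint.body_ofBody] at h1 h2
    exact h1.congr (h2.mono fun r hr => pt_injective .south (by rw [← hH, hr]))
  obtain ⟨K, hK, K0, hK'⟩ := (hF (pt .north SPoint.origin)).lift hN
  rw [origin_body] at hK hK'
  obtain ⟨v, w, hv, hw, rfl⟩ := eq_scale_of_lifts cH hK H0 K0 (by
    filter_upwards [hK'] with q hq hne
    rw [← pt_trans (c := .north) (d := .south) (Or.inr hne), trans_north_south, hH] at hq
    rw [(pt_eq_iff.1 hq.symm).2, trans_north_south])
  exact ⟨v, w, hv, hw, hH⟩

/-- Automorphisms that fix infinity are determined by their restriction to the southern chart. -/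
theorem AutConf.ext {F G : Sphere ≃ Sphere} (hF : AutConf F) (hG : AutConf G)
    (F0 : F (pt .north SPoint.origin) = pt .north SPoint.origin)
    (G0 : G (pt .north SPoint.origin) = pt .north SPoint.origin)
    (h : ∀ p, F (pt .south p) = G (pt .south p)) : F = G := by
  obtain ⟨K, hK, -, eK⟩ := (hF _).lift F0
  obtain ⟨L, hL, -, eL⟩ := (hG _).lift G0
  rw [origin_body] at hK eK hL eL
  have e := hK.1.eventually_eq_of_punctured hL.1 (by
    filter_upwards [eK, eL] with q a b hne
    rw [← pt_trans (c := .north) (d := .south) (Or.inr hne)] at a b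
    exact pt_injective .north (by rw [← a, h, b]))
  refine Equiv.ext fun x => ?_
  by_cases hx : x ∈ Pole.south.nbhd
  · obtain ⟨p, rfl⟩ := hx
    exact h p
  · obtain ⟨q, hq, rfl⟩ := not_mem_south hx
    rw [of_eventually_bn eK hq, of_eventually_bn eL hq, of_eventually_bn e hq]

theorem exists_left_inverse {v : GEven} (hv : gbody v ≠ 0) : ∃ v' : GEven, v' * v = 1 :=
  ⟨⟨_, extend_even _ v.2⟩, Subtype.ext (exists_inverse v.2 hv).1⟩

/-- The parametrization at infinity. -/
def infFrame (p : SPoint) : Sphere := pt .north (SPoint.scale (-1) (-1) p)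

/-- The expression of an affine automorphism near infinity. -/
def infMove (q : SPoint) (w v : GEven) (p : SPoint) : SPoint :=
  SPoint.scale (-1) (-1) (q.ntransl (SPoint.scale w v (SPoint.scale (-1) (-1) p)))

theorem exists_affine (q : SPoint) {v w v' w' : GEven} (hv : v' * v = 1) (hw : w' * w = 1) :
    ∃ F : Sphere ≃ Sphere, AutConf F ∧ F (pt .north SPoint.origin) = pt .north SPoint.origin ∧
      (∀ p, F (pt .south p) = pt .south (q.transl (SPoint.scale v w p))) ∧
      ∀ᶠ p in bn 0, F (infFrame p) = infFrame (infMove q w' v' p) := by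
  obtain ⟨E, hE, E1, E2, E3⟩ := exists_transl' q
  obtain ⟨D, hD, D1, D2, D3⟩ := exists_scale hv hw
  have t : ∀ v w, Tendsto (SPoint.scale v w) (bn 0) (bn 0) := fun v w =>
    (sanMap_scale v w 0).tendsto origin_body (by rw [scale_origin, origin_body])
  refine ⟨D.trans E, hD.trans hE, by rw [Equiv.trans_apply, D2, E2],
    fun p => by rw [Equiv.trans_apply, D1, E1], ?_⟩
  filter_upwards [(t (-1) (-1)).eventually D3, (t (-1) (-1)).eventually ((t w' v').eventually E3)]
    with p a b
  rw [Equiv.trans_apply, infFrame, a, b, infFrame, infMove, scale_neg_one_neg_one]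

/-- Automorphisms that fix infinity are affine. -/
theorem AutConf.eq_affine {F : Sphere ≃ Sphere} (hF : AutConf F)
    (hN : F (pt .north SPoint.origin) = pt .north SPoint.origin) :
    ∃ (q : SPoint) (v w v' w' : GEven), v' * v = 1 ∧ w' * w = 1 ∧
      F (pt .south SPoint.origin) = pt .south q ∧
      (∀ p, F (pt .south p) = pt .south (q.transl (SPoint.scale v w p))) ∧
      ∀ᶠ p in bn 0, F (infFrame p) = infFrame (infMove q w' v' p) := by
  obtain ⟨q, hq⟩ := hF.maps_south hN (not_sameBody_infinity SPoint.origin)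
  -- Translating the image of zero back to zero leaves an automorphism that fixes both zero and
  -- infinity, hence a scaling.
  obtain ⟨E, hE, E1, E2, -⟩ := exists_transl' q
  have N' : E.symm (pt .north SPoint.origin) = pt .north SPoint.origin := E.symm_apply_eq.2 E2.symm
  obtain ⟨v, w, hv, hw, h⟩ := (hF.trans hE.symm).eq_scale (by rw [Equiv.trans_apply, hN, N'])
    (by rw [Equiv.trans_apply, hq, E.symm_apply_eq, E1, transl_origin])
  obtain ⟨v', hv'⟩ := exists_left_inverse hv
  obtain ⟨w', hw'⟩ := exists_left_inverse hw
  obtain ⟨D, hD, D1, D2, D3⟩ := exists_affine q hv' hw'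
  have e : ∀ p, F (pt .south p) = pt .south (q.transl (SPoint.scale v w p)) := fun p => by
    rw [← E1, ← h, Equiv.trans_apply, E.apply_symm_apply]
  obtain rfl : F = D := hF.ext hD hN D1 fun p => by rw [e, D2]
  exact ⟨q, v, w, v', w', hv', hw', hq, e, D3⟩

/-! ### Coordinates near a puncture -/

/-- A local superconformal parametrization of the sphere at `x`. -/
structure Frame (f : SPoint → Sphere) (x : Sphere) : Prop where
  origin : f SPoint.origin = x
  eventually {Q : Sphere → Prop} : (∀ᶠ y in 𝓝 x, Q y) ↔ ∀ᶠ p in bn 0, Q (f p)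
  conf {Om : OpenPartialHomeomorph Sphere SPoint} (h : IsSuperconformalChart Om)
    (hx : x ∈ Om.source) : SConfAt 0 fun p => Om (f p)
  exists_chart {H : SPoint → SPoint} (h : SConfAt 0 H) : ∃ Om : OpenPartialHomeomorph Sphere SPoint,
    IsSuperconformalChart Om ∧ ∀ᶠ p in bn 0, f p ∈ Om.source ∧ Om (f p) = H p

theorem IsSuperconformalChart.sconfAt {Om : OpenPartialHomeomorph Sphere SPoint}
    (h : IsSuperconformalChart Om) {c : Pole} {p : SPoint} (hp : pt c p ∈ Om.source) :
    SConfAt p.body fun q => Om (pt c q) := by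
  obtain ⟨H, hH, -, e⟩ := (h.confAt hp).lift rfl
  exact hH.congr (e.mono fun r hr => pt_injective .south hr)

theorem frame_of {c : Pole} {q : SPoint} {g g' : SPoint → SPoint} (hg : SConfAt 0 g)
    (hg' : SConfAt q.body g') (h0 : g SPoint.origin = q) (h : ∀ p, g' (g p) = p)
    (h' : ∀ p, g (g' p) = p) : Frame (fun p => pt c (g p)) (pt c q) := by
  have h0' : g' q = SPoint.origin := by rw [← h0, h]
  have t : Tendsto g (bn 0) (bn q.body) := hg.1.tendsto origin_body (by rw [h0])
  have t' : Tendsto g' (bn q.body) (bn 0) := hg'.1.tendsto rfl (by rw [h0', origin_body])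
  refine ⟨by rw [h0], fun {Q} => ?_, fun {Om} hO hx => ?_, fun {H} hH => ?_⟩
  · rw [eventually_pt]
    exact ⟨t.eventually, fun e => (t'.eventually e).mono fun p hp => by rwa [h'] at hp⟩
  · exact (hO.sconfAt hx).comp hg origin_body (by rw [h0])
  · obtain ⟨Om, h1, h2⟩ := N2Sphere.exists_chart c (hH.comp hg' rfl (by rw [h0', origin_body]))
    exact ⟨Om, h1, (t.eventually h2).mono fun p hp => by rwa [h] at hp⟩

/-- The parametrization at `q`. -/
def southFrame (q p : SPoint) : Sphere := pt .south (q.transl p)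

theorem infFrame_frame : Frame infFrame (pt .north SPoint.origin) :=
  frame_of (sconfAt_scale (by simp) (by simp) 0) (sconfAt_scale (by simp) (by simp) _)
    (scale_origin _ _) scale_neg_one_neg_one scale_neg_one_neg_one

theorem southFrame_frame (q : SPoint) : Frame (southFrame q) (pt .south q) :=
  frame_of (sconfAt_transl q 0) (sconfAt_transl q.opp _) (transl_origin q) (opp_transl q)
    (transl_opp q)

theorem Ehat_one (B : InfData) : Ehat 1 1 B = Etilde B := by
  simp [Ehat, evenMul_one]

theorem FormalMap.Rep.congr {h : FormalMap} {H G : SPoint → SPoint} (hr : h.Rep H)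
    (e : ∀ᶠ p in bn 0, G p = H p) : h.Rep G := fun p hp => by
  rw [of_eventually_bn e hp]; exact hr p hp

/-- The prescription of a coordinate at infinity concerns only points with a southern coordinate;
superanalyticity determines the values on the remaining fibre. -/
theorem rep_of_punctured {B : InfData} (hB : B ∈ calH) {a b : GEvenˣ} {T : SPoint → SPoint}
    (hT : SConfAt 0 T)
    (h : ∀ᶠ p in bn 0, p.body ≠ 0 → (Ehat a b B).HasValue p.z p.tp p.tm (T p)) :
    (Ehat a b B).Rep T := by
  obtain ⟨H, hH, hr, -⟩ := exists_map_of_calH hB a b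
  refine hr.congr (hT.1.eventually_eq_of_punctured hH.1 ?_)
  filter_upwards [h, hr.hasValue hH.1] with p h1 h2 hne
  exact (h1 hne).unique h2

variable {n : ℕ}

theorem Frame.sconfAt {S : TubedSphere n} {j : Fin (n + 1)} {f : SPoint → Sphere} {x : Sphere}
    (h : Frame f x) (hx : S.puncture j = x) : SConfAt 0 fun p => S.coord j (f p) :=
  h.conf (S.coord_superconformal j) (hx ▸ S.mem_source j)

theorem Frame.eventually_source {S : TubedSphere n} {j : Fin (n + 1)} {f : SPoint → Sphere}
    {x : Sphere} (h : Frame f x) (hx : S.puncture j = x) :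
    ∀ᶠ p in bn 0, f p ∈ (S.coord j).source :=
  h.eventually.1 ((S.coord j).open_source.mem_nhds (hx ▸ S.mem_source j))

theorem coordAtInfinity_iff {S : TubedSphere n} {B : InfData} (hB : B ∈ calH) :
    CoordAtInfinity S B ↔ S.puncture 0 = pt .north SPoint.origin ∧
      (Ehat 1 1 B).Rep fun p => S.coord 0 (infFrame p) := by
  refine and_congr_right fun h0 => ?_
  have hT := infFrame_frame.sconfAt h0
  -- The prescribed coordinate is a function of `I(w, ρ⁺, ρ⁻)`, whereas the change to the northern
  -- chart is the inverse of `I`. The two differ by the sign of the odd coordinates, which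
  -- `infFrame` absorbs.
  have key : ∀ x : SPoint, x.body ≠ 0 → infFrame (x.inv Complex.I) = pt .south x ∧
      Ring.inverse x.z = (x.inv Complex.I).z ∧
      Complex.I • (x.tp * Ring.inverse x.z) = (x.inv Complex.I).tp ∧
      Complex.I • (x.tm * Ring.inverse x.z) = (x.inv Complex.I).tm := fun x hx => by
    have e : SPoint.scale (-1) (-1) (x.inv Complex.I) = x.inv (-Complex.I) := by
      obtain ⟨h1, h2, h3⟩ := scale_neg_one (x.inv Complex.I)
      refine SPoint.ext h1 (h2.trans ?_) (h3.trans ?_) <;> simp [SPoint.inv]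
    rw [inverse_eq_extend x.z_even hx, infFrame, e, ← trans_south_north]
    exact ⟨pt_trans (Or.inr hx), rfl, rfl, rfl⟩
  constructor
  · rintro ⟨r, hr, h⟩
    refine rep_of_punctured hB hT ?_
    have hb : ∀ᶠ w in 𝓝 (0 : ℂ), ‖w‖ < r⁻¹ := by
      filter_upwards [Metric.ball_mem_nhds (0 : ℂ) (inv_pos.2 hr)] with w hw using by simpa using hw
    filter_upwards [eventually_bn_body hb] with p hp hne
    have hx : (p.inv (-Complex.I)).body = p.body⁻¹ := SPoint.body_inv _ _
    have e : (p.inv (-Complex.I)).inv Complex.I = p := SPoint.inv_inv (by simp) hne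
    obtain ⟨k1, k2, k3, k4⟩ := key (p.inv (-Complex.I)) (by rw [hx]; exact inv_ne_zero hne)
    have := (h (p.inv (-Complex.I)) (by
      rw [hx, norm_inv]; exact (lt_inv_comm₀ (norm_pos_iff.2 hne) hr).1 hp)).2
    rw [k3, k4, k2, ← k1, e] at this
    rwa [Ehat_one]
  · intro h
    obtain ⟨r, hr, h⟩ := exists_ball_of_eventually
      ((h.hasValue hT.1).and (infFrame_frame.eventually_source h0))
    refine ⟨r⁻¹, inv_pos.2 hr, fun x hx => ?_⟩
    have hne : x.body ≠ 0 := norm_pos_iff.1 ((inv_pos.2 hr).trans hx)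
    obtain ⟨k1, k2, k3, k4⟩ := key x hne
    have := h (x.inv Complex.I) (by
      rw [SPoint.body_inv, sub_zero, norm_inv]; exact inv_lt_of_inv_lt₀ hr hx)
    rw [k1, Ehat_one] at this
    rw [k3, k4, k2]
    exact ⟨this.2, this.1⟩

theorem coordAt_iff {S : TubedSphere n} {j : Fin (n + 1)} {q : SPoint} {a b : GEvenˣ} {B : InfData}
    (hB : B ∈ calH) : CoordAt S j q a b B ↔ S.puncture j = pt .south q ∧
      (Ehat a b B).Rep fun p => S.coord j (southFrame q p) := by
  refine and_congr_right fun h0 => ?_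
  have hT := (southFrame_frame q).sconfAt h0
  have key : ∀ x : SPoint, x.z - q.z - x.tp * q.tm - x.tm * q.tp = (q.opp.transl x).z ∧
      x.tp - q.tp = (q.opp.transl x).tp ∧ x.tm - q.tm = (q.opp.transl x).tm := fun x => by
    simp [SPoint.transl, SPoint.opp, sub_eq_add_neg]
  constructor
  · rintro ⟨r, hr, h⟩
    refine rep_of_punctured hB hT ?_
    have hb : ∀ᶠ w in 𝓝 (0 : ℂ), ‖w‖ < r := by
      filter_upwards [Metric.ball_mem_nhds (0 : ℂ) hr] with w hw using by simpa using hw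
    filter_upwards [eventually_bn_body hb] with p hp _
    have := (h (q.transl p) (by rwa [body_transl, add_sub_cancel_right])).2
    obtain ⟨k1, k2, k3⟩ := key (q.transl p)
    rwa [k1, k2, k3, opp_transl] at this
  · intro h
    obtain ⟨r, hr, h⟩ := exists_ball_of_eventually
      ((h.hasValue hT.1).and ((southFrame_frame q).eventually_source h0))
    refine ⟨r, hr, fun x hx => ?_⟩
    have := h (q.opp.transl x) (by
      rw [sub_zero, body_transl]; simpa [SPoint.opp, SPoint.body, sub_eq_add_neg] using hx)
    obtain ⟨k1, k2, k3⟩ := key x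
    rw [k1, k2, k3]
    rw [southFrame, transl_opp] at this
    exact ⟨this.2, this.1⟩

/-- Spheres with tubes can be constructed from the punctures and the local coordinates. -/
theorem exists_tubedSphere {x : Fin (n + 1) → Sphere} (hx : ∀ j k, j ≠ k → ¬ SameBody (x j) (x k))
    {f : Fin (n + 1) → SPoint → Sphere} (hf : ∀ j, Frame (f j) (x j))
    {H : Fin (n + 1) → SPoint → SPoint} (hH : ∀ j, SConfAt 0 (H j))
    (H0 : ∀ j, H j SPoint.origin = SPoint.origin) :
    ∃ S : TubedSphere n, ∀ j, S.puncture j = x j ∧ ∀ᶠ p in bn 0, S.coord j (f j p) = H j p := by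
  choose Om h1 h2 using fun j => (hf j).exists_chart (hH j)
  have h3 := fun j => of_eventually_bn (h2 j) origin_body
  simp only [fun j => (hf j).origin] at h3
  exact ⟨⟨x, hx, Om, h1, fun j => (h3 j).1, fun j => (h3 j).2.trans (H0 j)⟩,
    fun j => ⟨rfl, (h2 j).mono fun p hp => hp.2⟩⟩

/-- Spheres with the same punctures and the same expansions are equivalent. -/
theorem equivalent_of_rep {S T : TubedSphere n} (hp : ∀ j, S.puncture j = T.puncture j)
    (h : ∀ j, ∃ (f : SPoint → Sphere) (e : FormalMap), Frame f (S.puncture j) ∧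
      e.Rep (fun p => S.coord j (f p)) ∧ e.Rep fun p => T.coord j (f p)) :
    SuperconformallyEquivalent S T := by
  refine superconformallyEquivalent_iff.2 ⟨Equiv.refl _, AutConf.refl, fun j => ⟨hp j, ?_⟩⟩
  obtain ⟨f, e, hf, h1, h2⟩ := h j
  exact hf.eventually.2 (h1.eventually_eq h2 (hf.sconfAt rfl).1 (hf.sconfAt (hp j).symm).1)

/-! ### The first coefficients of the local coordinates -/

theorem mul_extend_inv {x D : Grassmann} (hD : D ∈ GEven) (hb : gbody D ≠ 0) (h : x * D = x) :
    x * extend (fun w => w⁻¹) D = x := by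
  conv_lhs => rw [← h]
  rw [mul_assoc, (exists_inverse hD hb).2, mul_one]

/-- On points with a single odd coordinate the translation is invisible and only the scaling acts,
which separates the two normalizations at infinity. -/
theorem infMove_odd (q : SPoint) (w v : GEven) {η : Grassmann} (hη : η ∈ GOdd) :
    infMove q w v ⟨0, η, 0, zero_mem _, hη, zero_mem _⟩ =
      ⟨0, w * η, 0, zero_mem _, even_mul_odd w.2 hη, zero_mem _⟩ ∧
    infMove q w v ⟨0, 0, η, zero_mem _, zero_mem _, hη⟩ =
      ⟨0, 0, v * η, zero_mem _, zero_mem _, even_mul_odd v.2 hη⟩ := by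
  have key : ∀ (u : GEven) (r : Grassmann), r ∈ GOdd →
      (u : Grassmann) * η * extend (fun w => w⁻¹) (1 - Complex.I • (u * η * r)) = u * η :=
    fun u r hr => by
      have ho := even_mul_odd u.2 hη
      refine mul_extend_inv (sub_mem (one_mem _) (Subalgebra.smul_mem _ (odd_mul_odd ho hr) _)) ?_ ?_
      · simp [gbody_odd ho]
      · rw [mul_sub, mul_one, mul_smul_comm, ← mul_assoc, odd_mul_self ho, zero_mul, smul_zero,
          sub_zero]
  constructor
  · refine SPoint.ext ?_ ?_ ?_ <;> simp [infMove, SPoint.scale, SPoint.ntransl, translDen,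
      ← sub_eq_add_neg, key w q.tm q.tm_odd]
  · refine SPoint.ext ?_ ?_ ?_ <;> simp [infMove, SPoint.scale, SPoint.ntransl, translDen,
      ← sub_eq_add_neg, key v q.tp q.tp_odd]

/-- On even points of square zero the odd part of the translation appears to first order, and its
even part does not appear. -/
theorem infMove_even (q : SPoint) (t : GEven) (ht : (t : Grassmann) * t = 0) :
    infMove q 1 1 ⟨t, 0, 0, t.2, zero_mem _, zero_mem _⟩ =
      ⟨t, t * (Complex.I • q.tp), t * (Complex.I • q.tm), t.2,
        even_mul_odd t.2 (Submodule.smul_mem _ _ q.tp_odd),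
        even_mul_odd t.2 (Submodule.smul_mem _ _ q.tm_odd)⟩ := by
  have key : (t : Grassmann) * extend (fun w => w⁻¹) (1 + t * q.z) = t := by
    refine mul_extend_inv (add_mem (one_mem _) (even_mul_even t.2 q.z_even)) ?_ ?_
    · simp [gbody_eq_zero_of_sq ht]
    · rw [mul_add, mul_one, ← mul_assoc, ht, zero_mul, add_zero]
  have key' : ∀ r : Grassmann, t * r * extend (fun w => w⁻¹) (1 + t * q.z) = t * r := fun r => by
    rw [even_comm t.2, mul_assoc, key]
  refine SPoint.ext ?_ ?_ ?_ <;> simp [infMove, SPoint.scale, SPoint.ntransl, translDen, key, key']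

theorem infMove_of_body (q : SPoint) (hp : q.tp = 0) (hm : q.tm = 0) (x : SPoint)
    (ht : x.z * x.z = 0) : (infMove q 1 1 x).z = x.z ∧
      (infMove q 1 1 x).tp = x.tp * (1 - x.z * q.z) ∧ (infMove q 1 1 x).tm = x.tm * (1 - x.z * q.z) := by
  have hD : (1 + x.z * q.z) ∈ GEven := add_mem (one_mem _) (even_mul_even x.z_even q.z_even)
  have hb : gbody (1 + x.z * q.z) ≠ 0 := by simp [gbody_eq_zero_of_sq ht]
  have h1 : (1 - x.z * q.z) * (1 + x.z * q.z) = 1 := by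
    have : x.z * q.z * (x.z * q.z) = 0 := by
      rw [mul_assoc, ← mul_assoc q.z, even_comm q.z_even, mul_assoc, ← mul_assoc, ht, zero_mul]
    rw [sub_mul, one_mul, mul_add, mul_one, this]; abel
  have key : extend (fun w => w⁻¹) (1 + x.z * q.z) = 1 - x.z * q.z := by
    have h3 := congrArg ((1 - x.z * q.z) * ·) (exists_inverse hD hb).2
    simp only [← mul_assoc, h1, one_mul, mul_one] at h3
    exact h3
  have h2 : x.z * (1 - x.z * q.z) = x.z := by
    rw [mul_sub, mul_one, ← mul_assoc, ht, zero_mul, sub_zero]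
  refine ⟨?_, ?_, ?_⟩ <;> simp [infMove, SPoint.scale, SPoint.ntransl, translDen, hp, hm, key, h2]

theorem ev_of_sq {p : SPoint} (h : p.z * p.z = 0) (u : SSeries) :
    ev p u = assemble p.tp p.tm fun s => u s 0 + u s 1 * p.z := by
  simp [ev_apply, evz_eq (M := 2) (by rw [pow_two, h]), Finset.sum_range_succ]

theorem exp_zero_data (u : SSeries) : InfData.exp ⟨0, 0, 0, 0⟩ u = u := by
  have h : ∀ v, InfData.field ⟨0, 0, 0, 0⟩ v = 0 := fun v => by
    funext s n; simp [InfData.field, evenMul, oddMul]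
  funext s n
  rw [InfData.exp, Finset.sum_eq_single 0]
  · simp
  · intro k _ hk
    obtain ⟨k, rfl⟩ := Nat.exists_eq_succ_of_ne_zero hk
    rw [Function.iterate_succ_apply', h]; simp
  · simp

/-- Comparison with zero data, whose exponential is the identity. The formula for `A^±` assumes
vanishing odd data because products of two `M^±` have the same weight as `A^±`. -/
theorem exp_first (B : InfData) :
    (B.exp serP .one 1 = B.MP 0 ∧ B.exp serM .one 1 = B.MM 0) ∧
    (B.MP 0 = 0 → B.MM 0 = 0 → B.exp serP .p 1 = B.AP 0 + B.AM 0 ∧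
      B.exp serM .m 1 = B.AP 0 - B.AM 0) := by
  constructor
  · have := exp_odd_sub (B := B) (B' := ⟨0, 0, 0, 0⟩) (w := 1) (i := 0)
      (fun i => ⟨fun h => by omega, fun h => by omega⟩) (by omega)
    simpa [exp_zero_data, serP, serM] using this
  · intro h1 h2
    have := exp_even_sub (B := B) (B' := ⟨0, 0, 0, 0⟩) (w := 2) (i := 0)
      (fun i => ⟨fun h => by
        obtain rfl : i = 0 := by omega
        simp [InfData.sub, h1, h2], fun h => by omega⟩) (by omega)
    simpa [exp_zero_data, serP, serM] using this

theorem rep_leading {a b : GEvenˣ} {B : InfData} {T : SPoint → SPoint} (hr : (Ehat a b B).Rep T)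
    {η : Grassmann} (hη : η ∈ GOdd) :
    (T ⟨0, η, 0, zero_mem _, hη, zero_mem _⟩).tp = η * ((a * b : GEvenˣ) : GEven) ∧
    (T ⟨0, 0, η, zero_mem _, zero_mem _, hη⟩).tm = η * ((a * b⁻¹ : GEvenˣ) : GEven) := by
  obtain ⟨l1, l2⟩ := Ehat_leading a b B
  obtain ⟨⟨k1, k2⟩, -⟩ := exp_leading B
  have h1 := (hr ⟨0, η, 0, zero_mem _, hη, zero_mem _⟩ (by simp [SPoint.body])).2.1
  have h2 := (hr ⟨0, 0, η, zero_mem _, zero_mem _, hη⟩ (by simp [SPoint.body])).2.2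
  simp only [ev_apply, evz_zero_point, assemble, l1, l2, zero_mul, mul_zero, add_zero] at h1 h2
  rw [h1, h2]
  simp [Ehat, evenMul, Etilde, k1, k2]

theorem eq_one_of_odd {x : GEven} (h : ∀ η ∈ GOdd, η * (x : Grassmann) = η) : x = 1 :=
  Subtype.ext (sub_eq_zero.1 (odd_cancel fun η hη => by
    rw [mul_sub, h η hη, OneMemClass.coe_one, mul_one, sub_self]))

theorem exists_rep_of_leading {T : SPoint → SPoint} (hT : SConfAt 0 T)
    (h0 : T SPoint.origin = SPoint.origin)
    (h : ∀ η (hη : η ∈ GOdd), (T ⟨0, η, 0, zero_mem _, hη, zero_mem _⟩).tp = η ∧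
      (T ⟨0, 0, η, zero_mem _, zero_mem _, hη⟩).tm = η) :
    ∃ B ∈ calH, (Ehat 1 1 B).Rep T := by
  obtain ⟨a, b, B, hB, hr⟩ := hT.exists_Ehat h0
  have h1 := eq_one_of_odd fun η hη => (rep_leading hr hη).1.symm.trans (h η hη).1
  have h2 := eq_one_of_odd fun η hη => (rep_leading hr hη).2.symm.trans (h η hη).2
  refine ⟨B, hB, ?_⟩
  rw [Ehat_eq_scale, h1, h2] at hr
  rw [Ehat_eq_scale]
  simpa using hr

/-- Both coordinates have leading coefficients one, and along the odd directions the change of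
coordinates is the scaling alone. -/
theorem scale_eq_one {B B' : InfData} {T T' : SPoint → SPoint} (hr : (Ehat 1 1 B).Rep T)
    (hr' : (Ehat 1 1 B').Rep T') {q : SPoint} {w v : GEven}
    (e : ∀ p : SPoint, p.body = 0 → T p = T' (infMove q w v p)) : w = 1 ∧ v = 1 := by
  have h1 := fun η hη => (rep_leading hr (η := η) hη)
  have h2 := fun (u : GEven) η hη => (rep_leading hr' (even_mul_odd u.2 (y := η) hη))
  simp only [mul_one, inv_one, Units.val_one, OneMemClass.coe_one] at h1 h2
  constructor
  · refine eq_one_of_odd fun η hη => ?_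
    rw [← even_comm w.2, ← (h2 w η hη).1, ← (infMove_odd q w v hη).1, ← e _ (by simp [SPoint.body]),
      (h1 η hη).1]
  · refine eq_one_of_odd fun η hη => ?_
    rw [← even_comm v.2, ← (h2 v η hη).2, ← (infMove_odd q w v hη).2, ← e _ (by simp [SPoint.body]),
      (h1 η hη).2]

theorem Etilde_coef_zero (B : InfData) (n : ℕ) : B.exp serP .m n = 0 ∧ B.exp serM .p n = 0 := by
  obtain ⟨h1, h2, -⟩ := (Etilde_conf B).eqs
  have h1 := congrFun (congrFun h1 .one) n
  have h2 := congrFun (congrFun h2 .one) n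
  simp [dPs, dMs, dThetaP, dThetaM, thetaP, thetaM, Etilde] at h1 h2
  exact ⟨h2, h1⟩

/-- Evaluation at `(t, 0, 0)` with `t² = 0` isolates the coefficient of `x` in the odd components,
where the translation contributes `i` times the odd coordinates of `q`. -/
theorem first_order_odd {B B' : InfData} {T T' : SPoint → SPoint} (hr : (Ehat 1 1 B).Rep T)
    (hr' : (Ehat 1 1 B').Rep T') {q : SPoint}
    (e : ∀ p : SPoint, p.body = 0 → T p = T' (infMove q 1 1 p)) :
    (B.MP 0 : Grassmann) = B'.MP 0 + Complex.I • q.tp ∧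
    (B.MM 0 : Grassmann) = B'.MM 0 + Complex.I • q.tm := by
  rw [Ehat_one] at hr hr'
  have key : ∀ t : GEven, (t : Grassmann) * t = 0 →
      t * (B.MP 0 : Grassmann) = t * (B'.MP 0 + Complex.I • q.tp) ∧
      t * (B.MM 0 : Grassmann) = t * (B'.MM 0 + Complex.I • q.tm) := fun t ht => by
    have hb : (SPoint.mk t 0 0 t.2 (zero_mem _) (zero_mem _)).body = 0 := gbody_eq_zero_of_sq ht
    have h1 := hr _ hb
    rw [e _ hb, infMove_even q t ht, (hr' _ (gbody_eq_zero_of_sq ht)).2.1,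
      (hr' _ (gbody_eq_zero_of_sq ht)).2.2, ev_of_sq (u := (Etilde B').tp) ht,
      ev_of_sq (u := (Etilde B').tm) ht, ev_of_sq (u := (Etilde B).tp) ht, ev_of_sq (u := (Etilde B).tm) ht] at h1
    have c : ∀ x y : Grassmann, x * (t * y) = t * (x * y) := fun x y => by
      rw [← mul_assoc, ← even_comm t.2, mul_assoc]
    have c' : ∀ x : Grassmann, x * t = t * x := fun x => (even_comm t.2 x).symm
    have d : ∀ x : Grassmann, t * (t * x) = 0 := fun x => by rw [← mul_assoc, ht, zero_mul]
    simp only [assemble, Etilde, exp_leading, exp_first, Etilde_coef_zero, c, c', mul_assoc, d,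
      mul_add, mul_one, mul_zero, zero_mul, add_zero, zero_add] at h1
    rw [mul_add, mul_add]
    exact ⟨h1.2.1.symm, h1.2.2.symm⟩
  exact ⟨even_cancel fun t ht => (key t ht).1, even_cancel fun t ht => (key t ht).2⟩

/-- Evaluation at `(t, η, 0)` and `(t, 0, η)` with `t² = 0` isolates the coefficients of `φ^± x`,
which are `A⁺ ± A⁻`; the translation lowers both by its even coordinate. -/
theorem first_order_even {B B' : InfData} {T T' : SPoint → SPoint} (hr : (Ehat 1 1 B).Rep T)
    (hr' : (Ehat 1 1 B').Rep T') {q : SPoint} (hp : q.tp = 0) (hm : q.tm = 0)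
    (hB : B.MP 0 = 0 ∧ B.MM 0 = 0) (hB' : B'.MP 0 = 0 ∧ B'.MM 0 = 0)
    (e : ∀ p : SPoint, p.body = 0 → T p = T' (infMove q 1 1 p)) :
    (B.AP 0 : Grassmann) = B'.AP 0 - q.z := by
  rw [Ehat_one] at hr hr'
  obtain ⟨⟨b1, b2⟩, b⟩ := exp_first B
  obtain ⟨⟨b1', b2'⟩, b'⟩ := exp_first B'
  obtain ⟨b3, b4⟩ := b hB.1 hB.2
  obtain ⟨b3', b4'⟩ := b' hB'.1 hB'.2
  rw [hB.1] at b1; rw [hB.2] at b2; rw [hB'.1] at b1'; rw [hB'.2] at b2'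
  have d : ∀ (t : GEven), (t : Grassmann) * t = 0 → ∀ x : Grassmann, t * (t * x) = 0 :=
    fun t ht x => by rw [← mul_assoc, ht, zero_mul]
  have c : ∀ (t : GEven) (x y : Grassmann), x * (t * y) = t * (x * y) := fun t x y => by
    rw [← mul_assoc, ← even_comm t.2, mul_assoc]
  have c' : ∀ (t : GEven) (x : Grassmann), x * t = t * x := fun t x => (even_comm t.2 x).symm
  have fin : ∀ {η x y : Grassmann} {t : GEven},
      η - t * (η * q.z) + t * (η * x) = η + t * (η * y) → t * (η * y) = t * (η * (x - q.z)) :=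
    fun {η x y t} h => by
      rw [sub_add_eq_add_sub, add_sub_assoc, add_right_inj, ← mul_sub, ← mul_sub] at h
      exact h.symm
  have keyP : B.exp serP .p 1 = B'.exp serP .p 1 - q.z := by
    refine sub_eq_zero.1 (odd_cancel fun η hη => ?_)
    rw [mul_sub, sub_eq_zero]
    refine even_cancel fun t ht => ?_
    obtain ⟨m1, m2, m3⟩ := infMove_of_body q hp hm ⟨t, η, 0, t.2, hη, zero_mem _⟩ ht
    have h1 := (hr ⟨t, η, 0, t.2, hη, zero_mem _⟩ (gbody_eq_zero_of_sq ht)).2.1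
    rw [e _ (gbody_eq_zero_of_sq ht), (hr' _ (by rw [SPoint.body, m1]; exact gbody_eq_zero_of_sq ht)).2.1,
      ev_of_sq (p := infMove q 1 1 _) (by rw [m1]; exact ht),
      ev_of_sq ht, m1, m2, m3] at h1
    simp only [assemble, Etilde, exp_leading, b1, b1', ZeroMemClass.coe_zero, mul_sub, sub_mul, c,
      c', mul_assoc, d t ht, mul_add, mul_one, mul_zero, zero_mul, add_zero, zero_add, sub_zero] at h1
    exact fin h1
  have keyM : B.exp serM .m 1 = B'.exp serM .m 1 - q.z := by
    refine sub_eq_zero.1 (odd_cancel fun η hη => ?_)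
    rw [mul_sub, sub_eq_zero]
    refine even_cancel fun t ht => ?_
    obtain ⟨m1, m2, m3⟩ := infMove_of_body q hp hm ⟨t, 0, η, t.2, zero_mem _, hη⟩ ht
    have h1 := (hr ⟨t, 0, η, t.2, zero_mem _, hη⟩ (gbody_eq_zero_of_sq ht)).2.2
    rw [e _ (gbody_eq_zero_of_sq ht), (hr' _ (by rw [SPoint.body, m1]; exact gbody_eq_zero_of_sq ht)).2.2,
      ev_of_sq (p := infMove q 1 1 _) (by rw [m1]; exact ht),
      ev_of_sq ht, m1, m2, m3] at h1
    simp only [assemble, Etilde, exp_leading, b2, b2', ZeroMemClass.coe_zero, mul_sub, sub_mul, c,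
      c', mul_assoc, d t ht, mul_add, mul_one, mul_zero, zero_mul, add_zero, zero_add, sub_zero] at h1
    exact fin h1
  rw [b3, b3'] at keyP
  rw [b4, b4'] at keyM
  -- Adding the two identities eliminates `A⁻`.
  have h2 : (2 : ℂ) • (B.AP 0 : Grassmann) = (2 : ℂ) • (B'.AP 0 - q.z : Grassmann) := by
    have h3 : _ + _ = _ + _ := congrArg₂ (· + ·) keyP keyM
    rw [two_smul, two_smul]
    calc (B.AP 0 + B.AP 0 : Grassmann) = B.AP 0 + B.AM 0 + (B.AP 0 - B.AM 0) := by abel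
      _ = _ := h3
      _ = _ := by abel
  exact smul_right_injective _ two_ne_zero h2

/-! ### The moduli space -/

theorem sameBody_south {a b : SPoint} (h : SameBody (pt .south a) (pt .south b)) :
    a.body = b.body :=
  (((isOpenEmbedding_pt .south).isInducing.inseparable_iff.1 (sameBody_iff.1 h)).map
    SPoint.continuous_body).eq

/-- The relation `R` need not select one sphere for given data, since the chart domains are not
prescribed; it suffices that all selected spheres lie in one class. -/
theorem exists_equiv_moduli {n : ℕ} {K : Type} {R : K → TubedSphere n → Prop}
    (ex : ∀ Q, ∃ S, R Q S)
    (unique : ∀ Q S S', R Q S → R Q S' → SuperconformallyEquivalent S S')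
    (inj : ∀ Q Q' S S', R Q S → R Q' S' → SuperconformallyEquivalent S S' → Q = Q')
    (surj : ∀ S, ∃ Q S', R Q S' ∧ SuperconformallyEquivalent S S') :
    ∃ e : K ≃ Moduli n, ∀ Q, (∃ S, R Q S) ∧ ∀ S, R Q S → e Q = Quot.mk _ S := by
  have E := superconformallyEquivalent_equivalence n
  choose f hf using ex
  refine ⟨Equiv.ofBijective (fun Q => Quot.mk _ (f Q)) ⟨fun Q Q' h => ?_, fun y => ?_⟩,
    fun Q => ⟨⟨f Q, hf Q⟩, fun S hS => Quot.sound (unique Q _ _ (hf Q) hS)⟩⟩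
  · exact inj _ _ _ _ (hf Q) (hf Q') ((E.quot_mk_eq_iff _ _).1 h)
  · induction y using Quot.ind with
    | mk S =>
      obtain ⟨Q, S', h1, h2⟩ := surj S
      exact ⟨Q, Quot.sound (E.trans (unique Q _ _ (hf Q) h1) (E.symm h2))⟩

theorem TubedSphere.infFrame_origin {S : TubedSphere n}
    (h0 : S.puncture 0 = pt .north SPoint.origin) :
    S.coord 0 (infFrame SPoint.origin) = SPoint.origin := by
  rw [infFrame_frame.origin, ← h0, S.vanishing]

theorem exists_push_infinity (S : TubedSphere n) : ∃ S' : TubedSphere n,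
    SuperconformallyEquivalent S S' ∧ S'.puncture 0 = pt .north SPoint.origin := by
  obtain ⟨F, hF, h⟩ := exists_move_infinity (S.puncture 0)
  exact ⟨S.push hF, S.equivalent_push hF, h⟩

theorem exists_push_affine {S : TubedSphere n} (h0 : S.puncture 0 = pt .north SPoint.origin)
    (q : SPoint) {v w v' w' : GEven} (hv : v' * v = 1) (hw : w' * w = 1) : ∃ S' : TubedSphere n,
    SuperconformallyEquivalent S S' ∧ S'.puncture 0 = pt .north SPoint.origin ∧
    (∀ j p, S.puncture j = pt .south (q.transl (SPoint.scale v w p)) →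
      S'.puncture j = pt .south p) ∧
    ∀ p : SPoint, p.body = 0 →
      S'.coord 0 (infFrame p) = S.coord 0 (infFrame (infMove q w' v' p)) := by
  obtain ⟨E, hE, E1, E2, E3⟩ := exists_affine q hv hw
  refine ⟨S.push hE.symm, S.equivalent_push hE.symm, ?_, fun j p h => ?_, fun p hp => ?_⟩
  · show E.symm (S.puncture 0) = _
    rw [h0, E.symm_apply_eq, E1]
  · show E.symm (S.puncture j) = _
    rw [h, E.symm_apply_eq, E2]
  · rw [S.push_coord, E.symm_symm, of_eventually_bn E3 hp]

theorem exists_rep_of_move {a b : GEvenˣ} {B : InfData} {T T' : SPoint → SPoint}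
    (hr : (Ehat a b B).Rep T) (hT' : SConfAt 0 T') (h0 : T' SPoint.origin = SPoint.origin)
    {q : SPoint} {w v : GEven} (hw : ((a * b : GEvenˣ) : GEven) * w = 1)
    (hv : ((a * b⁻¹ : GEvenˣ) : GEven) * v = 1)
    (e : ∀ p : SPoint, p.body = 0 → T' p = T (infMove q w v p)) :
    ∃ B' ∈ calH, (Ehat 1 1 B').Rep T' := by
  refine exists_rep_of_leading hT' h0 fun η hη => ⟨?_, ?_⟩
  · rw [e _ (by simp [SPoint.body]), (infMove_odd q w v hη).1,
      (rep_leading hr (even_mul_odd w.2 hη)).1, ← even_comm (SetLike.coe_mem _), ← mul_assoc,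
      ← MulMemClass.coe_mul, hw, OneMemClass.coe_one, one_mul]
  · rw [e _ (by simp [SPoint.body]), (infMove_odd q w v hη).2,
      (rep_leading hr (even_mul_odd v.2 hη)).2, ← even_comm (SetLike.coe_mem _), ← mul_assoc,
      ← MulMemClass.coe_mul, hv, OneMemClass.coe_one, one_mul]

/-- Scaling by the leading coefficients of the coordinate at infinity normalizes them to one.
Scalings fix zero, so a puncture already placed there stays. -/
theorem exists_push_normal {S : TubedSphere n} (h0 : S.puncture 0 = pt .north SPoint.origin) :
    ∃ S' : TubedSphere n, SuperconformallyEquivalent S S' ∧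
      S'.puncture 0 = pt .north SPoint.origin ∧
      (∀ j, S.puncture j = pt .south SPoint.origin → S'.puncture j = pt .south SPoint.origin) ∧
      ∃ B ∈ calH, (Ehat 1 1 B).Rep fun p => S'.coord 0 (infFrame p) := by
  obtain ⟨a, b, B, -, hr⟩ := (infFrame_frame.sconfAt h0).exists_Ehat
    (TubedSphere.infFrame_origin h0)
  -- A southern scaling by `(v, w)` acts at infinity by `(w⁻¹, v⁻¹)`, so `w` is the leading
  -- coefficient of the `+` component and `v` that of the `-` component.
  obtain ⟨S', h1, h2, h3, h4⟩ := exists_push_affine h0 SPoint.origin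
    (v := (a * b⁻¹ : GEvenˣ)) (v' := ((a * b⁻¹)⁻¹ : GEvenˣ)) (w := (a * b : GEvenˣ))
    (w' := ((a * b)⁻¹ : GEvenˣ)) (Units.inv_mul _) (Units.inv_mul _)
  exact ⟨S', h1, h2, fun j hj => h3 j _ (by rw [hj, scale_origin, transl_origin]),
    exists_rep_of_move hr (infFrame_frame.sconfAt h2) (TubedSphere.infFrame_origin h2)
      (Units.mul_inv _) (Units.mul_inv _) h4⟩

/-- An equivalence of normalized spheres fixes infinity, hence is affine, and the leading
coefficients exclude the scaling. A translation by `q` remains; the cases `n = 0` and `n ≥ 1` differ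
in the reason why `q` is zero. -/
theorem exists_affine_of_equivalent {S S' : TubedSphere n} (h : SuperconformallyEquivalent S S')
    (h0 : S.puncture 0 = pt .north SPoint.origin) (h0' : S'.puncture 0 = pt .north SPoint.origin)
    {B B' : InfData} (hr : (Ehat 1 1 B).Rep fun p => S.coord 0 (infFrame p))
    (hr' : (Ehat 1 1 B').Rep fun p => S'.coord 0 (infFrame p)) :
    ∃ (F : Sphere ≃ Sphere) (q : SPoint), (∀ j, F (S.puncture j) = S'.puncture j ∧
      ∀ᶠ x in 𝓝 (S.puncture j), S.coord j x = S'.coord j (F x)) ∧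
      F (pt .south SPoint.origin) = pt .south q ∧ (q = SPoint.origin → F = Equiv.refl _) ∧
      ∀ p : SPoint, p.body = 0 →
        S.coord 0 (infFrame p) = S'.coord 0 (infFrame (infMove q 1 1 p)) := by
  obtain ⟨F, hF, h⟩ := superconformallyEquivalent_iff.1 h
  have hN : F (pt .north SPoint.origin) = pt .north SPoint.origin := by rw [← h0, (h 0).1, h0', h0]
  obtain ⟨q, v, w, v', w', hv, hw, hq, h1, h2⟩ := hF.eq_affine hN
  have e : ∀ p : SPoint, p.body = 0 →
      S.coord 0 (infFrame p) = S'.coord 0 (infFrame (infMove q w' v' p)) := fun p hp => by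
    have := (h 0).2
    rw [h0, infFrame_frame.eventually] at this
    rw [of_eventually_bn this hp, of_eventually_bn h2 hp]
  obtain ⟨rfl, rfl⟩ := scale_eq_one hr hr' e
  rw [one_mul] at hv hw
  subst hv hw
  refine ⟨F, q, h, hq, ?_, e⟩
  rintro rfl
  refine hF.ext AutConf.refl hN rfl fun p => ?_
  rw [h1, Equiv.refl_apply]
  congr 1
  ext <;> simp [SPoint.transl, SPoint.origin, SPoint.scale]

/-! ### One tube -/

theorem exists_equiv_moduli_zero : ∃ e : S2K0 ≃ Moduli 0, ∀ B : S2K0,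
    (∃ S : TubedSphere 0, CoordAtInfinity S B.1) ∧
    ∀ S : TubedSphere 0, CoordAtInfinity S B.1 → e B = Quot.mk _ S := by
  refine exists_equiv_moduli (R := fun (B : S2K0) S => CoordAtInfinity S B.1) ?_ ?_ ?_ ?_
  · intro B
    obtain ⟨H, hH, hr, h0⟩ := exists_map_of_calH B.2.1 1 1
    obtain ⟨S, hS⟩ := exists_tubedSphere (n := 0) (x := fun _ => pt .north SPoint.origin)
      (fun j k hjk => absurd (Fin.ext (by omega)) hjk) (fun _ => infFrame_frame)
      (fun _ => hH) fun _ => h0.1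
    exact ⟨S, (coordAtInfinity_iff B.2.1).2 ⟨(hS 0).1, hr.congr (hS 0).2⟩⟩
  · intro B S S' h h'
    rw [coordAtInfinity_iff B.2.1] at h h'
    refine equivalent_of_rep (fun j => ?_) fun j => ⟨infFrame, Ehat 1 1 B.1, ?_⟩
    · rw [Fin.fin_one_eq_zero j, h.1, h'.1]
    · rw [Fin.fin_one_eq_zero j, h.1]
      exact ⟨infFrame_frame, h.2, h'.2⟩
  · intro B B' S S' h h' hSS
    rw [coordAtInfinity_iff B.2.1] at h
    rw [coordAtInfinity_iff B'.2.1] at h'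
    obtain ⟨F, q, h1, h2, h3, e⟩ := exists_affine_of_equivalent hSS h.1 h'.1 h.2 h'.2
    obtain ⟨-, b1, b2, b3⟩ := B.2
    obtain ⟨-, b1', b2', b3'⟩ := B'.2
    -- Both spheres have vanishing `M^±_{1/2}`, so the translation has no odd part; then the
    -- vanishing of `A⁺_1` on both sides removes its even part.
    obtain ⟨o1, o2⟩ := first_order_odd h.2 h'.2 e
    rw [b2, b2', ZeroMemClass.coe_zero, zero_add, eq_comm, smul_eq_zero_iff_right Complex.I_ne_zero]
      at o1
    rw [b3, b3', ZeroMemClass.coe_zero, zero_add, eq_comm, smul_eq_zero_iff_right Complex.I_ne_zero]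
      at o2
    have o3 := first_order_even h.2 h'.2 o1 o2 ⟨b2, b3⟩ ⟨b2', b3'⟩ e
    rw [b1, b1', ZeroMemClass.coe_zero, zero_sub, eq_comm, neg_eq_zero] at o3
    obtain rfl := h3 (SPoint.ext o3 o1 o2)
    have h4 := (h1 0).2
    rw [h.1, infFrame_frame.eventually] at h4
    exact Subtype.ext (Ehat_injective (h.2.unique (h'.2.congr h4))).1
  · intro S
    have E := superconformallyEquivalent_equivalence 0
    obtain ⟨S₁, e₁, p₁⟩ := exists_push_infinity S
    obtain ⟨S₂, e₂, p₂, -, B₂, -, r₂⟩ := exists_push_normal p₁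
    -- A translation with odd part `i M^±` changes `M^±` by `i · i M^± = -M^±`. Once these vanish, a
    -- translation by `A⁺_1` removes `A⁺_1` and leaves them zero.
    obtain ⟨S₃, e₃, p₃, -, m₃⟩ := exists_push_affine p₂ ⟨0, Complex.I • B₂.MP 0, Complex.I • B₂.MM 0,
      zero_mem _, Submodule.smul_mem _ _ (B₂.MP 0).2, Submodule.smul_mem _ _ (B₂.MM 0).2⟩
      (one_mul 1) (one_mul 1)
    obtain ⟨B₃, -, r₃⟩ := exists_rep_of_move r₂ (infFrame_frame.sconfAt p₃)
      (TubedSphere.infFrame_origin p₃) (by simp) (by simp) m₃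
    obtain ⟨c₃, d₃⟩ := first_order_odd r₃ r₂ m₃
    rw [smul_smul, Complex.I_mul_I, neg_one_smul, add_neg_cancel] at c₃ d₃
    have z₃ : B₃.MP 0 = 0 ∧ B₃.MM 0 = 0 := ⟨Subtype.ext c₃, Subtype.ext d₃⟩
    obtain ⟨S₄, e₄, p₄, -, m₄⟩ := exists_push_affine p₃ ⟨B₃.AP 0, 0, 0,
      (B₃.AP 0).2, zero_mem _, zero_mem _⟩ (one_mul 1) (one_mul 1)
    obtain ⟨B₄, H₄, r₄⟩ := exists_rep_of_move r₃ (infFrame_frame.sconfAt p₄)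
      (TubedSphere.infFrame_origin p₄) (by simp) (by simp) m₄
    obtain ⟨c₄, d₄⟩ := first_order_odd r₄ r₃ m₄
    rw [smul_zero, add_zero, z₃.1] at c₄
    rw [smul_zero, add_zero, z₃.2] at d₄
    have z₄ : B₄.MP 0 = 0 ∧ B₄.MM 0 = 0 := ⟨Subtype.ext c₄, Subtype.ext d₄⟩
    have a₄ := first_order_even r₄ r₃ rfl rfl z₄ z₃ m₄
    rw [sub_self] at a₄
    exact ⟨⟨B₄, H₄, Subtype.ext a₄, z₄⟩, S₄, (coordAtInfinity_iff H₄).2 ⟨p₄, r₄⟩,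
      E.trans e₁ (E.trans e₂ (E.trans e₃ e₄))⟩

/-! ### Several tubes -/

theorem position_last (hn : 1 ≤ n) (q : Fin (n - 1) → SPoint) :
    position q (⟨n - 1, by omega⟩ : Fin n) = SPoint.origin := by
  simp [position]

theorem position_body {q : Fin (n - 1) → SPoint} (hq : q ∈ S2M (n - 1)) {j k : Fin n}
    (hjk : j ≠ k) : (position q j).body ≠ (position q k).body := by
  have hz : ∀ i, (q i).body ≠ 0 := fun i => body_ne_zero_of_isUnit (hq.1 i)
  unfold position
  split_ifs with h1 h2 h2
  · exact hq.2 _ _ fun h => hjk (Fin.ext (by simpa using h))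
  · rw [origin_body]; exact hz _
  · rw [origin_body]; exact (hz _).symm
  · exact absurd (Fin.ext (by omega)) hjk

theorem exists_equiv_moduli_pos (hn : 1 ≤ n) : ∃ e : S2K n ≃ Moduli n, ∀ Q : S2K n,
    (∃ S : TubedSphere n, Represents Q S) ∧
    ∀ S : TubedSphere n, Represents Q S → e Q = Quot.mk _ S := by
  refine exists_equiv_moduli (R := Represents) ?_ ?_ ?_ ?_
  · intro Q
    obtain ⟨H, hH, hr, h0⟩ := exists_map_of_calH Q.2.1.2 1 1
    choose ab hab using fun k => QuotientGroup.mk_surjective (Q.2.2 k).1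
    choose G hG gr g0 using fun k => exists_map_of_calH (Q.2.2 k).2.2 (ab k).1 (ab k).2
    obtain ⟨S, hS⟩ := exists_tubedSphere (n := n)
      (x := Fin.cons (pt .north SPoint.origin) fun k => pt .south (position Q.1.1 k))
      (f := Fin.cons infFrame fun k => southFrame (position Q.1.1 k)) (H := Fin.cons H G)
      (fun j k hjk h => by
        induction j using Fin.cases with
        | zero =>
          induction k using Fin.cases with
          | zero => exact hjk rfl
          | succ k => exact not_sameBody_infinity _ (sameBody_iff.2 (sameBody_iff.1 h).symm)
        | succ j =>
          induction k using Fin.cases with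
          | zero => exact not_sameBody_infinity _ h
          | succ k => exact position_body Q.1.2 (fun e => hjk (congrArg Fin.succ e)) (sameBody_south h))
      (fun j => by
        induction j using Fin.cases with
        | zero => exact infFrame_frame
        | succ j => exact southFrame_frame _)
      (fun j => by
        induction j using Fin.cases with
        | zero => exact hH
        | succ j => exact hG j)
      (fun j => by
        induction j using Fin.cases with
        | zero => exact h0.1
        | succ j => exact (g0 j).1)
    refine ⟨S, (coordAtInfinity_iff Q.2.1.2).2 ⟨(hS 0).1, hr.congr (hS 0).2⟩, fun k =>
      ⟨(ab k).1, (ab k).2, hab k, (coordAt_iff (Q.2.2 k).2.2).2 ⟨(hS k.succ).1, ?_⟩⟩⟩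
    exact (gr k).congr (hS k.succ).2
  · rintro Q S S' ⟨h, g⟩ ⟨h', g'⟩
    rw [coordAtInfinity_iff Q.2.1.2] at h h'
    choose a b ab g using g
    choose a' b' ab' g' using g'
    simp only [coordAt_iff (Q.2.2 _).2.2] at g g'
    refine equivalent_of_rep (fun j => ?_) fun j => ?_
    · induction j using Fin.cases with
      | zero => rw [h.1, h'.1]
      | succ k => rw [(g k).1, (g' k).1]
    · induction j using Fin.cases with
      | zero => exact ⟨_, _, by rw [h.1]; exact infFrame_frame, h.2, h'.2⟩
      | succ k =>
        refine ⟨_, _, by rw [(g k).1]; exact southFrame_frame _, (g k).2, ?_⟩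
        rw [Ehat_congr ((ab k).trans (ab' k).symm)]
        exact (g' k).2
  · rintro Q Q' S S' ⟨h, g⟩ ⟨h', g'⟩ hSS
    rw [coordAtInfinity_iff Q.2.1.2] at h
    rw [coordAtInfinity_iff Q'.2.1.2] at h'
    choose a b ab g using g
    choose a' b' ab' g' using g'
    simp only [coordAt_iff (Q.2.2 _).2.2] at g
    simp only [coordAt_iff (Q'.2.2 _).2.2] at g'
    obtain ⟨F, q, h1, h2, h3, -⟩ := exists_affine_of_equivalent hSS h.1 h'.1 h.2 h'.2
    -- The last puncture is at zero on both spheres, so the translation is trivial and the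
    -- equivalence is the identity; positions and expansions then agree.
    have hl := (h1 (Fin.succ ⟨n - 1, by omega⟩)).1
    rw [(g _).1, (g' _).1, position_last hn, position_last hn, h2] at hl
    obtain rfl := h3 (pt_injective .south hl)
    have h4 := (h1 0).2
    rw [h.1, infFrame_frame.eventually] at h4
    have hpos : ∀ k, position Q.1.1 k = position Q'.1.1 k := fun k =>
      pt_injective .south (by rw [← (g k).1, ← (g' k).1]; exact (h1 k.succ).1)
    have hE : ∀ k, _ ∧ _ := fun k => Ehat_injective ((g k).2.unique ((g' k).2.congr (by
      have := (h1 k.succ).2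
      rw [(g k).1, hpos, (southFrame_frame _).eventually] at this
      rw [hpos]
      exact this)))
    refine Prod.ext (Subtype.ext (funext fun j => ?_)) (Prod.ext ?_ (funext fun k => ?_))
    · have := hpos ⟨j, by omega⟩
      simpa [position] using this
    · exact Subtype.ext (Ehat_injective (h.2.unique (h'.2.congr h4))).1
    · exact Prod.ext ((ab k).symm.trans ((hE k).2.trans (ab' k))) (Subtype.ext (hE k).1)
  · intro S
    have E := superconformallyEquivalent_equivalence n
    obtain ⟨l, hl⟩ : ∃ l : Fin n, l.val = n - 1 := ⟨⟨n - 1, by omega⟩, rfl⟩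
    have south : ∀ T : TubedSphere n, T.puncture 0 = pt .north SPoint.origin → ∀ k : Fin n,
        ∃ q, T.puncture k.succ = pt .south q := fun T hT k =>
      AutConf.refl.maps_south rfl (by rw [← hT]; exact T.distinct _ _ (Fin.succ_ne_zero k))
    obtain ⟨S₁, e₁, p₁⟩ := exists_push_infinity S
    obtain ⟨q, hq⟩ := south S₁ p₁ l
    -- The last puncture is moved to zero before the scaling at infinity, which does not disturb it.
    obtain ⟨S₂, e₂, p₂, m₂, -⟩ := exists_push_affine p₁ q (one_mul 1) (one_mul 1)
    obtain ⟨S₃, e₃, p₃, m₃, B, hB, hr⟩ := exists_push_normal p₂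
    have hl3 := m₃ _ (m₂ l.succ SPoint.origin (by rw [hq, scale_origin, transl_origin]))
    choose r hr' using south S₃ p₃
    have rl : r l = SPoint.origin := pt_injective .south (by rw [← hr', hl3])
    have rb : ∀ j k, j ≠ k → (r j).body ≠ (r k).body := fun j k hjk h =>
      S₃.distinct j.succ k.succ (fun e => hjk (Fin.succ_injective _ e)) (by
        rw [hr', hr']; exact ⟨.south, _, _, rfl, rfl, h⟩)
    choose a b C hC hc using fun k => ((southFrame_frame (r k)).sconfAt (hr' k)).exists_Ehat (by
      rw [(southFrame_frame (r k)).origin, ← hr', S₃.vanishing])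
    refine ⟨⟨⟨fun j => r ⟨j, by omega⟩, fun j => ?_, fun j k hjk => ?_⟩, ⟨B, hB⟩,
      fun k => (QuotientGroup.mk (a k, b k), ⟨C k, hC k⟩)⟩, S₃,
      ⟨(coordAtInfinity_iff hB).2 ⟨p₃, hr⟩, fun k => ⟨a k, b k, rfl, (coordAt_iff (hC k)).2 ?_⟩⟩,
      E.trans e₁ (E.trans e₂ e₃)⟩
    -- Invertibility of the other positions means that their bodies differ from that of the last
    -- puncture, which is zero.
    · refine isUnit_of_body (SPoint.z_even _) ?_
      have := rb ⟨j, by omega⟩ l fun h => by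
        have := congrArg Fin.val h
        simp only at this
        omega
      rwa [rl, origin_body] at this
    · exact rb _ _ fun h => hjk (Fin.ext (congrArg Fin.val h :))
    · have hp : position (fun j : Fin (n - 1) => r ⟨j, by omega⟩) k = r k := by
        unfold position
        split_ifs with h
        · rfl
        · rw [← rl]; congr 1; exact Fin.ext (by omega)
      rw [hp]
      exact ⟨hr' k, hc k⟩

end N2Sphere

end

theorem theorem8p1 :
    -- superconformal equivalence is an equivalence relation, with the moduli space as quotient
    (∀ n : ℕ, Equivalence (N2Sphere.SuperconformallyEquivalent (n := n))) ∧
    -- spheres with `1 + n` tubes, `n ≥ 1`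
    (∀ n : ℕ, 1 ≤ n → ∃ e : N2Sphere.S2K n ≃ N2Sphere.Moduli n, ∀ Q : N2Sphere.S2K n,
      (∃ S : N2Sphere.TubedSphere n, N2Sphere.Represents Q S) ∧
      ∀ S : N2Sphere.TubedSphere n, N2Sphere.Represents Q S → e Q = Quot.mk _ S) ∧
    -- spheres with one tube
    (∃ e : N2Sphere.S2K0 ≃ N2Sphere.Moduli 0, ∀ B : N2Sphere.S2K0,
      (∃ S : N2Sphere.TubedSphere 0, N2Sphere.CoordAtInfinity S B.1) ∧
      ∀ S : N2Sphere.TubedSphere 0, N2Sphere.CoordAtInfinity S B.1 → e B = Quot.mk _ S) :=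
  ⟨N2Sphere.superconformallyEquivalent_equivalence,
    fun _ hn => N2Sphere.exists_equiv_moduli_pos hn, N2Sphere.exists_equiv_moduli_zero⟩
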